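/- Let $d\ge 1$, let $\mathbb T^d=\mathbb R^d/\mathbb Z^d$ be the flat torus with its Haar (Lebesgue) probability measure, and let $T>0$. Let $b\in L^1([0,T]\times\mathbb T^d;\mathbb R^d)$ be a vector field such that, for every $t\in[0,T]$, $b_t=b(t,\cdot)\in L^1(\mathbb T^d;\mathbb R^d)$ has an integrable distributional spatial gradient $\nabla b_t$, and $$\sup_{t\in[0,T]}\int_{\mathbb T^d}\exp\{\beta|\nabla b_t(x)|\}\,dx<\infty\quad\text{for every }\beta>0,\qquad \operatorname{div} b\in L^\infty([0,T]\times\mathbb T^d).$$ Let $0<\alpha\le 1$, $1<p<\infty$ and $u_0\in L^\infty(\mathbb T^d)\cap W^{\alpha,p}(\mathbb T^d)$. Then the Cauchy problem $$\partial_t u+b\cdot\nabla u=0,\qquad u(0,\cdot)=u_0$$ has a unique solution $u\in L^\infty([0,T]\times\mathbb T^d)$ (unique in the sense that any two solutions agree almost everywhere on $\mathbb T^d$ at each time $t\in[0,T]$), and it satisfies $$u_t\in W^{\alpha',p}(\mathbb T^d)\qquad\text{for all }0<\alpha'<\alpha\text{ and all }t\in[0,T].$$ If $\alpha=1$, then also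 $$u_t\in W^{1,p'}(\mathbb T^d)\qquad\text{for all }1\le p'<p\text{ and all }t\in[0,T].$$ Here a solution is a (jointly measurable) curve $t\in[0,T]\mapsto u_t\in L^\infty(\mathbb T^d)$, uniformly bounded in $L^\infty(\mathbb T^d)$, such that $t\mapsto\int_{\mathbb T^d}u_t\,\phi\,dx$ is continuous for every $\phi\in L^1(\mathbb T^d)$, and such that for every $t\in[0,T]$ and every $\phi\in C^\infty(\mathbb T^d)$ $$\int_{\mathbb T^d}u_t\,\phi\,dx-\int_{\mathbb T^d}u_0\,\phi\,dx=\int_0^t\int_{\mathbb T^d}u_s\,\bigl(b_s\cdot\nabla\phi+(\operatorname{div}b_s)\,\phi\bigr)\,dx\,ds .$$ The space $W^{1,p}(\mathbb T^d)$ consists of the $f\in L^p(\mathbb T^d)$ whose distributional first derivatives are in $L^p(\mathbb T^d)$. For $0<\alpha<1$, $W^{\alpha,p}(\mathbb T^d)$ consists of the $f\in L^p(\mathbb T^d)$ with $$\int_{(0,1]^d}\int_{\mathbb T^d}\frac{|f(x+h)-f(x)|^p}{|h|^{d+p\alpha}}\,dx\,dh<\infty .$$ -/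

import Mathlib

open MeasureTheory Set
open scoped ENNReal ContDiff

noncomputable section

/-- The flat torus `ℝ^d / ℤ^d`; its `volume` is the Haar probability measure. -/
abbrev Torus (d : ℕ) : Type := UnitAddTorus (Fin d)

/-- The projection `ℝ^d → 𝕋^d`. -/
def Torus.proj {d : ℕ} (y : EuclideanSpace ℝ (Fin d)) : Torus d :=
  fun i => (y i : UnitAddCircle)

/-- Smooth functions on the torus: those whose periodic lift to `ℝ^d` is smooth. -/
def Torus.Smooth {d : ℕ} (φ : Torus d → ℝ) : Prop :=
  ContDiff ℝ ∞ (fun y : EuclideanSpace ℝ (Fin d) => φ (Torus.proj y))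

/-- The classical partial derivative `∂φ/∂x_i` at `x`, that is, the derivative at `s = 0`
of `s ↦ φ (x + s e_i)`. -/
def Torus.partialDeriv {d : ℕ} (i : Fin d) (φ : Torus d → ℝ) (x : Torus d) : ℝ :=
  deriv (fun s : ℝ => φ (x + Torus.proj (EuclideanSpace.single i s))) 0

/-- `g` is the distributional partial derivative `∂f/∂x_i`, where `f, g ∈ L^1(𝕋^d)`. -/
structure IsWeakPartial {d : ℕ} (i : Fin d) (f g : Torus d → ℝ) : Prop where
  integrable : Integrable f
  integrable_deriv : Integrable g
  integral_eq : ∀ φ : Torus d → ℝ, Torus.Smooth φ →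
    ∫ x, f x * Torus.partialDeriv i φ x = - ∫ x, g x * φ x

/-- The `p`-th power of the Gagliardo seminorm,
`∫_{(0,1]^d} ∫_{𝕋^d} |f(x+h) - f(x)|^p / |h|^(d + p α) dx dh`, with `|h|` Euclidean. -/
def gagliardoEnergy {d : ℕ} (α p : ℝ) (f : Torus d → ℝ) : ℝ≥0∞ :=
  ∫⁻ h in {h : EuclideanSpace ℝ (Fin d) | ∀ i, h i ∈ Ioc (0 : ℝ) 1},
    ∫⁻ x : Torus d, ENNReal.ofReal (|f (x + Torus.proj h) - f x| ^ p / ‖h‖ ^ ((d : ℝ) + p * α))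

/-- `f ∈ W^{α,p}(𝕋^d)` for `0 < α < 1`. -/
def MemFracSobolev {d : ℕ} (α p : ℝ) (f : Torus d → ℝ) : Prop :=
  MemLp f (ENNReal.ofReal p) ∧ gagliardoEnergy α p f < ⊤

/-- `f ∈ W^{1,p}(𝕋^d)`: `f` and its distributional first derivatives are in `L^p`. -/
def MemSobolevOne {d : ℕ} (p : ℝ) (f : Torus d → ℝ) : Prop :=
  MemLp f (ENNReal.ofReal p) ∧
    ∀ i : Fin d, ∃ g : Torus d → ℝ, IsWeakPartial i f g ∧ MemLp g (ENNReal.ofReal p)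

open scoped Classical in
/-- `f ∈ W^{α,p}(𝕋^d)` for `0 < α ≤ 1` and `1 ≤ p < ∞`. -/
def MemSobolev {d : ℕ} (α p : ℝ) (f : Torus d → ℝ) : Prop :=
  if α = 1 then MemSobolevOne p f else MemFracSobolev α p f

/-- The Euclidean (Frobenius) norm of a matrix. -/
def frobNorm {d : ℕ} (A : Matrix (Fin d) (Fin d) ℝ) : ℝ :=
  Real.sqrt (∑ i, ∑ j, A i j ^ 2)

/-- `A` is the distributional gradient of the vector field `v`, with `A i j = ∂v_i/∂x_j`. -/
def IsWeakGradient {d : ℕ} (v : Torus d → EuclideanSpace ℝ (Fin d))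
    (A : Torus d → Matrix (Fin d) (Fin d) ℝ) : Prop :=
  ∀ i j : Fin d, IsWeakPartial j (fun x => v x i) (fun x => A x i j)

/-- `u ∈ L^∞([0,T] × 𝕋^d)` is a distributional solution of `∂_t u + b · ∇u = 0`, `u(0,·) = u₀`,
where `divb` is the divergence of `b`: a weakly continuous curve `t ↦ u_t`, bounded in
`L^∞(𝕋^d)`, that satisfies the equation tested with every smooth function of space,
`∫ u_t φ - ∫ u₀ φ = ∫_0^t ∫ u_s (b_s · ∇φ + (div b_s) φ) dx ds`. -/
structure IsTransportSolution {d : ℕ} (T : ℝ) (b : ℝ → Torus d → EuclideanSpace ℝ (Fin d))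
    (divb : ℝ → Torus d → ℝ) (u₀ : Torus d → ℝ) (u : ℝ → Torus d → ℝ) : Prop where
  aestronglyMeasurable : AEStronglyMeasurable (fun z : ℝ × Torus d => u z.1 z.2)
    ((volume.restrict (Icc 0 T)).prod volume)
  aestronglyMeasurable_slice : ∀ t ∈ Icc 0 T, AEStronglyMeasurable (u t) volume
  bounded : ∃ M : ℝ, ∀ t ∈ Icc 0 T, ∀ᵐ x, |u t x| ≤ M
  weaklyContinuous : ∀ φ : Torus d → ℝ, Integrable φ →
    ContinuousOn (fun t => ∫ x, u t x * φ x) (Icc 0 T)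
  integral_eq : ∀ t ∈ Icc 0 T, ∀ φ : Torus d → ℝ, Torus.Smooth φ →
    (∫ x, u t x * φ x) - ∫ x, u₀ x * φ x =
      ∫ s in (0 : ℝ)..t, ∫ x, u s x *
        ((∑ i, b s x i * Torus.partialDeriv i φ x) + divb s x * φ x)

end

/-! The heart of the matter is a gradient estimate with an arbitrarily small loss of integrability.
Formally `|∇u|^q` is transported by `b` with a source at most `q |∇b| |∇u|^q`. The factor `|∇b|` is
unbounded, but all its exponential moments are finite. Young's inequality `a z ≤ δ z log⁺ z + δ exp
(a/δ)` (`mul_le_posLog_add_exp`) with `z = |∇u|^q` turns the source into a small multiple of `z log⁺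
z` plus a constant. The term `z log⁺ z` is the derivative of `z` under a change of exponent
(`add_posLog_le_rpow`), so it is absorbed by letting the exponent decrease slowly in time. To
descend only from `p` to a given `q < p` during `[0,T]` one needs `δ` of order `log (p/q) / T`, and
any `δ` is allowed because every exponential moment is finite.

The computation is made rigorous without a flow, on an explicit Lax–Friedrichs scheme for a
mollified field. A step `lfStep` averages the values at neighbouring points with nonnegative
weights. Hence it obeys the maximum principle and Jensen's inequality, and the discrete divergence
controls the growth of integrals. The increment of a step is the step of the increment plus a
velocity increment times an increment of the function (`lfStep_translate_sub`), which gives the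
estimate for one step (`lfStep_gradient_le`) and, by iteration, for the scheme
(`GridField.integral_iterate_gradient_le`). Exponential moments of velocity increments come from
those of `∇b` by Jensen's inequality.

Since the equation is linear, convex combinations suffice for the passage to the limit. Bounded
sequences in `L^q`, `q > 1`, have tail convex combinations that converge strongly
(`exists_convex_tendsto`). These combinations inherit the consistency relation, the `L^p` bounds and
the gradient bounds (`ApproximationScheme.exists_solution`).

Uniqueness is the DiPerna–Lions argument: the commutator of mollification and transport tends to
zero in `L^1` (`tendsto_integral_abs_commutator`), the energy estimate survives the limit, and
Grönwall's lemma applies (`TransportField.eq_zero_of_solution`). Uniqueness also makes the solution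
operator additive in the datum.

Fractional regularity follows by real interpolation. At each scale `r` the datum splits as `a + c`,
with `∇a` of size `r^(α-1)` and `c` of size `r^α` in `L^p` (`IsInterpolable`). Both pieces are
propagated, the first with a loss from `p` to `q`, and the choice `r ~ |h|` gives a modulus of
continuity `|h|^α` for `u_t` in `L^q`. Boundedness of `u_t` converts this into finite Gagliardo
energy with exponent `p` and any order below `α q / p`. As `q` tends to `p`, every `α' < α` is
reached. -/

instance UnitAddCircle.isProbabilityMeasure_volume :
    IsProbabilityMeasure (volume : Measure UnitAddCircle) := ⟨by simp⟩

instance Torus.isNegInvariant_volume (d : ℕ) : (volume : Measure (Torus d)).IsNegInvariant :=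
  Pi.isNegInvariant_volume

instance Torus.isProbabilityMeasure_volume (d : ℕ) :
    IsProbabilityMeasure (volume : Measure (Torus d)) :=
  inferInstanceAs (IsProbabilityMeasure (Measure.pi fun _ : Fin d => (volume : Measure UnitAddCircle)))

/-! ### Calculus of smooth functions on the torus. -/

namespace Torus

variable {d : ℕ}

theorem proj_add (y z : EuclideanSpace ℝ (Fin d)) : proj (y + z) = proj y + proj z := by
  ext i; simp [proj]

theorem proj_zero : proj (0 : EuclideanSpace ℝ (Fin d)) = 0 := by
  ext i; simp [proj]

theorem proj_neg (y : EuclideanSpace ℝ (Fin d)) : proj (-y) = -proj y := by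
  ext i; simp [proj]

theorem continuous_proj : Continuous (proj (d := d)) := by
  unfold proj
  refine continuous_pi fun i => ?_
  exact (AddCircle.continuous_mk' (1 : ℝ)).comp (by fun_prop)

/-- Continuity and pointwise identities on the torus can thus be checked on periodic lifts. -/
theorem isOpenQuotientMap_proj : IsOpenQuotientMap (proj (d := d)) := by
  have h : IsOpenQuotientMap (Pi.map fun (_ : Fin d) (r : ℝ) => (r : UnitAddCircle)) :=
    IsOpenQuotientMap.piMap fun i => QuotientAddGroup.isOpenQuotientMap_mk
  exact h.comp (EuclideanSpace.equiv (Fin d) ℝ).toHomeomorph.isOpenQuotientMap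

theorem surjective_proj : Function.Surjective (proj (d := d)) := isOpenQuotientMap_proj.surjective

theorem Smooth.continuous {φ : Torus d → ℝ} (hφ : Smooth φ) : Continuous φ :=
  isOpenQuotientMap_proj.isQuotientMap.continuous_iff.2 (ContDiff.continuous hφ)

theorem exists_bound_of_continuous {φ : Torus d → ℝ} (hφ : Continuous φ) :
    ∃ C, 0 ≤ C ∧ ∀ x, |φ x| ≤ C := by
  obtain ⟨C, hC⟩ := (isCompact_univ (X := Torus d)).exists_bound_of_continuousOn hφ.continuousOn
  exact ⟨C, (abs_nonneg _).trans (hC 0 (mem_univ _)), fun x => hC x (mem_univ x)⟩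

theorem Smooth.exists_bound {φ : Torus d → ℝ} (hφ : Smooth φ) : ∃ C, 0 ≤ C ∧ ∀ x, |φ x| ≤ C :=
  exists_bound_of_continuous hφ.continuous

theorem Smooth.integrable {φ : Torus d → ℝ} (hφ : Smooth φ) : Integrable φ := by
  obtain ⟨C, -, hC⟩ := hφ.exists_bound
  exact Integrable.of_bound hφ.continuous.aestronglyMeasurable C (ae_of_all _ hC)

theorem Smooth.hasDerivAt {φ : Torus d → ℝ} (hφ : Smooth φ) (y v : EuclideanSpace ℝ (Fin d))
    (θ : ℝ) : HasDerivAt (fun θ : ℝ => φ (proj (y + θ • v)))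
      (fderiv ℝ (fun y => φ (proj y)) (y + θ • v) v) θ := by
  have h1 : HasFDerivAt (fun y => φ (proj y)) (fderiv ℝ (fun y => φ (proj y)) (y + θ • v))
      (y + θ • v) := (ContDiff.differentiable hφ (by simp) _).hasFDerivAt
  have h2 : HasDerivAt (fun θ : ℝ => y + θ • v) v θ := by
    simpa using ((hasDerivAt_id θ).smul_const v).const_add y
  exact h1.comp_hasDerivAt θ h2

theorem Smooth.partialDeriv_proj {φ : Torus d → ℝ} (hφ : Smooth φ) (i : Fin d)
    (y : EuclideanSpace ℝ (Fin d)) :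
    partialDeriv i φ (proj y) =
      fderiv ℝ (fun y => φ (proj y)) y (EuclideanSpace.single i 1) := by
  have h := hφ.hasDerivAt y (EuclideanSpace.single i 1) 0
  have e : (fun s : ℝ => φ (proj y + proj (EuclideanSpace.single i s))) =
      fun θ : ℝ => φ (proj (y + θ • EuclideanSpace.single i 1)) := by
    ext s
    rw [← proj_add]
    congr 3
    ext j
    by_cases hj : j = i <;> simp [hj]
  rw [partialDeriv, e, h.deriv]
  simp

theorem Smooth.partialDeriv {φ : Torus d → ℝ} (hφ : Smooth φ) (i : Fin d) :
    Smooth (partialDeriv i φ) := by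
  unfold Smooth
  simp_rw [hφ.partialDeriv_proj i]
  have : ContDiff ℝ ∞ (fderiv ℝ (fun y => φ (proj y))) := by
    exact (contDiff_infty_iff_fderiv.1 hφ).2
  exact this.clm_apply contDiff_const

theorem Smooth.fderiv_apply {φ : Torus d → ℝ} (hφ : Smooth φ) (y v : EuclideanSpace ℝ (Fin d)) :
    fderiv ℝ (fun y => φ (proj y)) y v = ∑ i, v i * Torus.partialDeriv i φ (proj y) := by
  have hv : v = ∑ i, v i • EuclideanSpace.single i (1 : ℝ) := by
    have := (EuclideanSpace.basisFun (Fin d) ℝ).sum_repr v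
    simpa using this.symm
  conv_lhs => rw [hv]
  simp [hφ.partialDeriv_proj]

/-- The derivative of a smooth function along the image of a line. -/
theorem Smooth.hasDerivAt_line {φ : Torus d → ℝ} (hφ : Smooth φ) (x : Torus d)
    (v : EuclideanSpace ℝ (Fin d)) (θ : ℝ) :
    HasDerivAt (fun θ : ℝ => φ (x + proj (θ • v)))
      (∑ i, v i * Torus.partialDeriv i φ (x + proj (θ • v))) θ := by
  obtain ⟨y, rfl⟩ := surjective_proj x
  have := hφ.hasDerivAt y v θ
  simpa only [hφ.fderiv_apply, proj_add] using this

theorem continuous_line (x : Torus d) (v : EuclideanSpace ℝ (Fin d)) :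
    Continuous fun θ : ℝ => x + proj (θ • v) :=
  continuous_const.add (continuous_proj.comp (by fun_prop))

theorem Smooth.sub_eq_integral {φ : Torus d → ℝ} (hφ : Smooth φ) (x : Torus d)
    (v : EuclideanSpace ℝ (Fin d)) :
    φ (x + proj v) - φ x =
      ∫ θ in (0 : ℝ)..1, ∑ i, v i * Torus.partialDeriv i φ (x + proj (θ • v)) := by
  rw [intervalIntegral.integral_eq_sub_of_hasDerivAt (fun θ _ => hφ.hasDerivAt_line x v θ)]
  · simp [proj_zero]
  · refine Continuous.intervalIntegrable ?_ _ _
    exact continuous_finsetSum _ fun i _ => continuous_const.mul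
      ((hφ.partialDeriv i).continuous.comp (continuous_line x v))

theorem Smooth.hasDerivAt_partialDeriv {φ : Torus d → ℝ} (hφ : Smooth φ) (i : Fin d)
    (x : Torus d) :
    HasDerivAt (fun s : ℝ => φ (x + proj (EuclideanSpace.single i s)))
      (Torus.partialDeriv i φ x) 0 := by
  have h := hφ.hasDerivAt_line x (EuclideanSpace.single i 1) 0
  have e : (fun s : ℝ => φ (x + proj (EuclideanSpace.single i s))) =
      fun θ : ℝ => φ (x + proj (θ • EuclideanSpace.single i 1)) := by
    ext s
    congr 3
    ext j
    by_cases hj : j = i <;> simp [hj]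
  have h' : DifferentiableAt ℝ (fun s : ℝ => φ (x + proj (EuclideanSpace.single i s))) 0 := by
    rw [e]; exact h.differentiableAt
  exact h'.hasDerivAt

theorem Smooth.comp_sub {φ : Torus d → ℝ} (hφ : Smooth φ) (a : Torus d) :
    Smooth fun x => φ (a - x) := by
  obtain ⟨y, rfl⟩ := surjective_proj a
  simp only [Smooth, sub_eq_add_neg, ← proj_neg, ← proj_add]
  exact (show ContDiff ℝ ∞ (fun y => φ (proj y)) from hφ).comp
    (contDiff_const.add contDiff_id.neg)

theorem Smooth.mul {φ ψ : Torus d → ℝ} (hφ : Smooth φ) (hψ : Smooth ψ) :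
    Smooth fun x => φ x * ψ x := ContDiff.mul hφ hψ

theorem smooth_const (c : ℝ) : Smooth fun _ : Torus d => c := contDiff_const

theorem Smooth.partialDeriv_mul {φ ψ : Torus d → ℝ} (hφ : Smooth φ) (hψ : Smooth ψ) (i : Fin d)
    (x : Torus d) : Torus.partialDeriv i (fun x => φ x * ψ x) x =
      Torus.partialDeriv i φ x * ψ x + φ x * Torus.partialDeriv i ψ x := by
  have h := ((hφ.hasDerivAt_partialDeriv i x).mul (hψ.hasDerivAt_partialDeriv i x)).deriv
  have e : proj (EuclideanSpace.single i (0 : ℝ)) = (0 : Torus d) := by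
    rw [← proj_zero]
    congr 1
    ext j; by_cases hj : j = i <;> simp [hj]
  simp only [e, add_zero] at h
  exact h

theorem Smooth.partialDeriv_comp_sub {φ : Torus d → ℝ} (hφ : Smooth φ) (i : Fin d)
    (a x : Torus d) :
    Torus.partialDeriv i (fun x => φ (a - x)) x = -Torus.partialDeriv i φ (a - x) := by
  have h := hφ.hasDerivAt_partialDeriv i (a - x)
  rw [← neg_zero (G := ℝ)] at h
  have h2 := HasDerivAt.scomp (0 : ℝ) h (hasDerivAt_neg (0 : ℝ))
  have e : (fun s : ℝ => φ (a - (x + proj (EuclideanSpace.single i s)))) =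
      (fun s : ℝ => φ (a - x + proj (EuclideanSpace.single i s))) ∘ Neg.neg := by
    ext s
    have : (EuclideanSpace.single i (-s) : EuclideanSpace ℝ (Fin d)) =
        -EuclideanSpace.single i s := by
      ext j; by_cases hj : j = i <;> simp [hj]
    simp only [Function.comp, this, proj_neg]
    congr 1; abel
  rw [Torus.partialDeriv, e, h2.deriv]
  simp

/-- The integral of a partial derivative of a smooth function vanishes. -/
theorem Smooth.integral_partialDeriv {φ : Torus d → ℝ} (hφ : Smooth φ) (i : Fin d) :
    ∫ x, Torus.partialDeriv i φ x = 0 := by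
  obtain ⟨C, -, hC⟩ := (hφ.partialDeriv i).exists_bound
  set ψ := Torus.partialDeriv i φ
  have hψ : Continuous ψ := (hφ.partialDeriv i).continuous
  have hsum : ∀ x : Torus d, ∀ θ : ℝ, ∑ j, (EuclideanSpace.single i (1 : ℝ)) j *
      Torus.partialDeriv j φ (x + proj (θ • EuclideanSpace.single i 1)) =
      ψ (x + proj (θ • EuclideanSpace.single i 1)) := by
    intro x θ
    rw [Finset.sum_eq_single i] <;> simp +contextual [ψ]
  -- Translation invariance kills the integral of the increment. Written as an integral of the
  -- derivative along the segment, the same increment integrates to the integral of the derivative,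
  -- by Fubini and invariance again.
  have h1 : ∫ x : Torus d, (φ (x + proj (EuclideanSpace.single i 1)) - φ x) = 0 := by
    rw [integral_sub, integral_add_right_eq_self, sub_self]
    · exact hφ.integrable.comp_add_right _
    · exact hφ.integrable
  simp_rw [hφ.sub_eq_integral, hsum] at h1
  rw [← h1]
  simp_rw [intervalIntegral.integral_of_le zero_le_one]
  rw [integral_integral_swap]
  · simp [integral_add_right_eq_self]
  · refine Integrable.of_bound (C := C) ?_ (ae_of_all _ fun z => hC _)
    refine Continuous.aestronglyMeasurable ?_
    exact hψ.comp (continuous_fst.add (continuous_proj.comp (by fun_prop)))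

end Torus

open Torus

theorem Torus.Smooth.isWeakPartial {φ : Torus d → ℝ} (hφ : Smooth φ) (i : Fin d) :
    IsWeakPartial i φ (Torus.partialDeriv i φ) where
  integrable := hφ.integrable
  integrable_deriv := (hφ.partialDeriv i).integrable
  integral_eq ψ hψ := by
    have h := (hφ.mul hψ).integral_partialDeriv i
    simp_rw [hφ.partialDeriv_mul hψ] at h
    rw [integral_add ((hφ.partialDeriv i).mul hψ).integrable
      (hφ.mul (hψ.partialDeriv i)).integrable] at h
    linarith

/-! ### A smooth approximate identity on the torus. -/

/-- A fixed smooth even bump function on the line. -/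
noncomputable def lineBump : ContDiffBump (0 : ℝ) := ⟨1 / 2, 1, by norm_num, by norm_num⟩

/-- A smooth `1`-periodic function concentrated near the integers. -/
noncomputable def periodicBump (n : ℕ) (s : ℝ) : ℝ := lineBump ((n + 1) * Real.sin (Real.pi * s))

/-- The sine only changes sign under `s ↦ s + 1`, and the bump is even. -/
theorem periodicBump_periodic (n : ℕ) : Function.Periodic (periodicBump n) 1 := by
  intro s
  unfold periodicBump
  rw [mul_add, mul_one, Real.sin_add_pi, mul_neg, ContDiffBump.neg]

theorem periodicBump_contDiff (n : ℕ) : ContDiff ℝ ∞ (periodicBump n) := by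
  unfold periodicBump
  exact lineBump.contDiff.comp (contDiff_const.mul (Real.contDiff_sin.comp
    (contDiff_const.mul contDiff_id)))

theorem periodicBump_nonneg (n : ℕ) (s : ℝ) : 0 ≤ periodicBump n s := lineBump.nonneg

/-- Jordan's inequality; it confines the support of the periodic bump to distance `O(1/n)` from the
integers. -/
theorem two_mul_abs_le_abs_sin {s : ℝ} (hs : |s| ≤ 1 / 2) :
    2 * |s| ≤ |Real.sin (Real.pi * s)| := by
  have key : ∀ r : ℝ, 0 ≤ r → r ≤ 1 / 2 → 2 * r ≤ Real.sin (Real.pi * r) := by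
    intro r h0 h1
    have h := Real.mul_le_sin (x := Real.pi * r) (by positivity)
      (by nlinarith [Real.pi_pos])
    have : 2 / Real.pi * (Real.pi * r) = 2 * r := by field_simp
    linarith
  rcases le_total 0 s with h | h
  · rw [abs_of_nonneg h] at hs ⊢
    exact (key s h hs).trans (le_abs_self _)
  · rw [abs_of_nonpos h] at hs ⊢
    have := key (-s) (by linarith) hs
    rw [mul_neg Real.pi, Real.sin_neg] at this
    exact this.trans (neg_le_abs _)

theorem lineBump_eq_zero {s : ℝ} (hs : 1 < |s|) : lineBump s = 0 :=
  lineBump.zero_of_le_dist (by simpa [lineBump] using hs.le)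

theorem deriv_lineBump_eq_zero {s : ℝ} (hs : 1 < |s|) : deriv lineBump s = 0 := by
  have h : (lineBump : ℝ → ℝ) =ᶠ[nhds s] fun _ => 0 := by
    filter_upwards [(isOpen_lt continuous_const continuous_abs).mem_nhds hs] with r hr
    exact lineBump_eq_zero hr
  rw [h.deriv_eq, deriv_const]

theorem abs_le_of_periodicBump_ne_zero {n : ℕ} {s : ℝ} (hs : |s| ≤ 1 / 2)
    (h : |(n + 1) * Real.sin (Real.pi * s)| ≤ 1) : |s| ≤ 1 / (2 * (n + 1)) := by
  have hn : (0 : ℝ) < n + 1 := by positivity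
  rw [abs_mul, abs_of_pos hn] at h
  have h2 := mul_le_mul_of_nonneg_left (two_mul_abs_le_abs_sin hs) hn.le
  rw [le_div_iff₀ (by positivity)]
  linarith

theorem exists_deriv_lineBump_bound : ∃ K, 0 ≤ K ∧ ∀ s, |deriv lineBump s| ≤ K := by
  have hc : Continuous (deriv (lineBump : ℝ → ℝ)) :=
    (lineBump.contDiff (n := 1)).continuous_deriv (by simp)
  have hs : HasCompactSupport (deriv (lineBump : ℝ → ℝ)) := lineBump.hasCompactSupport.deriv
  obtain ⟨K, hK⟩ := hc.bounded_above_of_compact_support hs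
  exact ⟨K, (norm_nonneg _).trans (hK 0), hK⟩

theorem deriv_periodicBump (n : ℕ) (s : ℝ) : deriv (periodicBump n) s =
    deriv lineBump ((n + 1) * Real.sin (Real.pi * s)) *
      ((n + 1) * (Real.cos (Real.pi * s) * Real.pi)) := by
  have h1 : HasDerivAt (fun s => ((n : ℝ) + 1) * Real.sin (Real.pi * s))
      ((n + 1) * (Real.cos (Real.pi * s) * Real.pi)) s := by
    have := ((Real.hasDerivAt_sin (Real.pi * s)).comp s
      ((hasDerivAt_id s).const_mul Real.pi)).const_mul ((n : ℝ) + 1)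
    simpa using this
  have h2 : HasDerivAt lineBump (deriv lineBump ((n + 1) * Real.sin (Real.pi * s)))
      ((n + 1) * Real.sin (Real.pi * s)) :=
    ((lineBump.contDiff (n := 1)).differentiable (by simp) _).hasDerivAt
  exact (h2.comp s h1).deriv

theorem deriv_periodicBump_periodic (n : ℕ) : Function.Periodic (deriv (periodicBump n)) 1 := by
  intro s
  rw [← deriv_comp_add_const]
  congr 1
  ext r
  exact periodicBump_periodic n r

/-- The bump `periodicBump n` on the circle. -/
noncomputable def circleBump (n : ℕ) : UnitAddCircle → ℝ := (periodicBump_periodic n).lift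

/-- The derivative of `circleBump n`. -/
noncomputable def circleBumpDeriv (n : ℕ) : UnitAddCircle → ℝ :=
  (deriv_periodicBump_periodic n).lift

@[simp] theorem circleBump_coe (n : ℕ) (s : ℝ) : circleBump n s = periodicBump n s := rfl

@[simp] theorem circleBumpDeriv_coe (n : ℕ) (s : ℝ) :
    circleBumpDeriv n s = deriv (periodicBump n) s := rfl

theorem circleBump_nonneg (n : ℕ) (a : UnitAddCircle) : 0 ≤ circleBump n a := by
  induction a using QuotientAddGroup.induction_on with
  | H s => exact periodicBump_nonneg n s

theorem integral_circle (f : UnitAddCircle → ℝ) :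
    ∫ a, f a = ∫ s in (-(1 / 2) : ℝ)..(1 / 2), f s := by
  have := UnitAddCircle.intervalIntegral_preimage (-(1 / 2)) f
  rw [← this]; norm_num

/-- Since `|sin (π s)| ≤ π |s|`, the bump equals one on an interval of this length. -/
theorem integral_circleBump_ge (n : ℕ) : 1 / (Real.pi * (n + 1)) ≤ ∫ a, circleBump n a := by
  have hn : (0 : ℝ) < n + 1 := by positivity
  set δ : ℝ := 1 / (2 * Real.pi * (n + 1)) with hδ
  have hδ0 : 0 < δ := by positivity
  have hδ1 : δ ≤ 1 / 2 := by
    rw [hδ]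
    apply one_div_le_one_div_of_le (by norm_num)
    nlinarith [Real.pi_gt_three, Real.pi_pos, (n.cast_nonneg : (0 : ℝ) ≤ n)]
  rw [integral_circle]
  have hcont : Continuous (periodicBump n) := (periodicBump_contDiff n).continuous
  calc 1 / (Real.pi * (n + 1)) = ∫ s in (-δ)..δ, (1 : ℝ) := by
        simp [hδ]; field_simp; norm_num
    _ = ∫ s in (-δ)..δ, periodicBump n s := by
        refine intervalIntegral.integral_congr fun s hs => ?_
        rw [uIcc_of_le (by linarith)] at hs
        refine (lineBump.one_of_mem_closedBall ?_).symm
        have h1 : |Real.sin (Real.pi * s)| ≤ |Real.pi * s| := Real.abs_sin_le_abs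
        have h2 : |s| ≤ δ := abs_le.2 hs
        have h3 : |Real.pi * s| ≤ Real.pi * δ := by
          rw [abs_mul, abs_of_pos Real.pi_pos]
          exact mul_le_mul_of_nonneg_left h2 Real.pi_pos.le
        simp only [Metric.mem_closedBall, dist_zero_right, Real.norm_eq_abs, abs_mul, lineBump]
        rw [abs_of_pos hn]
        calc (n + 1) * |Real.sin (Real.pi * s)| ≤ (n + 1) * (Real.pi * δ) :=
              mul_le_mul_of_nonneg_left (h1.trans h3) hn.le
          _ = 1 / 2 := by rw [hδ]; field_simp
    _ ≤ ∫ s in (-(1 / 2) : ℝ)..(1 / 2), periodicBump n s := by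
        refine intervalIntegral.integral_mono_interval (by linarith) (by linarith) hδ1
          (ae_of_all _ fun s => periodicBump_nonneg n s) (hcont.intervalIntegrable _ _)

/-- The derivative has size `O(n)` on an interval of length `O(1/n)`. -/
theorem integral_abs_circleBumpDeriv_le :
    ∃ K, 0 ≤ K ∧ ∀ n, ∫ a, |circleBumpDeriv n a| ≤ K := by
  obtain ⟨K, hK0, hK⟩ := exists_deriv_lineBump_bound
  refine ⟨K * Real.pi, by positivity, fun n => ?_⟩
  have hn : (0 : ℝ) < n + 1 := by positivity
  set δ : ℝ := 1 / (2 * (n + 1)) with hδ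
  have hδ0 : 0 < δ := by positivity
  rw [integral_circle]
  simp only [circleBumpDeriv_coe]
  rw [intervalIntegral.integral_of_le (by norm_num)]
  calc ∫ s in Ioc (-(1 / 2) : ℝ) (1 / 2), |deriv (periodicBump n) s|
      ≤ ∫ s in Ioc (-(1 / 2) : ℝ) (1 / 2),
          (Icc (-δ) δ).indicator (fun _ => K * ((n + 1) * Real.pi)) s := by
        refine setIntegral_mono_on ?_ ?_ measurableSet_Ioc fun s hs => ?_
        · have : Continuous fun s => |deriv (periodicBump n) s| :=
            ((periodicBump_contDiff n).continuous_deriv (by simp)).abs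
          exact (this.integrableOn_Icc (a := -(1 / 2)) (b := 1 / 2)).mono_set Ioc_subset_Icc_self
        · exact (integrable_const _).indicator measurableSet_Icc
        · rw [deriv_periodicBump]
          by_cases h : |((n : ℝ) + 1) * Real.sin (Real.pi * s)| ≤ 1
          · have hs' := abs_le_of_periodicBump_ne_zero
              (abs_le.2 ⟨by linarith [hs.1], hs.2⟩) h
            rw [indicator_of_mem (by exact abs_le.1 hs'), abs_mul]
            refine mul_le_mul (hK _) ?_ (abs_nonneg _) hK0
            rw [abs_mul, abs_of_pos hn, abs_mul, abs_of_pos Real.pi_pos]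
            have := Real.abs_cos_le_one (Real.pi * s)
            refine mul_le_mul_of_nonneg_left ?_ hn.le
            nlinarith [Real.pi_pos]
          · rw [deriv_lineBump_eq_zero (not_le.1 h)]
            simp only [zero_mul, abs_zero]
            exact indicator_nonneg (fun _ _ => by positivity) _
    _ ≤ ∫ s, (Icc (-δ) δ).indicator (fun _ => K * ((n + 1) * Real.pi)) s := by
        refine setIntegral_le_integral ?_ (ae_of_all _ fun s =>
          indicator_nonneg (fun _ _ => by positivity) _)
        rw [integrable_indicator_iff measurableSet_Icc]
        exact integrableOn_const (by simp)
    _ = K * Real.pi := by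
        rw [integral_indicator measurableSet_Icc, setIntegral_const]
        simp only [measureReal_def, Real.volume_Icc, smul_eq_mul]
        rw [ENNReal.toReal_ofReal (by linarith), hδ]
        field_simp; norm_num

/-- An approximate identity of smooth functions on the torus. -/
noncomputable def mollifier (n : ℕ) (z : Torus d) : ℝ :=
  ∏ i, circleBump n (z i) / ∫ a, circleBump n a

theorem integral_circleBump_pos (n : ℕ) : 0 < ∫ a, circleBump n a :=
  lt_of_lt_of_le (by positivity) (integral_circleBump_ge n)

theorem mollifier_nonneg (n : ℕ) (z : Torus d) : 0 ≤ mollifier n z :=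
  Finset.prod_nonneg fun _ _ => div_nonneg (circleBump_nonneg _ _) (integral_circleBump_pos n).le

theorem integral_mollifier (n : ℕ) : ∫ z : Torus d, mollifier n z = 1 := by
  unfold mollifier
  rw [integral_fintype_prod_volume_eq_prod (fun (_ : Fin d) a => circleBump n a / ∫ a, circleBump n a)]
  simp [integral_div, div_self (integral_circleBump_pos n).ne']

theorem mollifier_smooth (n : ℕ) : Smooth (mollifier (d := d) n) := by
  unfold Smooth mollifier proj
  simp only [circleBump_coe]
  refine contDiff_prod fun i _ => ContDiff.div_const ?_ _
  exact (periodicBump_contDiff n).comp (by fun_prop)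

theorem partialDeriv_mollifier (n : ℕ) (i : Fin d) (z : Torus d) :
    Torus.partialDeriv i (mollifier n) z =
      ∏ j, (if j = i then circleBumpDeriv n (z j) else circleBump n (z j)) /
        ∫ a, circleBump n a := by
  obtain ⟨y, rfl⟩ := surjective_proj z
  set c := ∫ a, circleBump n a
  have hd : ∀ j, HasDerivAt (fun s : ℝ => periodicBump n (y j + if j = i then s else 0) / c)
      ((if j = i then deriv (periodicBump n) (y j) else 0) / c) 0 := by
    intro j
    refine HasDerivAt.div_const ?_ c
    split_ifs with h
    · have h1 : HasDerivAt (periodicBump n) (deriv (periodicBump n) (y j)) (y j + 0) := by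
        rw [add_zero]
        exact ((periodicBump_contDiff n).differentiable (by simp) _).hasDerivAt
      exact h1.comp_const_add (y j) 0
    · exact hasDerivAt_const _ _
  have h := (HasDerivAt.fun_finsetProd (u := Finset.univ) fun j _ => hd j).deriv
  have e : (fun s : ℝ => mollifier n (proj y + proj (EuclideanSpace.single i s))) =
      fun s : ℝ => ∏ j, periodicBump n (y j + if j = i then s else 0) / c := by
    ext s
    rw [← proj_add]
    simp only [mollifier, proj, circleBump_coe, c]
    refine Finset.prod_congr rfl fun j _ => ?_
    by_cases hj : j = i <;> simp [hj]
  rw [Torus.partialDeriv, e, h, Finset.sum_eq_single i]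
  · rw [← Finset.mul_prod_erase _ _ (Finset.mem_univ i)]
    simp only [if_true, smul_eq_mul, proj, circleBumpDeriv_coe, circleBump_coe]
    rw [mul_comm]
    congr 1
    refine Finset.prod_congr rfl fun j hj => ?_
    simp [(Finset.mem_erase.1 hj).1]
  · intro j _ hj
    simp [hj]
  · simp

/-- The growth `O(n)` is the one that a support of radius `O(1/n)` compensates in the commutator
estimate. -/
theorem integral_abs_partialDeriv_mollifier_le :
    ∃ K, 0 ≤ K ∧ ∀ (n : ℕ) (i : Fin d),
      ∫ z : Torus d, |Torus.partialDeriv i (mollifier n) z| ≤ K * (n + 1) := by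
  obtain ⟨K, hK0, hK⟩ := integral_abs_circleBumpDeriv_le
  refine ⟨K * Real.pi, by positivity, fun n i => ?_⟩
  set c := ∫ a, circleBump n a
  have hc : 0 < c := integral_circleBump_pos n
  have hc' : 1 / (Real.pi * (n + 1)) ≤ c := integral_circleBump_ge n
  simp_rw [partialDeriv_mollifier, Finset.abs_prod]
  rw [integral_fintype_prod_volume_eq_prod (fun (j : Fin d) a =>
    |(if j = i then circleBumpDeriv n a else circleBump n a) / c|)]
  rw [← Finset.mul_prod_erase _ _ (Finset.mem_univ i)]
  have h1 : ∏ j ∈ Finset.univ.erase i,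
      ∫ a, |(if j = i then circleBumpDeriv n a else circleBump n a) / c| = 1 := by
    refine Finset.prod_eq_one fun j hj => ?_
    simp only [(Finset.mem_erase.1 hj).1, if_false, abs_div, abs_of_nonneg (circleBump_nonneg n _),
      abs_of_pos hc, integral_div]
    exact div_self hc.ne'
  rw [h1, mul_one]
  simp only [if_true, abs_div, abs_of_pos hc, integral_div]
  rw [div_le_iff₀ hc]
  refine (hK n).trans ?_
  have hn : (0 : ℝ) < n + 1 := by positivity
  have : 1 ≤ Real.pi * (n + 1) * c := by
    rw [div_le_iff₀ (by positivity)] at hc'; linarith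
  nlinarith [mul_le_mul_of_nonneg_left this hK0]

theorem exists_small_rep {n : ℕ} {a : UnitAddCircle}
    (h : circleBump n a ≠ 0 ∨ circleBumpDeriv n a ≠ 0) :
    ∃ s : ℝ, (s : UnitAddCircle) = a ∧ |s| ≤ 1 / (n + 1) := by
  obtain ⟨⟨s, hs⟩, rfl⟩ := (AddCircle.equivIoc (1 : ℝ) (-(1 / 2))).symm.surjective a
  have hs2 : |s| ≤ 1 / 2 := abs_le.2 ⟨hs.1.le, by have := hs.2; linarith⟩
  change circleBump n (s : UnitAddCircle) ≠ 0 ∨ circleBumpDeriv n (s : UnitAddCircle) ≠ 0 at h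
  refine ⟨s, rfl, ?_⟩
  have h' : |((n : ℝ) + 1) * Real.sin (Real.pi * s)| ≤ 1 := by
    by_contra hlt
    rw [not_le] at hlt
    simp only [circleBump_coe, circleBumpDeriv_coe, periodicBump, deriv_periodicBump,
      lineBump_eq_zero hlt, deriv_lineBump_eq_zero hlt] at h
    simp at h
  refine (abs_le_of_periodicBump_ne_zero hs2 h').trans ?_
  exact one_div_le_one_div_of_le (by positivity) (by linarith [(n.cast_nonneg : (0 : ℝ) ≤ n)])

theorem mollifier_support {n : ℕ} {z : Torus d}
    (h : mollifier n z ≠ 0 ∨ ∃ i, Torus.partialDeriv i (mollifier n) z ≠ 0) :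
    ∃ y : EuclideanSpace ℝ (Fin d), proj y = z ∧ ∀ i, |y i| ≤ 1 / (n + 1) := by
  have h2 : ∀ j, ∃ s : ℝ, (s : UnitAddCircle) = z j ∧ |s| ≤ 1 / (n + 1) := by
    intro j
    refine exists_small_rep ?_
    rcases h with h | ⟨i, h⟩
    · left
      have := Finset.prod_ne_zero_iff.1 h j (Finset.mem_univ j)
      exact (div_ne_zero_iff.1 this).1
    · rw [partialDeriv_mollifier] at h
      have := (div_ne_zero_iff.1 (Finset.prod_ne_zero_iff.1 h j (Finset.mem_univ j))).1
      by_cases hj : j = i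
      · right; simpa [hj] using this
      · left; simpa [hj] using this
  choose s hs hs' using h2
  exact ⟨WithLp.toLp 2 s, by ext j; simpa [proj] using hs j, fun i => hs' i⟩

/-! ### Convolution with smooth kernels. -/

open Torus Filter
open scoped Topology

/-- Convolution on the torus. -/
noncomputable def conv (k f : Torus d → ℝ) (x : Torus d) : ℝ := ∫ z, k z * f (x - z)

theorem conv_eq (k f : Torus d → ℝ) (x : Torus d) : conv k f x = ∫ z, k (x - z) * f z := by
  rw [← integral_sub_left_eq_self _ volume x]
  simp [conv]

theorem integrable_comp_sub_right {f : Torus d → ℝ} (hf : Integrable f) (a : Torus d) :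
    Integrable fun x => f (x - a) :=
  (measurePreserving_sub_right volume a).integrable_comp_of_integrable hf

theorem integrable_comp_sub_left {f : Torus d → ℝ} (hf : Integrable f) (a : Torus d) :
    Integrable fun x => f (a - x) := hf.comp_sub_left a

theorem Torus.Smooth.integrable_mul {k f : Torus d → ℝ} (hk : Smooth k) (hf : Integrable f) :
    Integrable fun x => k x * f x := by
  obtain ⟨C, -, hC⟩ := hk.exists_bound
  exact hf.bdd_mul hk.continuous.aestronglyMeasurable (ae_of_all _ hC)

theorem abs_conv_le {k f : Torus d → ℝ} {C : ℝ} (hC : ∀ x, |k x| ≤ C)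
    (hf : Integrable f) (x : Torus d) : |conv k f x| ≤ C * ∫ z, |f z| := by
  rw [conv_eq, ← integral_const_mul, ← Real.norm_eq_abs]
  refine norm_integral_le_of_norm_le (hf.abs.const_mul C) (ae_of_all _ fun z => ?_)
  rw [Real.norm_eq_abs, abs_mul]
  exact mul_le_mul_of_nonneg_right (hC _) (abs_nonneg _)

theorem Torus.Smooth.hasFDerivAt_translate {k : Torus d → ℝ} (hk : Smooth k) (c : ℝ)
    (y : EuclideanSpace ℝ (Fin d)) (z : Torus d) :
    HasFDerivAt (fun y => k (proj y - z) * c)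
      (∑ i, (Torus.partialDeriv i k (proj y - z) * c) •
        (EuclideanSpace.proj i : EuclideanSpace ℝ (Fin d) →L[ℝ] ℝ)) y := by
  obtain ⟨a, rfl⟩ := surjective_proj z
  have e : ∀ y : EuclideanSpace ℝ (Fin d), proj y - proj a = proj (y - a) := fun y => by
    rw [sub_eq_add_neg y, proj_add, proj_neg, ← sub_eq_add_neg]
  simp_rw [e]
  have h1 : HasFDerivAt (fun y => k (proj y)) (fderiv ℝ (fun y => k (proj y)) (y - a)) (y - a) :=
    (ContDiff.differentiable hk (by simp) _).hasFDerivAt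
  have h2 : HasFDerivAt (fun y => k (proj (y - a)) * c)
      (c • (fderiv ℝ (fun y => k (proj y)) (y - a)).comp (ContinuousLinearMap.id ℝ _)) y :=
    (h1.comp y ((hasFDerivAt_id y).sub_const a)).mul_const c
  refine h2.congr_fderiv (ContinuousLinearMap.ext fun v => ?_)
  rw [ContinuousLinearMap.comp_id, smul_apply, hk.fderiv_apply, sum_apply, smul_eq_mul,
    Finset.mul_sum]
  refine Finset.sum_congr rfl fun i _ => ?_
  rw [smul_apply, PiLp.proj_apply, smul_eq_mul]
  ring

theorem integrable_sum_of_normed {Y E ι : Type*} [MeasurableSpace Y] {μ : Measure Y}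
    [NormedAddCommGroup E] {s : Finset ι} {f : ι → Y → E} (h : ∀ i ∈ s, Integrable (f i) μ) :
    Integrable (fun z => ∑ i ∈ s, f i z) μ :=
  integrable_finsetSum _ h

theorem conv_hasFDerivAt {k f : Torus d → ℝ} (hk : Smooth k) (hf : Integrable f)
    (y : EuclideanSpace ℝ (Fin d)) :
    HasFDerivAt (fun y => conv k f (proj y))
      (∑ i, conv (Torus.partialDeriv i k) f (proj y) •
        (EuclideanSpace.proj i : EuclideanSpace ℝ (Fin d) →L[ℝ] ℝ)) y := by
  have hC : ∀ i, ∃ C, 0 ≤ C ∧ ∀ x, |Torus.partialDeriv i k x| ≤ C :=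
    fun i => (hk.partialDeriv i).exists_bound
  choose C hC0 hC using hC
  have hsm : ∀ (y : EuclideanSpace ℝ (Fin d)) (k' : Torus d → ℝ), Smooth k' →
      Integrable fun z => k' (proj y - z) * f z :=
    fun y k' hk' => (hk'.comp_sub (proj y)).integrable_mul hf
  have hI : ∀ i, Integrable fun z => (Torus.partialDeriv i k (proj y - z) * f z) •
        (EuclideanSpace.proj i : EuclideanSpace ℝ (Fin d) →L[ℝ] ℝ) :=
    fun i => (hsm y _ (hk.partialDeriv i)).smul_const _
  have hI' : Integrable fun z => ∑ i, (Torus.partialDeriv i k (proj y - z) * f z) •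
        (EuclideanSpace.proj i : EuclideanSpace ℝ (Fin d) →L[ℝ] ℝ) :=
    integrable_sum_of_normed fun i _ => hI i
  have hint : ∫ z, ∑ i, (Torus.partialDeriv i k (proj y - z) * f z) •
        (EuclideanSpace.proj i : EuclideanSpace ℝ (Fin d) →L[ℝ] ℝ) =
      ∑ i, conv (Torus.partialDeriv i k) f (proj y) •
        (EuclideanSpace.proj i : EuclideanSpace ℝ (Fin d) →L[ℝ] ℝ) := by
    rw [integral_finsetSum _ fun i _ => hI i]
    refine Finset.sum_congr rfl fun i _ => ?_
    rw [integral_smul_const, conv_eq]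
  have hB : ∀ z : Torus d, ∀ y ∈ (univ : Set (EuclideanSpace ℝ (Fin d))),
      ‖∑ i, (Torus.partialDeriv i k (proj y - z) * f z) •
        (EuclideanSpace.proj i : EuclideanSpace ℝ (Fin d) →L[ℝ] ℝ)‖ ≤
      ∑ i, (C i * |f z|) * ‖(EuclideanSpace.proj i : EuclideanSpace ℝ (Fin d) →L[ℝ] ℝ)‖ := by
    intro z y _
    apply norm_sum_le_of_le
    intro i _
    rw [norm_smul, Real.norm_eq_abs, abs_mul]
    exact mul_le_mul_of_nonneg_right (mul_le_mul_of_nonneg_right (hC i _) (abs_nonneg _))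
      (norm_nonneg _)
  have hBI : Integrable fun z =>
      ∑ i, (C i * |f z|) * ‖(EuclideanSpace.proj i : EuclideanSpace ℝ (Fin d) →L[ℝ] ℝ)‖ :=
    integrable_finsetSum _ fun i _ => (hf.abs.const_mul _).mul_const _
  have e : (fun y => conv k f (proj y)) = fun y => ∫ z, k (proj y - z) * f z :=
    funext fun y => conv_eq _ _ _
  rw [← hint, e]
  exact hasFDerivAt_integral_of_dominated_of_fderiv_le
    (F' := fun (y : EuclideanSpace ℝ (Fin d)) (z : Torus d) =>
      ∑ i, (Torus.partialDeriv i k (proj y - z) * f z) •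
        (EuclideanSpace.proj i : EuclideanSpace ℝ (Fin d) →L[ℝ] ℝ)) univ_mem
    (Eventually.of_forall fun y => (hsm y k hk).aestronglyMeasurable) (hsm y k hk)
    hI'.aestronglyMeasurable (ae_of_all _ hB) hBI
    (ae_of_all _ fun z y _ => hk.hasFDerivAt_translate (f z) y z)

/-- The derivative of a convolution is a convolution with the derivative of the kernel, so the
induction on the order must quantify over all smooth kernels. -/
theorem conv_smooth {k f : Torus d → ℝ} (hk : Smooth k) (hf : Integrable f) :
    Smooth (conv k f) := by
  unfold Smooth
  refine contDiff_infty.2 fun n => ?_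
  induction n generalizing k with
  | zero =>
    exact contDiff_zero.2 (continuous_iff_continuousAt.2 fun y =>
      (conv_hasFDerivAt hk hf y).continuousAt)
  | succ n ih =>
    rw [Nat.cast_succ, contDiff_succ_iff_fderiv]
    refine ⟨fun y => (conv_hasFDerivAt hk hf y).differentiableAt, by simp, ?_⟩
    have : (fderiv ℝ fun y => conv k f (proj y)) = fun y =>
        ∑ i, conv (Torus.partialDeriv i k) f (proj y) • EuclideanSpace.proj (𝕜 := ℝ) i :=
      funext fun y => (conv_hasFDerivAt hk hf y).fderiv
    rw [this]
    exact ContDiff.sum fun i _ => (ih (hk.partialDeriv i)).smul contDiff_const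

theorem partialDeriv_conv {k f : Torus d → ℝ} (hk : Smooth k) (hf : Integrable f) (i : Fin d)
    (x : Torus d) : Torus.partialDeriv i (conv k f) x = conv (Torus.partialDeriv i k) f x := by
  obtain ⟨y, rfl⟩ := surjective_proj x
  rw [(conv_smooth hk hf).partialDeriv_proj, (conv_hasFDerivAt hk hf y).fderiv]
  simp only [sum_apply, smul_apply, PiLp.proj_apply,
    smul_eq_mul]
  rw [Finset.sum_eq_single i] <;> simp +contextual [eq_comm]

/-- The weak derivative is tested with the reflected and translated kernel; the sign of the
reflection cancels that of the integration by parts. -/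
theorem IsWeakPartial.conv_partialDeriv {f g k : Torus d → ℝ} {i : Fin d}
    (h : IsWeakPartial i f g) (hk : Smooth k) (x : Torus d) :
    conv (Torus.partialDeriv i k) f x = conv k g x := by
  rw [conv_eq, conv_eq]
  have := h.integral_eq (fun z => k (x - z)) (hk.comp_sub x)
  simp_rw [hk.partialDeriv_comp_sub, mul_neg, integral_neg, neg_inj] at this
  simpa only [mul_comm] using this

/-! ### Continuity of translations in `L^1` and convergence of mollifications. -/

theorem tendsto_integral_abs_sub_translate {f : Torus d → ℝ} (hf : Integrable f) :
    Tendsto (fun a => ∫ x, |f (x - a) - f x|) (𝓝 0) (𝓝 0) := by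
  have hf1 : MemLp f 1 volume := memLp_one_iff_integrable.2 hf
  -- Translations form a continuous family of measure-preserving maps, and composition with such a
  -- family is continuous in `L^1`.
  let g : C(Torus d, C(Torus d, Torus d)) :=
    ContinuousMap.curry ⟨fun p => p.2 - p.1, by fun_prop⟩
  have hg : ∀ a, MeasurePreserving (g a) volume volume := fun a =>
    measurePreserving_sub_right volume a
  have h := Tendsto.compMeasurePreservingLp (p := 1) (f := fun _ : Torus d => hf1.toLp f)
    (l := 𝓝 0) tendsto_const_nhds (g.continuous.tendsto 0) hg (hg 0) (by simp)
  rw [tendsto_iff_norm_sub_tendsto_zero] at h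
  refine h.congr fun a => ?_
  rw [Lp.toLp_compMeasurePreserving, Lp.toLp_compMeasurePreserving, ← MemLp.toLp_sub,
    L1.norm_eq_integral_norm]
  refine integral_congr_ae ?_
  filter_upwards [MemLp.coeFn_toLp ((hf1.comp_measurePreserving (hg a)).sub
    (hf1.comp_measurePreserving (hg 0)))] with x hx
  rw [hx]
  simp [g, Real.norm_eq_abs]

theorem tendsto_integral_abs_add_translate {f : Torus d → ℝ} (hf : Integrable f) :
    Tendsto (fun a => ∫ x, |f (x + a) - f x|) (𝓝 0) (𝓝 0) := by
  have h := (tendsto_integral_abs_sub_translate hf).comp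
    (show Tendsto (fun a : Torus d => -a) (𝓝 0) (𝓝 0) by
      simpa using (continuous_neg.tendsto (0 : Torus d)))
  simpa [Function.comp_def] using h

theorem eventually_mollifier_support {U : Set (Torus d)} (hU : U ∈ 𝓝 0) :
    ∀ᶠ n in atTop, ∀ z : Torus d,
      (mollifier n z ≠ 0 ∨ ∃ i, Torus.partialDeriv i (mollifier n) z ≠ 0) → z ∈ U := by
  have h : Tendsto (proj (d := d)) (𝓝 0) (𝓝 0) := by
    simpa [proj_zero] using (continuous_proj (d := d)).tendsto 0
  have h2 : ∃ δ > 0, ∀ y : EuclideanSpace ℝ (Fin d), (∀ i, |y i| ≤ δ) → proj y ∈ U := by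
    have h3 : Tendsto (fun w : Fin d → ℝ => proj (WithLp.toLp 2 w)) (𝓝 0) (𝓝 (0 : Torus d)) := by
      refine h.comp ?_
      simpa using (PiLp.continuous_toLp 2 (fun _ : Fin d => ℝ)).tendsto 0
    obtain ⟨δ, hδ, hb⟩ := Metric.mem_nhds_iff.1 (h3 hU)
    refine ⟨δ / 2, by positivity, fun y hy => ?_⟩
    have : (fun i => y i) ∈ Metric.ball (0 : Fin d → ℝ) δ := by
      rw [mem_ball_zero_iff]
      refine lt_of_le_of_lt ((pi_norm_le_iff_of_nonneg (by positivity)).2 fun i => hy i)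
        (by linarith)
    exact hb this
  obtain ⟨δ, hδ, hb⟩ := h2
  filter_upwards [(tendsto_one_div_add_atTop_nhds_zero_nat (𝕜 := ℝ)).eventually
    (Iic_mem_nhds hδ)] with n hn z hz
  obtain ⟨y, rfl, hy⟩ := mollifier_support hz
  exact hb y fun i => (hy i).trans hn

/-- Averages against the approximate identity. -/
theorem tendsto_integral_mollifier_mul {F : Torus d → ℝ} (hF : Tendsto F (𝓝 0) (𝓝 0)) :
    Tendsto (fun n => ∫ z, mollifier n z * F z) atTop (𝓝 0) := by
  rw [Metric.tendsto_atTop']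
  intro ε hε
  have hU : {z | |F z| ≤ ε / 2} ∈ 𝓝 (0 : Torus d) := by
    have := hF (Metric.closedBall_mem_nhds 0 (half_pos hε))
    simpa [Metric.closedBall, Real.dist_eq] using this
  obtain ⟨N, hN⟩ := eventually_atTop.1 (eventually_mollifier_support hU)
  refine ⟨N, fun n hn => ?_⟩
  rw [dist_zero_right]
  have h : ‖∫ z : Torus d, mollifier n z * F z‖ ≤ ∫ z : Torus d, mollifier n z * (ε / 2) := by
    refine norm_integral_le_of_norm_le ((mollifier_smooth n).integrable.mul_const _)
      (ae_of_all _ fun z => ?_)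
    rw [norm_mul, Real.norm_eq_abs, Real.norm_eq_abs, abs_of_nonneg (mollifier_nonneg n z)]
    by_cases hz : mollifier n z = 0
    · simp [hz]
    · exact mul_le_mul_of_nonneg_left (hN n hn.le z (Or.inl hz)) (mollifier_nonneg n z)
  rw [integral_mul_const, integral_mollifier] at h
  linarith

theorem aestronglyMeasurable_comp_sub {f : Torus d → ℝ} (hf : AEStronglyMeasurable f volume) :
    AEStronglyMeasurable (fun p : Torus d × Torus d => f (p.1 - p.2)) (volume.prod volume) :=
  hf.comp_quasiMeasurePreserving (quasiMeasurePreserving_sub_of_right_invariant volume volume)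

theorem integrable_conv_kernel {k f : Torus d → ℝ} (hk : Integrable k) (hf : Integrable f) :
    Integrable (fun p : Torus d × Torus d => k p.2 * f (p.1 - p.2)) (volume.prod volume) := by
  have hm : AEStronglyMeasurable (fun p : Torus d × Torus d => k p.2 * f (p.1 - p.2))
      (volume.prod volume) :=
    hk.aestronglyMeasurable.comp_snd.mul (aestronglyMeasurable_comp_sub hf.aestronglyMeasurable)
  rw [integrable_prod_iff' hm]
  refine ⟨ae_of_all _ fun z => (integrable_comp_sub_right hf z).const_mul (k z), ?_⟩
  have : ∀ z, ∫ x, ‖k z * f (x - z)‖ = |k z| * ∫ x, |f x| := by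
    intro z
    simp_rw [norm_mul, Real.norm_eq_abs]
    rw [integral_const_mul, integral_sub_right_eq_self (fun x => |f x|)]
  simp_rw [this]
  exact hk.abs.mul_const _

theorem integral_abs_conv_sub_le {k f : Torus d → ℝ} (hk : Smooth k) (hk0 : ∀ z, 0 ≤ k z)
    (hk1 : ∫ z, k z = 1) (hf : Integrable f) :
    ∫ x, |conv k f x - f x| ≤ ∫ z, k z * ∫ x, |f (x - z) - f x| := by
  have hI : Integrable (fun p : Torus d × Torus d => k p.2 * (f (p.1 - p.2) - f p.1))
      (volume.prod volume) := by
    have := (integrable_conv_kernel hk.integrable hf).sub (hf.mul_prod hk.integrable)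
    refine this.congr (ae_of_all _ fun p => ?_)
    simp only [Pi.sub_apply]; ring
  have h1 : ∀ᵐ x, |conv k f x - f x| ≤ ∫ z, k z * |f (x - z) - f x| := by
    refine ae_of_all _ fun x => ?_
    have e : conv k f x - f x = ∫ z, k z * (f (x - z) - f x) := by
      simp_rw [mul_sub]
      rw [integral_sub (hk.integrable_mul (integrable_comp_sub_left hf x))
        (hk.integrable.mul_const _), integral_mul_const, hk1, one_mul]
      rfl
    rw [e]
    refine (abs_integral_le_integral_abs).trans (le_of_eq ?_)
    simp_rw [abs_mul, abs_of_nonneg (hk0 _)]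
  have h2 : Integrable (fun p : Torus d × Torus d => k p.2 * |f (p.1 - p.2) - f p.1|)
      (volume.prod volume) := by
    refine hI.abs.congr (ae_of_all _ fun p => ?_)
    simp only [abs_mul, abs_of_nonneg (hk0 _)]
  refine (integral_mono_ae ((conv_smooth hk hf).integrable.sub hf).abs
    h2.integral_prod_left h1).trans (le_of_eq ?_)
  rw [integral_integral_swap h2]
  simp_rw [integral_const_mul]

theorem tendsto_integral_abs_conv_sub {f : Torus d → ℝ} (hf : Integrable f) :
    Tendsto (fun n => ∫ x, |conv (mollifier n) f x - f x|) atTop (𝓝 0) :=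
  squeeze_zero (fun _ => integral_nonneg fun _ => abs_nonneg _)
    (fun n => integral_abs_conv_sub_le (mollifier_smooth n) (mollifier_nonneg n)
      (integral_mollifier n) hf)
    (tendsto_integral_mollifier_mul (tendsto_integral_abs_sub_translate hf))

/-- Convergence in `L¹` gives convergence almost everywhere along a subsequence. -/
theorem exists_subseq_tendsto_ae {Y : Type*} [MeasurableSpace Y] {μ : Measure Y}
    {f : ℕ → Y → ℝ} {g : Y → ℝ}
    (hf : ∀ n, Integrable (f n) μ) (hg : Integrable g μ)
    (h : Tendsto (fun n => ∫ x, |f n x - g x| ∂μ) atTop (𝓝 0)) :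
    ∃ ns : ℕ → ℕ, StrictMono ns ∧ ∀ᵐ x ∂μ, Tendsto (fun k => f (ns k) x) atTop (𝓝 (g x)) := by
  refine (tendstoInMeasure_of_tendsto_eLpNorm (p := 1) one_ne_zero
    (fun n => (hf n).aestronglyMeasurable) hg.aestronglyMeasurable ?_).exists_seq_tendsto_ae
  have : ∀ n, eLpNorm (f n - g) 1 μ = ENNReal.ofReal (∫ x, |f n x - g x| ∂μ) := by
    intro n
    rw [eLpNorm_one_eq_lintegral_enorm,
      ← ofReal_integral_norm_eq_lintegral_enorm ((hf n).sub hg)]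
    rfl
  simp_rw [this]
  simpa using ENNReal.tendsto_ofReal h

theorem abs_integral_mul_sub_le {f g φ : Torus d → ℝ} (hf : Integrable f) (hg : Integrable g)
    (hφ : AEStronglyMeasurable φ volume) {C : ℝ} (hC : ∀ᵐ x, |φ x| ≤ C) :
    |(∫ x, f x * φ x) - ∫ x, g x * φ x| ≤ C * ∫ x, |f x - g x| := by
  rw [← integral_sub (hf.mul_bdd (c := C) hφ hC) (hg.mul_bdd (c := C) hφ hC), ← integral_const_mul,
    ← Real.norm_eq_abs]
  refine norm_integral_le_of_norm_le ((hf.sub hg).abs.const_mul C) ?_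
  filter_upwards [hC] with x hx
  rw [← sub_mul, norm_mul, mul_comm]
  exact mul_le_mul_of_nonneg_right hx (abs_nonneg _)

/-! ### Jensen's inequality and finite differences of weakly differentiable functions. -/

/-- A nonnegative convex function on the line with minimum at `0`. -/
structure ConvexCost (Ψ : ℝ → ℝ) : Prop where
  convexOn : ConvexOn ℝ univ Ψ
  continuous : Continuous Ψ
  min_zero : ∀ t, Ψ 0 ≤ Ψ t
  zero_nonneg : 0 ≤ Ψ 0

theorem ConvexCost.nonneg {Ψ : ℝ → ℝ} (h : ConvexCost Ψ) (t : ℝ) : 0 ≤ Ψ t :=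
  h.zero_nonneg.trans (h.min_zero t)

theorem ConvexCost.comp_abs {g : ℝ → ℝ} (hg : ConvexOn ℝ (Ici 0) g) (hm : MonotoneOn g (Ici 0))
    (hc : Continuous fun t => g |t|) (h0 : 0 ≤ g 0) : ConvexCost fun t => g |t| where
  convexOn := by
    refine ⟨convex_univ, fun x _ y _ a b ha hb hab => ?_⟩
    have h1 : |a • x + b • y| ≤ a • |x| + b • |y| := by
      refine (abs_add_le _ _).trans (le_of_eq ?_)
      simp [abs_mul, abs_of_nonneg ha, abs_of_nonneg hb]
    refine (hm (mem_Ici.2 (abs_nonneg _)) (mem_Ici.2 ?_) h1).trans (hg.2 (abs_nonneg x) (abs_nonneg y) ha hb hab)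
    exact (abs_nonneg _).trans h1
  continuous := hc
  min_zero t := by rw [abs_zero]; exact hm self_mem_Ici (abs_nonneg t) (abs_nonneg t)
  zero_nonneg := by rwa [abs_zero]

theorem convexCost_rpow {p : ℝ} (hp : 1 ≤ p) : ConvexCost fun t => |t| ^ p :=
  ConvexCost.comp_abs (convexOn_rpow hp)
    (fun _ hx _ _ hxy => Real.rpow_le_rpow hx hxy (by linarith))
    (continuous_abs.rpow_const fun _ => Or.inr (by linarith)) (Real.rpow_nonneg le_rfl _)

theorem convexCost_exp {c : ℝ} (hc : 0 ≤ c) : ConvexCost fun t => Real.exp (c * |t|) :=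
  ConvexCost.comp_abs (g := fun t => Real.exp (c * t))
    (by
      have := convexOn_exp.comp_linearMap (LinearMap.mul ℝ ℝ c)
      exact (by simpa [Function.comp_def] using this :
        ConvexOn ℝ univ fun t : ℝ => Real.exp (c * t)).subset (subset_univ _) (convex_Ici 0))
    (fun _ _ _ _ hxy => Real.exp_le_exp.2 (mul_le_mul_of_nonneg_left hxy hc))
    (by fun_prop) (Real.exp_nonneg _)

theorem convexCost_abs : ConvexCost fun t => |t| :=
  ConvexCost.comp_abs (convexOn_id (convex_Ici 0)) (fun _ _ _ _ hxy => hxy) continuous_abs le_rfl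

/-- Jensen's inequality without integrability assumptions. -/
theorem ConvexCost.ofReal_integral_le {Y : Type*} [MeasurableSpace Y] {P : Measure Y}
    [IsProbabilityMeasure P] {Ψ : ℝ → ℝ} (hΨ : ConvexCost Ψ) (f : Y → ℝ) :
    ENNReal.ofReal (Ψ (∫ y, f y ∂P)) ≤ ∫⁻ y, ENNReal.ofReal (Ψ (f y)) ∂P := by
  by_cases hf : Integrable f P
  · by_cases hfin : ∫⁻ y, ENNReal.ofReal (Ψ (f y)) ∂P = ⊤
    · rw [hfin]; exact le_top
    · have hm : AEStronglyMeasurable (fun y => Ψ (f y)) P :=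
        hΨ.continuous.comp_aestronglyMeasurable hf.aestronglyMeasurable
      have hi : Integrable (fun y => Ψ (f y)) P :=
        (lintegral_ofReal_ne_top_iff_integrable hm (ae_of_all _ fun y => hΨ.nonneg _)).1 hfin
      rw [← ofReal_integral_eq_lintegral_ofReal hi (ae_of_all _ fun y => hΨ.nonneg _)]
      exact ENNReal.ofReal_le_ofReal (hΨ.convexOn.map_integral_le hΨ.continuous.continuousOn
        isClosed_univ (ae_of_all _ fun _ => mem_univ _) hf hi)
  -- The integral of a non-integrable function is `0` by convention, and `0` is where `Ψ` is
  -- smallest. This is the reason for the minimum condition in `ConvexCost`.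
  · rw [integral_undef hf]
    calc ENNReal.ofReal (Ψ 0) = ∫⁻ _, ENNReal.ofReal (Ψ 0) ∂P := by simp
      _ ≤ _ := lintegral_mono fun y => ENNReal.ofReal_le_ofReal (hΨ.min_zero _)

theorem ConvexCost.lintegral_integral_le {X Y : Type*} [MeasurableSpace X] [MeasurableSpace Y]
    {P : Measure Y} {μ : Measure X} [SFinite μ] [IsProbabilityMeasure P] {Ψ : ℝ → ℝ}
    (hΨ : ConvexCost Ψ) {a : Y → X → ℝ}
    (ha : AEStronglyMeasurable (Function.uncurry a) (P.prod μ)) :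
    ∫⁻ x, ENNReal.ofReal (Ψ (∫ y, a y x ∂P)) ∂μ ≤ ∫⁻ y, ∫⁻ x, ENNReal.ofReal (Ψ (a y x)) ∂μ ∂P := by
  rw [lintegral_lintegral_swap]
  · exact lintegral_mono fun x => hΨ.ofReal_integral_le _
  · exact (hΨ.continuous.comp_aestronglyMeasurable ha).aemeasurable.ennreal_ofReal

theorem conv_eq_integral_withDensity {k : Torus d → ℝ} (hk : Smooth k) (hk0 : ∀ z, 0 ≤ k z)
    (f : Torus d → ℝ) (x : Torus d) :
    conv k f x = ∫ z, f (x - z) ∂(volume.withDensity fun z => ENNReal.ofReal (k z)) := by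
  rw [integral_withDensity_eq_integral_toReal_smul hk.continuous.measurable.ennreal_ofReal (by simp)]
  simp [conv, ENNReal.toReal_ofReal (hk0 _)]

/-- Convolution with a probability density is an average of translates, each of which has the same
cost. -/
theorem lintegral_cost_conv_le {Ψ : ℝ → ℝ} (hΨ : ConvexCost Ψ) {k f : Torus d → ℝ} (hk : Smooth k)
    (hk0 : ∀ z, 0 ≤ k z) (hk1 : ∫ z, k z = 1) (hf : AEStronglyMeasurable f volume) :
    ∫⁻ x, ENNReal.ofReal (Ψ (conv k f x)) ≤ ∫⁻ x, ENNReal.ofReal (Ψ (f x)) := by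
  set P := (volume : Measure (Torus d)).withDensity fun z => ENNReal.ofReal (k z)
  have hP : IsProbabilityMeasure P := by
    constructor
    rw [withDensity_apply _ MeasurableSet.univ, Measure.restrict_univ,
      ← ofReal_integral_eq_lintegral_ofReal hk.integrable (ae_of_all _ hk0), hk1,
      ENNReal.ofReal_one]
  simp_rw [conv_eq_integral_withDensity hk hk0]
  refine (hΨ.lintegral_integral_le (a := fun z x => f (x - z)) ?_).trans (le_of_eq ?_)
  · have h1 := ((aestronglyMeasurable_comp_sub hf).prod_swap)
    exact h1.mono_ac ((withDensity_absolutelyContinuous _ _).prod Measure.AbsolutelyContinuous.rfl)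
  · have : ∀ z : Torus d, ∫⁻ x, ENNReal.ofReal (Ψ (f (x - z))) = ∫⁻ x, ENNReal.ofReal (Ψ (f x)) :=
      fun z => lintegral_sub_right_eq_self (fun x => ENNReal.ofReal (Ψ (f x))) z
    simp [this]

theorem conv_sum {ι : Type*} {s : Finset ι} {k : Torus d → ℝ} (hk : Smooth k)
    {g : ι → Torus d → ℝ} (hg : ∀ i, Integrable (g i)) (c : ι → ℝ) (x : Torus d) :
    conv k (fun x => ∑ i ∈ s, c i * g i x) x = ∑ i ∈ s, c i * conv k (g i) x := by
  simp_rw [conv, Finset.mul_sum]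
  rw [integral_finsetSum]
  · refine Finset.sum_congr rfl fun i _ => ?_
    rw [← integral_const_mul]
    refine integral_congr_ae (ae_of_all _ fun z => ?_)
    ring
  · intro i _
    refine ((hk.integrable_mul (integrable_comp_sub_left (hg i) x)).const_mul (c i)).congr
      (ae_of_all _ fun z => ?_)
    ring

theorem conv_sub {k f g : Torus d → ℝ} (hk : Smooth k) (hf : Integrable f) (hg : Integrable g)
    (x : Torus d) : conv k (fun x => f x - g x) x = conv k f x - conv k g x := by
  simp_rw [conv, mul_sub]
  exact integral_sub (hk.integrable_mul (integrable_comp_sub_left hf x))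
    (hk.integrable_mul (integrable_comp_sub_left hg x))

theorem conv_translate (k f : Torus d → ℝ) (a x : Torus d) :
    conv k (fun x => f (x + a)) x = conv k f (x + a) := by
  simp only [conv]
  congr 1 with z
  rw [sub_add_eq_add_sub]

theorem conv_sub_eq_integral {k f : Torus d → ℝ} {g : Fin d → Torus d → ℝ} (hk : Smooth k)
    (h : ∀ i, IsWeakPartial i f (g i)) (x : Torus d) (y : EuclideanSpace ℝ (Fin d)) :
    conv k f (x + proj y) - conv k f x =
      ∫ θ in Ioc (0 : ℝ) 1, conv k (fun x => ∑ i, y i * g i x) (x + proj (θ • y)) := by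
  -- For `d = 0` the weak derivative hypotheses are empty and do not yield integrability of `f`, but
  -- then every translation is trivial.
  by_cases hd : Nonempty (Fin d)
  · obtain ⟨i0⟩ := hd
    have hf := (h i0).integrable
    rw [(conv_smooth hk hf).sub_eq_integral, intervalIntegral.integral_of_le zero_le_one]
    refine integral_congr_ae (ae_of_all _ fun θ => ?_)
    simp only
    rw [conv_sum hk (fun i => (h i).integrable_deriv)]
    refine Finset.sum_congr rfl fun i _ => ?_
    rw [partialDeriv_conv hk hf, (h i).conv_partialDeriv hk]
  · have : x + proj y = x := by
      ext i; exact (hd ⟨i⟩).elim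
    rw [not_nonempty_iff] at hd
    simp [this, conv]

theorem integrable_comp_add_right {f : Torus d → ℝ} (hf : Integrable f) (a : Torus d) :
    Integrable fun x => f (x + a) :=
  (measurePreserving_add_right volume a).integrable_comp_of_integrable hf

theorem continuous_line_uncurry (y : EuclideanSpace ℝ (Fin d)) :
    Continuous fun p : ℝ × Torus d => p.2 + proj (p.1 • y) :=
  continuous_snd.add (continuous_proj.comp (by fun_prop))

theorem lintegral_cost_conv_translate_le {Ψ : ℝ → ℝ} (hΨ : ConvexCost Ψ) {k f : Torus d → ℝ}
    {g : Fin d → Torus d → ℝ} (hk : Smooth k) (hk0 : ∀ z, 0 ≤ k z) (hk1 : ∫ z, k z = 1)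
    (h : ∀ i, IsWeakPartial i f (g i)) (y : EuclideanSpace ℝ (Fin d)) :
    ∫⁻ x, ENNReal.ofReal (Ψ (conv k f (x + proj y) - conv k f x)) ≤
      ∫⁻ x, ENNReal.ofReal (Ψ (∑ i, y i * g i x)) := by
  set G : Torus d → ℝ := fun x => ∑ i, y i * g i x
  have hG : Integrable G := integrable_sum_of_normed fun i _ => (h i).integrable_deriv.const_mul _
  have hP : IsProbabilityMeasure ((volume : Measure ℝ).restrict (Ioc 0 1)) := ⟨by simp⟩
  simp_rw [conv_sub_eq_integral hk h]
  refine (hΨ.lintegral_integral_le (a := fun θ x => conv k G (x + proj (θ • y))) ?_).trans ?_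
  · exact ((conv_smooth hk hG).continuous.comp (continuous_line_uncurry y)).aestronglyMeasurable
  · have : ∀ θ : ℝ, ∫⁻ x, ENNReal.ofReal (Ψ (conv k G (x + proj (θ • y)))) ≤
        ∫⁻ x, ENNReal.ofReal (Ψ (G x)) := fun θ => by
      rw [lintegral_add_right_eq_self (fun x => ENNReal.ofReal (Ψ (conv k G x)))]
      exact lintegral_cost_conv_le hΨ hk hk0 hk1 hG.aestronglyMeasurable
    refine (lintegral_mono fun θ => this θ).trans (by simp [G])

/-- Convex integrals of finite differences are controlled by those of the weak gradient. -/
theorem lintegral_cost_translate_le {Ψ : ℝ → ℝ} (hΨ : ConvexCost Ψ) {f : Torus d → ℝ}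
    (hf : Integrable f) {g : Fin d → Torus d → ℝ}
    (h : ∀ i, IsWeakPartial i f (g i)) (y : EuclideanSpace ℝ (Fin d)) :
    ∫⁻ x, ENNReal.ofReal (Ψ (f (x + proj y) - f x)) ≤
      ∫⁻ x, ENNReal.ofReal (Ψ (∑ i, y i * g i x)) := by
  -- The inequality holds for mollifications; it passes to `f` by Fatou's lemma along a subsequence
  -- that converges almost everywhere.
  obtain ⟨ns, -, hae⟩ := exists_subseq_tendsto_ae
    (fun n => (conv_smooth (mollifier_smooth n) hf).integrable) hf
    (tendsto_integral_abs_conv_sub hf)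
  have hae2 : ∀ᵐ x, Tendsto (fun k => conv (mollifier (ns k)) f (x + proj y)) atTop
      (𝓝 (f (x + proj y))) :=
    (measurePreserving_add_right volume (proj y)).quasiMeasurePreserving.ae hae
  calc ∫⁻ x, ENNReal.ofReal (Ψ (f (x + proj y) - f x))
      = ∫⁻ x, liminf (fun k => ENNReal.ofReal (Ψ (conv (mollifier (ns k)) f (x + proj y) -
          conv (mollifier (ns k)) f x))) atTop := by
        refine lintegral_congr_ae ?_
        filter_upwards [hae, hae2] with x h1 h2
        exact (ENNReal.tendsto_ofReal ((hΨ.continuous.tendsto _).comp (h2.sub h1))).liminf_eq.symm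
    _ ≤ liminf (fun k => ∫⁻ x, ENNReal.ofReal (Ψ (conv (mollifier (ns k)) f (x + proj y) -
          conv (mollifier (ns k)) f x))) atTop := by
        refine lintegral_liminf_le' fun k => ?_
        have hc := (conv_smooth (mollifier_smooth (ns k)) hf).continuous
        exact (hΨ.continuous.comp ((hc.comp (continuous_id.add continuous_const)).sub
          hc)).measurable.ennreal_ofReal.aemeasurable
    _ ≤ liminf (fun _ : ℕ => ∫⁻ x, ENNReal.ofReal (Ψ (∑ i, y i * g i x))) atTop :=
        liminf_le_liminf (Eventually.of_forall fun k =>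
          lintegral_cost_conv_translate_le hΨ (mollifier_smooth _) (mollifier_nonneg _)
            (integral_mollifier _) h y)
    _ = _ := by simp

theorem integral_abs_conv_le {k f : Torus d → ℝ} (hk : Smooth k) (hk0 : ∀ z, 0 ≤ k z)
    (hk1 : ∫ z, k z = 1) (hf : Integrable f) : ∫ x, |conv k f x| ≤ ∫ x, |f x| := by
  have h := lintegral_cost_conv_le convexCost_abs hk hk0 hk1 hf.aestronglyMeasurable
  rw [← ofReal_integral_eq_lintegral_ofReal (conv_smooth hk hf).integrable.abs
    (ae_of_all _ fun _ => abs_nonneg _), ← ofReal_integral_eq_lintegral_ofReal hf.abs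
    (ae_of_all _ fun _ => abs_nonneg _)] at h
  exact (ENNReal.ofReal_le_ofReal_iff (integral_nonneg fun _ => abs_nonneg _)).1 h

theorem integral_abs_le_of_tendsto {f : Torus d → ℝ} (hf : Integrable f) {c : ℝ}
    (h : ∀ n, ∫ x, |conv (mollifier n) f x| ≤ c) : ∫ x, |f x| ≤ c := by
  have h2 : ∀ n, ∫ x, |f x| ≤ (∫ x, |conv (mollifier n) f x - f x|) + c := by
    intro n
    have hc := (conv_smooth (mollifier_smooth n) hf).integrable
    have : ∫ x, |f x| ≤ ∫ x, (|conv (mollifier n) f x - f x| + |conv (mollifier n) f x|) := by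
      refine integral_mono hf.abs ((hc.sub hf).abs.add hc.abs) fun x => ?_
      have := abs_sub_abs_le_abs_sub (f x) (conv (mollifier n) f x)
      rw [abs_sub_comm] at this
      simp only
      linarith
    have h5 := integral_add (hc.sub hf).abs hc.abs
    simp only [Pi.sub_apply] at h5
    rw [h5] at this
    linarith [h n]
  have h3 := (tendsto_integral_abs_conv_sub hf).add_const c
  rw [zero_add] at h3
  exact ge_of_tendsto' h3 h2

/-- First order Taylor estimate in `L¹` for functions with a weak gradient. -/
theorem integral_abs_taylor_le {f : Torus d → ℝ} (hf : Integrable f) {g : Fin d → Torus d → ℝ}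
    (h : ∀ i, IsWeakPartial i f (g i)) (y : EuclideanSpace ℝ (Fin d)) {m : ℝ}
    (hm : ∀ i, ∀ θ ∈ Ioc (0 : ℝ) 1, ∫ x, |g i (x + proj (θ • y)) - g i x| ≤ m) :
    ∫ x, |f (x + proj y) - f x - ∑ i, y i * g i x| ≤ (∑ i, |y i|) * m := by
  set G : Torus d → ℝ := fun x => ∑ i, y i * g i x
  have hG : Integrable G := integrable_sum_of_normed fun i _ => (h i).integrable_deriv.const_mul _
  have hft := integrable_comp_add_right hf (proj y)
  have hft2 : Integrable fun x => f (x + proj y) - f x := hft.sub hf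
  have hft3 : Integrable fun x => f (x + proj y) - f x - G x := hft2.sub hG
  have hP : IsProbabilityMeasure ((volume : Measure ℝ).restrict (Ioc 0 1)) := ⟨by simp⟩
  refine integral_abs_le_of_tendsto hft3 fun n => ?_
  have hk := mollifier_smooth (d := d) n
  -- The Taylor remainder is the average over `θ` of the increments of `G` along the segment, an
  -- identity available after mollification.
  have e : ∀ x, conv (mollifier n) (fun x => f (x + proj y) - f x - G x) x =
      ∫ θ in Ioc (0 : ℝ) 1, conv (mollifier n) (fun x => G (x + proj (θ • y)) - G x) x := by
    intro x
    have e1 : ∀ θ : ℝ, conv (mollifier n) (fun x => G (x + proj (θ • y)) - G x) x =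
        conv (mollifier n) G (x + proj (θ • y)) - conv (mollifier n) G x := fun θ => by
      rw [conv_sub hk (integrable_comp_add_right hG _) hG, conv_translate]
    simp_rw [e1]
    rw [integral_sub, ← conv_sub_eq_integral hk h, conv_sub hk hft2 hG,
      conv_sub hk hft hf, conv_translate]
    · simp
    · exact (((conv_smooth hk hG).continuous.comp (continuous_line x y)).integrableOn_Icc
        (a := 0) (b := 1)).mono_set Ioc_subset_Icc_self
    · exact integrable_const _
  have hmeas : AEStronglyMeasurable (Function.uncurry fun (θ : ℝ) (x : Torus d) =>
      conv (mollifier n) (fun x => G (x + proj (θ • y)) - G x) x)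
      (((volume : Measure ℝ).restrict (Ioc 0 1)).prod volume) := by
    have hc := (conv_smooth hk hG).continuous
    have : (Function.uncurry fun (θ : ℝ) (x : Torus d) =>
        conv (mollifier n) (fun x => G (x + proj (θ • y)) - G x) x) =
        fun p => conv (mollifier n) G (p.2 + proj (p.1 • y)) - conv (mollifier n) G p.2 := by
      ext p
      simp only [Function.uncurry]
      rw [conv_sub hk (integrable_comp_add_right hG _) hG, conv_translate]
    rw [this]
    exact ((hc.comp (continuous_line_uncurry y)).sub (hc.comp continuous_snd)).aestronglyMeasurable
  have hJ := convexCost_abs.lintegral_integral_le hmeas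
  have hb : ∀ θ ∈ Ioc (0 : ℝ) 1, ∫⁻ x, ENNReal.ofReal
      |conv (mollifier n) (fun x => G (x + proj (θ • y)) - G x) x| ≤
      ENNReal.ofReal ((∑ i, |y i|) * m) := by
    intro θ hθ
    have hD : Integrable fun x => G (x + proj (θ • y)) - G x :=
      (integrable_comp_add_right hG _).sub hG
    rw [← ofReal_integral_eq_lintegral_ofReal (conv_smooth hk hD).integrable.abs
      (ae_of_all _ fun _ => abs_nonneg _)]
    refine ENNReal.ofReal_le_ofReal ((integral_abs_conv_le hk (mollifier_nonneg n)
      (integral_mollifier n) hD).trans ?_)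
    have hgi : ∀ i, Integrable fun x => |g i (x + proj (θ • y)) - g i x| := fun i =>
      ((integrable_comp_add_right (h i).integrable_deriv _).sub (h i).integrable_deriv).abs
    calc ∫ x, |G (x + proj (θ • y)) - G x|
        ≤ ∫ x, ∑ i, |y i| * |g i (x + proj (θ • y)) - g i x| := by
          refine integral_mono hD.abs (integrable_sum_of_normed fun i _ =>
            (hgi i).const_mul _) fun x => ?_
          simp only [G, ← Finset.sum_sub_distrib, ← mul_sub]
          refine (Finset.abs_sum_le_sum_abs _ _).trans (Finset.sum_le_sum fun i _ => ?_)
          rw [abs_mul]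
      _ = ∑ i, |y i| * ∫ x, |g i (x + proj (θ • y)) - g i x| := by
          rw [integral_finsetSum _ fun i _ => (hgi i).const_mul _]
          simp_rw [integral_const_mul]
      _ ≤ (∑ i, |y i|) * m := by
          rw [Finset.sum_mul]
          exact Finset.sum_le_sum fun i _ => mul_le_mul_of_nonneg_left (hm i θ hθ) (abs_nonneg _)
  have h4 := hJ.trans (setLIntegral_mono' measurableSet_Ioc hb)
  simp only [setLIntegral_const, Real.volume_Ioc, sub_zero, ENNReal.ofReal_one, mul_one] at h4
  simp_rw [← e] at h4
  rw [← ofReal_integral_eq_lintegral_ofReal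
    (conv_smooth hk hft3).integrable.abs (ae_of_all _ fun _ => abs_nonneg _)] at h4
  by_cases hd : Nonempty (Fin d)
  · obtain ⟨i0⟩ := hd
    have hm0 : 0 ≤ m := (integral_nonneg fun _ => abs_nonneg _).trans (hm i0 1 (by simp))
    exact (ENNReal.ofReal_le_ofReal_iff
      (mul_nonneg (Finset.sum_nonneg fun _ _ => abs_nonneg _) hm0)).1 h4
  · rw [not_nonempty_iff] at hd
    have : ∀ x : Torus d, x + proj y = x := fun x => by ext i; exact hd.elim i
    simp [this, G, conv]

/-! ### The commutator of mollification and transport. -/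

theorem integrable_bdd_mul {Y : Type*} [MeasurableSpace Y] {μ : Measure Y} {V f : Y → ℝ} {M : ℝ}
    (hV : AEStronglyMeasurable V μ) (hM : ∀ x, |V x| ≤ M) (hf : Integrable f μ) :
    Integrable (fun x => V x * f x) μ :=
  hf.bdd_mul (c := M) hV (ae_of_all _ hM)

theorem integrable_sub_fun {Y : Type*} [MeasurableSpace Y] {μ : Measure Y} {f g : Y → ℝ}
    (hf : Integrable f μ) (hg : Integrable g μ) : Integrable (fun x => f x - g x) μ := hf.sub hg

theorem integrable_add_fun {Y : Type*} [MeasurableSpace Y] {μ : Measure Y} {f g : Y → ℝ}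
    (hf : Integrable f μ) (hg : Integrable g μ) : Integrable (fun x => f x + g x) μ := hf.add hg

theorem sum_fin_le {a : Fin d → ℝ} {c : ℝ} (h : ∀ i, a i ≤ c) : ∑ i, a i ≤ d * c := by
  simpa using Finset.sum_le_card_nsmul Finset.univ a c fun i _ => h i

/-- The commutator of mollification and of the transport operator. -/
noncomputable def transportCommutator (k V : Torus d → ℝ) (b : Fin d → Torus d → ℝ) (D : Torus d → ℝ)
    (x : Torus d) : ℝ :=
  ∑ i, (b i x * conv (Torus.partialDeriv i k) V x -
    conv (Torus.partialDeriv i k) (fun x => V x * b i x) x) + conv k (fun x => V x * D x) x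

/-- The terms in which `V` is evaluated at `x` cancel, because `∂k` has zero integral and `∂ᵢk * bᵢ
= k * Gᵢᵢ`. What remains carries an increment of `V`, and each `∂k` is accompanied by an increment
of `b`. -/
theorem commutator_eq {k V : Torus d → ℝ} {b : Fin d → Torus d → ℝ}
    {G : Fin d → Fin d → Torus d → ℝ} {M : ℝ} (hk : Smooth k)
    (hV : Measurable V) (hM : ∀ x, |V x| ≤ M) (hb : ∀ i, Integrable (b i))
    (h : ∀ i j, IsWeakPartial j (b i) (G i j)) (x : Torus d) :
    transportCommutator k V b (fun x => ∑ i, G i i x) x =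
      ∫ z, (∑ i, Torus.partialDeriv i k z * ((V (x - z) - V x) * (b i x - b i (x - z))) +
        k z * ((V (x - z) - V x) * ∑ i, G i i (x - z))) := by
  have hVi : Integrable V := Integrable.of_bound hV.aestronglyMeasurable M (ae_of_all _ hM)
  have hD : Integrable fun x => ∑ i, G i i x :=
    integrable_sum_of_normed fun i _ => (h i i).integrable_deriv
  have hVb : ∀ i, Integrable fun x => V x * b i x := fun i =>
    integrable_bdd_mul hV.aestronglyMeasurable hM (hb i)
  have hVD : Integrable fun x => V x * ∑ i, G i i x :=
    integrable_bdd_mul hV.aestronglyMeasurable hM hD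
  have e1 : ∀ i, ∫ z, Torus.partialDeriv i k z * ((V (x - z) - V x) * (b i x - b i (x - z))) =
      b i x * conv (Torus.partialDeriv i k) V x -
        conv (Torus.partialDeriv i k) (fun x => V x * b i x) x + V x * conv k (G i i) x := by
    intro i
    have hki := hk.partialDeriv i
    have i1 := (hki.integrable_mul (integrable_comp_sub_left hVi x)).const_mul (b i x)
    have i2 := hki.integrable_mul (integrable_comp_sub_left (hVb i) x)
    have i3 := hki.integrable.mul_const (V x * b i x)
    have i4 := (hki.integrable_mul (integrable_comp_sub_left (hb i) x)).const_mul (V x)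
    have : ∀ z, Torus.partialDeriv i k z * ((V (x - z) - V x) * (b i x - b i (x - z))) =
        b i x * (Torus.partialDeriv i k z * V (x - z)) -
          Torus.partialDeriv i k z * (V (x - z) * b i (x - z)) -
          Torus.partialDeriv i k z * (V x * b i x) +
          V x * (Torus.partialDeriv i k z * b i (x - z)) := fun z => by ring
    simp_rw [this]
    have i12 := integrable_sub_fun i1 i2
    rw [integral_add (integrable_sub_fun i12 i3) i4, integral_sub i12 i3, integral_sub i1 i2,
      integral_const_mul, integral_const_mul, integral_mul_const, hk.integral_partialDeriv,
      ← (h i i).conv_partialDeriv hk]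
    simp [conv]
  have e2 : ∫ z, k z * ((V (x - z) - V x) * ∑ i, G i i (x - z)) =
      conv k (fun x => V x * ∑ i, G i i x) x - V x * ∑ i, conv k (G i i) x := by
    have hs := conv_sum (s := Finset.univ) hk (fun i => (h i i).integrable_deriv)
      (fun _ => (1 : ℝ)) x
    simp only [one_mul] at hs
    rw [← hs]
    have i1 := hk.integrable_mul (integrable_comp_sub_left hVD x)
    have i2 := (hk.integrable_mul (integrable_comp_sub_left hD x)).const_mul (V x)
    simp only [conv]
    rw [← integral_const_mul, ← integral_sub i1 i2]
    refine integral_congr_ae (ae_of_all _ fun z => ?_)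
    ring
  have hI1 : ∀ i, Integrable fun z => Torus.partialDeriv i k z *
      ((V (x - z) - V x) * (b i x - b i (x - z))) := by
    intro i
    refine (hk.partialDeriv i).integrable_mul ?_
    refine integrable_bdd_mul (M := M + M) ?_ (fun z => ?_)
      ((integrable_const _).sub (integrable_comp_sub_left (hb i) x))
    · exact ((hV.comp (measurable_const.sub measurable_id)).sub_const _).aestronglyMeasurable
    · exact (abs_sub _ _).trans (add_le_add (hM _) (hM _))
  have hI2 : Integrable fun z => k z * ((V (x - z) - V x) * ∑ i, G i i (x - z)) := by
    refine hk.integrable_mul (integrable_bdd_mul (M := M + M) ?_ (fun z => ?_)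
      (integrable_comp_sub_left hD x))
    · exact ((hV.comp (measurable_const.sub measurable_id)).sub_const _).aestronglyMeasurable
    · exact (abs_sub _ _).trans (add_le_add (hM _) (hM _))
  rw [integral_add (integrable_sum_of_normed fun i _ => hI1 i) hI2,
    integral_finsetSum _ fun i _ => hI1 i, e2]
  simp_rw [e1]
  rw [Finset.sum_add_distrib, Finset.mul_sum, transportCommutator]
  ring

/-- By Fubini only bounds at a fixed shift `z` in the support of the kernel are needed. With the
mollifier, `A i` is multiplied by an `L^1` norm of order `n`, so it should be `O(1/n)` for
boundedness and `o(1/n)` for convergence. -/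
theorem integral_abs_commutator_le {k V : Torus d → ℝ} {b : Fin d → Torus d → ℝ}
    {G : Fin d → Fin d → Torus d → ℝ} {M : ℝ} (hk : Smooth k) (hk0 : ∀ z, 0 ≤ k z)
    (hV : Measurable V) (hM : ∀ x, |V x| ≤ M) (hb : ∀ i, Integrable (b i))
    (h : ∀ i j, IsWeakPartial j (b i) (G i j)) {A : Fin d → ℝ} {B : ℝ}
    (hA : ∀ i z, Torus.partialDeriv i k z ≠ 0 →
      ∫ x, |(V (x - z) - V x) * (b i x - b i (x - z))| ≤ A i)
    (hB : ∀ z, k z ≠ 0 → ∫ x, |(V (x - z) - V x) * ∑ i, G i i (x - z)| ≤ B) :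
    ∫ x, |transportCommutator k V b (fun x => ∑ i, G i i x) x| ≤
      ∑ i, A i * (∫ z, |Torus.partialDeriv i k z|) + B * ∫ z, k z := by
  have hD : Integrable fun x => ∑ i, G i i x :=
    integrable_sum_of_normed fun i _ => (h i i).integrable_deriv
  have hVm : AEStronglyMeasurable (fun p : Torus d × Torus d => V (p.1 - p.2) - V p.1)
      (volume.prod volume) :=
    ((hV.comp (measurable_fst.sub measurable_snd)).sub (hV.comp measurable_fst)).aestronglyMeasurable
  have hVb : ∀ p : Torus d × Torus d, |V (p.1 - p.2) - V p.1| ≤ M + M := fun p =>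
    (abs_sub _ _).trans (add_le_add (hM _) (hM _))
  have hP1 : ∀ i, Integrable (fun p : Torus d × Torus d => Torus.partialDeriv i k p.2 *
      ((V (p.1 - p.2) - V p.1) * (b i p.1 - b i (p.1 - p.2)))) (volume.prod volume) := by
    intro i
    have hki := (hk.partialDeriv i).integrable
    have i1 := ((hb i).mul_prod hki).sub (integrable_conv_kernel hki (hb i))
    refine (integrable_bdd_mul hVm hVb i1).congr (ae_of_all _ fun p => ?_)
    simp only [Pi.sub_apply]; ring
  have hP2 : Integrable (fun p : Torus d × Torus d => k p.2 *
      ((V (p.1 - p.2) - V p.1) * ∑ i, G i i (p.1 - p.2))) (volume.prod volume) := by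
    refine (integrable_bdd_mul hVm hVb (integrable_conv_kernel hk.integrable hD)).congr
      (ae_of_all _ fun p => ?_)
    ring
  set Q1 : Fin d → Torus d × Torus d → ℝ := fun i p => |Torus.partialDeriv i k p.2 *
      ((V (p.1 - p.2) - V p.1) * (b i p.1 - b i (p.1 - p.2)))| with hQ1
  set Q2 : Torus d × Torus d → ℝ := fun p => |k p.2 *
      ((V (p.1 - p.2) - V p.1) * ∑ i, G i i (p.1 - p.2))| with hQ2
  have hQ1i : ∀ i, Integrable (Q1 i) (volume.prod volume) := fun i => (hP1 i).abs
  have hQ2i : Integrable Q2 (volume.prod volume) := hP2.abs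
  have hQ : Integrable (fun p => ∑ i, Q1 i p + Q2 p) (volume.prod volume) :=
    (integrable_sum_of_normed fun i _ => hQ1i i).add hQ2i
  have hpt : ∀ x, |transportCommutator k V b (fun x => ∑ i, G i i x) x| ≤ ∫ z, (∑ i, Q1 i (x, z) + Q2 (x, z)) := by
    intro x
    rw [commutator_eq hk hV hM hb h]
    by_cases hx : Integrable fun z => ∑ i, Q1 i (x, z) + Q2 (x, z)
    · rw [← Real.norm_eq_abs]
      refine norm_integral_le_of_norm_le hx (ae_of_all _ fun z => ?_)
      refine (abs_add_le _ _).trans (add_le_add (Finset.abs_sum_le_sum_abs _ _) le_rfl)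
    · have : ¬ Integrable fun z => (∑ i, Torus.partialDeriv i k z * ((V (x - z) - V x) *
          (b i x - b i (x - z))) + k z * ((V (x - z) - V x) * ∑ i, G i i (x - z))) := by
        intro _
        apply hx
        refine (integrable_sum_of_normed fun i _ => ?_).add ?_
        · refine ((hk.partialDeriv i).integrable_mul (integrable_bdd_mul (M := M + M) ?_ (fun z => ?_)
            ((integrable_const (b i x)).sub (integrable_comp_sub_left (hb i) x)))).abs
          · exact ((hV.comp (measurable_const.sub measurable_id)).sub_const
              (V x)).aestronglyMeasurable
          · exact (abs_sub _ _).trans (add_le_add (hM _) (hM _))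
        · refine (hk.integrable_mul (integrable_bdd_mul (M := M + M) ?_ (fun z => ?_)
            (integrable_comp_sub_left hD x))).abs
          · exact ((hV.comp (measurable_const.sub measurable_id)).sub_const
              (V x)).aestronglyMeasurable
          · exact (abs_sub _ _).trans (add_le_add (hM _) (hM _))
      rw [integral_undef this, abs_zero]
      exact integral_nonneg fun z => add_nonneg (Finset.sum_nonneg fun i _ => abs_nonneg _)
        (abs_nonneg _)
  have h1 : ∫ x, |transportCommutator k V b (fun x => ∑ i, G i i x) x| ≤
      ∫ x, ∫ z, (∑ i, Q1 i (x, z) + Q2 (x, z)) :=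
    integral_mono_of_nonneg (ae_of_all _ fun _ => abs_nonneg _) hQ.integral_prod_left
      (ae_of_all _ hpt)
  refine h1.trans ?_
  rw [integral_integral_swap hQ]
  have hz : ∀ z, ∫ x, (∑ i, Q1 i (x, z) + Q2 (x, z)) ≤
      ∑ i, A i * |Torus.partialDeriv i k z| + B * k z := by
    intro z
    have hVz : AEStronglyMeasurable (fun x => V (x - z) - V x) volume :=
      ((hV.comp (measurable_id.sub_const z)).sub hV).aestronglyMeasurable
    have hVzb : ∀ x, |V (x - z) - V x| ≤ M + M := fun x =>
      (abs_sub _ _).trans (add_le_add (hM _) (hM _))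
    have i1 : ∀ i, Integrable fun x => Q1 i (x, z) := fun i =>
      ((integrable_bdd_mul hVz hVzb ((hb i).sub (integrable_comp_sub_right (hb i) z))).const_mul
        (Torus.partialDeriv i k z)).abs
    have i2 : Integrable fun x => Q2 (x, z) :=
      ((integrable_bdd_mul hVz hVzb (integrable_comp_sub_right hD z)).const_mul (k z)).abs
    rw [integral_add (integrable_sum_of_normed fun i _ => i1 i) i2,
      integral_finsetSum _ fun i _ => i1 i]
    refine add_le_add (Finset.sum_le_sum fun i _ => ?_) ?_
    · simp only [hQ1, abs_mul (Torus.partialDeriv i k z)]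
      rw [integral_const_mul, mul_comm]
      by_cases hz : Torus.partialDeriv i k z = 0
      · simp [hz]
      · exact mul_le_mul_of_nonneg_right (hA i z hz) (abs_nonneg _)
    · simp only [hQ2, abs_mul (k z), abs_of_nonneg (hk0 z)]
      rw [integral_const_mul, mul_comm]
      by_cases hz : k z = 0
      · simp [hz]
      · exact mul_le_mul_of_nonneg_right (hB z hz) (hk0 z)
  have i1 : ∀ i, Integrable fun z => A i * |Torus.partialDeriv i k z| := fun i =>
    (hk.partialDeriv i).integrable.abs.const_mul _
  have i2 := hk.integrable.const_mul B
  refine (integral_mono hQ.integral_prod_right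
    ((integrable_sum_of_normed fun i _ => i1 i).add i2) hz).trans (le_of_eq ?_)
  have e := integral_add (integrable_sum_of_normed (s := Finset.univ) fun i _ => i1 i) i2
  rw [integral_finsetSum _ fun i _ => i1 i] at e
  simp_rw [integral_const_mul] at e
  exact e

theorem eventually_translate_le {f : Torus d → ℝ} (hf : Integrable f) {ε : ℝ} (hε : 0 < ε) :
    ∀ᶠ n : ℕ in atTop, ∀ y : EuclideanSpace ℝ (Fin d), (∀ i, |y i| ≤ 1 / ((n : ℝ) + 1)) →
      ∫ x, |f (x + proj y) - f x| ≤ ε := by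
  have h1 : Tendsto (fun w : Fin d → ℝ => ∫ x, |f (x + proj (WithLp.toLp 2 w)) - f x|)
      (𝓝 0) (𝓝 0) := by
    refine (tendsto_integral_abs_add_translate hf).comp ?_
    have h : Tendsto (proj (d := d)) (𝓝 0) (𝓝 0) := by
      simpa [proj_zero] using (continuous_proj (d := d)).tendsto 0
    exact h.comp (by simpa using (PiLp.continuous_toLp 2 (fun _ : Fin d => ℝ)).tendsto 0)
  obtain ⟨δ, hδ, hb⟩ := Metric.mem_nhds_iff.1 (h1 (Iic_mem_nhds hε))
  filter_upwards [(tendsto_one_div_add_atTop_nhds_zero_nat (𝕜 := ℝ)).eventually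
    (Iio_mem_nhds hδ)] with n hn y hy
  have : (fun i => y i) ∈ Metric.ball (0 : Fin d → ℝ) δ := by
    rw [mem_ball_zero_iff]
    exact lt_of_le_of_lt ((pi_norm_le_iff_of_nonneg (by positivity)).2 fun i => hy i) hn
  exact hb this

theorem integral_abs_translate_le {f : Torus d → ℝ} (hf : Integrable f) {g : Fin d → Torus d → ℝ}
    (h : ∀ i, IsWeakPartial i f (g i)) (y : EuclideanSpace ℝ (Fin d)) :
    ∫ x, |f (x + proj y) - f x| ≤ ∑ i, |y i| * ∫ x, |g i x| := by
  have hJ := lintegral_cost_translate_le convexCost_abs hf h y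
  have i1 : Integrable fun x => f (x + proj y) - f x := (integrable_comp_add_right hf _).sub hf
  have i2 : Integrable fun x => ∑ i, y i * g i x :=
    integrable_sum_of_normed fun i _ => (h i).integrable_deriv.const_mul _
  rw [← ofReal_integral_eq_lintegral_ofReal i1.abs (ae_of_all _ fun _ => abs_nonneg _),
    ← ofReal_integral_eq_lintegral_ofReal i2.abs (ae_of_all _ fun _ => abs_nonneg _),
    ENNReal.ofReal_le_ofReal_iff (integral_nonneg fun _ => abs_nonneg _)] at hJ
  refine hJ.trans ?_
  have i3 : ∀ i, Integrable fun x => |y i| * |g i x| := fun i =>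
    (h i).integrable_deriv.abs.const_mul _
  calc ∫ x, |∑ i, y i * g i x| ≤ ∫ x, ∑ i, |y i| * |g i x| := by
        refine integral_mono i2.abs (integrable_sum_of_normed fun i _ => i3 i) fun x => ?_
        refine (Finset.abs_sum_le_sum_abs _ _).trans (le_of_eq ?_)
        simp_rw [abs_mul]
    _ = _ := by
        rw [integral_finsetSum _ fun i _ => i3 i]
        simp_rw [integral_const_mul]

section Commutator

variable {V : Torus d → ℝ} {b : Fin d → Torus d → ℝ} {G : Fin d → Fin d → Torus d → ℝ} {M : ℝ}

/-- This bound, uniform in `n`, is the dominating constant when the limit is taken under the time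
integral. -/
theorem exists_integral_abs_commutator_mollifier_le (d : ℕ) :
    ∃ C, 0 ≤ C ∧ ∀ (n : ℕ) (V : Torus d → ℝ) (b : Fin d → Torus d → ℝ)
      (G : Fin d → Fin d → Torus d → ℝ) (M K : ℝ), Measurable V → (∀ x, |V x| ≤ M) →
      (∀ i, Integrable (b i)) → (∀ i j, IsWeakPartial j (b i) (G i j)) →
      (∀ i j, ∫ x, |G i j x| ≤ K) →
      ∫ x, |transportCommutator (mollifier n) V b (fun x => ∑ i, G i i x) x| ≤ C * M * K := by
  obtain ⟨C, hC0, hC⟩ := integral_abs_partialDeriv_mollifier_le (d := d)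
  refine ⟨∑ _i : Fin d, 2 * d * C + 2 * d, by positivity, fun n V b G M K hV hM hb h hK => ?_⟩
  have hn : (0 : ℝ) < n + 1 := by positivity
  have hM0 : 0 ≤ M := (abs_nonneg _).trans (hM 0)
  have hD : Integrable fun x => ∑ i, G i i x :=
    integrable_sum_of_normed fun i _ => (h i i).integrable_deriv
  have key := integral_abs_commutator_le (mollifier_smooth n) (mollifier_nonneg n) hV hM hb h
    (A := fun _ => 2 * M * (d * (1 / (n + 1) * K))) (B := 2 * M * (d * K)) ?_ ?_
  · refine key.trans ?_
    rw [integral_mollifier, mul_one, add_mul, add_mul, Finset.sum_mul, Finset.sum_mul]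
    refine add_le_add (Finset.sum_le_sum fun i _ => ?_) (by ring_nf; rfl)
    have hK0 : 0 ≤ K := (integral_nonneg fun _ => abs_nonneg _).trans (hK i i)
    calc _ ≤ 2 * M * (d * (1 / (n + 1) * K)) * (C * (n + 1)) :=
          mul_le_mul_of_nonneg_left (hC n i) (by positivity)
      _ = _ := by field_simp
  · intro i z hz
    obtain ⟨y, rfl, hy⟩ := mollifier_support (Or.inr ⟨i, hz⟩)
    have hK0 : 0 ≤ K := (integral_nonneg fun _ => abs_nonneg _).trans (hK i i)
    have h1 := integral_abs_translate_le (hb i) (h i) (-y)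
    have hbi : Integrable fun x => b i (x - proj y) - b i x :=
      (integrable_comp_sub_right (hb i) _).sub (hb i)
    calc ∫ x, |(V (x - proj y) - V x) * (b i x - b i (x - proj y))|
        ≤ ∫ x, 2 * M * |b i (x - proj y) - b i x| := by
          refine integral_mono_of_nonneg (ae_of_all _ fun _ => abs_nonneg _)
            (hbi.abs.const_mul _) (ae_of_all _ fun x => ?_)
          simp only
          rw [abs_mul, abs_sub_comm (b i x)]
          refine mul_le_mul_of_nonneg_right ?_ (abs_nonneg _)
          linarith [abs_sub (V (x - proj y)) (V x), hM (x - proj y), hM x]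
      _ ≤ 2 * M * (d * (1 / (n + 1) * K)) := by
          rw [integral_const_mul]
          refine mul_le_mul_of_nonneg_left ?_ (by positivity)
          simp_rw [proj_neg, ← sub_eq_add_neg] at h1
          refine h1.trans (sum_fin_le fun j => ?_)
          rw [PiLp.neg_apply, abs_neg]
          exact mul_le_mul (hy j) (hK i j) (integral_nonneg fun _ => abs_nonneg _) (by positivity)
  · intro z _
    calc ∫ x, |(V (x - z) - V x) * ∑ i, G i i (x - z)|
        ≤ ∫ x, 2 * M * ∑ i, |G i i (x - z)| := by
          refine integral_mono_of_nonneg (ae_of_all _ fun _ => abs_nonneg _)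
            ((integrable_sum_of_normed fun i _ => (integrable_comp_sub_right
              (h i i).integrable_deriv z).abs).const_mul _) (ae_of_all _ fun x => ?_)
          simp only
          rw [abs_mul]
          refine mul_le_mul ?_ (Finset.abs_sum_le_sum_abs _ _) (abs_nonneg _) (by positivity)
          linarith [abs_sub (V (x - z)) (V x), hM (x - z), hM x]
      _ ≤ 2 * M * (d * K) := by
          rw [integral_const_mul, integral_finsetSum _ fun i _ => (integrable_comp_sub_right
              (h i i).integrable_deriv z).abs]
          refine mul_le_mul_of_nonneg_left ?_ (by positivity)
          refine sum_fin_le fun i => ?_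
          rw [integral_sub_right_eq_self (fun x => |G i i x|)]
          exact hK i i

/-- The DiPerna–Lions commutator lemma. -/
theorem tendsto_integral_abs_commutator (hV : Measurable V) (hM : ∀ x, |V x| ≤ M)
    (hb : ∀ i, Integrable (b i)) (h : ∀ i j, IsWeakPartial j (b i) (G i j)) :
    Tendsto (fun n => ∫ x, |transportCommutator (mollifier n) V b (fun x => ∑ i, G i i x) x|)
      atTop (𝓝 0) := by
  obtain ⟨C, hC0, hC⟩ := integral_abs_partialDeriv_mollifier_le (d := d)
  have hM0 : 0 ≤ M := (abs_nonneg _).trans (hM 0)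
  have hD : Integrable fun x => ∑ i, G i i x :=
    integrable_sum_of_normed fun i _ => (h i i).integrable_deriv
  have hVG : ∀ g : Torus d → ℝ, Integrable g → Integrable fun x => V x * g x := fun g hg =>
    integrable_bdd_mul hV.aestronglyMeasurable hM hg
  -- differences of `V` against a fixed integrable function are small
  have hsmall : ∀ g : Torus d → ℝ, Integrable g → ∀ ε > 0, ∀ᶠ n : ℕ in atTop,
      ∀ y : EuclideanSpace ℝ (Fin d), (∀ i, |y i| ≤ 1 / ((n : ℝ) + 1)) →
      ∫ x, |(V (x + proj y) - V x) * g x| ≤ (1 + M) * ε := by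
    intro g hg ε hε
    filter_upwards [eventually_translate_le hg hε, eventually_translate_le (hVG g hg) hε]
      with n h1 h2 y hy
    have i1 : Integrable fun x => g (x + proj y) - g x := (integrable_comp_add_right hg _).sub hg
    have i2 : Integrable fun x => V (x + proj y) * g (x + proj y) - V x * g x :=
      (integrable_comp_add_right (hVG g hg) _).sub (hVG g hg)
    calc ∫ x, |(V (x + proj y) - V x) * g x|
        ≤ ∫ x, (|V (x + proj y) * g (x + proj y) - V x * g x| +
            M * |g (x + proj y) - g x|) := by
          refine integral_mono_of_nonneg (ae_of_all _ fun _ => abs_nonneg _)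
            (i2.abs.add (i1.abs.const_mul M)) (ae_of_all _ fun x => ?_)
          simp only
          -- Only translates of the integrable functions `V * g` and `g` appear, so no regularity of
          -- `V` enters.
          have e : (V (x + proj y) - V x) * g x = (V (x + proj y) * g (x + proj y) - V x * g x) -
            V (x + proj y) * (g (x + proj y) - g x) := by ring
          rw [e]
          refine (abs_sub _ _).trans (add_le_add le_rfl ?_)
          rw [abs_mul]
          exact mul_le_mul_of_nonneg_right (hM _) (abs_nonneg _)
      _ ≤ (1 + M) * ε := by
          rw [integral_add i2.abs (i1.abs.const_mul M), integral_const_mul]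
          nlinarith [h1 y hy, h2 y hy, mul_le_mul_of_nonneg_left (h1 y hy) hM0]
  rw [Metric.tendsto_atTop']
  intro ε hε
  set c : ℝ := ∑ _i : Fin d, ((2 * M * d + d * (1 + M)) * C) + (1 + 3 * M) with hc
  have hc0 : 0 < c := by positivity
  set η := ε / (2 * c) with hη
  have hη0 : 0 < η := by positivity
  have hev : ∀ᶠ n : ℕ in atTop, ∫ x, |transportCommutator (mollifier n) V b (fun x => ∑ i, G i i x) x| ≤
      c * η := by
    have e1 := eventually_all.2 fun i => eventually_all.2 fun j =>
      eventually_translate_le (h i j).integrable_deriv hη0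
    have e2 := eventually_all.2 fun i => eventually_all.2 fun j =>
      hsmall _ (h i j).integrable_deriv η hη0
    filter_upwards [e1, e2, hsmall _ hD η hη0, eventually_translate_le hD hη0] with n h1 h2 h3 h4
    have hn : (0 : ℝ) < n + 1 := by positivity
    have hneg : ∀ y : EuclideanSpace ℝ (Fin d), (∀ i, |y i| ≤ 1 / ((n : ℝ) + 1)) →
        ∀ i, |(-y) i| ≤ 1 / ((n : ℝ) + 1) := fun y hy i => by
      rw [PiLp.neg_apply, abs_neg]; exact hy i
    have key := integral_abs_commutator_le (mollifier_smooth n) (mollifier_nonneg n) hV hM hb h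
      (A := fun _ => 1 / (n + 1) * ((2 * M * d + d * (1 + M)) * η)) (B := (1 + 3 * M) * η) ?_ ?_
    · refine key.trans ?_
      rw [integral_mollifier, mul_one, hc, add_mul (∑ _i : Fin d, _), Finset.sum_mul]
      refine add_le_add (Finset.sum_le_sum fun i _ => ?_) le_rfl
      calc _ ≤ 1 / (n + 1) * ((2 * M * d + d * (1 + M)) * η) * (C * (n + 1)) :=
            mul_le_mul_of_nonneg_left (hC n i) (by positivity)
        _ = _ := by field_simp
    · intro i z hz
      obtain ⟨y, rfl, hy⟩ := mollifier_support (Or.inr ⟨i, hz⟩)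
      have hy' := hneg y hy
      -- The increment of `b` is its linear part up to an error `o(|y|)` in `L^1`. The linear part
      -- has size `|y|` and multiplies an increment of `V`, which is small against the fixed
      -- functions `G i j`.
      have ht := integral_abs_taylor_le (hb i) (h i) (-y) (m := η) fun j θ hθ => by
        refine h1 i j (θ • -y) fun l => ?_
        rw [PiLp.smul_apply, smul_eq_mul, abs_mul, abs_of_pos hθ.1]
        calc θ * |(-y) l| ≤ 1 * |(-y) l| := mul_le_mul_of_nonneg_right hθ.2 (abs_nonneg _)
          _ ≤ _ := by rw [one_mul]; exact hy' l
      have hyn : ∑ j, |(-y) j| ≤ d * (1 / (n + 1)) := by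
        refine (Finset.sum_le_sum fun j _ => hy' j).trans ?_
        simp
      have iT : Integrable fun x => b i (x + proj (-y)) - b i x - ∑ j, (-y) j * G i j x :=
        ((integrable_comp_add_right (hb i) _).sub (hb i)).sub
          (integrable_sum_of_normed fun j _ => (h i j).integrable_deriv.const_mul _)
      have hVm : AEStronglyMeasurable (fun x => V (x + proj (-y)) - V x) volume :=
        ((hV.comp (measurable_id.add_const _)).sub hV).aestronglyMeasurable
      have hVb : ∀ x, |V (x + proj (-y)) - V x| ≤ 2 * M := fun x => by
        linarith [abs_sub (V (x + proj (-y))) (V x), hM (x + proj (-y)), hM x]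
      have iG : ∀ j, Integrable fun x => |(V (x + proj (-y)) - V x) * G i j x| := fun j =>
        (integrable_bdd_mul hVm hVb (h i j).integrable_deriv).abs
      have iS : Integrable fun x => ∑ j, |(-y) j| * |(V (x + proj (-y)) - V x) * G i j x| :=
        integrable_sum_of_normed fun j _ => (iG j).const_mul _
      calc ∫ x, |(V (x - proj y) - V x) * (b i x - b i (x - proj y))|
          ≤ ∫ x, (2 * M * |b i (x + proj (-y)) - b i x - ∑ j, (-y) j * G i j x| +
              ∑ j, |(-y) j| * |(V (x + proj (-y)) - V x) * G i j x|) := by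
            refine integral_mono_of_nonneg (ae_of_all _ fun _ => abs_nonneg _)
              ((iT.abs.const_mul _).add iS) (ae_of_all _ fun x => ?_)
            simp only
            have e : (V (x - proj y) - V x) * (b i x - b i (x - proj y)) =
              -((V (x + proj (-y)) - V x) *
                (b i (x + proj (-y)) - b i x - ∑ j, (-y) j * G i j x)) -
              ∑ j, (-y) j * ((V (x + proj (-y)) - V x) * G i j x) := by
              rw [proj_neg, ← sub_eq_add_neg]
              have : ∑ j, (-y) j * ((V (x - proj y) - V x) * G i j x) =
                  (V (x - proj y) - V x) * ∑ j, (-y) j * G i j x := by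
                rw [Finset.mul_sum]
                exact Finset.sum_congr rfl fun j _ => by ring
              rw [this]; ring
            rw [e]
            refine (abs_sub _ _).trans (add_le_add ?_ ?_)
            · rw [abs_neg, abs_mul]
              exact mul_le_mul_of_nonneg_right (hVb x) (abs_nonneg _)
            · refine (Finset.abs_sum_le_sum_abs _ _).trans (le_of_eq ?_)
              exact Finset.sum_congr rfl fun j _ => abs_mul _ _
        _ ≤ 1 / (n + 1) * ((2 * M * d + d * (1 + M)) * η) := by
            rw [integral_add (iT.abs.const_mul _) iS, integral_const_mul,
              integral_finsetSum _ fun j _ => (iG j).const_mul _]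
            simp_rw [integral_const_mul]
            have hs : ∑ j, |(-y) j| * ∫ x, |(V (x + proj (-y)) - V x) * G i j x| ≤
                d * (1 / (n + 1)) * ((1 + M) * η) := by
              refine (Finset.sum_le_sum fun j _ => mul_le_mul_of_nonneg_left
                (h2 i j (-y) hy') (abs_nonneg _)).trans ?_
              rw [← Finset.sum_mul]
              exact mul_le_mul_of_nonneg_right hyn (by positivity)
            have ht' := mul_le_mul_of_nonneg_left (ht.trans
              (mul_le_mul_of_nonneg_right hyn hη0.le)) (by positivity : 0 ≤ 2 * M)
            calc _ ≤ 2 * M * (d * (1 / (n + 1)) * η) + d * (1 / (n + 1)) * ((1 + M) * η) :=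
                  add_le_add ht' hs
              _ = _ := by ring
    · intro z hz
      obtain ⟨y, rfl, hy⟩ := mollifier_support (Or.inl hz)
      have hy' := hneg y hy
      have hVm : AEStronglyMeasurable (fun x => V (x - proj y) - V x) volume :=
        ((hV.comp (measurable_id.sub_const _)).sub hV).aestronglyMeasurable
      have hVb : ∀ x, |V (x - proj y) - V x| ≤ 2 * M := fun x => by
        linarith [abs_sub (V (x - proj y)) (V x), hM (x - proj y), hM x]
      have h3' := h3 (-y) hy'
      have h4' := h4 (-y) hy'
      simp_rw [proj_neg, ← sub_eq_add_neg] at h3' h4'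
      have i1 := (integrable_bdd_mul hVm hVb hD).abs
      have i2 := (((integrable_comp_sub_right hD (proj y)).sub hD).abs.const_mul (2 * M))
      calc ∫ x, |(V (x - proj y) - V x) * ∑ i, G i i (x - proj y)|
          ≤ ∫ x, (|(V (x - proj y) - V x) * ∑ i, G i i x| +
              2 * M * |∑ i, G i i (x - proj y) - ∑ i, G i i x|) := by
            refine integral_mono_of_nonneg (ae_of_all _ fun _ => abs_nonneg _) (i1.add i2)
              (ae_of_all _ fun x => ?_)
            simp only
            have e : (V (x - proj y) - V x) * ∑ i, G i i (x - proj y) =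
              (V (x - proj y) - V x) * ∑ i, G i i x + (V (x - proj y) - V x) *
                (∑ i, G i i (x - proj y) - ∑ i, G i i x) := by ring
            rw [e]
            refine (abs_add_le _ _).trans (add_le_add le_rfl ?_)
            rw [abs_mul]
            exact mul_le_mul_of_nonneg_right (hVb x) (abs_nonneg _)
        _ ≤ (1 + 3 * M) * η := by
            have e := integral_add i1 i2
            rw [integral_const_mul] at e
            refine (le_of_eq e).trans ?_
            have := mul_le_mul_of_nonneg_left h4' (by positivity : 0 ≤ 2 * M)
            simp only [Pi.sub_apply]
            linarith
  obtain ⟨N, hN⟩ := eventually_atTop.1 hev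
  refine ⟨N, fun n hn => ?_⟩
  rw [Real.dist_eq, sub_zero, abs_of_nonneg (integral_nonneg fun _ => abs_nonneg _)]
  refine (hN n hn.le).trans_lt ?_
  rw [hη]
  field_simp
  norm_num

end Commutator

/-! ### Energy estimate and uniqueness. -/

/-- A vector field with uniformly exponentially integrable gradient and bounded divergence, given by
jointly measurable representatives that are controlled at every time. -/
structure TransportField (b : Fin d → ℝ → Torus d → ℝ) (G : Fin d → Fin d → ℝ → Torus d → ℝ) :
    Prop where
  measurable : ∀ i, Measurable (Function.uncurry (b i))
  measurable_grad : ∀ i j, Measurable (Function.uncurry (G i j))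
  integrable : ∀ i, Integrable (Function.uncurry (b i)) (volume.prod volume)
  isWeakPartial : ∀ s i j, IsWeakPartial j (b i s) (G i j s)
  exp_bound : ∀ c : ℝ, 0 < c → ∃ K : ℝ, 0 ≤ K ∧ ∀ s i j,
    ∫⁻ x, ENNReal.ofReal (Real.exp (c * |G i j s x|)) ≤ ENNReal.ofReal K
  div_bound : ∃ L : ℝ, 0 ≤ L ∧ ∀ s, ∀ᵐ x, |∑ i, G i i s x| ≤ L

theorem measurable_conv {Y : Type*} [MeasurableSpace Y] {k : Torus d → ℝ} {f : Y → Torus d → ℝ}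
    (hk : Measurable k) (hf : Measurable (Function.uncurry f)) :
    Measurable (Function.uncurry fun s x => conv k (f s) x) := by
  have : StronglyMeasurable (Function.uncurry fun (p : Y × Torus d) (z : Torus d) =>
      k z * f p.1 (p.2 - z)) := by
    refine Measurable.stronglyMeasurable ((hk.comp measurable_snd).mul ?_)
    exact hf.comp ((measurable_fst.comp measurable_fst).prodMk
      ((measurable_snd.comp measurable_fst).sub measurable_snd))
  exact this.integral_prod_right.measurable

theorem integrable_conv_slice {Y : Type*} [MeasurableSpace Y] {μ : Measure Y} [SFinite μ]
    {k : Torus d → ℝ} {f : Y → Torus d → ℝ} (hk : Smooth k)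
    (hf : Measurable (Function.uncurry f)) (hfi : Integrable (Function.uncurry f) (μ.prod volume))
    (x : Torus d) : Integrable (fun s => conv k (f s) x) μ := by
  obtain ⟨C, -, hC⟩ := hk.exists_bound
  refine (hfi.abs.integral_prod_left.const_mul C).mono'
    ((measurable_conv hk.continuous.measurable hf).comp
      (measurable_id.prodMk measurable_const)).aestronglyMeasurable ?_
  filter_upwards [hfi.prod_right_ae] with s hs
  exact abs_conv_le hC hs x

theorem integrable_conv_uncurry {Y : Type*} [MeasurableSpace Y] {μ : Measure Y} [SFinite μ]
    {k : Torus d → ℝ} {f : Y → Torus d → ℝ} (hk : Smooth k)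
    (hf : Measurable (Function.uncurry f)) (hfi : Integrable (Function.uncurry f) (μ.prod volume)) :
    Integrable (Function.uncurry fun s x => conv k (f s) x) (μ.prod volume) := by
  obtain ⟨C, -, hC⟩ := hk.exists_bound
  refine ((hfi.abs.integral_prod_left.const_mul C).comp_fst volume).mono'
    (measurable_conv hk.continuous.measurable hf).aestronglyMeasurable ?_
  have := hfi.prod_right_ae
  have h2 := (Measure.quasiMeasurePreserving_fst (μ := μ) (ν := (volume : Measure (Torus d)))).ae this
  filter_upwards [h2] with p hp
  exact abs_conv_le hC hp p.2

/-- Integration by parts for an absolutely continuous primitive, which is differentiable only almost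
everywhere. -/
theorem sq_intervalIntegral {h : ℝ → ℝ} {t : ℝ} (hh : IntervalIntegrable h volume 0 t) :
    (∫ s in (0 : ℝ)..t, h s) ^ 2 = 2 * ∫ s in (0 : ℝ)..t, (∫ r in (0 : ℝ)..s, h r) * h s := by
  have hac := hh.absolutelyContinuousOnInterval_intervalIntegral (c := 0) (by simp)
  have key := hac.integral_mul_deriv_eq_deriv_mul hac
  have e1 : ∫ s in (0 : ℝ)..t, (∫ r in (0 : ℝ)..s, h r) *
      deriv (fun s => ∫ r in (0 : ℝ)..s, h r) s =
      ∫ s in (0 : ℝ)..t, (∫ r in (0 : ℝ)..s, h r) * h s := by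
    apply intervalIntegral.integral_congr_ae
    filter_upwards [hh.ae_hasDerivAt_integral] with s hs hs2
    rw [(hs (uIoc_subset_uIcc hs2) 0 (by simp)).deriv]
  simp_rw [mul_comm (deriv _ _)] at key
  rw [e1] at key
  simp only [intervalIntegral.integral_same] at key
  linarith

/-- Mollification of the right hand side of the transport equation. -/
noncomputable def transportRhs (k V : Torus d → ℝ) (b : Fin d → Torus d → ℝ) (D : Torus d → ℝ)
    (x : Torus d) : ℝ :=
  conv k (fun x => V x * D x) x - ∑ i, conv (Torus.partialDeriv i k) (fun x => V x * b i x) x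

/-- With the kernel centred at `x` as test function, the weak formulation becomes an ordinary
differential equation in time for the mollified solution at `x`. -/
theorem integral_test_kernel {k V : Torus d → ℝ} {b : Fin d → Torus d → ℝ} {D : Torus d → ℝ}
    (hk : Smooth k) (hVb : ∀ i, Integrable fun x => V x * b i x)
    (hVD : Integrable fun x => V x * D x) (x : Torus d) :
    ∫ z, V z * ((∑ i, b i z * Torus.partialDeriv i (fun z => k (x - z)) z) + D z * k (x - z)) =
      transportRhs k V b D x := by
  simp_rw [hk.partialDeriv_comp_sub, transportRhs, conv_eq]
  have hks : Smooth fun z => k (x - z) := hk.comp_sub x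
  have hks' : ∀ i, Smooth fun z => Torus.partialDeriv i k (x - z) := fun i =>
    (hk.partialDeriv i).comp_sub x
  have i1 := fun i => (hks' i).integrable_mul (hVb i)
  rw [← integral_finsetSum _ fun i _ => i1 i, ← integral_sub (hks.integrable_mul hVD)
    (integrable_sum_of_normed fun i _ => i1 i)]
  refine integral_congr_ae (ae_of_all _ fun z => ?_)
  simp only [mul_add, Finset.mul_sum, mul_neg, Finset.sum_neg_distrib]
  have : ∀ i, V z * (b i z * Torus.partialDeriv i k (x - z)) =
    Torus.partialDeriv i k (x - z) * (V z * b i z) := fun i => by ring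
  simp_rw [this]; ring

/-- With `W = k * V` the right-hand side is the commutator minus `b · ∇W`. Tested with `W`, the
transport term becomes half the divergence against `W ^ 2`, so of `∇b` only the bounded divergence
enters outside the commutator. -/
theorem integral_conv_mul_rhs_le {k V : Torus d → ℝ} {b : Fin d → Torus d → ℝ}
    {G : Fin d → Fin d → Torus d → ℝ} {M L : ℝ} (hk : Smooth k) (hk0 : ∀ z, 0 ≤ k z)
    (hk1 : ∫ z, k z = 1) (hV : Measurable V) (hM : ∀ x, |V x| ≤ M) (hb : ∀ i, Integrable (b i))
    (h : ∀ i j, IsWeakPartial j (b i) (G i j)) (hL : ∀ᵐ x, |∑ i, G i i x| ≤ L) (hL0 : 0 ≤ L) :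
    2 * ∫ x, conv k V x * transportRhs k V b (fun x => ∑ i, G i i x) x ≤
      2 * M * (∫ x, |transportCommutator k V b (fun x => ∑ i, G i i x) x|) + L * ∫ x, V x ^ 2 := by
  have hVi : Integrable V := Integrable.of_bound hV.aestronglyMeasurable M (ae_of_all _ hM)
  have hD : Integrable fun x => ∑ i, G i i x :=
    integrable_sum_of_normed fun i _ => (h i i).integrable_deriv
  have hVb : ∀ i, Integrable fun x => V x * b i x := fun i =>
    integrable_bdd_mul hV.aestronglyMeasurable hM (hb i)
  have hVD : Integrable fun x => V x * ∑ i, G i i x :=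
    integrable_bdd_mul hV.aestronglyMeasurable hM hD
  have hW := conv_smooth hk hVi
  have hWM : ∀ x, |conv k V x| ≤ M := by
    intro x
    rw [conv, ← Real.norm_eq_abs]
    refine (norm_integral_le_of_norm_le (hk.integrable.mul_const M)
      (ae_of_all _ fun z => ?_)).trans (le_of_eq ?_)
    · rw [Real.norm_eq_abs, abs_mul, abs_of_nonneg (hk0 z)]
      exact mul_le_mul_of_nonneg_left (hM _) (hk0 z)
    · rw [integral_mul_const, hk1, one_mul]
  set W := conv k V
  have hWd : ∀ i x, Torus.partialDeriv i W x = conv (Torus.partialDeriv i k) V x :=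
    fun i x => partialDeriv_conv hk hVi i x
  have hW2 : Smooth fun x => W x * W x := hW.mul hW
  have e1 : ∀ i, ∫ x, W x * (b i x * Torus.partialDeriv i W x) = -(1/2) * ∫ x, G i i x * (W x * W x) := by
    intro i
    have := (h i i).integral_eq _ hW2
    simp_rw [hW.partialDeriv_mul hW] at this
    have e : ∀ x, W x * (b i x * Torus.partialDeriv i W x) =
      (1/2) * (b i x * (Torus.partialDeriv i W x * W x + W x * Torus.partialDeriv i W x)) :=
      fun x => by ring
    simp_rw [e]
    rw [integral_const_mul, this]; ring
  have hr : ∀ x, W x * transportRhs k V b (fun x => ∑ i, G i i x) x =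
      W x * transportCommutator k V b (fun x => ∑ i, G i i x) x -
        ∑ i, W x * (b i x * Torus.partialDeriv i W x) := by
    intro x
    simp only [transportRhs, transportCommutator, hWd, Finset.sum_sub_distrib]
    rw [← Finset.mul_sum]; ring
  have ir : Integrable (transportCommutator k V b (fun x => ∑ i, G i i x)) := by
    refine integrable_add_fun (integrable_sum_of_normed fun i _ => integrable_sub_fun ?_ ?_)
      (conv_smooth hk hVD).integrable
    · have := (conv_smooth (hk.partialDeriv i) hVi).integrable_mul (hb i)
      exact this.congr (ae_of_all _ fun x => mul_comm _ _)
    · exact (conv_smooth (hk.partialDeriv i) (hVb i)).integrable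
  have iWr := hW.integrable_mul ir
  have iWb : ∀ i, Integrable fun x => W x * (b i x * Torus.partialDeriv i W x) := fun i =>
    hW.integrable_mul (((hW.partialDeriv i).integrable_mul (hb i)).congr
      (ae_of_all _ fun x => mul_comm _ _))
  have iGW : ∀ i, Integrable fun x => G i i x * (W x * W x) := fun i =>
    (hW2.integrable_mul (h i i).integrable_deriv).congr (ae_of_all _ fun x => mul_comm _ _)
  have hWV : ∫ x, W x ^ 2 ≤ ∫ x, V x ^ 2 := by
    have := lintegral_cost_conv_le (convexCost_rpow (p := 2) (by norm_num)) hk hk0 hk1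
      hV.aestronglyMeasurable
    have e : ∀ t : ℝ, |t| ^ (2 : ℝ) = t ^ 2 := fun t => by
      rw [show (2 : ℝ) = ((2 : ℕ) : ℝ) by norm_num, Real.rpow_natCast, sq_abs]
    simp_rw [e] at this
    have iV2 : Integrable fun x => V x ^ 2 := by
      simpa [sq] using integrable_bdd_mul hV.aestronglyMeasurable hM hVi
    have iW2 : Integrable fun x => W x ^ 2 := by simpa [sq] using hW2.integrable
    rw [← ofReal_integral_eq_lintegral_ofReal iW2 (ae_of_all _ fun _ => sq_nonneg _),
      ← ofReal_integral_eq_lintegral_ofReal iV2 (ae_of_all _ fun _ => sq_nonneg _)] at this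
    exact (ENNReal.ofReal_le_ofReal_iff (integral_nonneg fun _ => sq_nonneg _)).1 this
  have e2 : ∫ x, W x * transportRhs k V b (fun x => ∑ i, G i i x) x =
      (∫ x, W x * transportCommutator k V b (fun x => ∑ i, G i i x) x) +
        (1/2) * ∫ x, ∑ i, G i i x * (W x * W x) := by
    simp_rw [hr]
    rw [integral_sub iWr (integrable_sum_of_normed fun i _ => iWb i),
      integral_finsetSum _ fun i _ => iWb i, integral_finsetSum _ fun i _ => iGW i]
    simp_rw [e1]
    rw [← Finset.mul_sum]; ring
  have b1 : ∫ x, W x * transportCommutator k V b (fun x => ∑ i, G i i x) x ≤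
      M * ∫ x, |transportCommutator k V b (fun x => ∑ i, G i i x) x| := by
    rw [← integral_const_mul]
    refine integral_mono iWr (ir.abs.const_mul _) fun x => ?_
    refine (le_abs_self _).trans ?_
    simp only [abs_mul]
    exact mul_le_mul_of_nonneg_right (hWM x) (abs_nonneg _)
  have b2 : ∫ x, ∑ i, G i i x * (W x * W x) ≤ L * ∫ x, W x ^ 2 := by
    rw [← integral_const_mul]
    have iW2 : Integrable fun x => W x ^ 2 := by simpa [sq] using hW2.integrable
    refine integral_mono_ae (integrable_sum_of_normed fun i _ => iGW i) (iW2.const_mul L) ?_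
    filter_upwards [hL] with x hx
    rw [← Finset.sum_mul, ← sq]
    exact mul_le_mul_of_nonneg_right ((le_abs_self _).trans hx) (sq_nonneg _)
  have := mul_le_mul_of_nonneg_left hWV hL0
  rw [e2]; linarith

theorem TransportField.exists_integral_abs_grad_le {b : Fin d → ℝ → Torus d → ℝ}
    {G : Fin d → Fin d → ℝ → Torus d → ℝ} (h : TransportField b G) :
    ∃ K, 0 ≤ K ∧ ∀ s i j, ∫ x, |G i j s x| ≤ K := by
  obtain ⟨K, hK0, hK⟩ := h.exp_bound 1 one_pos
  refine ⟨K, hK0, fun s i j => ?_⟩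
  have i1 := (h.isWeakPartial s i j).integrable_deriv.abs
  rw [← ENNReal.ofReal_le_ofReal_iff hK0, ofReal_integral_eq_lintegral_ofReal i1
    (ae_of_all _ fun _ => abs_nonneg _)]
  refine (lintegral_mono fun x => ENNReal.ofReal_le_ofReal ?_).trans (hK s i j)
  rw [one_mul]
  linarith [Real.add_one_le_exp |G i j s x|]

theorem TransportField.integrable_slice {b : Fin d → ℝ → Torus d → ℝ}
    {G : Fin d → Fin d → ℝ → Torus d → ℝ} (h : TransportField b G) (hd : Nonempty (Fin d))
    (s : ℝ) (i : Fin d) : Integrable (b i s) :=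
  (h.isWeakPartial s i hd.some).integrable

/-- Grönwall's lemma by iteration: the bound acquires a factor `(L t)^m / m!`. The inequality holds
for `f` at every time, while the integrand is a measurable function `F` that agrees with `f` only
almost everywhere. -/
theorem integral_abs_pow_iterate_le {F : ℝ → ℝ} {T L C : ℝ} (hL : 0 ≤ L) (hC : 0 ≤ C)
    (hF : ∀ᵐ s ∂volume.restrict (Icc 0 T), F s ≤ C) (hF0 : ∀ s, 0 ≤ F s)
    (hFm : Measurable F) {f : ℝ → ℝ} (hf0 : ∀ s, 0 ≤ f s)
    (hFf : ∀ᵐ s ∂volume.restrict (Icc 0 T), F s = f s)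
    (hle : ∀ t ∈ Icc 0 T, f t ≤ L * ∫ s in (0 : ℝ)..t, F s) {t : ℝ} (ht : t ∈ Icc 0 T) :
    f t = 0 := by
  have hFi : IntegrableOn F (Icc 0 T) := by
    refine Integrable.of_bound hFm.aestronglyMeasurable C ?_
    filter_upwards [hF] with s hs
    rw [Real.norm_eq_abs, abs_of_nonneg (hF0 s)]; exact hs
  have key : ∀ m : ℕ, ∀ t ∈ Icc 0 T, f t ≤ C * L * T * ((L * t) ^ m / m.factorial) := by
    intro m
    induction m with
    | zero =>
      intro t ht
      refine (hle t ht).trans ?_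
      simp only [pow_zero, Nat.factorial_zero, Nat.cast_one, div_one, mul_one]
      have : ∫ s in (0 : ℝ)..t, F s ≤ ∫ s in (0 : ℝ)..t, C := by
        refine intervalIntegral.integral_mono_ae_restrict ht.1 ?_ (by simp) ?_
        · rw [intervalIntegrable_iff_integrableOn_Icc_of_le ht.1]
          exact hFi.mono_set (Icc_subset_Icc_right ht.2)
        · exact ae_restrict_of_ae_restrict_of_subset (Icc_subset_Icc_right ht.2) hF
      rw [intervalIntegral.integral_const, smul_eq_mul, sub_zero] at this
      calc _ ≤ L * (t * C) := mul_le_mul_of_nonneg_left this hL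
        _ ≤ L * (T * C) := by gcongr; exact ht.2
        _ = _ := by ring
    | succ m ih =>
      intro t ht
      refine (hle t ht).trans ?_
      have : ∫ s in (0 : ℝ)..t, F s ≤
          ∫ s in (0 : ℝ)..t, C * L * T * (L ^ m / m.factorial) * s ^ m := by
        refine intervalIntegral.integral_mono_ae_restrict ht.1 ?_
          (Continuous.intervalIntegrable (by fun_prop) _ _) ?_
        · rw [intervalIntegrable_iff_integrableOn_Icc_of_le ht.1]
          exact hFi.mono_set (Icc_subset_Icc_right ht.2)
        · refine ae_restrict_of_ae_restrict_of_subset (Icc_subset_Icc_right ht.2) ?_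
          filter_upwards [hFf, ae_restrict_mem measurableSet_Icc] with s hs hs2
          rw [hs]
          refine (ih s hs2).trans (le_of_eq ?_)
          rw [mul_pow]; ring
      rw [intervalIntegral.integral_const_mul, integral_pow] at this
      refine (mul_le_mul_of_nonneg_left this hL).trans (le_of_eq ?_)
      rw [Nat.factorial_succ]
      push_cast
      field_simp
      simp
      try ring
  have hlim : Tendsto (fun m : ℕ => C * L * T * ((L * t) ^ m / m.factorial)) atTop (𝓝 0) := by
    simpa using (FloorSemiring.tendsto_pow_div_factorial_atTop (L * t)).const_mul (C * L * T)
  exact le_antisymm (ge_of_tendsto' hlim fun m => key m t ht) (hf0 t)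

theorem abs_conv_le_of_bound {k f : Torus d → ℝ} {M : ℝ} (hk : Smooth k) (hk0 : ∀ z, 0 ≤ k z)
    (hk1 : ∫ z, k z = 1) (hM : ∀ᵐ x, |f x| ≤ M) (x : Torus d) : |conv k f x| ≤ M := by
  rw [conv, ← Real.norm_eq_abs]
  have hM' : ∀ᵐ z, |f (x - z)| ≤ M :=
    (Measure.measurePreserving_sub_left volume x).quasiMeasurePreserving.ae hM
  refine (norm_integral_le_of_norm_le (hk.integrable.mul_const M) ?_).trans (le_of_eq ?_)
  · filter_upwards [hM'] with z hz
    rw [Real.norm_eq_abs, abs_mul, abs_of_nonneg (hk0 z)]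
    exact mul_le_mul_of_nonneg_left hz (hk0 z)
  · rw [integral_mul_const, hk1, one_mul]

theorem conv_congr_ae {k f g : Torus d → ℝ} (h : f =ᵐ[volume] g) (x : Torus d) :
    conv k f x = conv k g x := by
  have h' : ∀ᵐ z, f (x - z) = g (x - z) :=
    (Measure.measurePreserving_sub_left volume x).quasiMeasurePreserving.ae h
  exact integral_congr_ae (h'.mono fun z hz => by simp only [hz])

section Uniqueness

variable {b : Fin d → ℝ → Torus d → ℝ} {G : Fin d → Fin d → ℝ → Torus d → ℝ}

theorem TransportField.measurable_div (h : TransportField b G) :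
    Measurable (Function.uncurry fun s x => ∑ i, G i i s x) := by
  have : (Function.uncurry fun s x => ∑ i, G i i s x) =
      fun p : ℝ × Torus d => ∑ i, Function.uncurry (G i i) p := rfl
  rw [this]
  exact Finset.measurable_sum _ fun i _ => h.measurable_grad i i

theorem TransportField.integrable_restrict (h : TransportField b G) (A : Set ℝ) (i : Fin d) :
    Integrable (Function.uncurry (b i)) ((volume.restrict A).prod volume) :=
  (h.integrable i).mono_measure (Measure.prod_mono Measure.restrict_le_self le_rfl)

theorem TransportField.ae_div_le (h : TransportField b G) {L : ℝ}
    (hL : ∀ s, ∀ᵐ x, |∑ i, G i i s x| ≤ L) (μ : Measure ℝ) [SFinite μ] :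
    ∀ᵐ p ∂μ.prod (volume : Measure (Torus d)), |∑ i, G i i p.1 p.2| ≤ L := by
  have hm : MeasurableSet {p : ℝ × Torus d | |∑ i, G i i p.1 p.2| ≤ L} :=
    measurableSet_le h.measurable_div.abs measurable_const
  exact (Measure.ae_prod_iff_ae_ae hm).2 (ae_of_all _ hL)

theorem integrable_transport_products (h : TransportField b G) {V : ℝ → Torus d → ℝ} {M : ℝ}
    (hV : Measurable (Function.uncurry V)) (hM : ∀ s x, |V s x| ≤ M) (A : Set ℝ)
    [IsFiniteMeasure (volume.restrict A)] :
    (∀ i, Integrable (Function.uncurry fun s x => V s x * b i s x)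
      ((volume.restrict A).prod volume)) ∧
    Integrable (Function.uncurry fun s x => V s x * ∑ i, G i i s x)
      ((volume.restrict A).prod volume) := by
  refine ⟨fun i => integrable_bdd_mul hV.aestronglyMeasurable (fun p => hM p.1 p.2)
    (h.integrable_restrict A i), ?_⟩
  obtain ⟨L, hL0, hL⟩ := h.div_bound
  refine integrable_bdd_mul hV.aestronglyMeasurable (fun p => hM p.1 p.2) ?_
  exact Integrable.of_bound h.measurable_div.aestronglyMeasurable L (h.ae_div_le hL _)

theorem TransportField.measurable_commutator (h : TransportField b G) {k : Torus d → ℝ}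
    (hk : Smooth k) {V : ℝ → Torus d → ℝ} (hV : Measurable (Function.uncurry V)) :
    Measurable (Function.uncurry fun s x =>
      transportCommutator k (V s) (fun i => b i s) (fun x => ∑ i, G i i s x) x) := by
  have e : (Function.uncurry fun s x =>
      transportCommutator k (V s) (fun i => b i s) (fun x => ∑ i, G i i s x) x) =
      fun p : ℝ × Torus d => ∑ i, (Function.uncurry (b i) p *
        (Function.uncurry fun s x => conv (Torus.partialDeriv i k) (V s) x) p -
        (Function.uncurry fun s x => conv (Torus.partialDeriv i k) (fun x => V s x * b i s x) x) p) +
        (Function.uncurry fun s x => conv k (fun x => V s x * ∑ i, G i i s x) x) p := rfl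
  rw [e]
  refine (Finset.measurable_sum _ fun i _ => ?_).add
    (measurable_conv hk.continuous.measurable (hV.mul h.measurable_div))
  have hki := (hk.partialDeriv i).continuous.measurable
  exact ((h.measurable i).mul (measurable_conv hki hV)).sub
    (measurable_conv hki (hV.mul (h.measurable i)))

set_option maxHeartbeats 400000 in
-- At each `x` the mollified solution is absolutely continuous in time; its square is differentiated
-- and integrated in `x`. Here `v` is the solution at every time and `V` a jointly measurable
-- version, equal to it at almost every time.
theorem integral_sq_le_of_solution (h : TransportField b G) (hd : Nonempty (Fin d)) {M L t : ℝ}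
    (ht : 0 ≤ t) {v V : ℝ → Torus d → ℝ} (hV : Measurable (Function.uncurry V))
    (hM : ∀ s x, |V s x| ≤ M) (hL0 : 0 ≤ L) (hL : ∀ s, ∀ᵐ x, |∑ i, G i i s x| ≤ L)
    (hVv : ∀ᵐ s ∂volume.restrict (Ioc 0 t), V s =ᵐ[volume] v s)
    {k : Torus d → ℝ} (hk : Smooth k) (hk0 : ∀ z, 0 ≤ k z) (hk1 : ∫ z, k z = 1)
    (eq : ∀ τ ∈ Icc 0 t, ∀ φ, Smooth φ → ∫ x, v τ x * φ x = ∫ s in (0 : ℝ)..τ, ∫ x, V s x *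
      ((∑ i, b i s x * Torus.partialDeriv i φ x) + (∑ i, G i i s x) * φ x)) :
    ∫ x, conv k (v t) x ^ 2 ≤ ∫ s in (0 : ℝ)..t, (2 * M * (∫ x, |transportCommutator k (V s)
      (fun i => b i s) (fun x => ∑ i, G i i s x) x|) + L * ∫ x, V s x ^ 2) := by
  have hM0 : 0 ≤ M := (abs_nonneg _).trans (hM 0 0)
  set D : ℝ → Torus d → ℝ := fun s x => ∑ i, G i i s x with hD
  set H : ℝ → Torus d → ℝ := fun s x => transportRhs k (V s) (fun i => b i s) (D s) x with hH
  have hVs : ∀ s, Measurable (V s) := fun s => hV.comp measurable_prodMk_left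
  have hVi : ∀ s, Integrable (V s) := fun s =>
    Integrable.of_bound (hVs s).aestronglyMeasurable M (ae_of_all _ (hM s))
  have hVb : ∀ s i, Integrable fun x => V s x * b i s x := fun s i =>
    integrable_bdd_mul (hVs s).aestronglyMeasurable (hM s) (h.integrable_slice hd s i)
  have hVD : ∀ s, Integrable fun x => V s x * D s x := fun s =>
    integrable_bdd_mul (hVs s).aestronglyMeasurable (hM s)
      (integrable_sum_of_normed fun i _ => (h.isWeakPartial s i i).integrable_deriv)
  obtain ⟨p1, p2⟩ := integrable_transport_products h hV hM (Ioc 0 t)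
  have mH : Measurable (Function.uncurry H) := by
    have e : Function.uncurry H = fun p : ℝ × Torus d =>
        (Function.uncurry fun s x => conv k (fun x => V s x * D s x) x) p -
        ∑ i, (Function.uncurry fun s x =>
          conv (Torus.partialDeriv i k) (fun x => V s x * b i s x) x) p := rfl
    rw [e]
    exact (measurable_conv hk.continuous.measurable (hV.mul h.measurable_div)).sub
      (Finset.measurable_sum _ fun i _ => measurable_conv
        (hk.partialDeriv i).continuous.measurable (hV.mul (h.measurable i)))
  have iH : Integrable (Function.uncurry H) ((volume.restrict (Ioc 0 t)).prod volume) := by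
    refine integrable_sub_fun (integrable_conv_uncurry hk (hV.mul h.measurable_div) p2)
      (integrable_sum_of_normed fun i _ => ?_)
    exact integrable_conv_uncurry (hk.partialDeriv i) (hV.mul (h.measurable i)) (p1 i)
  have iHx : ∀ x, IntervalIntegrable (fun s => H s x) volume 0 t := by
    intro x
    rw [intervalIntegrable_iff_integrableOn_Ioc_of_le ht]
    refine integrable_sub_fun (integrable_conv_slice hk (hV.mul h.measurable_div) p2 x)
      (integrable_sum_of_normed fun i _ => ?_)
    exact integrable_conv_slice (hk.partialDeriv i) (hV.mul (h.measurable i)) (p1 i) x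
  have hw : ∀ τ ∈ Icc 0 t, ∀ x, conv k (v τ) x = ∫ s in (0 : ℝ)..τ, H s x := by
    intro τ hτ x
    have := eq τ hτ _ (hk.comp_sub x)
    rw [conv_eq]
    simp_rw [mul_comm (v τ _)] at this
    rw [this]
    refine intervalIntegral.integral_congr fun s _ => ?_
    exact integral_test_kernel hk (hVb s) (hVD s) x
  set W : ℝ → Torus d → ℝ := fun s x => conv k (V s) x with hW
  have hWM : ∀ s x, |W s x| ≤ M := fun s x =>
    abs_conv_le_of_bound hk hk0 hk1 (ae_of_all _ (hM s)) x
  have mW : Measurable (Function.uncurry W) := measurable_conv hk.continuous.measurable hV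
  have iWH : Integrable (Function.uncurry fun s x => W s x * H s x)
      ((volume.restrict (Ioc 0 t)).prod volume) :=
    integrable_bdd_mul mW.aestronglyMeasurable (fun p => hWM p.1 p.2) iH
  have hsq : ∀ x, conv k (v t) x ^ 2 = 2 * ∫ s in (0 : ℝ)..t, W s x * H s x := by
    intro x
    rw [hw t ⟨ht, le_rfl⟩ x, sq_intervalIntegral (iHx x)]
    congr 1
    rw [intervalIntegral.integral_of_le ht, intervalIntegral.integral_of_le ht]
    refine integral_congr_ae ?_
    filter_upwards [hVv, ae_restrict_mem measurableSet_Ioc] with s hs hs2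
    rw [← hw s ⟨hs2.1.le, hs2.2⟩ x, ← conv_congr_ae hs x]
  simp_rw [hsq]
  rw [integral_const_mul, ← intervalIntegral_integral_swap (by rwa [uIoc_of_le ht]),
    ← intervalIntegral.integral_const_mul]
  obtain ⟨K, hK0, hK⟩ := h.exists_integral_abs_grad_le
  have hV2 : Measurable (Function.uncurry fun s x => V s x ^ 2) := hV.pow_const 2
  refine intervalIntegral.integral_mono_on_of_le_Ioo ht ?_ ?_ fun s _ => ?_
  · rw [intervalIntegrable_iff_integrableOn_Ioc_of_le ht]
    exact iWH.integral_prod_left.const_mul 2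
  · rw [intervalIntegrable_iff_integrableOn_Ioc_of_le ht]
    refine integrable_add_fun (Integrable.const_mul ?_ _) (Integrable.const_mul ?_ _)
    · have i3 : Integrable (Function.uncurry fun s x =>
          transportCommutator k (V s) (fun i => b i s) (D s) x)
          ((volume.restrict (Ioc 0 t)).prod volume) := by
        refine integrable_add_fun (integrable_sum_of_normed fun i _ => integrable_sub_fun ?_ ?_)
          (integrable_conv_uncurry hk (hV.mul h.measurable_div) p2)
        · obtain ⟨C, -, hC⟩ := (hk.partialDeriv i).exists_bound
          have := integrable_bdd_mul (M := C * M) (measurable_conv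
            (hk.partialDeriv i).continuous.measurable hV).aestronglyMeasurable
            (fun p => ?_) (h.integrable_restrict (Ioc 0 t) i)
          · exact this.congr (ae_of_all _ fun p => mul_comm _ _)
          · refine (abs_conv_le hC (hVi p.1) p.2).trans (mul_le_mul_of_nonneg_left ?_
              ((abs_nonneg _).trans (hC 0)))
            simpa using integral_mono (hVi p.1).abs (integrable_const M) (hM p.1)
        · exact integrable_conv_uncurry (hk.partialDeriv i) (hV.mul (h.measurable i)) (p1 i)
      exact i3.abs.integral_prod_left
    · have : Integrable (Function.uncurry fun s x => V s x ^ 2)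
          ((volume.restrict (Ioc 0 t)).prod volume) := by
        refine Integrable.of_bound hV2.aestronglyMeasurable (M ^ 2) (ae_of_all _ fun p => ?_)
        rw [Real.norm_eq_abs, abs_of_nonneg (sq_nonneg _)]
        exact sq_le_sq' (by linarith [(abs_le.1 (hM p.1 p.2)).1]) (abs_le.1 (hM p.1 p.2)).2
      exact this.integral_prod_left
  · exact integral_conv_mul_rhs_le (b := fun i => b i s) (G := fun i j => G i j s) hk hk0 hk1 (hVs s) (hM s) (h.integrable_slice hd s)
      (h.isWeakPartial s) (hL s) hL0

set_option maxHeartbeats 400000 in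
-- As the mollification is removed, the commutator disappears by dominated convergence in time. The
-- energy is then at most `L` times its own time integral, and the initial energy is zero.
theorem TransportField.eq_zero_of_solution (h : TransportField b G) (hd : Nonempty (Fin d))
    {T M : ℝ} {v V : ℝ → Torus d → ℝ} (hV : Measurable (Function.uncurry V))
    (hM : ∀ s x, |V s x| ≤ M) (hvm : ∀ t ∈ Icc 0 T, AEStronglyMeasurable (v t) volume)
    (hvM : ∀ t ∈ Icc 0 T, ∀ᵐ x, |v t x| ≤ M)
    (hVv : ∀ᵐ s ∂volume.restrict (Icc 0 T), V s =ᵐ[volume] v s)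
    (eq : ∀ t ∈ Icc 0 T, ∀ φ, Smooth φ → ∫ x, v t x * φ x = ∫ s in (0 : ℝ)..t, ∫ x, V s x *
      ((∑ i, b i s x * Torus.partialDeriv i φ x) + (∑ i, G i i s x) * φ x))
    {t : ℝ} (ht : t ∈ Icc 0 T) : v t =ᵐ[volume] 0 := by
  have hM0 : 0 ≤ M := (abs_nonneg _).trans (hM 0 0)
  obtain ⟨L, hL0, hL⟩ := h.div_bound
  obtain ⟨K, hK0, hK⟩ := h.exists_integral_abs_grad_le
  obtain ⟨C, hC0, hC⟩ := exists_integral_abs_commutator_mollifier_le d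
  have hVs : ∀ s, Measurable (V s) := fun s => hV.comp measurable_prodMk_left
  have hvi : ∀ t ∈ Icc 0 T, Integrable (v t) := fun t ht =>
    Integrable.of_bound (hvm t ht) M (hvM t ht)
  have hv2 : ∀ t ∈ Icc 0 T, Integrable fun x => v t x ^ 2 := fun t ht => by
    refine Integrable.of_bound ((hvm t ht).pow 2) (M ^ 2) ?_
    filter_upwards [hvM t ht] with x hx
    rw [Real.norm_eq_abs, abs_of_nonneg (sq_nonneg _)]
    exact sq_le_sq' (by linarith [(abs_le.1 hx).1]) (abs_le.1 hx).2
  have hV2 : Measurable (Function.uncurry fun s x => V s x ^ 2) := hV.pow_const 2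
  have hFm : Measurable fun s => ∫ x, V s x ^ 2 := hV2.stronglyMeasurable.integral_prod_right.measurable
  have hF0 : ∀ s, 0 ≤ ∫ x, V s x ^ 2 := fun s => integral_nonneg fun _ => sq_nonneg _
  have hFM : ∀ s, ∫ x, V s x ^ 2 ≤ M ^ 2 := by
    intro s
    have : ∀ x, V s x ^ 2 ≤ M ^ 2 := fun x =>
      sq_le_sq' (by linarith [(abs_le.1 (hM s x)).1]) (abs_le.1 (hM s x)).2
    have i : Integrable fun x => V s x ^ 2 := by
      refine Integrable.of_bound ((hVs s).pow_const 2).aestronglyMeasurable (M ^ 2)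
        (ae_of_all _ fun x => ?_)
      rw [Real.norm_eq_abs, abs_of_nonneg (sq_nonneg _)]; exact this x
    simpa using integral_mono i (integrable_const (M ^ 2)) this
  have hle : ∀ t ∈ Icc 0 T, ∫ x, v t x ^ 2 ≤ L * ∫ s in (0 : ℝ)..t, ∫ x, V s x ^ 2 := by
    intro t ht
    set ρ : ℕ → ℝ → ℝ := fun n s => ∫ x, |transportCommutator (mollifier n) (V s)
      (fun i => b i s) (fun x => ∑ i, G i i s x) x| with hρ
    have hρb : ∀ n s, ρ n s ≤ C * M * K := fun n s =>
      hC n (V s) (fun i => b i s) (fun i j => G i j s) M K (hVs s) (hM s) (h.integrable_slice hd s) (h.isWeakPartial s) (hK s)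
    have hρ0 : ∀ n s, 0 ≤ ρ n s := fun n s => integral_nonneg fun _ => abs_nonneg _
    have hρm : ∀ n, Measurable (ρ n) := fun n =>
      (h.measurable_commutator (mollifier_smooth n) hV).abs.stronglyMeasurable.integral_prod_right.measurable
    have hρi : ∀ n, IntervalIntegrable (ρ n) volume 0 t := by
      intro n
      rw [intervalIntegrable_iff_integrableOn_Ioc_of_le ht.1]
      refine Integrable.of_bound (hρm n).aestronglyMeasurable (C * M * K) (ae_of_all _ fun s => ?_)
      rw [Real.norm_eq_abs, abs_of_nonneg (hρ0 n s)]; exact hρb n s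
    have hFi : IntervalIntegrable (fun s => ∫ x, V s x ^ 2) volume 0 t := by
      rw [intervalIntegrable_iff_integrableOn_Ioc_of_le ht.1]
      refine Integrable.of_bound hFm.aestronglyMeasurable (M ^ 2) (ae_of_all _ fun s => ?_)
      rw [Real.norm_eq_abs, abs_of_nonneg (hF0 s)]; exact hFM s
    have hρs : ∀ s, Tendsto (fun n => ρ n s) atTop (𝓝 0) := fun s =>
      tendsto_integral_abs_commutator (b := fun i => b i s) (G := fun i j => G i j s) (hVs s)
        (hM s) (h.integrable_slice hd s) (h.isWeakPartial s)
    have hρt : Tendsto (fun n => ∫ s in (0 : ℝ)..t, ρ n s) atTop (𝓝 0) := by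
      have := intervalIntegral.tendsto_integral_filter_of_dominated_convergence
        (μ := volume) (a := 0) (b := t) (F := ρ) (f := fun _ => 0) (l := atTop)
        (fun _ => C * M * K)
        (Eventually.of_forall fun n => (hρm n).aestronglyMeasurable)
        (Eventually.of_forall fun n => ae_of_all _ fun s _ => by
          rw [Real.norm_eq_abs, abs_of_nonneg (hρ0 n s)]; exact hρb n s)
        (by simp)
        (ae_of_all _ fun s _ => hρs s)
      simpa using this
    -- Both `v t` and its mollification are bounded by `M`, so their squares differ in `L^1` by at
    -- most `2 * M` times the distance of the functions.
    have hn : ∀ n, ∫ x, v t x ^ 2 ≤ (2 * M * ∫ x, |conv (mollifier n) (v t) x - v t x|) +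
        (2 * M * (∫ s in (0 : ℝ)..t, ρ n s) + L * ∫ s in (0 : ℝ)..t, ∫ x, V s x ^ 2) := by
      intro n
      have hk := mollifier_smooth (d := d) n
      have key := integral_sq_le_of_solution h hd ht.1 hV hM hL0 hL
        (v := v) (ae_restrict_of_ae_restrict_of_subset
          (Ioc_subset_Icc_self.trans (Icc_subset_Icc_right ht.2)) hVv) hk (mollifier_nonneg n)
        (integral_mollifier n) fun τ hτ => eq τ ⟨hτ.1, hτ.2.trans ht.2⟩
      rw [intervalIntegral.integral_add ((hρi n).const_mul _) (hFi.const_mul _),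
        intervalIntegral.integral_const_mul, intervalIntegral.integral_const_mul] at key
      have hcs := conv_smooth hk (hvi t ht)
      have i1 := (hcs.integrable.sub (hvi t ht)).abs
      have i2 : Integrable fun x => conv (mollifier n) (v t) x ^ 2 := by
        simpa [sq] using (hcs.mul hcs).integrable
      have : ∫ x, v t x ^ 2 ≤ ∫ x, (2 * M * |conv (mollifier n) (v t) x - v t x| +
          conv (mollifier n) (v t) x ^ 2) := by
        refine integral_mono_ae (hv2 t ht) ((i1.const_mul _).add i2) ?_
        filter_upwards [hvM t ht] with x hx
        have hc := abs_conv_le_of_bound hk (mollifier_nonneg n) (integral_mollifier n) (hvM t ht) x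
        try dsimp only
        have h1 : v t x ^ 2 - conv (mollifier n) (v t) x ^ 2 =
          -(conv (mollifier n) (v t) x - v t x) * (v t x + conv (mollifier n) (v t) x) := by ring
        have h2 := le_abs_self (v t x ^ 2 - conv (mollifier n) (v t) x ^ 2)
        rw [h1, abs_mul, abs_neg] at h2
        have h3 : |v t x + conv (mollifier n) (v t) x| ≤ 2 * M :=
          (abs_add_le _ _).trans (by linarith)
        nlinarith [mul_le_mul_of_nonneg_left h3 (abs_nonneg (conv (mollifier n) (v t) x - v t x))]
      have e := integral_add (i1.const_mul (2 * M)) i2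
      rw [integral_const_mul] at e
      simp only [Pi.sub_apply] at e
      linarith
    have hlim := ((tendsto_integral_abs_conv_sub (hvi t ht)).const_mul (2 * M)).add
      ((hρt.const_mul (2 * M)).add_const (L * ∫ s in (0 : ℝ)..t, ∫ x, V s x ^ 2))
    simp only [mul_zero, zero_add] at hlim
    exact ge_of_tendsto' hlim hn
  have h0 := integral_abs_pow_iterate_le (F := fun s => ∫ x, V s x ^ 2)
    (f := fun s => ∫ x, v s x ^ 2) hL0 (sq_nonneg M)
    (ae_of_all _ hFM) hF0 hFm (fun s => integral_nonneg fun _ => sq_nonneg _)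
    (by filter_upwards [hVv] with s hs
        exact integral_congr_ae (hs.mono fun x hx => by simp only [hx])) hle ht
  have := (integral_eq_zero_iff_of_nonneg (fun _ => sq_nonneg _) (hv2 t ht)).1 h0
  filter_upwards [this] with x hx
  simpa using hx

end Uniqueness

/-! ### Jointly measurable versions of the field and of its gradient. -/

theorem exists_tendsto_integral_of_cauchy {Y : Type*} [MeasurableSpace Y] {μ : Measure Y}
    {f : ℕ → Y → ℝ} (hf : ∀ n, Integrable (f n) μ)
    (h : Tendsto (fun p : ℕ × ℕ => ∫ x, |f p.1 x - f p.2 x| ∂μ) atTop (𝓝 0)) :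
    ∃ g : Y → ℝ, Measurable g ∧ Integrable g μ ∧
      Tendsto (fun n => ∫ x, |f n x - g x| ∂μ) atTop (𝓝 0) := by
  have hd : ∀ n m, dist ((hf n).toL1 (f n)) ((hf m).toL1 (f m)) = ∫ x, |f n x - f m x| ∂μ := by
    intro n m
    rw [dist_eq_norm, ← Integrable.toL1_sub, L1.norm_eq_integral_norm]
    refine integral_congr_ae ?_
    filter_upwards [((hf n).sub (hf m)).coeFn_toL1] with x hx
    rw [hx]; rfl
  have hc : CauchySeq fun n => (hf n).toL1 (f n) := by
    rw [cauchySeq_iff_tendsto_dist_atTop_0]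
    simpa only [hd] using h
  obtain ⟨g, hg⟩ := cauchySeq_tendsto_of_complete hc
  have hgi := L1.integrable_coeFn g
  have hgm := hgi.aestronglyMeasurable
  refine ⟨hgm.mk g, hgm.stronglyMeasurable_mk.measurable, hgi.congr hgm.ae_eq_mk, ?_⟩
  rw [tendsto_iff_dist_tendsto_zero] at hg
  refine hg.congr fun n => ?_
  rw [dist_eq_norm, L1.norm_eq_integral_norm]
  refine integral_congr_ae ?_
  filter_upwards [(hf n).coeFn_toL1, Lp.coeFn_sub ((hf n).toL1 (f n)) g, hgm.ae_eq_mk] with x h1 h2 h3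
  rw [h2, Pi.sub_apply, h1, h3]; rfl

theorem IsWeakPartial.congr {f g f' g' : Torus d → ℝ} {i : Fin d} (h : IsWeakPartial i f g)
    (hf : f =ᵐ[volume] f') (hg : g =ᵐ[volume] g') : IsWeakPartial i f' g' where
  integrable := h.integrable.congr hf
  integrable_deriv := h.integrable_deriv.congr hg
  integral_eq φ hφ := by
    have := h.integral_eq φ hφ
    rw [integral_congr_ae (hf.mono fun x hx => by simp only [hx] :
      (fun x => f x * Torus.partialDeriv i φ x) =ᵐ[volume] fun x => f' x * Torus.partialDeriv i φ x),
      integral_congr_ae (hg.mono fun x hx => by simp only [hx] :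
      (fun x => g x * φ x) =ᵐ[volume] fun x => g' x * φ x)] at this
    exact this

theorem IsWeakPartial.zero (i : Fin d) : IsWeakPartial i (fun _ : Torus d => (0 : ℝ)) fun _ => 0 where
  integrable := integrable_zero _ _ _
  integrable_deriv := integrable_zero _ _ _
  integral_eq φ _ := by simp

theorem abs_le_frobNorm (A : Matrix (Fin d) (Fin d) ℝ) (i j : Fin d) : |A i j| ≤ frobNorm A := by
  refine Real.abs_le_sqrt ?_
  have h1 : A i j ^ 2 ≤ ∑ j, A i j ^ 2 :=
    Finset.single_le_sum (f := fun j => A i j ^ 2) (fun _ _ => sq_nonneg _) (Finset.mem_univ j)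
  exact h1.trans (Finset.single_le_sum (f := fun i => ∑ j, A i j ^ 2)
    (fun _ _ => Finset.sum_nonneg fun _ _ => sq_nonneg _) (Finset.mem_univ i))

theorem integral_abs_sub_triangle {Y : Type*} [MeasurableSpace Y] {μ : Measure Y} {f g h : Y → ℝ}
    (hf : Integrable f μ) (hg : Integrable g μ) (hh : Integrable h μ) :
    ∫ x, |f x - h x| ∂μ ≤ (∫ x, |f x - g x| ∂μ) + ∫ x, |g x - h x| ∂μ := by
  have i1 := (integrable_sub_fun hf hg).abs
  have i2 := (integrable_sub_fun hg hh).abs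
  rw [← integral_add i1 i2]
  exact integral_mono (integrable_sub_fun hf hh).abs (i1.add i2) fun x => abs_sub_le _ _ _

theorem ae_eq_of_integral_abs_tendsto {Y : Type*} [MeasurableSpace Y] {μ : Measure Y}
    {f : ℕ → Y → ℝ} {g h : Y → ℝ} (hf : ∀ n, Integrable (f n) μ) (hg : Integrable g μ)
    (hh : Integrable h μ) (h1 : Tendsto (fun n => ∫ x, |f n x - g x| ∂μ) atTop (𝓝 0))
    (h2 : Tendsto (fun n => ∫ x, |f n x - h x| ∂μ) atTop (𝓝 0)) : g =ᵐ[μ] h := by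
  have h3 : ∫ x, |g x - h x| ∂μ = 0 := by
    refine le_antisymm ?_ (integral_nonneg fun _ => abs_nonneg _)
    have := h1.add h2
    rw [add_zero] at this
    refine ge_of_tendsto' this fun n => ?_
    have := integral_abs_sub_triangle hg (hf n) hh
    simpa only [abs_sub_comm (g _) (f n _)] using this
  have := (integral_eq_zero_iff_of_nonneg (fun _ => abs_nonneg _)
    (integrable_sub_fun hg hh).abs).1 h3
  filter_upwards [this] with x hx
  exact sub_eq_zero.1 (abs_eq_zero.1 hx)

/-- The spatial gradient of a jointly measurable field has a jointly measurable version. -/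
theorem exists_measurable_partial {μ : Measure ℝ} [IsFiniteMeasure μ] {β : ℝ → Torus d → ℝ}
    {g : ℝ → Torus d → ℝ} {j : Fin d} {K : ℝ} (hβ : Measurable (Function.uncurry β))
    (hw : ∀ᵐ s ∂μ, IsWeakPartial j (β s) (g s)) (hK : ∀ᵐ s ∂μ, ∫ x, |g s x| ≤ K) :
    ∃ γ : ℝ → Torus d → ℝ, Measurable (Function.uncurry γ) ∧ ∀ᵐ s ∂μ, γ s =ᵐ[volume] g s := by
  -- These functions are jointly measurable because `β` is, and at almost every time they are
  -- mollifications of `g s`. They are therefore Cauchy in `L^1` of space-time, and their limit is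
  -- the version sought.
  set A : ℕ → ℝ → Torus d → ℝ := fun n s x => conv (Torus.partialDeriv j (mollifier n)) (β s) x
  have hAm : ∀ n, Measurable (Function.uncurry (A n)) := fun n =>
    measurable_conv ((mollifier_smooth n).partialDeriv j).continuous.measurable hβ
  have hA : ∀ n s, IsWeakPartial j (β s) (g s) → A n s = conv (mollifier n) (g s) :=
    fun n s hs => funext fun x => hs.conv_partialDeriv (mollifier_smooth n) x
  have hAi : ∀ n, Integrable (Function.uncurry (A n)) (μ.prod volume) := by
    intro n
    obtain ⟨C, hC0, hC⟩ := (mollifier_smooth (d := d) n).exists_bound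
    refine Integrable.of_bound (hAm n).aestronglyMeasurable (C * K) ?_
    have hm : MeasurableSet {p : ℝ × Torus d | ‖Function.uncurry (A n) p‖ ≤ C * K} :=
      measurableSet_le (hAm n).norm measurable_const
    refine (Measure.ae_prod_iff_ae_ae hm).2 ?_
    filter_upwards [hw, hK] with s hs hs2
    refine ae_of_all _ fun x => ?_
    simp only [Function.uncurry_apply_pair, hA n s hs]
    exact (abs_conv_le hC hs.integrable_deriv x).trans (mul_le_mul_of_nonneg_left hs2 hC0)
  have hc : Tendsto (fun p : ℕ × ℕ => ∫ z, |Function.uncurry (A p.1) z - Function.uncurry (A p.2) z|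
      ∂(μ.prod volume)) atTop (𝓝 0) := by
    have e : ∀ p : ℕ × ℕ, ∫ z, |Function.uncurry (A p.1) z - Function.uncurry (A p.2) z|
        ∂(μ.prod volume) = ∫ s, ∫ x, |A p.1 s x - A p.2 s x| ∂volume ∂μ := fun p => by
      rw [integral_prod _ (integrable_sub_fun (hAi p.1) (hAi p.2)).abs]; rfl
    simp_rw [e]
    have := tendsto_integral_filter_of_dominated_convergence (μ := μ) (l := (atTop : Filter (ℕ × ℕ)))
      (F := fun p s => ∫ x, |A p.1 s x - A p.2 s x|) (f := fun _ => (0 : ℝ)) (fun _ => K + K)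
      (Eventually.of_forall fun p => ?_) (Eventually.of_forall fun p => ?_)
      (integrable_const _) ?_
    · simpa using this
    · exact (((hAm p.1).sub (hAm p.2)).abs.stronglyMeasurable.integral_prod_right
        (f := fun s x => |A p.1 s x - A p.2 s x|)).aestronglyMeasurable
    · filter_upwards [hw, hK] with s hs hs2
      have hg := hs.integrable_deriv
      have i1 := fun n => (conv_smooth (mollifier_smooth n) hg).integrable
      have b1 := fun n => integral_abs_conv_le (mollifier_smooth n) (mollifier_nonneg n)
        (integral_mollifier n) hg
      rw [hA _ s hs, hA _ s hs, Real.norm_eq_abs,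
        abs_of_nonneg (integral_nonneg fun _ => abs_nonneg _)]
      have := integral_abs_sub_triangle (i1 p.1) (g := fun _ => (0 : ℝ)) (integrable_zero _ _ _) (i1 p.2)
      simp only [sub_zero, zero_sub, abs_neg] at this
      linarith [b1 p.1, b1 p.2]
    · filter_upwards [hw] with s hs
      have hg := hs.integrable_deriv
      have i1 := fun n => (conv_smooth (mollifier_smooth n) hg).integrable
      have ht := tendsto_integral_abs_conv_sub hg
      rw [← prod_atTop_atTop_eq]
      have h2 := (ht.comp tendsto_fst).add (ht.comp (tendsto_snd (f := (atTop : Filter ℕ))))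
      rw [add_zero] at h2
      refine squeeze_zero (fun _ => integral_nonneg fun _ => abs_nonneg _) (fun p => ?_) h2
      have := integral_abs_sub_triangle (i1 p.1) hg (i1 p.2)
      rw [hA _ s hs, hA _ s hs]
      simp only [abs_sub_comm (g s _)] at this
      exact this
  obtain ⟨γ, hγm, hγi, hγ⟩ := exists_tendsto_integral_of_cauchy hAi hc
  refine ⟨Function.curry γ, by simpa using hγm, ?_⟩
  have i2 : ∀ n, Integrable (fun s => ∫ x, |A n s x - γ (s, x)|) μ := fun n =>
    (integrable_sub_fun (hAi n) hγi).abs.integral_prod_left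
  obtain ⟨ns, hns, hae⟩ := exists_subseq_tendsto_ae i2 (integrable_zero _ _ _) (by
    refine hγ.congr fun n => ?_
    rw [integral_prod _ (integrable_sub_fun (hAi n) hγi).abs]
    refine integral_congr_ae (ae_of_all _ fun s => ?_)
    simp only [Pi.zero_apply, sub_zero]
    exact (abs_of_nonneg (integral_nonneg fun x => abs_nonneg (A n s x - γ (s, x)))).symm)
  filter_upwards [hw, hae, hγi.prod_right_ae] with s hs hs2 hs3
  have hg := hs.integrable_deriv
  have i1 := fun n => (conv_smooth (mollifier_smooth n) hg).integrable
  refine ae_eq_of_integral_abs_tendsto (f := fun n => conv (mollifier (ns n)) (g s))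
    (fun n => i1 _) hs3 hg ?_ ((tendsto_integral_abs_conv_sub hg).comp hns.tendsto_atTop)
  simp only [hA _ s hs, Pi.zero_apply] at hs2
  exact hs2

/-- The gradient is given time by time, with no joint measurability. Measurable versions are chosen
and set to zero on a measurable set of bad times, negligible in `[0,T]` and containing the
complement of `[0,T]`, so that every bound holds at every time. -/
theorem exists_transportField {T : ℝ} {b : ℝ → Torus d → EuclideanSpace ℝ (Fin d)}
    {Db : ℝ → Torus d → Matrix (Fin d) (Fin d) ℝ}
    (hb : Integrable (fun z : ℝ × Torus d => b z.1 z.2)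
      ((volume.restrict (Icc 0 T)).prod volume))
    (hDb : ∀ t ∈ Icc 0 T, IsWeakGradient (b t) (Db t))
    (hexp : ∀ β : ℝ, 0 < β →
      (⨆ t ∈ Icc 0 T, ∫⁻ x, ENNReal.ofReal (Real.exp (β * frobNorm (Db t x)))) < ⊤)
    (hdiv : ∃ L : ℝ, ∀ᵐ t ∂(volume.restrict (Icc 0 T)), ∀ᵐ x, |(Db t x).trace| ≤ L) :
    ∃ (β : Fin d → ℝ → Torus d → ℝ) (G : Fin d → Fin d → ℝ → Torus d → ℝ), TransportField β G ∧
      ∀ᵐ s ∂(volume.restrict (Icc 0 T)), (∀ i, β i s =ᵐ[volume] fun x => b s x i) ∧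
        ∀ i j, G i j s =ᵐ[volume] fun x => Db s x i j := by
  set μ : Measure ℝ := volume.restrict (Icc 0 T)
  have hbi : ∀ i, Integrable (fun z : ℝ × Torus d => b z.1 z.2 i) (μ.prod volume) := fun i =>
    (EuclideanSpace.proj (𝕜 := ℝ) i).integrable_comp hb
  set β : Fin d → ℝ → Torus d → ℝ := fun i => Function.curry ((hbi i).aestronglyMeasurable.mk _)
  have hβm : ∀ i, Measurable (Function.uncurry (β i)) := fun i => by
    simpa [β] using (hbi i).aestronglyMeasurable.stronglyMeasurable_mk.measurable
  have hβi : ∀ i, Integrable (Function.uncurry (β i)) (μ.prod volume) := fun i => by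
    simpa [β] using (hbi i).congr (hbi i).aestronglyMeasurable.ae_eq_mk
  have hβ : ∀ᵐ s ∂μ, ∀ i, β i s =ᵐ[volume] fun x => b s x i := by
    rw [ae_all_iff]
    intro i
    filter_upwards [Measure.ae_ae_of_ae_prod (hbi i).aestronglyMeasurable.ae_eq_mk] with s hs
    filter_upwards [hs] with x hx
    exact hx.symm
  have hmem : ∀ᵐ s ∂μ, s ∈ Icc 0 T := ae_restrict_mem measurableSet_Icc
  have hExp : ∀ c : ℝ, 0 < c → ∃ K : ℝ, 0 ≤ K ∧ ∀ s ∈ Icc 0 T, ∀ i j,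
      ∫⁻ x, ENNReal.ofReal (Real.exp (c * |Db s x i j|)) ≤ ENNReal.ofReal K := by
    intro c hc
    refine ⟨(⨆ t ∈ Icc 0 T, ∫⁻ x, ENNReal.ofReal (Real.exp (c * frobNorm (Db t x)))).toReal,
      ENNReal.toReal_nonneg, fun s hs i j => ?_⟩
    rw [ENNReal.ofReal_toReal (hexp c hc).ne]
    refine le_trans (lintegral_mono fun x => ENNReal.ofReal_le_ofReal (Real.exp_le_exp.2 ?_))
      (le_iSup₂ (f := fun t (_ : t ∈ Icc 0 T) =>
        ∫⁻ x, ENNReal.ofReal (Real.exp (c * frobNorm (Db t x)))) s hs)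
    exact mul_le_mul_of_nonneg_left (abs_le_frobNorm _ i j) hc.le
  obtain ⟨K, hK0, hK⟩ := hExp 1 one_pos
  have hK1 : ∀ s ∈ Icc 0 T, ∀ i j, ∫ x, |Db s x i j| ≤ K := by
    intro s hs i j
    have i1 := (hDb s hs i j).integrable_deriv.abs
    rw [← ENNReal.ofReal_le_ofReal_iff hK0, ofReal_integral_eq_lintegral_ofReal i1
      (ae_of_all _ fun _ => abs_nonneg _)]
    refine (lintegral_mono fun x => ENNReal.ofReal_le_ofReal ?_).trans (hK s hs i j)
    rw [one_mul]
    linarith [Real.add_one_le_exp |Db s x i j|]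
  have hγ : ∀ i j, ∃ γ : ℝ → Torus d → ℝ, Measurable (Function.uncurry γ) ∧
      ∀ᵐ s ∂μ, γ s =ᵐ[volume] fun x => Db s x i j := fun i j => by
    refine exists_measurable_partial (j := j) (K := K) (hβm i) ?_ ?_
    · filter_upwards [hβ, hmem] with s hs hs2
      exact (hDb s hs2 i j).congr (hs i).symm (ae_eq_refl _)
    · filter_upwards [hmem] with s hs
      exact hK1 s hs i j
  choose γ hγm hγ using hγ
  obtain ⟨L, hL⟩ := hdiv
  have hgood : ∀ᵐ s ∂μ, s ∈ Icc 0 T ∧ (∀ i, β i s =ᵐ[volume] fun x => b s x i) ∧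
      (∀ i j, γ i j s =ᵐ[volume] fun x => Db s x i j) ∧ ∀ᵐ x, |(Db s x).trace| ≤ L := by
    filter_upwards [hmem, hβ, ae_all_iff.2 fun i => ae_all_iff.2 fun j => hγ i j, hL]
      with s h1 h2 h3 h4 using ⟨h1, h2, h3, h4⟩
  obtain ⟨E, hE, hEm, hEμ⟩ := exists_measurable_superset_of_null (mem_ae_iff.1 hgood)
  have hEg : ∀ s, s ∉ E → s ∈ Icc 0 T ∧ (∀ i, β i s =ᵐ[volume] fun x => b s x i) ∧
      (∀ i j, γ i j s =ᵐ[volume] fun x => Db s x i j) ∧ ∀ᵐ x, |(Db s x).trace| ≤ L := fun s hs => by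
    by_contra h
    exact hs (hE h)
  classical
  have key : ∀ f : ℝ → Torus d → ℝ, Measurable (Function.uncurry f) →
      Measurable (Function.uncurry fun s x => if s ∈ E then 0 else f s x) := fun f hf =>
    Measurable.ite (hEm.preimage measurable_fst) measurable_const hf
  refine ⟨fun i s x => if s ∈ E then 0 else β i s x, fun i j s x => if s ∈ E then 0 else γ i j s x,
    ⟨fun i => key _ (hβm i), fun i j => key _ (hγm i j), fun i => ?_, fun s i j => ?_,
      fun c hc => ?_, ⟨max L 0, le_max_right _ _, fun s => ?_⟩⟩, ?_⟩
  · have i1 : IntegrableOn (Function.uncurry (β i)) (Icc 0 T ×ˢ univ) (volume.prod volume) := by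
      rw [IntegrableOn, ← Measure.prod_restrict, Measure.restrict_univ]; exact hβi i
    have hS : MeasurableSet ((Icc 0 T : Set ℝ) ×ˢ (univ : Set (Torus d))) :=
      measurableSet_Icc.prod MeasurableSet.univ
    refine (i1.integrable_indicator hS).mono (key _ (hβm i)).aestronglyMeasurable
      (ae_of_all _ fun p => ?_)
    obtain ⟨s, x⟩ := p
    by_cases hs : s ∈ E
    · simp [hs]
    · have : (s, x) ∈ (Icc 0 T : Set ℝ) ×ˢ (univ : Set (Torus d)) := ⟨(hEg s hs).1, mem_univ _⟩
      simp [hs, indicator_of_mem this]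
  · by_cases hs : s ∈ E
    · simpa [hs] using IsWeakPartial.zero j
    · simp only [hs, if_false]
      obtain ⟨h1, h2, h3, h4⟩ := hEg s hs
      exact (hDb s h1 i j).congr (h2 i).symm (h3 i j).symm
  · obtain ⟨K, hK0, hK⟩ := hExp c hc
    -- At the discarded times the exponential is `1`.
    refine ⟨max K 1, le_max_of_le_left hK0, fun s i j => ?_⟩
    by_cases hs : s ∈ E
    · simp [hs]
    · simp only [hs, if_false]
      obtain ⟨h1, h2, h3, h4⟩ := hEg s hs
      refine le_trans (le_of_eq (lintegral_congr_ae ?_)) ((hK s h1 i j).trans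
        (ENNReal.ofReal_le_ofReal (le_max_left _ _)))
      filter_upwards [h3 i j] with x hx
      rw [hx]
  · by_cases hs : s ∈ E
    · simp [hs]
    · simp only [hs, if_false]
      obtain ⟨h1, h2, h3, h4⟩ := hEg s hs
      filter_upwards [ae_all_iff.2 fun i => h3 i i, h4] with x hx1 hx2
      simp only [hx1]
      exact hx2.trans (le_max_left _ _)
  · have : ∀ᵐ s ∂μ, s ∉ E := measure_eq_zero_iff_ae_notMem.1 hEμ
    filter_upwards [this] with s hs
    obtain ⟨h1, h2, h3, h4⟩ := hEg s hs
    simp only [hs, if_false]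
    exact ⟨h2, h3⟩

/-! ### Strong compactness by convex combinations. -/

section ConvexCompactness

variable {Y : Type*} [MeasurableSpace Y] {μ : Measure Y} {q C : ℝ}

/-- The functions `f` with `∫ |f|^q ≤ C`. -/
def powBall (μ : Measure Y) (q C : ℝ) : Set (Y → ℝ) :=
  {f | AEStronglyMeasurable f μ ∧ Integrable (fun x => |f x| ^ q) μ ∧ ∫ x, |f x| ^ q ∂μ ≤ C}

theorem convex_powBall (hq : 1 ≤ q) : Convex ℝ (powBall μ q C) := by
  rintro f ⟨f1, f2, f3⟩ g ⟨g1, g2, g3⟩ a b ha hb hab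
  have hm : AEStronglyMeasurable (a • f + b • g) μ := (f1.const_smul a).add (g1.const_smul b)
  have hle : ∀ x, |(a • f + b • g) x| ^ q ≤ a * |f x| ^ q + b * |g x| ^ q := fun x =>
    (convexCost_rpow hq).convexOn.2 (mem_univ (f x)) (mem_univ (g x)) ha hb hab
  have hi : Integrable (fun x => a * |f x| ^ q + b * |g x| ^ q) μ :=
    (f2.const_mul a).add (g2.const_mul b)
  have hi2 : Integrable (fun x => |(a • f + b • g) x| ^ q) μ := by
    refine hi.mono' ?_ (ae_of_all _ fun x => ?_)
    · exact (convexCost_rpow hq).continuous.comp_aestronglyMeasurable hm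
    · rw [Real.norm_eq_abs, abs_of_nonneg (Real.rpow_nonneg (abs_nonneg _) _)]; exact hle x
  refine ⟨hm, hi2, (integral_mono hi2 hi hle).trans ?_⟩
  rw [integral_add (f2.const_mul a) (g2.const_mul b), integral_const_mul, integral_const_mul]
  calc _ ≤ a * C + b * C := add_le_add (mul_le_mul_of_nonneg_left f3 ha)
        (mul_le_mul_of_nonneg_left g3 hb)
    _ = C := by rw [← add_mul, hab, one_mul]

theorem abs_le_one_add_rpow (hq : 1 ≤ q) (x : ℝ) : |x| ≤ 1 + |x| ^ q := by
  rcases le_total |x| 1 with h | h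
  · linarith [Real.rpow_nonneg (abs_nonneg x) q]
  · linarith [Real.self_le_rpow_of_one_le h hq]

theorem integrable_of_mem_powBall [IsFiniteMeasure μ] (hq : 1 ≤ q) {f : Y → ℝ}
    (hf : f ∈ powBall μ q C) : Integrable f μ :=
  ((integrable_const (1 : ℝ)).add hf.2.1).mono' hf.1
    (ae_of_all _ fun x => abs_le_one_add_rpow hq (f x))

theorem mem_powBall_of_lintegral {f : Y → ℝ} (hf : AEStronglyMeasurable f μ) (hq : 1 ≤ q)
    (hC : 0 ≤ C) (h : ∫⁻ x, ENNReal.ofReal (|f x| ^ q) ∂μ ≤ ENNReal.ofReal C) :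
    f ∈ powBall μ q C := by
  have hi : Integrable (fun x => |f x| ^ q) μ := by
    refine ⟨(convexCost_rpow hq).continuous.comp_aestronglyMeasurable hf, ?_⟩
    rw [hasFiniteIntegral_iff_ofReal (ae_of_all _ fun x => Real.rpow_nonneg (abs_nonneg _) _)]
    exact h.trans_lt ENNReal.ofReal_lt_top
  refine ⟨hf, hi, ?_⟩
  rwa [← ENNReal.ofReal_le_ofReal_iff hC, ofReal_integral_eq_lintegral_ofReal hi
    (ae_of_all _ fun x => Real.rpow_nonneg (abs_nonneg _) _)]

theorem lintegral_le_of_mem_powBall {f : Y → ℝ} (hf : f ∈ powBall μ q C) :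
    ∫⁻ x, ENNReal.ofReal (|f x| ^ q) ∂μ ≤ ENNReal.ofReal C := by
  rw [← ofReal_integral_eq_lintegral_ofReal hf.2.1
    (ae_of_all _ fun x => Real.rpow_nonneg (abs_nonneg _) _)]
  exact ENNReal.ofReal_le_ofReal hf.2.2

theorem nonneg_of_mem_powBall {f : Y → ℝ} (hf : f ∈ powBall μ q C) : 0 ≤ C :=
  (integral_nonneg fun _ => Real.rpow_nonneg (abs_nonneg _) _).trans hf.2.2

theorem mem_powBall_of_tendsto_ae (hq : 1 ≤ q) {f : ℕ → Y → ℝ} {g : Y → ℝ}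
    (hf : ∀ n, f n ∈ powBall μ q C) (h : ∀ᵐ x ∂μ, Tendsto (fun n => f n x) atTop (𝓝 (g x))) :
    g ∈ powBall μ q C := by
  refine mem_powBall_of_lintegral (aestronglyMeasurable_of_tendsto_ae atTop (fun n => (hf n).1) h) hq
    (nonneg_of_mem_powBall (hf 0)) ?_
  have h1 : ∫⁻ x, ENNReal.ofReal (|g x| ^ q) ∂μ =
      ∫⁻ x, liminf (fun n => ENNReal.ofReal (|f n x| ^ q)) atTop ∂μ := by
    refine lintegral_congr_ae ?_
    filter_upwards [h] with x hx
    refine (Tendsto.liminf_eq ?_).symm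
    exact (ENNReal.continuous_ofReal.tendsto _).comp
      (((convexCost_rpow hq).continuous.tendsto _).comp hx)
  rw [h1]
  refine (lintegral_liminf_le' fun n => (hf n).2.1.aestronglyMeasurable.aemeasurable.ennreal_ofReal).trans ?_
  refine liminf_le_of_frequently_le' (Frequently.of_forall fun n => ?_)
  exact lintegral_le_of_mem_powBall (hf n)

theorem mem_powBall_of_tendsto [IsFiniteMeasure μ] (hq : 1 ≤ q) {f : ℕ → Y → ℝ} {g : Y → ℝ}
    (hf : ∀ n, f n ∈ powBall μ q C) (hg : Integrable g μ)
    (h : Tendsto (fun n => ∫ x, |f n x - g x| ∂μ) atTop (𝓝 0)) : g ∈ powBall μ q C := by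
  obtain ⟨ns, -, hae⟩ := exists_subseq_tendsto_ae
    (fun n => integrable_of_mem_powBall hq (hf n)) hg h
  exact mem_powBall_of_tendsto_ae hq (fun n => hf (ns n)) hae

theorem sqrt_midpoint_le (x y : ℝ) :
    √(4 + (x + y) ^ 2) ≤ √(1 + x ^ 2) + √(1 + y ^ 2) := by
  have ha := Real.sq_sqrt (by positivity : 0 ≤ 1 + x ^ 2)
  have hb := Real.sq_sqrt (by positivity : 0 ≤ 1 + y ^ 2)
  have ha0 := Real.sqrt_nonneg (1 + x ^ 2)
  have hb0 := Real.sqrt_nonneg (1 + y ^ 2)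
  set a := √(1 + x ^ 2)
  set b := √(1 + y ^ 2)
  refine Real.sqrt_le_iff.2 ⟨by positivity, ?_⟩
  have : 1 + x * y ≤ a * b := by
    refine le_of_sq_le_sq ?_ (by positivity)
    rw [mul_pow, ha, hb]; nlinarith [sq_nonneg (x - y)]
  nlinarith

/-- Quantitative strict convexity of `√(1 + x²)`. With `a`, `b`, `c` the three roots, `(a + b - c)(a
+ b + c) = 2 (a b - 1 - x y)` and `(a b - 1 - x y)(a b + 1 + x y) = (x - y)²`. -/
theorem sq_sub_le_sqrt_defect {x y S : ℝ} (hx : √(1 + x ^ 2) ≤ S) (hy : √(1 + y ^ 2) ≤ S) :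
    (x - y) ^ 2 ≤ 4 * S ^ 3 * (√(1 + x ^ 2) + √(1 + y ^ 2) - √(4 + (x + y) ^ 2)) := by
  have hc1 := sqrt_midpoint_le x y
  have ha := Real.sq_sqrt (by positivity : 0 ≤ 1 + x ^ 2)
  have hb := Real.sq_sqrt (by positivity : 0 ≤ 1 + y ^ 2)
  have hc := Real.sq_sqrt (by positivity : 0 ≤ 4 + (x + y) ^ 2)
  have ha0 := Real.sqrt_nonneg (1 + x ^ 2)
  have hb0 := Real.sqrt_nonneg (1 + y ^ 2)
  have hc0 := Real.sqrt_nonneg (4 + (x + y) ^ 2)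
  set a := √(1 + x ^ 2)
  set b := √(1 + y ^ 2)
  set c := √(4 + (x + y) ^ 2)
  have h1 : 1 + x * y ≤ a * b := by
    refine le_of_sq_le_sq ?_ (by positivity)
    rw [mul_pow, ha, hb]; nlinarith [sq_nonneg (x - y)]
  have hab : a * b ≤ S ^ 2 := by rw [sq]; exact mul_le_mul hx hy hb0 (ha0.trans hx)
  have e1 : (a * b - (1 + x * y)) * (a * b + (1 + x * y)) = (x - y) ^ 2 := by
    have : (a * b) ^ 2 = (1 + x ^ 2) * (1 + y ^ 2) := by rw [mul_pow, ha, hb]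
    linear_combination this
  have e2 : (a + b - c) * (a + b + c) = 2 * (a * b - (1 + x * y)) := by
    linear_combination ha + hb - hc
  have h2 : (x - y) ^ 2 ≤ (a * b - (1 + x * y)) * (2 * S ^ 2) := by
    rw [← e1]; exact mul_le_mul_of_nonneg_left (by linarith) (by linarith)
  have h3 : (a + b - c) * (a + b + c) ≤ (a + b - c) * (4 * S) :=
    mul_le_mul_of_nonneg_left (by linarith) (by linarith)
  nlinarith [mul_le_mul_of_nonneg_left h3 (sq_nonneg S)]

/-- On bounded values the convexity defect controls the distance; if one value is large, the
superlinear power absorbs it. This is where `q > 1` matters. -/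
theorem exists_abs_sub_le_sqrt_defect (hq : 1 < q) {ε : ℝ} (hε : 0 < ε) :
    ∃ K, 0 ≤ K ∧ ∀ x y : ℝ, |x - y| ≤ ε * (1 + |x| ^ q + |y| ^ q) +
      K * (√(1 + x ^ 2) + √(1 + y ^ 2) - √(4 + (x + y) ^ 2)) := by
  have hlim : Tendsto (fun R : ℝ => R ^ (q - 1)) atTop atTop := tendsto_rpow_atTop (by linarith)
  obtain ⟨R, hR1, hR⟩ := ((eventually_ge_atTop 1).and (hlim.eventually_ge_atTop (2 / ε))).exists
  have hR0 : (0 : ℝ) < R := by linarith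
  refine ⟨4 * (1 + R) ^ 3 / ε, by positivity, fun x y => ?_⟩
  have hdef := sub_nonneg.2 (sqrt_midpoint_le x y)
  have hxq := Real.rpow_nonneg (abs_nonneg x) q
  have hyq := Real.rpow_nonneg (abs_nonneg y) q
  have hbig : ∀ x y : ℝ, R < |x| → |y| ≤ |x| → |x - y| ≤ ε * |x| ^ q := by
    intro x y hx hxy
    have h1 : 2 / ε ≤ |x| ^ (q - 1) :=
      hR.trans (Real.rpow_le_rpow hR0.le hx.le (by linarith))
    have h2 : |x| ^ q = |x| ^ (q - 1) * |x| := by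
      rw [← Real.rpow_add_one (by linarith), sub_add_cancel]
    rw [h2, ← mul_assoc]
    have h3 : 2 ≤ ε * |x| ^ (q - 1) := by rwa [div_le_iff₀' hε] at h1
    calc |x - y| ≤ |x| + |y| := abs_sub _ _
      _ ≤ 2 * |x| := by linarith
      _ ≤ _ := mul_le_mul_of_nonneg_right h3 (abs_nonneg _)
  by_cases h : |x| ≤ R ∧ |y| ≤ R
  · have hs : ∀ z : ℝ, |z| ≤ R → √(1 + z ^ 2) ≤ 1 + R := fun z hz => by
      refine Real.sqrt_le_iff.2 ⟨by positivity, ?_⟩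
      nlinarith [sq_abs z, abs_nonneg z]
    have key := sq_sub_le_sqrt_defect (hs x h.1) (hs y h.2)
    have h1 : |x - y| ≤ ε + (x - y) ^ 2 / ε := by
      rw [← sub_nonneg]
      have : ε + (x - y) ^ 2 / ε - |x - y| = ((|x - y| - ε / 2) ^ 2 + 3 / 4 * ε ^ 2) / ε := by
        rw [← sq_abs (x - y)]; field_simp; ring
      rw [this]; positivity
    have h2 := div_le_div_of_nonneg_right key hε.le
    rw [mul_div_right_comm] at h2
    nlinarith [mul_nonneg hε.le hxq, mul_nonneg hε.le hyq]
  · have h0 : 0 ≤ 4 * (1 + R) ^ 3 / ε * (√(1 + x ^ 2) + √(1 + y ^ 2) - √(4 + (x + y) ^ 2)) :=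
      mul_nonneg (by positivity) hdef
    rcases le_total |y| |x| with hxy | hxy
    · have hx : R < |x| := by
        by_contra! hx; exact h ⟨hx, hxy.trans hx⟩
      nlinarith [hbig x y hx hxy, mul_nonneg hε.le hyq]
    · have hx : R < |y| := by
        by_contra! hx; exact h ⟨hxy.trans hx, hx⟩
      have := hbig y x hx hxy
      rw [abs_sub_comm] at this
      nlinarith [mul_nonneg hε.le hxq]

theorem integrable_sqrt_one_add_sq [IsFiniteMeasure μ] {f : Y → ℝ} (hf : Integrable f μ) (c : ℝ)
    (hc : 0 ≤ c) : Integrable (fun x => √(c ^ 2 + f x ^ 2)) μ := by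
  refine ((integrable_const c).add hf.abs).mono' ?_ (ae_of_all _ fun x => ?_)
  · exact (by fun_prop : Continuous fun t : ℝ => √(c ^ 2 + t ^ 2)).comp_aestronglyMeasurable
      hf.aestronglyMeasurable
  · rw [Real.norm_eq_abs, abs_of_nonneg (Real.sqrt_nonneg _)]
    refine Real.sqrt_le_iff.2 ⟨add_nonneg hc (abs_nonneg _), ?_⟩
    simp only [Pi.add_apply]
    nlinarith [sq_abs (f x), mul_nonneg hc (abs_nonneg (f x))]

/-- A weak form of Komlós' theorem: tail convex combinations of a sequence bounded in `L^q`, `q > 1`,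
converge in `L^1`. -/
theorem exists_convex_tendsto [IsFiniteMeasure μ] (hq : 1 < q)
    {F : ℕ → Y → ℝ} (hF : ∀ m, F m ∈ powBall μ q C) :
    ∃ (H : ℕ → Y → ℝ) (g : Y → ℝ), (∀ n, H n ∈ convexHull ℝ (F '' Ici n)) ∧
      Measurable g ∧ g ∈ powBall μ q C ∧
      Tendsto (fun n => ∫ x, |H n x - g x| ∂μ) atTop (𝓝 0) := by
  have hB : ∀ n, convexHull ℝ (F '' Ici n) ⊆ powBall μ q C := fun n =>
    convexHull_min (by rintro _ ⟨m, -, rfl⟩; exact hF m) (convex_powBall hq.le)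
  -- The infima of this strictly convex functional over the tail hulls increase to a finite limit.
  -- Midpoints of two near-minimisers stay in the larger hull, so their convexity defect tends to
  -- zero, and near-minimisers form a Cauchy sequence in `L^1`.
  set J : (Y → ℝ) → ℝ := fun f => ∫ x, √(1 ^ 2 + f x ^ 2) ∂μ with hJ
  have hJ0 : ∀ f, 0 ≤ J f := fun f => integral_nonneg fun _ => Real.sqrt_nonneg _
  set j : ℕ → ℝ := fun n => sInf (J '' convexHull ℝ (F '' Ici n)) with hj
  have hbdd : ∀ n, BddBelow (J '' convexHull ℝ (F '' Ici n)) := fun n =>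
    ⟨0, by rintro _ ⟨f, -, rfl⟩; exact hJ0 f⟩
  have hFn : ∀ n, F n ∈ convexHull ℝ (F '' Ici n) := fun n =>
    subset_convexHull ℝ _ ⟨n, mem_Ici.2 le_rfl, rfl⟩
  have hmono' : ∀ n m, n ≤ m → convexHull ℝ (F '' Ici m) ⊆ convexHull ℝ (F '' Ici n) :=
    fun n m h => convexHull_mono (image_mono (Ici_subset_Ici.2 h))
  have hmono : Monotone j := fun n m h =>
    csInf_le_csInf (hbdd n) ⟨_, mem_image_of_mem J (hFn m)⟩ (image_mono (hmono' n m h))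
  have hup : BddAbove (range j) := by
    refine ⟨(∫ _x, (2 : ℝ) ∂μ) + C, ?_⟩
    rintro _ ⟨n, rfl⟩
    refine (csInf_le (hbdd n) (mem_image_of_mem J (hFn n))).trans ?_
    have h1 := hF n
    refine le_trans ?_ (add_le_add_right h1.2.2 _)
    rw [← integral_add (integrable_const _) h1.2.1]
    refine integral_mono (integrable_sqrt_one_add_sq (integrable_of_mem_powBall hq.le h1) 1
      zero_le_one) ((integrable_const _).add h1.2.1) fun x => ?_
    refine Real.sqrt_le_iff.2 ⟨by positivity, ?_⟩
    have := abs_le_one_add_rpow hq.le (F n x)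
    nlinarith [sq_abs (F n x), abs_nonneg (F n x), Real.rpow_nonneg (abs_nonneg (F n x)) q]
  have hjl := tendsto_atTop_ciSup hmono hup
  have hex : ∀ n, ∃ f ∈ convexHull ℝ (F '' Ici n), J f < j n + 1 / ((n : ℝ) + 1) := by
    intro n
    obtain ⟨_, ⟨f, hf, rfl⟩, hlt⟩ := Real.lt_sInf_add_pos
      (⟨_, mem_image_of_mem J (hFn n)⟩ : (J '' convexHull ℝ (F '' Ici n)).Nonempty)
      (Nat.one_div_pos_of_nat (α := ℝ) (n := n))
    exact ⟨f, hf, hlt⟩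
  choose H hH hHJ using hex
  have hHi : ∀ n, Integrable (H n) μ := fun n => integrable_of_mem_powBall hq.le (hB n (hH n))
  have hC0 : 0 ≤ C := nonneg_of_mem_powBall (hF 0)
  set δ : ℕ → ℕ → ℝ := fun n m => ∫ x, (√(1 + H n x ^ 2) + √(1 + H m x ^ 2) -
    √(4 + (H n x + H m x) ^ 2)) ∂μ with hδ
  have idef : ∀ n m, Integrable (fun x => √(1 + H n x ^ 2) + √(1 + H m x ^ 2) -
      √(4 + (H n x + H m x) ^ 2)) μ := by
    intro n m
    have a1 := integrable_sqrt_one_add_sq (hHi n) 1 zero_le_one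
    have a2 := integrable_sqrt_one_add_sq (hHi m) 1 zero_le_one
    have a3 := integrable_sqrt_one_add_sq ((hHi n).add (hHi m)) 2 zero_le_two
    simp only [one_pow] at a1 a2
    norm_num at a3
    exact integrable_sub_fun (integrable_add_fun a1 a2) a3
  have hδeq : ∀ n m, δ n m = J (H n) + J (H m) - 2 * J ((1/2 : ℝ) • H n + (1/2 : ℝ) • H m) := by
    intro n m
    simp only [hδ, hJ]
    have a1 := integrable_sqrt_one_add_sq (hHi n) 1 zero_le_one
    have a2 := integrable_sqrt_one_add_sq (hHi m) 1 zero_le_one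
    have a3 := integrable_sqrt_one_add_sq ((hHi n).add (hHi m)) 2 zero_le_two
    simp only [one_pow] at a1 a2
    norm_num at a3
    rw [integral_sub (integrable_add_fun a1 a2) a3, integral_add a1 a2, ← integral_const_mul]
    simp only [one_pow]
    congr 1
    refine integral_congr_ae (ae_of_all _ fun x => ?_)
    simp only [Pi.add_apply, Pi.smul_apply, smul_eq_mul]
    rw [show (4 : ℝ) + (H n x + H m x) ^ 2 =
      2 ^ 2 * (1 + (1 / 2 * H n x + 1 / 2 * H m x) ^ 2) by ring,
      Real.sqrt_mul (by positivity), Real.sqrt_sq zero_le_two]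
  have hδle : ∀ n m, n ≤ m → δ n m ≤ (j m - j n) + 2 * (1 / ((n : ℝ) + 1)) := by
    intro n m h
    have h1 : j n ≤ J ((1/2 : ℝ) • H n + (1/2 : ℝ) • H m) := by
      refine csInf_le (hbdd n) (mem_image_of_mem J ?_)
      exact (convex_convexHull ℝ _) (hH n) (hmono' n m h (hH m)) (by norm_num) (by norm_num)
        (by norm_num)
    have h2 := hHJ n
    have h3 := hHJ m
    have h4 : 1 / ((m : ℝ) + 1) ≤ 1 / ((n : ℝ) + 1) := Nat.one_div_le_one_div h
    rw [hδeq]; linarith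
  have hcau : Tendsto (fun p : ℕ × ℕ => ∫ x, |H p.1 x - H p.2 x| ∂μ) atTop (𝓝 0) := by
    rw [Metric.tendsto_atTop']
    intro ε hε
    set B := μ.real univ + 2 * C with hBdef
    have hB0 : 0 ≤ B := add_nonneg measureReal_nonneg (mul_nonneg zero_le_two hC0)
    obtain ⟨K, hK0, hK⟩ := exists_abs_sub_le_sqrt_defect hq
      (show 0 < ε / (2 * (B + 1)) by positivity)
    have hle : ∀ n m, ∫ x, |H n x - H m x| ∂μ ≤ ε / 2 + K * δ n m := by
      intro n m
      have m1 := hB n (hH n)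
      have m2 := hB m (hH m)
      have i1 : Integrable (fun x => 1 + |H n x| ^ q + |H m x| ^ q) μ :=
        ((integrable_const _).add m1.2.1).add m2.2.1
      have h1 : ∫ x, |H n x - H m x| ∂μ ≤ ∫ x, (ε / (2 * (B + 1)) * (1 + |H n x| ^ q +
          |H m x| ^ q) + K * (√(1 + H n x ^ 2) + √(1 + H m x ^ 2) -
          √(4 + (H n x + H m x) ^ 2))) ∂μ :=
        integral_mono (integrable_sub_fun (hHi n) (hHi m)).abs
          ((i1.const_mul _).add ((idef n m).const_mul _)) fun x => hK _ _
      refine h1.trans ?_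
      rw [integral_add (i1.const_mul _) ((idef n m).const_mul _), integral_const_mul,
        integral_const_mul]
      refine add_le_add ?_ le_rfl
      · rw [integral_add (integrable_add_fun (integrable_const _) m1.2.1) m2.2.1,
          integral_add (integrable_const _) m1.2.1]
        have h3 : (∫ _x, (1 : ℝ) ∂μ) + (∫ x, |H n x| ^ q ∂μ) + ∫ x, |H m x| ^ q ∂μ ≤ B := by
          rw [integral_const, smul_eq_mul, mul_one, hBdef]
          linarith [m1.2.2, m2.2.2]
        calc _ ≤ ε / (2 * (B + 1)) * (B + 1) :=
              mul_le_mul_of_nonneg_left (h3.trans (by linarith)) (by positivity)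
          _ = ε / 2 := by field_simp
    have hη : 0 < ε / (2 * (K + 1)) / 3 := by positivity
    obtain ⟨N1, hN1⟩ := Metric.cauchySeq_iff.1 hjl.cauchySeq _ hη
    obtain ⟨N2, hN2⟩ := eventually_atTop.1 ((tendsto_one_div_add_atTop_nhds_zero_nat
      (𝕜 := ℝ)).eventually (Iio_mem_nhds hη))
    have hmain : ∀ n m, max N1 N2 ≤ n → n ≤ m → ∫ x, |H n x - H m x| ∂μ < ε := by
      intro n m hn hm
      have a1 := hN1 m ((le_max_left _ _).trans (hn.trans hm)) n ((le_max_left _ _).trans hn)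
      rw [Real.dist_eq] at a1
      have a2 : 1 / ((n : ℝ) + 1) < ε / (2 * (K + 1)) / 3 := hN2 n ((le_max_right _ _).trans hn)
      have a3 : δ n m ≤ ε / (2 * (K + 1)) :=
        (hδle n m hm).trans (by linarith [(abs_lt.1 a1).2])
      have a4 : K * δ n m ≤ K * (ε / (2 * (K + 1))) := mul_le_mul_of_nonneg_left a3 hK0
      have a5 : K * (ε / (2 * (K + 1))) < ε / 2 := by
        rw [← sub_pos]
        have : ε / 2 - K * (ε / (2 * (K + 1))) = ε / (2 * (K + 1)) := by field_simp; ring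
        rw [this]; positivity
      linarith [hle n m]
    refine ⟨(max N1 N2, max N1 N2), fun p hp => ?_⟩
    have hp1 : max N1 N2 ≤ p.1 := hp.le.1
    have hp2 : max N1 N2 ≤ p.2 := hp.le.2
    rw [Real.dist_eq, sub_zero, abs_of_nonneg (integral_nonneg fun _ => abs_nonneg _)]
    rcases le_total p.1 p.2 with h | h
    · exact hmain _ _ hp1 h
    · have := hmain _ _ hp2 h
      simpa only [abs_sub_comm (H p.2 _) (H p.1 _)] using this
  obtain ⟨g, hgm, hgi, hg⟩ := exists_tendsto_integral_of_cauchy hHi hcau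
  exact ⟨H, g, hH, hgm, mem_powBall_of_tendsto hq.le (fun n => hB n (hH n)) hgi hg, hg⟩

end ConvexCompactness

/-! ### One step of the Lax–Friedrichs scheme. -/

/-- One step of the Lax–Friedrichs scheme with velocities `c` and grid vectors `e`. -/
noncomputable def lfStep (c : Fin d → Torus d → ℝ) (e : Fin d → Torus d) (u : Torus d → ℝ)
    (x : Torus d) : ℝ :=
  (2 * (d : ℝ))⁻¹ * ∑ i, ((1 - c i x) * u (x + e i) + (1 + c i x) * u (x - e i))

section LaxFriedrichs

variable {c : Fin d → Torus d → ℝ} {e : Fin d → Torus d} {u : Torus d → ℝ}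

/-- The weights at each point sum to one. -/
theorem lfStep_linear (hd : 0 < d) (a b : ℝ) (x : Torus d) :
    lfStep c e (fun y => a * u y + b) x = a * lfStep c e u x + b := by
  have hd' : (0 : ℝ) < d := by exact_mod_cast hd
  have : ∀ i, ((1 - c i x) * (a * u (x + e i) + b) + (1 + c i x) * (a * u (x - e i) + b)) =
    a * ((1 - c i x) * u (x + e i) + (1 + c i x) * u (x - e i)) + 2 * b := fun i => by ring
  simp only [lfStep, this, Finset.sum_add_distrib, ← Finset.mul_sum]
  simp only [Finset.sum_const, Finset.card_univ, Fintype.card_fin, nsmul_eq_mul]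
  field_simp

theorem lfStep_mono {x : Torus d} (hc : ∀ i, |c i x| ≤ 1) {v : Torus d → ℝ} (h : ∀ y, u y ≤ v y) :
    lfStep c e u x ≤ lfStep c e v x := by
  refine mul_le_mul_of_nonneg_left (Finset.sum_le_sum fun i _ => ?_) (by positivity)
  have := abs_le.1 (hc i)
  exact add_le_add (mul_le_mul_of_nonneg_left (h _) (by linarith))
    (mul_le_mul_of_nonneg_left (h _) (by linarith))

theorem lfStep_nonneg {x : Torus d} (hc : ∀ i, |c i x| ≤ 1) (h : ∀ y, 0 ≤ u y) :
    0 ≤ lfStep c e u x := by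
  have := lfStep_mono (e := e) (u := fun _ => 0) hc h
  simpa [lfStep] using this

theorem abs_lfStep_le (hd : 0 < d) {x : Torus d} (hc : ∀ i, |c i x| ≤ 1) {M : ℝ}
    (h : ∀ y, |u y| ≤ M) : |lfStep c e u x| ≤ M := by
  have hM : ∀ b : ℝ, lfStep c e (fun _ => b) x = b := fun b => by
    simpa using lfStep_linear (c := c) (e := e) (u := fun _ => 0) hd 0 b x
  rw [abs_le]
  constructor
  · have := lfStep_mono (e := e) (u := fun _ => -M) hc fun y => (abs_le.1 (h y)).1
    rwa [hM] at this
  · have := lfStep_mono (e := e) (v := fun _ => M) hc fun y => (abs_le.1 (h y)).2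
    rwa [hM] at this

theorem measurable_lfStep (hc : ∀ i, Measurable (c i)) (hu : Measurable u) :
    Measurable (lfStep c e u) := by
  refine measurable_const.mul (Finset.measurable_sum _ fun i _ => ?_)
  exact ((measurable_const.sub (hc i)).mul (hu.comp (measurable_id.add_const _))).add
    ((measurable_const.add (hc i)).mul (hu.comp (measurable_id.sub_const _)))

/-- For velocities of modulus at most one the step is a convex combination of `2 d` values, so
Jensen's inequality holds pointwise. -/
theorem ConvexCost.comp_lfStep_le {Ψ : ℝ → ℝ} (hΨ : ConvexCost Ψ) (hd : 0 < d) {x : Torus d}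
    (hc : ∀ i, |c i x| ≤ 1) : Ψ (lfStep c e u x) ≤ lfStep c e (fun y => Ψ (u y)) x := by
  have hd' : (0 : ℝ) < d := by exact_mod_cast hd
  have key := hΨ.convexOn.map_sum_le (t := (Finset.univ : Finset (Fin d ⊕ Fin d)))
    (w := Sum.elim (fun i => (2 * (d : ℝ))⁻¹ * (1 - c i x)) fun i => (2 * (d : ℝ))⁻¹ * (1 + c i x))
    (p := Sum.elim (fun i => u (x + e i)) fun i => u (x - e i)) ?_ ?_ (fun _ _ => mem_univ _)
  · simp only [Fintype.sum_sum_type, Sum.elim_inl, Sum.elim_inr, smul_eq_mul] at key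
    simp only [lfStep, Finset.sum_add_distrib, mul_add, Finset.mul_sum, ← mul_assoc] at key ⊢
    exact key
  · rintro (i | i) - <;> have := abs_le.1 (hc i)
    · exact mul_nonneg (by positivity) (by linarith)
    · exact mul_nonneg (by positivity) (by linarith)
  · simp only [Fintype.sum_sum_type, Sum.elim_inl, Sum.elim_inr, ← Finset.mul_sum]
    rw [← mul_add, ← Finset.sum_add_distrib]
    have : ∀ i, 1 - c i x + (1 + c i x) = 2 := fun i => by ring
    simp only [this, Finset.sum_const, Finset.card_univ, Fintype.card_fin, nsmul_eq_mul]
    field_simp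

theorem integrable_mul_bdd {Y : Type*} [MeasurableSpace Y] {μ : Measure Y} {V f : Y → ℝ} {M : ℝ}
    (hf : Integrable f μ) (hV : AEStronglyMeasurable V μ) (hM : ∀ x, |V x| ≤ M) :
    Integrable (fun x => f x * V x) μ := hf.mul_bdd (c := M) hV (ae_of_all _ hM)

/-- Summation by parts for the Lax–Friedrichs scheme. -/
theorem integral_lfStep_mul (hc : ∀ i, Measurable (c i)) (hc1 : ∀ i x, |c i x| ≤ 1)
    (hu : Integrable u) {φ : Torus d → ℝ} (hφ : Measurable φ) {M : ℝ} (hM : ∀ x, |φ x| ≤ M) :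
    ∫ x, lfStep c e u x * φ x = ∫ x, u x * ((2 * (d : ℝ))⁻¹ *
      ∑ i, ((1 - c i (x - e i)) * φ (x - e i) + (1 + c i (x + e i)) * φ (x + e i))) := by
  have hM0 : 0 ≤ M := (abs_nonneg _).trans (hM 0)
  have b1 : ∀ i x, |(1 - c i x) * φ x| ≤ 2 * M := fun i x => by
    rw [abs_mul]
    refine mul_le_mul ?_ (hM x) (abs_nonneg _) zero_le_two
    have := abs_le.1 (hc1 i x); rw [abs_le]; constructor <;> linarith
  have b2 : ∀ i x, |(1 + c i x) * φ x| ≤ 2 * M := fun i x => by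
    rw [abs_mul]
    refine mul_le_mul ?_ (hM x) (abs_nonneg _) zero_le_two
    have := abs_le.1 (hc1 i x); rw [abs_le]; constructor <;> linarith
  have m1 : ∀ i, Measurable fun x => (1 - c i x) * φ x := fun i => (measurable_const.sub (hc i)).mul hφ
  have m2 : ∀ i, Measurable fun x => (1 + c i x) * φ x := fun i => (measurable_const.add (hc i)).mul hφ
  have i1 : ∀ i, Integrable fun x => u (x + e i) * ((1 - c i x) * φ x) := fun i =>
    integrable_mul_bdd (integrable_comp_add_right hu _) (m1 i).aestronglyMeasurable (b1 i)
  have i2 : ∀ i, Integrable fun x => u (x - e i) * ((1 + c i x) * φ x) := fun i =>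
    integrable_mul_bdd (integrable_comp_sub_right hu _) (m2 i).aestronglyMeasurable (b2 i)
  have i3 : ∀ i, Integrable fun x => u x * ((1 - c i (x - e i)) * φ (x - e i)) := fun i =>
    integrable_mul_bdd hu ((m1 i).comp (measurable_id.sub_const _)).aestronglyMeasurable
      fun x => b1 i _
  have i4 : ∀ i, Integrable fun x => u x * ((1 + c i (x + e i)) * φ (x + e i)) := fun i =>
    integrable_mul_bdd hu ((m2 i).comp (measurable_id.add_const _)).aestronglyMeasurable
      fun x => b2 i _
  have e1 : ∀ x, lfStep c e u x * φ x = (2 * (d : ℝ))⁻¹ * ∑ i, (u (x + e i) * ((1 - c i x) * φ x) +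
      u (x - e i) * ((1 + c i x) * φ x)) := fun x => by
    rw [lfStep, mul_assoc, Finset.sum_mul]
    congr 1
    exact Finset.sum_congr rfl fun i _ => by ring
  have e2 : ∀ x, u x * ((2 * (d : ℝ))⁻¹ * ∑ i, ((1 - c i (x - e i)) * φ (x - e i) +
      (1 + c i (x + e i)) * φ (x + e i))) = (2 * (d : ℝ))⁻¹ * ∑ i,
      (u x * ((1 - c i (x - e i)) * φ (x - e i)) + u x * ((1 + c i (x + e i)) * φ (x + e i))) :=
    fun x => by
      rw [mul_left_comm, Finset.mul_sum]
      congr 1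
      exact Finset.sum_congr rfl fun i _ => by ring
  simp_rw [e1, e2]
  rw [integral_const_mul, integral_const_mul, integral_finsetSum _ fun i _ => integrable_add_fun (i1 i) (i2 i),
    integral_finsetSum _ fun i _ => integrable_add_fun (i3 i) (i4 i)]
  congr 1
  refine Finset.sum_congr rfl fun i _ => ?_
  rw [integral_add (i1 i) (i2 i), integral_add (i3 i) (i4 i)]
  congr 1
  · rw [← integral_add_right_eq_self (μ := volume) (fun x => u x * ((1 - c i (x - e i)) * φ (x - e i)))
      (e i)]
    simp
  · rw [← integral_sub_right_eq_self (μ := volume) (fun x => u x * ((1 + c i (x + e i)) * φ (x + e i)))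
      (e i)]
    simp

/-- The adjoint step maps the constant `1` to `1` plus the discrete divergence. -/
theorem integral_lfStep_le (hd : 0 < d) (hc : ∀ i, Measurable (c i)) (hc1 : ∀ i x, |c i x| ≤ 1)
    {κ : ℝ} (hκ : ∀ x, (2 * (d : ℝ))⁻¹ * ∑ i, (c i (x + e i) - c i (x - e i)) ≤ κ)
    (hu : Integrable u) (hu0 : ∀ x, 0 ≤ u x) : ∫ x, lfStep c e u x ≤ (1 + κ) * ∫ x, u x := by
  have hd' : (0 : ℝ) < d := by exact_mod_cast hd
  have key := integral_lfStep_mul (e := e) hc hc1 hu (φ := fun _ => 1) measurable_const (M := 1)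
    (by simp)
  simp only [mul_one] at key
  rw [key, ← integral_const_mul]
  have e1 : ∀ x, (2 * (d : ℝ))⁻¹ * ∑ i, (1 - c i (x - e i) + (1 + c i (x + e i))) =
      1 + (2 * (d : ℝ))⁻¹ * ∑ i, (c i (x + e i) - c i (x - e i)) := fun x => by
    have : ∀ i, 1 - c i (x - e i) + (1 + c i (x + e i)) = 2 + (c i (x + e i) - c i (x - e i)) :=
      fun i => by ring
    simp only [this, Finset.sum_add_distrib, Finset.sum_const, Finset.card_univ, Fintype.card_fin,
      nsmul_eq_mul, mul_add]
    field_simp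
  simp_rw [e1]
  refine integral_mono_of_nonneg (ae_of_all _ fun x => mul_nonneg (hu0 x) ?_) (hu.const_mul _)
    (ae_of_all _ fun x => ?_)
  · rw [← e1 x]
    refine mul_nonneg (by positivity) (Finset.sum_nonneg fun i _ => ?_)
    linarith [(abs_le.1 (hc1 i (x - e i))).2, (abs_le.1 (hc1 i (x + e i))).1]
  · simp only
    rw [mul_comm (1 + κ)]
    exact mul_le_mul_of_nonneg_left (by linarith [hκ x]) (hu0 x)

theorem lfStep_mem_powBall (hd : 0 < d) (hc : ∀ i, Measurable (c i)) (hc1 : ∀ i x, |c i x| ≤ 1)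
    {κ : ℝ} (hκ : ∀ x, (2 * (d : ℝ))⁻¹ * ∑ i, (c i (x + e i) - c i (x - e i)) ≤ κ)
    (hum : Measurable u) {M : ℝ} (hM : ∀ x, |u x| ≤ M) {p : ℝ} (hp : 1 ≤ p) :
    ∫ x, |lfStep c e u x| ^ p ≤ (1 + κ) * ∫ x, |u x| ^ p := by
  have hcont := (convexCost_rpow hp).continuous
  have i1 : ∀ v : Torus d → ℝ, Measurable v → (∀ x, |v x| ≤ M) → Integrable fun x => |v x| ^ p := by
    intro v hv hvM
    refine Integrable.of_bound (hcont.measurable.comp hv).aestronglyMeasurable (M ^ p)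
      (ae_of_all _ fun x => ?_)
    rw [Real.norm_eq_abs, abs_of_nonneg (Real.rpow_nonneg (abs_nonneg _) _)]
    exact Real.rpow_le_rpow (abs_nonneg _) (hvM x) (by linarith)
  refine le_trans ?_ (integral_lfStep_le (e := e) hd hc hc1 hκ (i1 u hum hM)
    fun x => Real.rpow_nonneg (abs_nonneg _) _)
  have hbd : ∀ x, |lfStep c e (fun y => |u y| ^ p) x| ≤ M ^ p := fun x =>
    abs_lfStep_le hd (fun i => hc1 i x) fun y => by
      rw [abs_of_nonneg (Real.rpow_nonneg (abs_nonneg _) _)]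
      exact Real.rpow_le_rpow (abs_nonneg _) (hM y) (by linarith)
  refine integral_mono (i1 _ (measurable_lfStep hc hum)
    fun x => abs_lfStep_le hd (fun i => hc1 i x) hM) ?_ fun x => ?_
  · exact Integrable.of_bound (measurable_lfStep hc (hcont.measurable.comp hum)).aestronglyMeasurable
      (M ^ p) (ae_of_all _ hbd)
  · exact (convexCost_rpow hp).comp_lfStep_le hd fun i => hc1 i x

/-- With `E = ∑ |a i|`, the left side is bounded by `1 + E` times a convex combination. The
prefactor is `1 + O(E)` rather than `2 ^ q`, without which the estimate could not be iterated over
many small time steps. -/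
theorem abs_add_sum_rpow_le {q : ℝ} (hq : 1 ≤ q) {ι : Type*} [Fintype ι] {a z : ι → ℝ}
    (ha : ∑ i, |a i| ≤ 1) (P : ℝ) :
    |P + ∑ i, a i * z i| ^ q ≤
      (1 + 2 ^ q * ∑ i, |a i|) * (|P| ^ q + ∑ i, |a i| * |z i| ^ q) := by
  set E := ∑ i, |a i|
  have hE0 : 0 ≤ E := Finset.sum_nonneg fun i _ => abs_nonneg _
  have hE1 : 0 < 1 + E := by linarith
  have h1 : |P + ∑ i, a i * z i| ≤ (1 + E) * ((1 + E)⁻¹ * |P| + ∑ i, (1 + E)⁻¹ * |a i| * |z i|) := by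
    rw [mul_add, Finset.mul_sum]
    refine (abs_add_le _ _).trans (add_le_add (le_of_eq (by field_simp)) ?_)
    refine (Finset.abs_sum_le_sum_abs _ _).trans (Finset.sum_le_sum fun i _ => le_of_eq ?_)
    rw [abs_mul]; field_simp
  have h2 := Real.rpow_arith_mean_le_arith_mean_rpow (Finset.univ : Finset (Option ι))
    (fun o => o.elim (1 + E)⁻¹ fun i => (1 + E)⁻¹ * |a i|) (fun o => o.elim |P| fun i => |z i|)
    (by rintro (_ | i) - <;> simp <;> positivity)
    (by
      simp only [Fintype.sum_option, Option.elim, ← Finset.mul_sum]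
      rw [← mul_one_add (1 + E)⁻¹ E]; exact inv_mul_cancel₀ hE1.ne')
    (by rintro (_ | i) - <;> simp) hq
  simp only [Fintype.sum_option, Option.elim] at h2
  -- The power lies below its chord between `1` and `2`, and `E ≤ 1`.
  have h3 : (1 + E) ^ q ≤ 1 + 2 ^ q * E := by
    have := (convexOn_rpow hq).2 (show (1 : ℝ) ∈ Ici 0 by simp) (show (2 : ℝ) ∈ Ici 0 by simp)
      (by linarith : 0 ≤ 1 - E) hE0 (by ring)
    simp only [smul_eq_mul, mul_one, Real.one_rpow] at this
    rw [show 1 - E + E * 2 = 1 + E by ring] at this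
    linarith
  have hS : 0 ≤ |P| ^ q + ∑ i, |a i| * |z i| ^ q := add_nonneg (Real.rpow_nonneg (abs_nonneg _) _)
    (Finset.sum_nonneg fun i _ => mul_nonneg (abs_nonneg _) (Real.rpow_nonneg (abs_nonneg _) _))
  calc |P + ∑ i, a i * z i| ^ q
      ≤ ((1 + E) * ((1 + E)⁻¹ * |P| + ∑ i, (1 + E)⁻¹ * |a i| * |z i|)) ^ q :=
        Real.rpow_le_rpow (abs_nonneg _) h1 (by linarith)
    _ ≤ (1 + E) ^ q * ((1 + E)⁻¹ * |P| ^ q + ∑ i, (1 + E)⁻¹ * |a i| * |z i| ^ q) := by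
        rw [Real.mul_rpow hE1.le (by positivity)]
        exact mul_le_mul_of_nonneg_left h2 (by positivity)
    _ = (1 + E) ^ q * ((1 + E)⁻¹ * (|P| ^ q + ∑ i, |a i| * |z i| ^ q)) := by
        rw [mul_add (1 + E)⁻¹, Finset.mul_sum]; simp_rw [mul_assoc]
    _ ≤ (1 + E) ^ q * (1 * (|P| ^ q + ∑ i, |a i| * |z i| ^ q)) := by
        gcongr
        exact inv_le_one_of_one_le₀ (by linarith)
    _ ≤ _ := by rw [one_mul]; exact mul_le_mul_of_nonneg_right h3 hS

/-- Young's inequality for the conjugate pair formed by the entropy and the exponential, scaled by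
`δ`. It follows from `1 + r ≤ exp r` at `r = a / δ - log z`. -/
theorem mul_le_posLog_add_exp {a z δ : ℝ} (hz : 0 ≤ z) (hδ : 0 < δ) :
    a * z ≤ δ * (z * Real.posLog z) + δ * Real.exp (a / δ) := by
  rcases hz.eq_or_lt with rfl | hz
  · simp; positivity
  have h1 : Real.log z ≤ Real.posLog z := le_max_right _ _
  have h2 := Real.add_one_le_exp (a / δ - Real.log z)
  rw [Real.exp_sub, Real.exp_log hz, le_div_iff₀ hz] at h2
  have h3 := mul_le_mul_of_nonneg_left h2 hδ.le
  have h4 : δ * ((a / δ - Real.log z + 1) * z) = a * z - δ * (z * Real.log z) + δ * z := by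
    field_simp
  have h5 := mul_le_mul_of_nonneg_left (mul_le_mul_of_nonneg_left h1 hz.le) hδ.le
  nlinarith [mul_pos hδ hz]

/-- A slightly larger exponent pays for the entropy, because `x ^ (1 + s) = x exp (s log x) ≥ x + s
x log x`. The additive `s` covers `x < 1`, where `x log x ≥ -1`. -/
theorem add_posLog_le_rpow {x s : ℝ} (hx : 0 ≤ x) (hs : 0 ≤ s) :
    x + s * (x * Real.posLog x) ≤ x ^ (1 + s) + s := by
  rcases hx.eq_or_lt with rfl | hx
  · simp only [zero_mul, mul_zero, add_zero]
    have := Real.rpow_nonneg (le_refl (0 : ℝ)) (1 + s); linarith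
  have h1 := Real.add_one_le_exp (s * Real.log x)
  have h2 : x ^ (1 + s) = x * Real.exp (s * Real.log x) := by
    rw [Real.rpow_add hx, Real.rpow_one, Real.rpow_def_of_pos hx, mul_comm s]
  have h3 := mul_le_mul_of_nonneg_left h1 hx.le
  rw [h2]
  rcases le_total x 1 with h | h
  · have : Real.posLog x = 0 := by
      rw [Real.posLog_eq_zero_iff, abs_of_pos hx]; exact h
    rw [this]
    have h4 : -1 ≤ x * Real.log x := by
      have := Real.one_sub_inv_le_log_of_pos hx
      have h5 := mul_le_mul_of_nonneg_left this hx.le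
      rw [mul_sub, mul_inv_cancel₀ hx.ne'] at h5
      linarith
    nlinarith [mul_le_mul_of_nonneg_left h4 hs]
  · have : Real.posLog x = Real.log x := Real.posLog_eq_log (by rwa [abs_of_pos hx])
    rw [this]; nlinarith

end LaxFriedrichs

section LaxFriedrichs

variable {c : Fin d → Torus d → ℝ} {e : Fin d → Torus d} {u : Torus d → ℝ}

/-- The centred difference in the scheme is a forward difference over `e i + e i` based at `x - e
i`. Increments over doubled grid vectors are thus closed under the scheme and serve as its discrete
gradient. -/
theorem lfStep_translate_sub (j : Fin d) (x : Torus d) :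
    lfStep c e u (x + (e j + e j)) - lfStep c e u x =
      lfStep (fun i y => c i (y + (e j + e j))) e (fun y => u (y + (e j + e j)) - u y) x +
        ∑ i, -((2 * (d : ℝ))⁻¹ * (c i (x + (e j + e j)) - c i x)) *
          (u (x - e i + (e i + e i)) - u (x - e i)) := by
  simp only [lfStep, ← mul_sub, ← Finset.sum_sub_distrib, neg_mul, mul_assoc,
    Finset.sum_neg_distrib, ← sub_eq_add_neg]
  rw [← Finset.mul_sum, ← mul_sub, ← Finset.sum_sub_distrib]
  congr 1
  refine Finset.sum_congr rfl fun i _ => ?_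
  have h1 : x + (e j + e j) + e i = x + e i + (e j + e j) := by abel
  have h2 : x + (e j + e j) - e i = x - e i + (e j + e j) := by abel
  have h3 : x - e i + (e i + e i) = x + e i := by abel
  rw [h1, h2, h3]; ring

theorem integrable_of_measurable_of_bound {Y : Type*} [MeasurableSpace Y] {μ : Measure Y}
    [IsFiniteMeasure μ] {f : Y → ℝ} (hf : Measurable f) {M : ℝ} (hM : ∀ x, |f x| ≤ M) :
    Integrable f μ :=
  Integrable.of_bound hf.aestronglyMeasurable M (ae_of_all _ hM)

set_option maxHeartbeats 800000 in
-- The discrete form of the gradient estimate with decreasing exponent. The velocity increments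
-- multiply powers of the discrete gradient; Young's inequality splits them into an exponential
-- moment and an entropy, and the larger exponent before the step absorbs the entropy. The free
-- factor `Λ` is kept because the estimate is not homogeneous.
theorem lfStep_gradient_le (hd : 0 < d) (hc : ∀ i, Measurable (c i)) (hc1 : ∀ i x, |c i x| ≤ 1)
    {κ τ δ K : ℝ} (hκ0 : 0 ≤ κ) (hκ1 : κ ≤ 1)
    (hκ : ∀ x, (2 * (d : ℝ))⁻¹ * ∑ i, (c i (x + e i) - c i (x - e i)) ≤ κ) (hτ : 0 < τ) (hδ : 0 < δ)
    (hexp : ∀ i j, ∫ x, Real.exp (|(2 * (d : ℝ))⁻¹ * (c i (x + (e j + e j)) - c i x)| / τ / δ) ≤ K)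
    (hum : Measurable u) {M : ℝ} (hM : ∀ x, |u x| ≤ M) {p q : ℝ} (hq : 1 ≤ q) (hqp : q ≤ p) (Λ : ℝ) :
    ∑ j, ∫ x, |Λ * (lfStep c e u (x + (e j + e j)) - lfStep c e u x)| ^ q ≤
      (1 + κ) * (∑ j, ∫ x, |Λ * (u (x + (e j + e j)) - u x)| ^
        (q * (1 + τ * (3 * (1 + 2 ^ p) * d * δ)))) +
        τ * ((1 + 2 ^ p) * d ^ 2 * δ * (6 + 2 * K)) := by
  have hd' : (0 : ℝ) < d := by exact_mod_cast hd
  have hd1 : (1 : ℝ) ≤ d := by exact_mod_cast hd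
  have hq0 : 0 ≤ q := by linarith
  have hM0 : 0 ≤ M := (abs_nonneg _).trans (hM 0)
  have hcont := (convexCost_rpow hq).continuous
  have hpow : (2 : ℝ) ^ q ≤ 2 ^ p := Real.rpow_le_rpow_of_exponent_le one_le_two hqp
  have hpow0 : (0 : ℝ) < 2 ^ q := by positivity
  set w : Fin d → Torus d → ℝ := fun j x => Λ * (u (x + (e j + e j)) - u x) with hw
  have hwm : ∀ j, Measurable (w j) := fun j =>
    ((hum.comp (measurable_id.add_const _)).sub hum).const_mul Λ
  have hwM : ∀ j x, |w j x| ≤ |Λ| * (2 * M) := fun j x => by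
    rw [hw]; simp only [abs_mul]
    refine mul_le_mul_of_nonneg_left ?_ (abs_nonneg _)
    linarith [abs_sub (u (x + (e j + e j))) (u x), hM (x + (e j + e j)), hM x]
  set B := (|Λ| * (2 * M)) ^ q
  set z : Fin d → Torus d → ℝ := fun j x => |w j x| ^ q with hz
  have hz0 : ∀ j x, 0 ≤ z j x := fun j x => Real.rpow_nonneg (abs_nonneg _) _
  have hzm : ∀ j, Measurable (z j) := fun j => hcont.measurable.comp (hwm j)
  have hzB : ∀ j x, |z j x| ≤ B := fun j x => by
    rw [abs_of_nonneg (hz0 j x)]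
    exact Real.rpow_le_rpow (abs_nonneg _) (hwM j x) hq0
  set l : Fin d → Torus d → ℝ := fun j x => z j x * Real.posLog (z j x) with hl
  have hl0 : ∀ j x, 0 ≤ l j x := fun j x => mul_nonneg (hz0 j x) Real.posLog_nonneg
  have hlm : ∀ j, Measurable (l j) := fun j =>
    (hzm j).mul (measurable_const.max (Real.measurable_log.comp (hzm j)))
  have hlB : ∀ j x, |l j x| ≤ B * B := fun j x => by
    rw [abs_of_nonneg (hl0 j x)]
    have h1 : Real.posLog (z j x) ≤ z j x := by
      refine max_le (hz0 j x) (Real.log_le_self (hz0 j x))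
    have h2 := (le_abs_self _).trans (hzB j x)
    exact mul_le_mul h2 (h1.trans h2) Real.posLog_nonneg ((hz0 j x).trans h2)
  set ε : Fin d → Fin d → Torus d → ℝ := fun i j x =>
    |(2 * (d : ℝ))⁻¹ * (c i (x + (e j + e j)) - c i x)| with hε
  have hεm : ∀ i j, Measurable (ε i j) := fun i j =>
    ((((hc i).comp (measurable_id.add_const _)).sub (hc i)).const_mul _).abs
  have hε0 : ∀ i j x, 0 ≤ ε i j x := fun i j x => abs_nonneg _
  have hε1 : ∀ i j x, ε i j x ≤ 1 / d := fun i j x => by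
    rw [hε]; simp only [abs_mul]
    have : |c i (x + (e j + e j)) - c i x| ≤ 2 := by
      linarith [abs_sub (c i (x + (e j + e j))) (c i x), hc1 i (x + (e j + e j)), hc1 i x]
    rw [abs_of_pos (by positivity : (0 : ℝ) < (2 * (d : ℝ))⁻¹)]
    calc _ ≤ (2 * (d : ℝ))⁻¹ * 2 := by gcongr
      _ = 1 / d := by field_simp
  set E : Fin d → Fin d → Torus d → ℝ := fun i j x => Real.exp (ε i j x / τ / δ) with hE
  have hEm : ∀ i j, Measurable (E i j) := fun i j =>
    Real.measurable_exp.comp (((hεm i j).div_const _).div_const _)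
  have hEi : ∀ i j, Integrable (E i j) := fun i j =>
    integrable_of_measurable_of_bound (hEm i j) (M := Real.exp (1 / d / τ / δ)) fun x => by
      rw [abs_of_pos (Real.exp_pos _), Real.exp_le_exp]
      have := hε1 i j x
      gcongr
  have hEK : ∀ i j, ∫ x, E i j x ≤ K := hexp
  set cj : Fin d → Fin d → Torus d → ℝ := fun j i y => c i (y + (e j + e j)) with hcj
  have hcjm : ∀ j i, Measurable (cj j i) := fun j i => (hc i).comp (measurable_id.add_const _)
  have hcj1 : ∀ j i x, |cj j i x| ≤ 1 := fun j i x => hc1 i _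
  have hcjκ : ∀ j x, (2 * (d : ℝ))⁻¹ * ∑ i, (cj j i (x + e i) - cj j i (x - e i)) ≤ κ := fun j x => by
    have := hκ (x + (e j + e j))
    have h1 : ∀ i, x + (e j + e j) + e i = x + e i + (e j + e j) := fun i => by abel
    have h2 : ∀ i, x + (e j + e j) - e i = x - e i + (e j + e j) := fun i => by abel
    simpa only [h1, h2] using this
  -- Young's inequality is applied to `ε / τ`: it is the velocity increment per unit time that has a
  -- bounded exponential moment.
  have hEz : ∀ i j x, ∀ t : ℝ, 0 ≤ t → ε i j x * t ≤
      τ * δ * (t * Real.posLog t) + τ * δ * E i j x := fun i j x t ht => by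
    have h1 := mul_le_posLog_add_exp (a := ε i j x / τ) ht hδ
    have h2 := mul_le_mul_of_nonneg_left h1 hτ.le
    have h3 : τ * (ε i j x / τ * t) = ε i j x * t := by field_simp
    rw [h3] at h2
    linarith
  -- the pointwise inequality
  have hpt : ∀ j x, |Λ * (lfStep c e u (x + (e j + e j)) - lfStep c e u x)| ^ q ≤
      lfStep (cj j) e (z j) x + 2 ^ q * ∑ i, (τ * δ * lfStep (cj j) e (l j) x + τ * δ * E i j x) +
        (1 + 2 ^ q) * ∑ i, (τ * δ * l i (x - e i) + τ * δ * E i j x) := by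
    intro j x
    have e1 : Λ * (lfStep c e u (x + (e j + e j)) - lfStep c e u x) =
        lfStep (cj j) e (w j) x + ∑ i, -((2 * (d : ℝ))⁻¹ * (c i (x + (e j + e j)) - c i x)) *
          w i (x - e i) := by
      have h1 := lfStep_linear (c := cj j) (e := e) (u := fun y => u (y + (e j + e j)) - u y) hd Λ 0 x
      simp only [add_zero] at h1
      rw [lfStep_translate_sub, mul_add, Finset.mul_sum, ← h1]
      congr 1
      exact Finset.sum_congr rfl fun i _ => by simp only [hw]; ring
    have hsum : ∑ i, |-((2 * (d : ℝ))⁻¹ * (c i (x + (e j + e j)) - c i x))| ≤ 1 := by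
      simp only [abs_neg]
      refine (sum_fin_le fun i => hε1 i j x).trans (le_of_eq (by field_simp))
    rw [e1]
    refine (abs_add_sum_rpow_le hq hsum _).trans ?_
    simp only [abs_neg]
    change (1 + 2 ^ q * ∑ i, ε i j x) * (|lfStep (cj j) e (w j) x| ^ q +
      ∑ i, ε i j x * z i (x - e i)) ≤ _
    have hs1 : ∑ i, ε i j x ≤ 1 := (sum_fin_le fun i => hε1 i j x).trans (le_of_eq (by field_simp))
    have hs0 : 0 ≤ ∑ i, ε i j x := Finset.sum_nonneg fun i _ => hε0 i j x
    have hJ : |lfStep (cj j) e (w j) x| ^ q ≤ lfStep (cj j) e (z j) x :=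
      (convexCost_rpow hq).comp_lfStep_le hd fun i => hcj1 j i x
    -- The factor `ε i j x` does not depend on the points being averaged, so it enters the average,
    -- where Young's inequality is applied to each value.
    have hL : ∀ i, ε i j x * lfStep (cj j) e (z j) x ≤
        τ * δ * lfStep (cj j) e (l j) x + τ * δ * E i j x := by
      intro i
      have h1 := lfStep_linear (c := cj j) (e := e) (u := z j) hd (ε i j x) 0 x
      have h2 := lfStep_linear (c := cj j) (e := e) (u := l j) hd (τ * δ) (τ * δ * E i j x) x
      simp only [add_zero] at h1
      rw [← h1, ← h2]
      exact lfStep_mono (fun i => hcj1 j i x) fun y => hEz i j x _ (hz0 j y)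
    have hz' : ∑ i, ε i j x * z i (x - e i) ≤ ∑ i, (τ * δ * l i (x - e i) + τ * δ * E i j x) :=
      Finset.sum_le_sum fun i _ => hEz i j x _ (hz0 i _)
    have hzs0 : 0 ≤ ∑ i, ε i j x * z i (x - e i) :=
      Finset.sum_nonneg fun i _ => mul_nonneg (hε0 i j x) (hz0 i _)
    have hP0 : 0 ≤ lfStep (cj j) e (z j) x := lfStep_nonneg (fun i => hcj1 j i x) (hz0 j)
    have hLs : (∑ i, ε i j x) * lfStep (cj j) e (z j) x ≤
        ∑ i, (τ * δ * lfStep (cj j) e (l j) x + τ * δ * E i j x) := by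
      rw [Finset.sum_mul]; exact Finset.sum_le_sum fun i _ => hL i
    calc _ ≤ (1 + 2 ^ q * ∑ i, ε i j x) * (lfStep (cj j) e (z j) x + ∑ i, ε i j x * z i (x - e i)) :=
          mul_le_mul_of_nonneg_left (by linarith) (by positivity)
      _ = lfStep (cj j) e (z j) x + 2 ^ q * ((∑ i, ε i j x) * lfStep (cj j) e (z j) x) +
          (1 + 2 ^ q * ∑ i, ε i j x) * ∑ i, ε i j x * z i (x - e i) := by ring
      _ ≤ _ := by
          refine add_le_add (add_le_add le_rfl (mul_le_mul_of_nonneg_left hLs hpow0.le)) ?_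
          refine mul_le_mul ?_ hz' hzs0 (by positivity)
          nlinarith
  -- integration
  have iz : ∀ j, Integrable (z j) := fun j => integrable_of_measurable_of_bound (hzm j) (hzB j)
  have il : ∀ j, Integrable (l j) := fun j => integrable_of_measurable_of_bound (hlm j) (hlB j)
  have iLz : ∀ j, Integrable (lfStep (cj j) e (z j)) := fun j =>
    integrable_of_measurable_of_bound (measurable_lfStep (hcjm j) (hzm j))
      fun x => abs_lfStep_le hd (fun i => hcj1 j i x) (hzB j)
  have iLl : ∀ j, Integrable (lfStep (cj j) e (l j)) := fun j =>
    integrable_of_measurable_of_bound (measurable_lfStep (hcjm j) (hlm j))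
      fun x => abs_lfStep_le hd (fun i => hcj1 j i x) (hlB j)
  have hint : ∀ j, ∫ x, |Λ * (lfStep c e u (x + (e j + e j)) - lfStep c e u x)| ^ q ≤
      (1 + κ) * (∫ x, z j x) + 2 ^ q * (d * (τ * δ * ((1 + κ) * ∫ x, l j x) + τ * δ * K)) +
        (1 + 2 ^ q) * (τ * δ * (∑ i, ∫ x, l i x) + d * (τ * δ * K)) := by
    intro j
    have a1 : ∀ i, Integrable fun x => τ * δ * lfStep (cj j) e (l j) x + τ * δ * E i j x := fun i =>
      ((iLl j).const_mul _).add ((hEi i j).const_mul _)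
    have a2 : ∀ i, Integrable fun x => τ * δ * l i (x - e i) + τ * δ * E i j x := fun i =>
      ((integrable_comp_sub_right (il i) _).const_mul _).add ((hEi i j).const_mul _)
    have a3 := (integrable_sum_of_normed (s := Finset.univ) fun i _ => a1 i).const_mul ((2 : ℝ) ^ q)
    have a4 := (integrable_sum_of_normed (s := Finset.univ) fun i _ => a2 i).const_mul (1 + (2 : ℝ) ^ q)
    refine (integral_mono_of_nonneg (ae_of_all _ fun x => Real.rpow_nonneg (abs_nonneg _) _)
      (integrable_add_fun (integrable_add_fun (iLz j) a3) a4) (ae_of_all _ (hpt j))).trans ?_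
    rw [integral_add (integrable_add_fun (iLz j) a3) a4, integral_add (iLz j) a3, integral_const_mul,
      integral_const_mul, integral_finsetSum _ fun i _ => a1 i, integral_finsetSum _ fun i _ => a2 i]
    have t1 := integral_lfStep_le hd (hcjm j) (hcj1 j) (hcjκ j) (iz j) (hz0 j)
    have t2 := integral_lfStep_le hd (hcjm j) (hcj1 j) (hcjκ j) (il j) (hl0 j)
    have hτδ : 0 ≤ τ * δ := (mul_pos hτ hδ).le
    refine add_le_add (add_le_add t1 (mul_le_mul_of_nonneg_left (sum_fin_le fun i => ?_) hpow0.le))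
      (mul_le_mul_of_nonneg_left ?_ (by positivity))
    · rw [integral_add ((iLl j).const_mul _) ((hEi i j).const_mul _), integral_const_mul,
        integral_const_mul]
      exact add_le_add (mul_le_mul_of_nonneg_left t2 hτδ) (mul_le_mul_of_nonneg_left (hEK i j) hτδ)
    · have : ∀ i, ∫ x, (τ * δ * l i (x - e i) + τ * δ * E i j x) ≤ τ * δ * (∫ x, l i x) + τ * δ * K := by
        intro i
        rw [integral_add ((integrable_comp_sub_right (il i) _).const_mul _) ((hEi i j).const_mul _),
          integral_const_mul, integral_const_mul, integral_sub_right_eq_self (l i)]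
        exact add_le_add le_rfl (mul_le_mul_of_nonneg_left (hEK i j) hτδ)
      refine (Finset.sum_le_sum fun i _ => this i).trans (le_of_eq ?_)
      rw [Finset.sum_add_distrib, ← Finset.mul_sum]
      simp
  -- The constant is such that `s` times the entropy absorbs all the entropy terms: `2 ^ q * (1 + κ)
  -- + (1 + 2 ^ q) ≤ 3 * (1 + 2 ^ p)` for `κ ≤ 1`.
  set s := τ * (3 * (1 + 2 ^ p) * d * δ) with hs
  have hs0 : 0 ≤ s := by positivity
  have hfin : ∀ j, (∫ x, z j x) + s * (∫ x, l j x) ≤ (∫ x, |w j x| ^ (q * (1 + s))) + s := by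
    intro j
    have i5 : Integrable fun x => |w j x| ^ (q * (1 + s)) := by
      have h1 : 1 ≤ q * (1 + s) := by nlinarith
      refine integrable_of_measurable_of_bound ((convexCost_rpow h1).continuous.measurable.comp (hwm j))
        (M := (|Λ| * (2 * M)) ^ (q * (1 + s))) fun x => ?_
      rw [abs_of_nonneg (Real.rpow_nonneg (abs_nonneg _) _)]
      exact Real.rpow_le_rpow (abs_nonneg _) (hwM j x) (by linarith)
    have h1 : ∫ x, (z j x + s * l j x) ≤ ∫ x, (|w j x| ^ (q * (1 + s)) + s) := by
      refine integral_mono ((iz j).add ((il j).const_mul s)) (i5.add (integrable_const _)) fun x => ?_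
      have := add_posLog_le_rpow (hz0 j x) hs0
      simp only
      rwa [hz, ← Real.rpow_mul (abs_nonneg _)] at this
    rw [integral_add (iz j) ((il j).const_mul s), integral_add i5 (integrable_const _),
      integral_const_mul] at h1
    simpa using h1
  have hK0 : 0 ≤ K := by
    have i0 : Fin d := ⟨0, hd⟩
    exact (integral_nonneg fun _ => (Real.exp_pos _).le).trans (hEK i0 i0)
  set Z := ∑ j, ∫ x, z j x with hZ
  set Lg := ∑ j, ∫ x, l j x with hLg
  set X := ∑ j, ∫ x, |w j x| ^ (q * (1 + s)) with hX
  have hLg0 : 0 ≤ Lg := Finset.sum_nonneg fun j _ => integral_nonneg (hl0 j)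
  have hsum : Z + s * Lg ≤ X + d * s := by
    have := Finset.sum_le_sum fun j (_ : j ∈ (Finset.univ : Finset (Fin d))) => hfin j
    rw [Finset.sum_add_distrib, Finset.sum_add_distrib, ← Finset.mul_sum] at this
    simpa using this
  have hall := Finset.sum_le_sum fun j (_ : j ∈ (Finset.univ : Finset (Fin d))) => hint j
  refine hall.trans ?_
  have e3 : ∑ j, ((1 + κ) * (∫ x, z j x) + 2 ^ q * (d * (τ * δ * ((1 + κ) * ∫ x, l j x) + τ * δ * K)) +
        (1 + 2 ^ q) * (τ * δ * (∑ i, ∫ x, l i x) + d * (τ * δ * K))) =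
      (1 + κ) * Z + 2 ^ q * (d * (τ * δ * ((1 + κ) * Lg) + d * (τ * δ * K))) +
        d * ((1 + 2 ^ q) * (τ * δ * Lg + d * (τ * δ * K))) := by
    rw [Finset.sum_add_distrib, Finset.sum_add_distrib, ← Finset.mul_sum, ← Finset.mul_sum,
      ← Finset.mul_sum, Finset.sum_add_distrib, ← Finset.mul_sum, ← Finset.mul_sum]
    simp only [Finset.sum_const, Finset.card_univ, Fintype.card_fin, nsmul_eq_mul]
    rfl
  rw [e3]
  have hτδ : 0 < τ * δ := mul_pos hτ hδ
  have g1 : 2 ^ q * (d * (τ * δ * ((1 + κ) * Lg))) + d * ((1 + 2 ^ q) * (τ * δ * Lg)) ≤ s * Lg := by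
    have : 2 ^ q * (1 + κ) + (1 + 2 ^ q) ≤ 3 * (1 + 2 ^ p) := by nlinarith
    calc _ = (2 ^ q * (1 + κ) + (1 + 2 ^ q)) * (d * (τ * δ) * Lg) := by ring
      _ ≤ 3 * (1 + 2 ^ p) * (d * (τ * δ) * Lg) := mul_le_mul_of_nonneg_right this (by positivity)
      _ = s * Lg := by rw [hs]; ring
  have g2 : 2 ^ q * (d * (d * (τ * δ * K))) + d * ((1 + 2 ^ q) * (d * (τ * δ * K))) ≤
      2 * (1 + 2 ^ p) * (d ^ 2 * (τ * δ) * K) := by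
    calc _ = (2 ^ q + (1 + 2 ^ q)) * (d ^ 2 * (τ * δ) * K) := by ring
      _ ≤ _ := mul_le_mul_of_nonneg_right (by linarith) (by positivity)
  have g3 : (1 + κ) * (Z + s * Lg) ≤ (1 + κ) * (X + d * s) :=
    mul_le_mul_of_nonneg_left hsum (by linarith)
  have g4 : (1 + κ) * (d * s) ≤ 2 * (d * s) := mul_le_mul_of_nonneg_right (by linarith) (by positivity)
  have g5 : s * Lg ≤ (1 + κ) * (s * Lg) := by nlinarith [mul_nonneg hs0 hLg0]
  have g6 : 2 * (d * s) + 2 * (1 + 2 ^ p) * (d ^ 2 * (τ * δ) * K) =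
      τ * ((1 + 2 ^ p) * d ^ 2 * δ * (6 + 2 * K)) := by rw [hs]; ring
  linarith

end LaxFriedrichs

/-! ### Iteration of the scheme. -/

/-- The Lax–Friedrichs scheme. -/
noncomputable def lfIterate (c : ℕ → Fin d → Torus d → ℝ) (e : Fin d → Torus d) (u : Torus d → ℝ) :
    ℕ → Torus d → ℝ
  | 0 => u
  | k + 1 => lfStep (c k) e (lfIterate c e u k)

/-- Velocities of the Lax–Friedrichs scheme that satisfy the CFL condition and have discrete
divergence at most `L`. -/
structure GridField (c : ℕ → Fin d → Torus d → ℝ) (e : Fin d → Torus d) (τ L : ℝ) : Prop where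
  measurable : ∀ k i, Measurable (c k i)
  abs_le : ∀ k i x, |c k i x| ≤ 1
  div_le : ∀ k x, (2 * (d : ℝ))⁻¹ * ∑ i, (c k i (x + e i) - c k i (x - e i)) ≤ τ * L

section Iterate

variable {c : ℕ → Fin d → Torus d → ℝ} {e : Fin d → Torus d} {τ L : ℝ} {u : Torus d → ℝ} {M : ℝ}

theorem GridField.measurable_iterate (h : GridField c e τ L) (hu : Measurable u) (k : ℕ) :
    Measurable (lfIterate c e u k) := by
  induction k with
  | zero => exact hu
  | succ k ih => exact measurable_lfStep (h.measurable k) ih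

theorem GridField.abs_iterate_le (h : GridField c e τ L) (hd : 0 < d) (hM : ∀ x, |u x| ≤ M) (k : ℕ)
    (x : Torus d) : |lfIterate c e u k x| ≤ M := by
  induction k generalizing x with
  | zero => exact hM x
  | succ k ih => exact abs_lfStep_le hd (fun i => h.abs_le k i x) ih

theorem one_add_mul_pow_le {τ L T : ℝ} (hτ : 0 ≤ τ) (hL : 0 ≤ L) {k : ℕ} (hk : k * τ ≤ T) :
    (1 + τ * L) ^ k ≤ Real.exp (L * T) := by
  calc (1 + τ * L) ^ k ≤ Real.exp (τ * L) ^ k := by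
        gcongr; linarith [Real.add_one_le_exp (τ * L)]
    _ = Real.exp (k * (τ * L)) := (Real.exp_nat_mul _ _).symm
    _ ≤ _ := Real.exp_le_exp.2 (by nlinarith)

theorem GridField.integral_iterate_rpow_le (h : GridField c e τ L) (hd : 0 < d) (hu : Measurable u)
    (hM : ∀ x, |u x| ≤ M) (hτ : 0 ≤ τ) (hL : 0 ≤ L) {p T : ℝ} (hp : 1 ≤ p) {k : ℕ} (hk : k * τ ≤ T) :
    ∫ x, |lfIterate c e u k x| ^ p ≤ Real.exp (L * T) * ∫ x, |u x| ^ p := by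
  have h0 : 0 ≤ ∫ x, |u x| ^ p := integral_nonneg fun _ => Real.rpow_nonneg (abs_nonneg _) _
  have key : ∀ k, ∫ x, |lfIterate c e u k x| ^ p ≤ (1 + τ * L) ^ k * ∫ x, |u x| ^ p := by
    intro k
    induction k with
    | zero => simp [lfIterate]
    | succ k ih =>
      refine (lfStep_mem_powBall hd (h.measurable k) (h.abs_le k) (h.div_le k)
        (h.measurable_iterate hu k) (h.abs_iterate_le hd hM k) hp).trans ?_
      rw [pow_succ', mul_assoc]
      exact mul_le_mul_of_nonneg_left ih (by positivity)
  exact (key k).trans (mul_le_mul_of_nonneg_right (one_add_mul_pow_le hτ hL hk) h0)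

/-- Propagation of discrete gradient bounds by the Lax–Friedrichs scheme, with a loss of
integrability. -/
theorem GridField.integral_iterate_gradient_le (h : GridField c e τ L) (hd : 0 < d)
    (hu : Measurable u) (hM : ∀ x, |u x| ≤ M) (hτ : 0 < τ) (hL : 0 ≤ L) (hτL : τ * L ≤ 1)
    {p q T K δ : ℝ} (hq : 1 ≤ q) (hqp : q < p) (hδ : 0 < δ)
    (hδT : 3 * (1 + 2 ^ p) * d * δ * T ≤ Real.log (p / q))
    (hK : ∀ k i j, ∫ x, Real.exp (|(2 * (d : ℝ))⁻¹ * (c k i (x + (e j + e j)) - c k i x)| / τ / δ) ≤ K)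
    (Λ : ℝ) {k : ℕ} (hk : k * τ ≤ T) :
    ∑ j, ∫ x, |Λ * (lfIterate c e u k (x + (e j + e j)) - lfIterate c e u k x)| ^ q ≤
      Real.exp (L * T) * ((∑ j, ∫ x, |Λ * (u (x + (e j + e j)) - u x)| ^ p) +
        T * ((1 + 2 ^ p) * d ^ 2 * δ * (6 + 2 * K))) + d := by
  have hK0 : 0 ≤ K := by
    have i0 : Fin d := ⟨0, hd⟩
    exact (integral_nonneg fun _ => (Real.exp_pos _).le).trans (hK 0 i0 i0)
  have hp : 1 ≤ p := by linarith
  set s₀ := 3 * (1 + 2 ^ p) * d * δ with hs₀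
  have hs₀0 : 0 ≤ s₀ := by positivity
  set s := τ * s₀ with hs
  have hs0 : 0 ≤ s := by positivity
  set C := (1 + 2 ^ p) * d ^ 2 * δ * (6 + 2 * K) with hC
  have hC0 : 0 ≤ C := by positivity
  set X : ℕ → ℝ → ℝ := fun k r =>
    ∑ j, ∫ x, |Λ * (lfIterate c e u k (x + (e j + e j)) - lfIterate c e u k x)| ^ r with hX
  have hX0 : ∀ k r, 0 ≤ X k r := fun k r => Finset.sum_nonneg fun j _ =>
    integral_nonneg fun _ => Real.rpow_nonneg (abs_nonneg _) _
  -- The exponent is divided by `1 + s` at each step, so that the bound on step `k + 1` is fed by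
  -- exactly the exponent available at step `k`.
  have key : ∀ k : ℕ, 1 ≤ p / (1 + s) ^ k →
      X k (p / (1 + s) ^ k) ≤ (1 + τ * L) ^ k * (X 0 p + k * τ * C) := by
    intro k
    induction k with
    | zero => intro _; simp
    | succ k ih =>
      intro hk1
      have hle : p / (1 + s) ^ (k + 1) ≤ p / (1 + s) ^ k := by
        refine div_le_div_of_nonneg_left (by linarith) (by positivity) ?_
        exact pow_le_pow_right₀ (by linarith) (Nat.le_succ k)
      have hle2 : p / (1 + s) ^ (k + 1) ≤ p :=
        div_le_self (by linarith) (one_le_pow₀ (by linarith))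
      have ih' := ih (hk1.trans hle)
      have step := lfStep_gradient_le hd (h.measurable k) (h.abs_le k) (by positivity) hτL
        (h.div_le k) hτ hδ (hK k) (h.measurable_iterate hu k) (h.abs_iterate_le hd hM k) hk1 hle2 Λ
      have e1 : p / (1 + s) ^ (k + 1) * (1 + τ * (3 * (1 + 2 ^ p) * d * δ)) = p / (1 + s) ^ k := by
        rw [← hs₀, ← hs, pow_succ]; field_simp
      rw [e1] at step
      have h1 : 1 ≤ (1 + τ * L) ^ (k + 1) := one_le_pow₀ (by nlinarith)
      calc X (k + 1) (p / (1 + s) ^ (k + 1)) ≤ (1 + τ * L) * X k (p / (1 + s) ^ k) + τ * C := step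
        _ ≤ (1 + τ * L) * ((1 + τ * L) ^ k * (X 0 p + k * τ * C)) + (1 + τ * L) ^ (k + 1) * (τ * C) := by
            refine add_le_add (mul_le_mul_of_nonneg_left ih' (by positivity)) ?_
            exact le_mul_of_one_le_left (by positivity) h1
        _ = _ := by push_cast; ring
  -- Up to time `T` the total loss is at most `exp (s₀ * T)`, which the choice of `δ` keeps below `p
  -- / q`.
  have hqk : q ≤ p / (1 + s) ^ k := by
    have h1 : (1 + s) ^ k ≤ p / q := by
      calc (1 + s) ^ k ≤ Real.exp (s₀ * T) := one_add_mul_pow_le hτ.le hs₀0 hk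
        _ ≤ p / q := by
            rw [← Real.le_log_iff_exp_le (by positivity)]; exact hδT
    rw [le_div_iff₀ (by positivity)]
    rw [le_div_iff₀ (by linarith)] at h1
    linarith
  have hm := h.measurable_iterate hu k
  have hkM := h.abs_iterate_le hd hM k
  have hM0 : 0 ≤ M := (abs_nonneg _).trans (hM 0)
  have hwm : ∀ j, Measurable fun x =>
      Λ * (lfIterate c e u k (x + (e j + e j)) - lfIterate c e u k x) := fun j =>
    ((hm.comp (measurable_id.add_const _)).sub hm).const_mul Λ
  have hwM : ∀ j x, |Λ * (lfIterate c e u k (x + (e j + e j)) - lfIterate c e u k x)| ≤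
      |Λ| * (2 * M) := fun j x => by
    rw [abs_mul]
    refine mul_le_mul_of_nonneg_left ?_ (abs_nonneg _)
    linarith [abs_sub (lfIterate c e u k (x + (e j + e j))) (lfIterate c e u k x),
      hkM (x + (e j + e j)), hkM x]
  have hi : ∀ j, ∀ r : ℝ, 1 ≤ r → Integrable fun x =>
      |Λ * (lfIterate c e u k (x + (e j + e j)) - lfIterate c e u k x)| ^ r := fun j r hr => by
    refine integrable_of_measurable_of_bound ((convexCost_rpow hr).continuous.measurable.comp (hwm j))
      (M := (|Λ| * (2 * M)) ^ r) fun x => ?_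
    rw [abs_of_nonneg (Real.rpow_nonneg (abs_nonneg _) _)]
    exact Real.rpow_le_rpow (abs_nonneg _) (hwM j x) (by linarith)
  -- For a larger exponent `r` one has `t ^ q ≤ t ^ r + 1`; each of the `d` directions contributes
  -- the constant `1` on a probability space.
  have hXq : X k q ≤ X k (p / (1 + s) ^ k) + d := by
    have : ∀ j, ∫ x, |Λ * (lfIterate c e u k (x + (e j + e j)) - lfIterate c e u k x)| ^ q ≤
        (∫ x, |Λ * (lfIterate c e u k (x + (e j + e j)) - lfIterate c e u k x)| ^
          (p / (1 + s) ^ k)) + 1 := by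
      intro j
      have i1 := hi j _ (hq.trans hqk)
      have h1 := integral_mono (hi j q hq) (integrable_add_fun i1 (integrable_const (1 : ℝ)))
        fun x => (?_ : _ ≤ |Λ * (lfIterate c e u k (x + (e j + e j)) - lfIterate c e u k x)| ^
          (p / (1 + s) ^ k) + 1)
      · rw [integral_add i1 (integrable_const _)] at h1
        simpa using h1
      · set t := |Λ * (lfIterate c e u k (x + (e j + e j)) - lfIterate c e u k x)|
        have ht : 0 ≤ t := abs_nonneg _
        rcases le_total t 1 with h | h
        · have h2 : t ^ q ≤ 1 := Real.rpow_le_one ht h (by linarith)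
          have h3 := Real.rpow_nonneg ht (p / (1 + s) ^ k)
          linarith
        · have := Real.rpow_le_rpow_of_exponent_le h hqk
          linarith
    refine (Finset.sum_le_sum fun j _ => this j).trans (le_of_eq ?_)
    rw [Finset.sum_add_distrib]; simp [hX]
  refine hXq.trans (add_le_add ((key k (hq.trans hqk)).trans ?_) le_rfl)
  refine mul_le_mul (one_add_mul_pow_le hτ.le hL hk) ?_ ?_ (Real.exp_pos _).le
  · exact add_le_add le_rfl (mul_le_mul_of_nonneg_right hk hC0)
  · exact add_nonneg (hX0 0 p) (by positivity)

/-- Discrete weak formulation. -/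
theorem GridField.integral_iterate_mul_sub (h : GridField c e τ L) (hd : 0 < d)
    (hu : Measurable u) (hM : ∀ x, |u x| ≤ M) {φ : Torus d → ℝ} (hφ : Measurable φ) {B : ℝ}
    (hB : ∀ x, |φ x| ≤ B) (k : ℕ) :
    (∫ x, lfIterate c e u k x * φ x) - ∫ x, u x * φ x = ∑ m ∈ Finset.range k,
      ((2 * (d : ℝ))⁻¹ * ∑ i, (∫ x, lfIterate c e u m x * (φ (x + e i) + φ (x - e i) - 2 * φ x)) +
       (2 * (d : ℝ))⁻¹ * ∑ i, ∫ x, lfIterate c e u m x *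
        (c m i (x + e i) * φ (x + e i) - c m i (x - e i) * φ (x - e i))) := by
  have hd' : (0 : ℝ) < d := by exact_mod_cast hd
  induction k with
  | zero => simp [lfIterate]
  | succ k ih =>
    rw [Finset.sum_range_succ, ← ih]
    have hm := h.measurable_iterate hu k
    have hui : Integrable (lfIterate c e u k) :=
      integrable_of_measurable_of_bound hm (h.abs_iterate_le hd hM k)
    rw [show lfIterate c e u (k + 1) = lfStep (c k) e (lfIterate c e u k) from rfl,
      integral_lfStep_mul (h.measurable k) (h.abs_le k) hui hφ hB]
    set v := lfIterate c e u k
    have i0 : Integrable fun x => v x * φ x := integrable_mul_bdd hui hφ.aestronglyMeasurable hB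
    have i1 : ∀ i, Integrable fun x => v x * (φ (x + e i) + φ (x - e i) - 2 * φ x) := fun i => by
      refine integrable_mul_bdd (M := B + B + 2 * B) hui ?_ fun x => ?_
      · exact (((hφ.comp (measurable_id.add_const _)).add (hφ.comp (measurable_id.sub_const _))).sub
          (hφ.const_mul 2)).aestronglyMeasurable
      · refine (abs_sub _ _).trans (add_le_add ((abs_add_le _ _).trans
          (add_le_add (hB _) (hB _))) ?_)
        rw [abs_mul, abs_two]; linarith [hB x]
    have hcφ : ∀ i x, |c k i x * φ x| ≤ B := fun i x => by
      rw [abs_mul]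
      exact (mul_le_of_le_one_left (abs_nonneg _) (h.abs_le k i x)).trans (hB x)
    have i2 : ∀ i, Integrable fun x => v x *
        (c k i (x + e i) * φ (x + e i) - c k i (x - e i) * φ (x - e i)) := fun i => by
      refine integrable_mul_bdd (M := B + B) hui ?_ fun x => ?_
      · exact ((((h.measurable k i).mul hφ).comp (measurable_id.add_const (e i))).sub
          (((h.measurable k i).mul hφ).comp (measurable_id.sub_const (e i)))).aestronglyMeasurable
      · exact (abs_sub _ _).trans (add_le_add (hcφ i _) (hcφ i _))
    have e1 : ∀ x, v x * ((2 * (d : ℝ))⁻¹ * ∑ i, ((1 - c k i (x - e i)) * φ (x - e i) +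
        (1 + c k i (x + e i)) * φ (x + e i))) = v x * φ x +
        ((2 * (d : ℝ))⁻¹ * (∑ i, v x * (φ (x + e i) + φ (x - e i) - 2 * φ x)) +
        (2 * (d : ℝ))⁻¹ * ∑ i, v x *
          (c k i (x + e i) * φ (x + e i) - c k i (x - e i) * φ (x - e i))) := fun x => by
      rw [← mul_add, ← Finset.sum_add_distrib]
      have h1 : ∀ i, (1 - c k i (x - e i)) * φ (x - e i) + (1 + c k i (x + e i)) * φ (x + e i) =
        2 * φ x + ((φ (x + e i) + φ (x - e i) - 2 * φ x) +
          (c k i (x + e i) * φ (x + e i) - c k i (x - e i) * φ (x - e i))) := fun i => by ring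
      have h2 : ∀ S : Fin d → ℝ, v x * ((2 * (d : ℝ))⁻¹ * ∑ i, (2 * φ x + S i)) =
          v x * φ x + (2 * (d : ℝ))⁻¹ * ∑ i, v x * S i := fun S => by
        rw [Finset.sum_add_distrib, ← Finset.mul_sum]
        simp only [Finset.sum_const, Finset.card_univ, Fintype.card_fin, nsmul_eq_mul]
        rw [← Finset.mul_sum]
        field_simp
      simp_rw [h1, ← mul_add]
      exact h2 _
    simp_rw [e1]
    have s1 := (integrable_sum_of_normed (s := Finset.univ) fun i _ => i1 i).const_mul
      (2 * (d : ℝ))⁻¹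
    have s2 := (integrable_sum_of_normed (s := Finset.univ) fun i _ => i2 i).const_mul
      (2 * (d : ℝ))⁻¹
    rw [integral_add i0 (integrable_add_fun s1 s2), integral_add s1 s2, integral_const_mul,
      integral_const_mul, integral_finsetSum _ fun i _ => i1 i, integral_finsetSum _ fun i _ => i2 i]
    ring

end Iterate

/-! ### Finite differences of smooth functions along the axes. -/

/-- The point at distance `h` from the origin in the `i`-th direction. -/
noncomputable def axisPoint (i : Fin d) (h : ℝ) : Torus d := proj (EuclideanSpace.single i h)

theorem axisPoint_zero (i : Fin d) : axisPoint i 0 = 0 := by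
  rw [axisPoint, ← proj_zero]
  congr 1
  ext j; simp [PiLp.single_apply]

theorem axisPoint_add (i : Fin d) (a b : ℝ) : axisPoint i (a + b) = axisPoint i a + axisPoint i b := by
  rw [axisPoint, axisPoint, axisPoint, ← proj_add]
  congr 1
  ext j; by_cases hj : j = i <;> simp [hj]

theorem axisPoint_neg (i : Fin d) (a : ℝ) : axisPoint i (-a) = -axisPoint i a := by
  rw [axisPoint, axisPoint, ← proj_neg]
  congr 1
  ext j; by_cases hj : j = i <;> simp [hj]

theorem Torus.Smooth.hasDerivAt_axis {φ : Torus d → ℝ} (hφ : Smooth φ) (i : Fin d) (x : Torus d)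
    (θ : ℝ) : HasDerivAt (fun θ => φ (x + axisPoint i θ))
      (Torus.partialDeriv i φ (x + axisPoint i θ)) θ := by
  have h := hφ.hasDerivAt_line x (EuclideanSpace.single i 1) θ
  have e : ∀ θ : ℝ, θ • EuclideanSpace.single i (1 : ℝ) = EuclideanSpace.single i θ := fun θ => by
    ext j; by_cases hj : j = i <;> simp [hj]
  simp only [e] at h
  rw [Finset.sum_eq_single i] at h
  · simpa [axisPoint] using h
  · intro j _ hj; simp [hj]
  · simp

theorem Torus.Smooth.abs_axis_sub_le {φ : Torus d → ℝ} (hφ : Smooth φ) (i : Fin d) {C : ℝ}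
    (hC : ∀ x, |Torus.partialDeriv i φ x| ≤ C) (x : Torus d) (h : ℝ) :
    |φ (x + axisPoint i h) - φ x| ≤ C * |h| := by
  have := (convex_uIcc (0 : ℝ) h).norm_image_sub_le_of_norm_hasDerivWithin_le
    (fun θ _ => (hφ.hasDerivAt_axis i x θ).hasDerivWithinAt) (fun θ _ => hC _)
    (left_mem_uIcc) (right_mem_uIcc)
  simpa [axisPoint_zero] using this

theorem Torus.Smooth.abs_axis_taylor_le {φ : Torus d → ℝ} (hφ : Smooth φ) (i : Fin d) {C : ℝ}
    (hC : ∀ x, |Torus.partialDeriv i (Torus.partialDeriv i φ) x| ≤ C) (x : Torus d) (h : ℝ) :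
    |φ (x + axisPoint i h) - φ x - h * Torus.partialDeriv i φ x| ≤ C * h ^ 2 := by
  have hC0 : 0 ≤ C := (abs_nonneg _).trans (hC 0)
  have := (convex_uIcc (0 : ℝ) h).norm_image_sub_le_of_norm_hasDerivWithin_le (C := C * |h|)
    (fun θ _ => ((hφ.hasDerivAt_axis i x θ).sub
      ((hasDerivAt_id θ).mul_const (Torus.partialDeriv i φ x))).hasDerivWithinAt)
    (fun θ hθ => by
      rw [one_mul, Real.norm_eq_abs]
      refine ((hφ.partialDeriv i).abs_axis_sub_le i hC x θ).trans ?_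
      refine mul_le_mul_of_nonneg_left ?_ hC0
      have := abs_sub_left_of_mem_uIcc hθ
      simpa using this)
    (left_mem_uIcc) (right_mem_uIcc)
  simp only [Pi.sub_apply, id, axisPoint_zero, add_zero, zero_mul, sub_zero,
    Real.norm_eq_abs] at this
  rw [mul_assoc, ← sq, sq_abs] at this
  convert! this using 2
  ring

theorem Torus.Smooth.abs_axis_second_difference_le {φ : Torus d → ℝ} (hφ : Smooth φ) (i : Fin d)
    {C : ℝ} (hC : ∀ x, |Torus.partialDeriv i (Torus.partialDeriv i φ) x| ≤ C) (x : Torus d) (h : ℝ) :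
    |φ (x + axisPoint i h) + φ (x - axisPoint i h) - 2 * φ x| ≤ 2 * C * h ^ 2 := by
  have h1 := hφ.abs_axis_taylor_le i hC x h
  have h2 := hφ.abs_axis_taylor_le i hC x (-h)
  rw [axisPoint_neg, ← sub_eq_add_neg, neg_sq] at h2
  rw [abs_le] at *
  constructor <;> linarith [h1.1, h1.2, h2.1, h2.2]

theorem Torus.Smooth.abs_axis_central_difference_le {φ : Torus d → ℝ} (hφ : Smooth φ) (i : Fin d)
    {C : ℝ} (hC : ∀ x, |Torus.partialDeriv i (Torus.partialDeriv i φ) x| ≤ C) (x : Torus d) {h : ℝ}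
    (hh : 0 < h) : |(φ (x + axisPoint i h) - φ (x - axisPoint i h)) / (2 * h) -
      Torus.partialDeriv i φ x| ≤ C * h := by
  have h1 := hφ.abs_axis_taylor_le i hC x h
  have h2 := hφ.abs_axis_taylor_le i hC x (-h)
  rw [axisPoint_neg, ← sub_eq_add_neg, neg_sq] at h2
  have h3 : |φ (x + axisPoint i h) - φ (x - axisPoint i h) - 2 * h * Torus.partialDeriv i φ x| ≤
      2 * C * h ^ 2 := by
    rw [abs_le] at *
    constructor <;> linarith [h1.1, h1.2, h2.1, h2.2]
  have e : (φ (x + axisPoint i h) - φ (x - axisPoint i h)) / (2 * h) - Torus.partialDeriv i φ x =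
      (φ (x + axisPoint i h) - φ (x - axisPoint i h) - 2 * h * Torus.partialDeriv i φ x) / (2 * h) := by
    field_simp
  rw [e, abs_div, abs_of_pos (by positivity : 0 < 2 * h), div_le_iff₀ (by positivity)]
  refine h3.trans (le_of_eq (by ring))

/-! ### Regularised fields and the velocities of the scheme. -/

open scoped Classical in
/-- Mollification of a vector field, cut off at the times at which its `L^1` norm is large. -/
noncomputable def truncField (b : Fin d → ℝ → Torus d → ℝ) (n : ℕ) (i : Fin d) (s : ℝ) :
    Torus d → ℝ :=
  if ∀ i, ∫ x, |b i s x| ≤ n then conv (mollifier n) (b i s) else fun _ => 0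

section TruncField

variable {b : Fin d → ℝ → Torus d → ℝ} {G : Fin d → Fin d → ℝ → Torus d → ℝ}

theorem partialDeriv_zero (i : Fin d) : Torus.partialDeriv i (fun _ : Torus d => (0 : ℝ)) = 0 := by
  ext x; simp [Torus.partialDeriv]

theorem TransportField.truncField_smooth (h : TransportField b G) (hd : Nonempty (Fin d)) (n : ℕ)
    (i : Fin d) (s : ℝ) : Smooth (truncField b n i s) := by
  unfold truncField
  split_ifs
  · exact conv_smooth (mollifier_smooth n) (h.integrable_slice hd s i)
  · exact smooth_const 0

theorem TransportField.measurableSet_trunc (h : TransportField b G) (n : ℕ) :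
    MeasurableSet {s | ∀ i, ∫ x, |b i s x| ≤ n} := by
  have : {s | ∀ i, ∫ x, |b i s x| ≤ n} = ⋂ i, {s | ∫ x, |b i s x| ≤ n} := by ext; simp
  rw [this]
  exact MeasurableSet.iInter fun i => measurableSet_le
    ((h.measurable i).abs.stronglyMeasurable.integral_prod_right
      (f := fun s x => |b i s x|)).measurable measurable_const

theorem TransportField.measurable_truncField (h : TransportField b G) (n : ℕ) (i : Fin d) :
    Measurable (Function.uncurry (truncField b n i)) := by
  classical
  have : Function.uncurry (truncField b n i) = fun p : ℝ × Torus d =>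
      if p.1 ∈ {s | ∀ i, ∫ x, |b i s x| ≤ n} then
        (Function.uncurry fun s x => conv (mollifier n) (b i s) x) p else 0 := by
    ext ⟨s, x⟩
    simp only [Function.uncurry_apply_pair, truncField, mem_ofPred_eq]
    split_ifs <;> rfl
  rw [this]
  exact Measurable.ite ((h.measurableSet_trunc n).preimage measurable_fst)
    (measurable_conv (mollifier_smooth n).continuous.measurable (h.measurable i)) measurable_const

/-- Derivatives fall on the kernel at the cost of the `L^1` norm of `b i s`, which the cut-off keeps
below `n`. The bounds are therefore uniform in time although `b` is merely integrable in time; the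
stability condition of the scheme requires this. -/
theorem TransportField.exists_truncField_bound (h : TransportField b G) (hd : Nonempty (Fin d))
    (n : ℕ) : ∃ C, 0 ≤ C ∧ ∀ i s x, |truncField b n i s x| ≤ C ∧
      ∀ j, |Torus.partialDeriv j (truncField b n i s) x| ≤ C ∧
        ∀ l, |Torus.partialDeriv l (Torus.partialDeriv j (truncField b n i s)) x| ≤ C := by
  have hk := mollifier_smooth (d := d) n
  obtain ⟨C0, h00, h0⟩ := hk.exists_bound
  choose C1 h10 h1 using fun j => (hk.partialDeriv j).exists_bound
  choose C2 h20 h2 using fun l j => ((hk.partialDeriv j).partialDeriv l).exists_bound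
  set S := C0 + ∑ j, C1 j + ∑ l, ∑ j, C2 l j with hS
  have hs1 : ∀ j, C1 j ≤ ∑ j, C1 j := fun j =>
    Finset.single_le_sum (f := C1) (fun j _ => h10 j) (Finset.mem_univ j)
  have hs2 : ∀ l j, C2 l j ≤ ∑ l, ∑ j, C2 l j := fun l j =>
    (Finset.single_le_sum (f := fun j => C2 l j) (fun j _ => h20 l j) (Finset.mem_univ j)).trans
      (Finset.single_le_sum (f := fun l => ∑ j, C2 l j)
        (fun l _ => Finset.sum_nonneg fun j _ => h20 l j) (Finset.mem_univ l))
  have hp1 : 0 ≤ ∑ j, C1 j := Finset.sum_nonneg fun j _ => h10 j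
  have hp2 : 0 ≤ ∑ l, ∑ j, C2 l j := Finset.sum_nonneg fun l _ => Finset.sum_nonneg fun j _ => h20 l j
  have hSn : 0 ≤ S * n := by positivity
  refine ⟨S * n, hSn, fun i s x => ?_⟩
  by_cases hs : ∀ i, ∫ x, |b i s x| ≤ n
  · have hbi := h.integrable_slice hd s i
    have e0 : truncField b n i s = conv (mollifier n) (b i s) := by simp only [truncField, hs]; simp
    have e1 : ∀ j, Torus.partialDeriv j (truncField b n i s) =
        conv (Torus.partialDeriv j (mollifier n)) (b i s) := fun j => by
      rw [e0]; exact funext fun x => partialDeriv_conv hk hbi j x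
    have e2 : ∀ l j, Torus.partialDeriv l (Torus.partialDeriv j (truncField b n i s)) =
        conv (Torus.partialDeriv l (Torus.partialDeriv j (mollifier n))) (b i s) := fun l j => by
      rw [e1]; exact funext fun x => partialDeriv_conv (hk.partialDeriv j) hbi l x
    have key : ∀ (k : Torus d → ℝ) (A : ℝ), (∀ x, |k x| ≤ A) → A ≤ S → |conv k (b i s) x| ≤ S * n :=
      fun k A hA hAS => (abs_conv_le hA hbi x).trans (mul_le_mul hAS (hs i)
        (integral_nonneg fun _ => abs_nonneg _) (by positivity))
    refine ⟨?_, fun j => ⟨?_, fun l => ?_⟩⟩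
    · rw [e0]; exact key _ _ h0 (by linarith)
    · rw [e1]; exact key _ _ (h1 j) (by linarith [hs1 j])
    · rw [e2]; exact key _ _ (h2 l j) (by linarith [hs2 l j])
  · have e0 : truncField b n i s = fun _ => 0 := by simp only [truncField, hs]; simp
    refine ⟨?_, fun j => ⟨?_, fun l => ?_⟩⟩
    · rw [e0]; simpa using hSn
    · rw [e0, partialDeriv_zero]; simpa using hSn
    · rw [e0, partialDeriv_zero]
      change |Torus.partialDeriv l (fun _ => (0 : ℝ)) x| ≤ _
      rw [partialDeriv_zero]; simpa using hSn

theorem TransportField.partialDeriv_truncField (h : TransportField b G) (hd : Nonempty (Fin d))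
    (n : ℕ) (i j : Fin d) (s : ℝ) (hs : ∀ i, ∫ x, |b i s x| ≤ n) (x : Torus d) :
    Torus.partialDeriv j (truncField b n i s) x = conv (mollifier n) (G i j s) x := by
  have e0 : truncField b n i s = conv (mollifier n) (b i s) := by simp only [truncField, hs]; simp
  rw [e0, partialDeriv_conv (mollifier_smooth n) (h.integrable_slice hd s i),
    (h.isWeakPartial s i j).conv_partialDeriv (mollifier_smooth n)]

theorem TransportField.sum_partialDeriv_truncField (h : TransportField b G) (hd : Nonempty (Fin d))
    (n : ℕ) (s : ℝ) (hs : ∀ i, ∫ x, |b i s x| ≤ n) (x : Torus d) :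
    ∑ i, Torus.partialDeriv i (truncField b n i s) x =
      conv (mollifier n) (fun x => ∑ i, G i i s x) x := by
  simp_rw [h.partialDeriv_truncField hd n _ _ s hs]
  have := conv_sum (s := Finset.univ) (mollifier_smooth n)
    (fun i => (h.isWeakPartial s i i).integrable_deriv) (fun _ => (1 : ℝ)) x
  simpa using this.symm

theorem TransportField.sum_partialDeriv_truncField_le (h : TransportField b G)
    (hd : Nonempty (Fin d)) {L : ℝ} (hL0 : 0 ≤ L) (hL : ∀ s, ∀ᵐ x, |∑ i, G i i s x| ≤ L) (n : ℕ)
    (s : ℝ) (x : Torus d) : |∑ i, Torus.partialDeriv i (truncField b n i s) x| ≤ L := by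
  by_cases hs : ∀ i, ∫ x, |b i s x| ≤ n
  · rw [h.sum_partialDeriv_truncField hd n s hs]
    exact abs_conv_le_of_bound (mollifier_smooth n) (mollifier_nonneg n) (integral_mollifier n)
      (hL s) x
  · have e0 : ∀ i, truncField b n i s = fun _ => 0 := fun i => by
      simp only [truncField, hs]; simp
    simp only [e0, partialDeriv_zero]
    simpa using hL0

/-- The exponential bound passes to difference quotients of the truncated field. -/
theorem TransportField.lintegral_exp_truncField_le (h : TransportField b G) {δ K : ℝ} (hδ : 0 < δ)
    (hK : ∀ s i j, ∫⁻ x, ENNReal.ofReal (Real.exp (1 / δ * |G i j s x|)) ≤ ENNReal.ofReal K)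
    (n : ℕ) (i j : Fin d) (s : ℝ) {η : ℝ} (hη : 0 < η) :
    ∫⁻ x, ENNReal.ofReal (Real.exp (1 / (η * δ) *
      |truncField b n i s (x + axisPoint j η) - truncField b n i s x|)) ≤ ENNReal.ofReal K := by
  by_cases hs : ∀ i, ∫ x, |b i s x| ≤ n
  · have e0 : truncField b n i s = conv (mollifier n) (b i s) := by simp only [truncField, hs]; simp
    rw [e0]
    have := lintegral_cost_conv_translate_le (convexCost_exp (c := 1 / (η * δ)) (by positivity))
      (mollifier_smooth n) (mollifier_nonneg n) (integral_mollifier n) (h.isWeakPartial s i)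
      (EuclideanSpace.single j η)
    refine this.trans (le_trans (le_of_eq ?_) (hK s i j))
    refine lintegral_congr fun x => ?_
    rw [Finset.sum_eq_single j]
    · simp only [PiLp.single_apply, if_true]
      rw [abs_mul, abs_of_pos hη]
      congr 2; field_simp
    · intro l _ hl; simp [hl]
    · simp
  · have e0 : truncField b n i s = fun _ => 0 := by simp only [truncField, hs]; simp
    rw [e0]
    refine le_trans (lintegral_mono fun x => ENNReal.ofReal_le_ofReal ?_) (hK s i j)
    simp only [sub_self, abs_zero, mul_zero, Real.exp_zero]
    exact Real.one_le_exp (by positivity)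

/-- The velocities of the scheme with step sizes `h` and `τ`. -/
noncomputable def gridVelocity (b : Fin d → ℝ → Torus d → ℝ) (n : ℕ) (h τ : ℝ) (k : ℕ) (i : Fin d)
    (x : Torus d) : ℝ :=
  d / h * ∫ s in (k * τ)..((k + 1) * τ), truncField b n i s x

end TruncField

/-- The adjoint of the transport operator, applied to `φ`. -/
noncomputable def transportTest (b : Fin d → ℝ → Torus d → ℝ) (G : Fin d → Fin d → ℝ → Torus d → ℝ)
    (φ : Torus d → ℝ) (s : ℝ) (x : Torus d) : ℝ :=
  (∑ i, b i s x * Torus.partialDeriv i φ x) + (∑ i, G i i s x) * φ x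

/-- The discretization of `transportTest`. -/
noncomputable def discreteTest (b : Fin d → ℝ → Torus d → ℝ) (n : ℕ) (h : ℝ) (φ : Torus d → ℝ) (s : ℝ)
    (x : Torus d) : ℝ :=
  ∑ i, (truncField b n i s (x + axisPoint i h) * φ (x + axisPoint i h) -
    truncField b n i s (x - axisPoint i h) * φ (x - axisPoint i h)) / (2 * h)

section GridVelocity

variable {b : Fin d → ℝ → Torus d → ℝ} {G : Fin d → Fin d → ℝ → Torus d → ℝ}

theorem gridVelocity_eq (b : Fin d → ℝ → Torus d → ℝ) (n : ℕ) (h : ℝ) {τ : ℝ} (hτ : 0 ≤ τ) (k : ℕ)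
    (i : Fin d) (x : Torus d) : gridVelocity b n h τ k i x =
      d / h * ∫ s in Ioc (k * τ) ((k + 1) * τ), truncField b n i s x := by
  rw [gridVelocity, intervalIntegral.integral_of_le (by nlinarith)]

theorem TransportField.integrable_truncField_slice (hF : TransportField b G) {n : ℕ} {C : ℝ}
    (hC : ∀ i s x, |truncField b n i s x| ≤ C) (i : Fin d) (x : Torus d) (a c : ℝ) :
    Integrable (fun s => truncField b n i s x) (volume.restrict (Ioc a c)) :=
  integrable_of_measurable_of_bound
    ((hF.measurable_truncField n i).comp (measurable_id.prodMk measurable_const)) fun s => hC i s x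

theorem TransportField.measurable_gridVelocity (hF : TransportField b G) (n : ℕ) (h : ℝ) {τ : ℝ}
    (hτ : 0 ≤ τ) (k : ℕ) (i : Fin d) : Measurable (gridVelocity b n h τ k i) := by
  have : gridVelocity b n h τ k i = fun x => d / h *
      ∫ s in Ioc (k * τ) ((k + 1) * τ), truncField b n i s x :=
    funext fun x => gridVelocity_eq b n h hτ k i x
  rw [this]
  exact ((hF.measurable_truncField n i).stronglyMeasurable.integral_prod_left
    (f := truncField b n i)).measurable.const_mul _

/-- The factor `d / h` in `gridVelocity` cancels the weight `(2 d)⁻¹` of the scheme and produces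
centred difference quotients, integrated over a time cell. -/
theorem TransportField.gridVelocity_sub (hF : TransportField b G) (hd : Nonempty (Fin d)) {n : ℕ}
    {C : ℝ} (hC : ∀ i s x, |truncField b n i s x| ≤ C) {h τ : ℝ} (hτ : 0 ≤ τ)
    (k : ℕ) (i : Fin d) (x y : Torus d) :
    (2 * (d : ℝ))⁻¹ * (gridVelocity b n h τ k i x - gridVelocity b n h τ k i y) =
      ∫ s in Ioc (k * τ) ((k + 1) * τ), (truncField b n i s x - truncField b n i s y) / (2 * h) := by
  have hd' : (d : ℝ) ≠ 0 := by
    have := Fin.pos hd.some; positivity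
  rw [gridVelocity_eq b n h hτ, gridVelocity_eq b n h hτ, integral_div,
    integral_sub (hF.integrable_truncField_slice hC i x _ _)
      (hF.integrable_truncField_slice hC i y _ _)]
  field_simp

theorem volume_real_step {τ : ℝ} (hτ : 0 ≤ τ) (k : ℕ) :
    (volume.real (Ioc (k * τ) ((k + 1) * τ))) = τ := by
  rw [Real.volume_real_Ioc_of_le (by nlinarith)]; ring

/-- The condition `d τ C ≤ h` is the CFL condition. The discrete divergence differs from the true
one by at most `d C h ≤ 1`, which explains `L + 1`. -/
theorem TransportField.gridField (hF : TransportField b G) (hd : Nonempty (Fin d)) {n : ℕ}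
    {C L : ℝ} (hL0 : 0 ≤ L) (hL : ∀ s, ∀ᵐ x, |∑ i, G i i s x| ≤ L)
    (hC : ∀ i s x, |truncField b n i s x| ≤ C)
    (hC2 : ∀ i s x, |Torus.partialDeriv i (Torus.partialDeriv i (truncField b n i s)) x| ≤ C)
    {h τ : ℝ} (hh : 0 < h) (hτ : 0 < τ) (hcfl : d * τ * C ≤ h) (hdiv : d * C * h ≤ 1) :
    GridField (gridVelocity b n h τ) (fun i => axisPoint i h) τ (L + 1) where
  measurable k i := hF.measurable_gridVelocity n h hτ.le k i
  abs_le k i x := by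
    rw [gridVelocity_eq b n h hτ.le, abs_mul, abs_of_nonneg (by positivity)]
    have := norm_setIntegral_le_of_norm_le_const (μ := volume) (s := Ioc (k * τ) ((k + 1) * τ))
      (f := fun s => truncField b n i s x) (C := C) measure_Ioc_lt_top fun s _ => hC i s x
    rw [volume_real_step hτ.le, Real.norm_eq_abs] at this
    calc _ ≤ d / h * (C * τ) := mul_le_mul_of_nonneg_left this (by positivity)
      _ = d * τ * C / h := by ring
      _ ≤ 1 := (div_le_one hh).2 hcfl
  div_le k x := by
    rw [Finset.mul_sum]
    simp_rw [hF.gridVelocity_sub hd hC hτ.le]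
    have hi : ∀ i, Integrable (fun s => (truncField b n i s (x + axisPoint i h) -
        truncField b n i s (x - axisPoint i h)) / (2 * h))
        (volume.restrict (Ioc (k * τ) ((k + 1) * τ))) := fun i =>
      ((hF.integrable_truncField_slice hC i _ _ _).sub
        (hF.integrable_truncField_slice hC i _ _ _)).div_const _
    rw [← integral_finsetSum _ fun i _ => hi i]
    have hle : ∀ s, ∑ i, (truncField b n i s (x + axisPoint i h) -
        truncField b n i s (x - axisPoint i h)) / (2 * h) ≤ L + 1 := by
      intro s
      have h1 := (le_abs_self _).trans (hF.sum_partialDeriv_truncField_le hd hL0 hL n s x)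
      have h2 : ∀ i, (truncField b n i s (x + axisPoint i h) -
          truncField b n i s (x - axisPoint i h)) / (2 * h) -
          Torus.partialDeriv i (truncField b n i s) x ≤ C * h := fun i =>
        (le_abs_self _).trans ((hF.truncField_smooth hd n i s).abs_axis_central_difference_le i
          (hC2 i s) x hh)
      have h3 := sum_fin_le h2
      rw [Finset.sum_sub_distrib] at h3
      linarith
    refine (integral_mono (integrable_sum_of_normed fun i _ => hi i) (integrable_const (L + 1))
      hle).trans (le_of_eq ?_)
    simp only [integral_const, MeasurableSet.univ, measureReal_restrict_apply, univ_inter,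
      smul_eq_mul]
    rw [volume_real_step hτ.le]

/-- The velocity is an average of `b` in time and space, and its increment over `2 h` an average of
`∇b` along a segment. Jensen's inequality for the exponential carries the moment bound through all
three averages. -/
theorem TransportField.integral_exp_gridVelocity_le (hF : TransportField b G)
    (hd : Nonempty (Fin d)) {n : ℕ} {C : ℝ} (hC : ∀ i s x, |truncField b n i s x| ≤ C) {δ K : ℝ}
    (hδ : 0 < δ) (hK0 : 0 ≤ K)
    (hK : ∀ s i j, ∫⁻ x, ENNReal.ofReal (Real.exp (1 / δ * |G i j s x|)) ≤ ENNReal.ofReal K)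
    {h τ : ℝ} (hh : 0 < h) (hτ : 0 < τ) (k : ℕ) (i j : Fin d) :
    ∫ x, Real.exp (|(2 * (d : ℝ))⁻¹ * (gridVelocity b n h τ k i (x + (axisPoint j h + axisPoint j h)) -
      gridVelocity b n h τ k i x)| / τ / δ) ≤ K := by
  set I := Ioc ((k : ℝ) * τ) ((k + 1) * τ) with hI
  have hvol : volume I = ENNReal.ofReal τ := by
    rw [hI, Real.volume_Ioc]; congr 1; ring
  have hvol0 : volume I ≠ 0 := by rw [hvol]; simpa using hτ
  -- Normalised measure on the time cell; its mass `τ` accounts for the division by `τ` in the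
  -- exponent.
  set P : Measure ℝ := (volume I)⁻¹ • volume.restrict I with hP
  have hPp : IsProbabilityMeasure P := by
    constructor
    rw [hP, Measure.smul_apply, Measure.restrict_apply_univ, smul_eq_mul]
    exact ENNReal.inv_mul_cancel hvol0 (by rw [hvol]; exact ENNReal.ofReal_ne_top)
  set a : ℝ → Torus d → ℝ := fun s x =>
    truncField b n i s (x + axisPoint j (h + h)) - truncField b n i s x with ha
  have ham : Measurable (Function.uncurry a) := by
    refine Measurable.sub ?_ (hF.measurable_truncField n i)
    exact (hF.measurable_truncField n i).comp (measurable_fst.prodMk (measurable_snd.add_const _))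
  have key := (convexCost_exp (c := 1 / ((h + h) * δ)) (by positivity)).lintegral_integral_le
    (P := P) (μ := (volume : Measure (Torus d))) (a := a) ham.aestronglyMeasurable
  have hb : ∫⁻ s, ∫⁻ x, ENNReal.ofReal (Real.exp (1 / ((h + h) * δ) * |a s x|)) ∂volume ∂P ≤
      ENNReal.ofReal K := by
    refine (lintegral_mono fun s => hF.lintegral_exp_truncField_le hδ hK n i j s
      (show 0 < h + h by positivity)).trans ?_
    simp
  have e1 : ∀ x, Real.exp (|(2 * (d : ℝ))⁻¹ * (gridVelocity b n h τ k i
      (x + (axisPoint j h + axisPoint j h)) - gridVelocity b n h τ k i x)| / τ / δ) =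
      Real.exp (1 / ((h + h) * δ) * |∫ s, a s x ∂P|) := by
    intro x
    rw [hF.gridVelocity_sub hd hC hτ.le, ← axisPoint_add, hP, integral_smul_measure, hvol,
      ENNReal.toReal_inv, ENNReal.toReal_ofReal hτ.le, integral_div, smul_eq_mul, abs_mul, abs_div,
      abs_of_pos (inv_pos.2 hτ), abs_of_pos (by positivity : 0 < 2 * h)]
    change Real.exp (|∫ s in I, a s x| / (2 * h) / τ / δ) =
      Real.exp (1 / ((h + h) * δ) * (τ⁻¹ * |∫ s in I, a s x|))
    congr 1
    field_simp
    ring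
  simp_rw [e1]
  have him : Measurable fun x => Real.exp (1 / ((h + h) * δ) * |∫ s, a s x ∂P|) :=
    Real.measurable_exp.comp ((ham.stronglyMeasurable.integral_prod_left
      (f := a)).measurable.abs.const_mul _)
  have hle := key.trans hb
  rw [integral_eq_lintegral_of_nonneg_ae (ae_of_all _ fun x => (Real.exp_pos _).le)
    him.aestronglyMeasurable]
  exact ENNReal.toReal_le_of_le_ofReal hK0 hle

theorem TransportField.integrable_transportTest (hF : TransportField b G) {φ : Torus d → ℝ}
    (hφ : Smooth φ) (A : Set ℝ) [IsFiniteMeasure (volume.restrict A)] :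
    Integrable (Function.uncurry (transportTest b G φ)) ((volume.restrict A).prod volume) := by
  obtain ⟨L, hL0, hL⟩ := hF.div_bound
  obtain ⟨C, -, hC⟩ := hφ.exists_bound
  refine integrable_add_fun (integrable_sum_of_normed fun i _ => ?_) ?_
  · obtain ⟨C, -, hC⟩ := (hφ.partialDeriv i).exists_bound
    exact integrable_mul_bdd (hF.integrable_restrict A i)
      ((hφ.partialDeriv i).continuous.measurable.comp measurable_snd).aestronglyMeasurable
      fun p => hC p.2
  · exact integrable_mul_bdd (Integrable.of_bound hF.measurable_div.aestronglyMeasurable L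
      (hF.ae_div_le hL _)) (hφ.continuous.measurable.comp measurable_snd).aestronglyMeasurable
      fun p => hC p.2

theorem TransportField.integrable_transportTest_slice (hF : TransportField b G)
    (hd : Nonempty (Fin d)) {φ : Torus d → ℝ} (hφ : Smooth φ) (s : ℝ) :
    Integrable (transportTest b G φ s) := by
  refine integrable_add_fun (integrable_sum_of_normed fun i _ => ?_) ?_
  · simpa only [mul_comm] using (hφ.partialDeriv i).integrable_mul (hF.integrable_slice hd s i)
  · simpa only [mul_comm] using hφ.integrable_mul (integrable_sum_of_normed (s := Finset.univ)
      fun i _ => (hF.isWeakPartial s i i).integrable_deriv)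

theorem TransportField.measurable_transportTest (hF : TransportField b G) {φ : Torus d → ℝ}
    (hφ : Smooth φ) : Measurable (Function.uncurry (transportTest b G φ)) := by
  have e : Function.uncurry (transportTest b G φ) = fun p : ℝ × Torus d =>
    (∑ i, Function.uncurry (b i) p * Torus.partialDeriv i φ p.2) +
      (Function.uncurry fun s x => ∑ i, G i i s x) p * φ p.2 := rfl
  rw [e]
  exact (Finset.measurable_sum _ fun i _ => (hF.measurable i).mul
    ((hφ.partialDeriv i).continuous.measurable.comp measurable_snd)).add
    (hF.measurable_div.mul (hφ.continuous.measurable.comp measurable_snd))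

theorem TransportField.measurable_discreteTest (hF : TransportField b G) (n : ℕ) (h : ℝ)
    {φ : Torus d → ℝ} (hφ : Smooth φ) : Measurable (Function.uncurry (discreteTest b n h φ)) := by
  have hm : ∀ (i : Fin d) (a : Torus d), Measurable fun p : ℝ × Torus d =>
      truncField b n i p.1 (p.2 + a) * φ (p.2 + a) := fun i a =>
    ((hF.measurable_truncField n i).comp (measurable_fst.prodMk (measurable_snd.add_const a))).mul
      (hφ.continuous.measurable.comp (measurable_snd.add_const a))
  have e : Function.uncurry (discreteTest b n h φ) = fun p : ℝ × Torus d =>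
      ∑ i, (truncField b n i p.1 (p.2 + axisPoint i h) * φ (p.2 + axisPoint i h) -
        truncField b n i p.1 (p.2 - axisPoint i h) * φ (p.2 - axisPoint i h)) / (2 * h) := rfl
  rw [e]
  refine Finset.measurable_sum _ fun i _ => ?_
  refine ((hm i (axisPoint i h)).sub ?_).div_const _
  simpa only [sub_eq_add_neg] using hm i (-axisPoint i h)

theorem TransportField.integrable_discreteTest (hF : TransportField b G) {n : ℕ} {C : ℝ}
    (hC : ∀ i s x, |truncField b n i s x| ≤ C) (h : ℝ) {φ : Torus d → ℝ}
    (hφ : Smooth φ) (A : Set ℝ) [IsFiniteMeasure (volume.restrict A)] :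
    Integrable (Function.uncurry (discreteTest b n h φ)) ((volume.restrict A).prod volume) := by
  obtain ⟨B, hB0, hB⟩ := hφ.exists_bound
  refine integrable_of_measurable_of_bound (hF.measurable_discreteTest n h hφ)
    (M := ∑ _i : Fin d, (C * B + C * B) / |2 * h|) fun p => ?_
  change |∑ i, (truncField b n i p.1 (p.2 + axisPoint i h) * φ (p.2 + axisPoint i h) -
        truncField b n i p.1 (p.2 - axisPoint i h) * φ (p.2 - axisPoint i h)) / (2 * h)| ≤ _
  refine (Finset.abs_sum_le_sum_abs _ _).trans (Finset.sum_le_sum fun i _ => ?_)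
  rw [abs_div]
  refine div_le_div_of_nonneg_right ((abs_sub _ _).trans (add_le_add ?_ ?_)) (abs_nonneg _)
  · rw [abs_mul]
    exact mul_le_mul (hC _ _ _) (hB _) (abs_nonneg _) ((abs_nonneg _).trans (hC i 0 0))
  · rw [abs_mul]
    exact mul_le_mul (hC _ _ _) (hB _) (abs_nonneg _) ((abs_nonneg _).trans (hC i 0 0))

theorem TransportField.sum_integral_gridVelocity (hF : TransportField b G) (hd : Nonempty (Fin d))
    {n : ℕ} {C : ℝ} (hC : ∀ i s x, |truncField b n i s x| ≤ C) {h τ : ℝ} (hτ : 0 ≤ τ) (k : ℕ)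
    {φ v : Torus d → ℝ} (hφ : Smooth φ) (hv : Measurable v) {M : ℝ} (hM : ∀ x, |v x| ≤ M) :
    (2 * (d : ℝ))⁻¹ * ∑ i, ∫ x, v x *
      (gridVelocity b n h τ k i (x + axisPoint i h) * φ (x + axisPoint i h) -
        gridVelocity b n h τ k i (x - axisPoint i h) * φ (x - axisPoint i h)) =
    ∫ s in Ioc (k * τ) ((k + 1) * τ), ∫ x, v x * discreteTest b n h φ s x := by
  have hd' : (d : ℝ) ≠ 0 := by
    have := Fin.pos hd.some; positivity
  obtain ⟨B, hB0, hB⟩ := hφ.exists_bound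
  set I := Ioc ((k : ℝ) * τ) ((k + 1) * τ) with hI
  have iQ : Integrable (Function.uncurry fun s x => v x * discreteTest b n h φ s x)
      ((volume.restrict I).prod volume) :=
    integrable_bdd_mul (hv.comp measurable_snd).aestronglyMeasurable (fun p => hM p.2)
      (hF.integrable_discreteTest hC h hφ I)
  rw [integral_integral_swap iQ]
  have e1 : ∀ i x, gridVelocity b n h τ k i x * φ x =
      d / h * ∫ s in I, truncField b n i s x * φ x := fun i x => by
    rw [gridVelocity_eq b n h hτ, integral_mul_const, mul_assoc]
  have is : ∀ i x, Integrable (fun s => truncField b n i s x * φ x) (volume.restrict I) :=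
    fun i x => (hF.integrable_truncField_slice hC i x _ _).mul_const _
  have iv : Integrable v := integrable_of_measurable_of_bound hv hM
  have hgm : ∀ i, Measurable (gridVelocity b n h τ k i) := fun i =>
    hF.measurable_gridVelocity n h hτ k i
  have hgb : ∀ i x, |gridVelocity b n h τ k i x * φ x| ≤ |d / h| * (C * τ) * B := fun i x => by
    rw [gridVelocity_eq b n h hτ, abs_mul, abs_mul]
    have := norm_setIntegral_le_of_norm_le_const (μ := volume) (s := I)
      (f := fun s => truncField b n i s x) (C := C) measure_Ioc_lt_top fun s _ => hC i s x
    rw [hI, volume_real_step hτ, Real.norm_eq_abs] at this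
    refine mul_le_mul (mul_le_mul_of_nonneg_left this (abs_nonneg _)) (hB x) (abs_nonneg _) ?_
    exact mul_nonneg (abs_nonneg _) ((abs_nonneg _).trans this)
  have ig : ∀ i, Integrable fun x => v x *
      (gridVelocity b n h τ k i (x + axisPoint i h) * φ (x + axisPoint i h) -
        gridVelocity b n h τ k i (x - axisPoint i h) * φ (x - axisPoint i h)) := fun i => by
    refine integrable_mul_bdd iv ?_ fun x => (abs_sub _ _).trans (add_le_add (hgb i _) (hgb i _))
    exact ((((hgm i).mul hφ.continuous.measurable).comp (measurable_id.add_const (axisPoint i h))).sub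
      (((hgm i).mul hφ.continuous.measurable).comp
        (measurable_id.sub_const (axisPoint i h)))).aestronglyMeasurable
  rw [← integral_finsetSum _ fun i _ => ig i, ← integral_const_mul]
  refine integral_congr_ae (ae_of_all _ fun x => ?_)
  simp only [e1]
  rw [integral_const_mul, ← Finset.mul_sum, mul_left_comm]
  congr 1
  simp only [discreteTest]
  rw [integral_finsetSum _ fun i _ => (integrable_sub_fun (is i _) (is i _)).div_const _, Finset.mul_sum]
  refine Finset.sum_congr rfl fun i _ => ?_
  rw [integral_div, integral_sub (is i _) (is i _)]
  have halg : ∀ A B : ℝ, (2 * (d : ℝ))⁻¹ * (d / h * A - d / h * B) = (A - B) / (2 * h) :=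
    fun A B => by field_simp
  exact halg _ _

end GridVelocity

/-! ### Consistency of the scheme. -/

theorem Torus.Smooth.abs_second_partialDeriv_mul_le {f g : Torus d → ℝ} (hf : Smooth f)
    (hg : Smooth g) {C B : ℝ} (i : Fin d) (hf0 : ∀ x, |f x| ≤ C)
    (hf1 : ∀ x, |Torus.partialDeriv i f x| ≤ C)
    (hf2 : ∀ x, |Torus.partialDeriv i (Torus.partialDeriv i f) x| ≤ C) (hg0 : ∀ x, |g x| ≤ B)
    (hg1 : ∀ x, |Torus.partialDeriv i g x| ≤ B)
    (hg2 : ∀ x, |Torus.partialDeriv i (Torus.partialDeriv i g) x| ≤ B) (x : Torus d) :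
    |Torus.partialDeriv i (Torus.partialDeriv i fun x => f x * g x) x| ≤ 4 * C * B := by
  have h1 : Torus.partialDeriv i (fun x => f x * g x) = fun x =>
      Torus.partialDeriv i f x * g x + f x * Torus.partialDeriv i g x :=
    funext fun x => hf.partialDeriv_mul hg i x
  have h2 : Torus.partialDeriv i (fun x => Torus.partialDeriv i f x * g x +
      f x * Torus.partialDeriv i g x) x =
      Torus.partialDeriv i (fun x => Torus.partialDeriv i f x * g x) x +
        Torus.partialDeriv i (fun x => f x * Torus.partialDeriv i g x) x :=
    ((((hf.partialDeriv i).mul hg).hasDerivAt_partialDeriv i x).add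
      ((hf.mul (hg.partialDeriv i)).hasDerivAt_partialDeriv i x)).deriv
  rw [h1, h2, (hf.partialDeriv i).partialDeriv_mul hg, hf.partialDeriv_mul (hg.partialDeriv i)]
  have hC : 0 ≤ C := (abs_nonneg _).trans (hf0 0)
  have key : ∀ a b : ℝ, |a| ≤ C → |b| ≤ B → |a * b| ≤ C * B := fun a b ha hb => by
    rw [abs_mul]; exact mul_le_mul ha hb (abs_nonneg _) hC
  have k1 := key _ _ (hf2 x) (hg0 x)
  have k2 := key _ _ (hf1 x) (hg1 x)
  have k3 := key _ _ (hf0 x) (hg2 x)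
  rw [abs_le] at *
  constructor <;> linarith [k1.1, k1.2, k2.1, k2.2, k3.1, k3.2]

section Consistency

variable {b : Fin d → ℝ → Torus d → ℝ} {G : Fin d → Fin d → ℝ → Torus d → ℝ}

theorem measurable_path {w : ℕ → Torus d → ℝ} (hw : ∀ k, Measurable (w k)) (τ : ℝ) :
    Measurable (Function.uncurry fun (s : ℝ) x => w ⌊s / τ⌋₊ x) := by
  have h1 : Measurable (Function.uncurry w) := measurable_from_prod_countable_right hw
  exact h1.comp ((Nat.measurable_floor.comp (measurable_fst.div_const τ)).prodMk measurable_snd)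

/-- Each step contributes a second difference of `φ`, of size `h ^ 2` and due to the numerical
viscosity, and the `L^1` distance between the discrete and the exact adjoint operator over one time
cell. -/
theorem TransportField.scheme_consistency (hF : TransportField b G) (hd : Nonempty (Fin d))
    {n : ℕ} {C L h τ : ℝ} (hC : ∀ i s x, |truncField b n i s x| ≤ C)
    (hg : GridField (gridVelocity b n h τ) (fun i => axisPoint i h) τ L) (hτ : 0 < τ)
    {u : Torus d → ℝ} {M : ℝ} (hu : Measurable u) (hM : ∀ x, |u x| ≤ M) {φ : Torus d → ℝ}
    (hφ : Smooth φ) {B : ℝ}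
    (hB : ∀ i x, |Torus.partialDeriv i (Torus.partialDeriv i φ) x| ≤ B) (k : ℕ) :
    |(∫ x, lfIterate (gridVelocity b n h τ) (fun i => axisPoint i h) u k x * φ x) - (∫ x, u x * φ x) -
      ∫ s in (0 : ℝ)..(k * τ), ∫ x, lfIterate (gridVelocity b n h τ) (fun i => axisPoint i h) u
        ⌊s / τ⌋₊ x * transportTest b G φ s x| ≤
      M * (k * (B * h ^ 2) + ∫ s in (0 : ℝ)..(k * τ), ∫ x,
        |discreteTest b n h φ s x - transportTest b G φ s x|) := by
  have hd0 : 0 < d := Fin.pos hd.some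
  have hd' : (0 : ℝ) < d := by exact_mod_cast hd0
  have hM0 : 0 ≤ M := (abs_nonneg _).trans (hM 0)
  have hB0 : 0 ≤ B := (abs_nonneg _).trans (hB hd.some 0)
  obtain ⟨B0, hB00, hB0'⟩ := hφ.exists_bound
  set w := lfIterate (gridVelocity b n h τ) (fun i => axisPoint i h) u with hw
  have hwm : ∀ k, Measurable (w k) := fun k => hg.measurable_iterate hu k
  have hwM : ∀ k x, |w k x| ≤ M := fun k x => hg.abs_iterate_le hd0 hM k x
  have hpm := measurable_path hwm τ
  have iF : ∀ a c : ℝ, Integrable (Function.uncurry (transportTest b G φ))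
      ((volume.restrict (Ioc a c)).prod volume) := fun a c => hF.integrable_transportTest hφ _
  have iQ : ∀ a c : ℝ, Integrable (Function.uncurry (discreteTest b n h φ))
      ((volume.restrict (Ioc a c)).prod volume) := fun a c => hF.integrable_discreteTest hC h hφ _
  have i1 : ∀ a c : ℝ, a ≤ c → IntervalIntegrable
      (fun s => ∫ x, w ⌊s / τ⌋₊ x * transportTest b G φ s x) volume a c := fun a c hac => by
    rw [intervalIntegrable_iff_integrableOn_Ioc_of_le hac]
    exact (integrable_bdd_mul hpm.aestronglyMeasurable (fun p => hwM _ p.2) (iF a c)).integral_prod_left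
  have i2 : ∀ a c : ℝ, a ≤ c → IntervalIntegrable
      (fun s => ∫ x, |discreteTest b n h φ s x - transportTest b G φ s x|) volume a c :=
    fun a c hac => by
      rw [intervalIntegrable_iff_integrableOn_Ioc_of_le hac]
      exact (integrable_sub_fun (iQ a c) (iF a c)).abs.integral_prod_left
  induction k with
  | zero => simp [hw, lfIterate]
  | succ k ih =>
    have hk0 : (0 : ℝ) ≤ k * τ := by positivity
    have hk1 : (k : ℝ) * τ ≤ (k + 1) * τ := by nlinarith
    have step : (∫ x, w (k + 1) x * φ x) - ∫ x, w k x * φ x =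
      ((2 * (d : ℝ))⁻¹ * ∑ i, (∫ x, w k x * (φ (x + axisPoint i h) + φ (x - axisPoint i h) - 2 * φ x))) +
        ∫ s in Ioc (k * τ) ((k + 1) * τ), ∫ x, w k x * discreteTest b n h φ s x := by
      have s1 := hg.integral_iterate_mul_sub hd0 hu hM hφ.continuous.measurable hB0' (k + 1)
      have s2 := hg.integral_iterate_mul_sub hd0 hu hM hφ.continuous.measurable hB0' k
      rw [Finset.sum_range_succ, ← s2] at s1
      rw [← hF.sum_integral_gridVelocity hd hC hτ.le k hφ (hwm k) (hwM k)]
      linear_combination s1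
    have t1 : |(2 * (d : ℝ))⁻¹ * ∑ i, (∫ x, w k x *
        (φ (x + axisPoint i h) + φ (x - axisPoint i h) - 2 * φ x))| ≤ M * (B * h ^ 2) := by
      have : ∀ i, |∫ x, w k x * (φ (x + axisPoint i h) + φ (x - axisPoint i h) - 2 * φ x)| ≤
          M * (2 * B * h ^ 2) := fun i => by
        rw [← Real.norm_eq_abs]
        refine (norm_integral_le_of_norm_le (integrable_const (M * (2 * B * h ^ 2)))
          (ae_of_all _ fun x => ?_)).trans (le_of_eq (by simp))
        rw [Real.norm_eq_abs, abs_mul]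
        exact mul_le_mul (hwM k x) (hφ.abs_axis_second_difference_le i (hB i) x h) (abs_nonneg _) hM0
      rw [abs_mul, abs_of_pos (by positivity : 0 < (2 * (d : ℝ))⁻¹)]
      calc _ ≤ (2 * (d : ℝ))⁻¹ * (d * (M * (2 * B * h ^ 2))) :=
            mul_le_mul_of_nonneg_left ((Finset.abs_sum_le_sum_abs _ _).trans (sum_fin_le this))
              (by positivity)
        _ = _ := by field_simp
    set I := Ioc ((k : ℝ) * τ) ((k + 1) * τ) with hI
    have e1 : ∫ s in I, ∫ x, w ⌊s / τ⌋₊ x * transportTest b G φ s x =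
        ∫ s in I, ∫ x, w k x * transportTest b G φ s x := by
      refine setIntegral_congr_ae measurableSet_Ioc ?_
      -- On the half-open cell the integer part differs from `k` only at the right endpoint.
      have hne : ∀ᵐ s : ℝ, s ≠ (k + 1) * τ := by simp [ae_iff, measure_singleton]
      filter_upwards [hne] with s hs hsI
      have : ⌊s / τ⌋₊ = k := by
        rw [Nat.floor_eq_iff (div_nonneg (hk0.trans hsI.1.le) hτ.le), le_div_iff₀ hτ, div_lt_iff₀ hτ]
        exact ⟨hsI.1.le, lt_of_le_of_ne hsI.2 hs⟩
      rw [this]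
    have j1 : Integrable (fun s => ∫ x, w k x * discreteTest b n h φ s x) (volume.restrict I) :=
      (integrable_bdd_mul ((hwm k).comp measurable_snd).aestronglyMeasurable
        (fun p => hwM k p.2) (iQ _ _)).integral_prod_left
    have j2 : Integrable (fun s => ∫ x, w k x * transportTest b G φ s x) (volume.restrict I) :=
      (integrable_bdd_mul ((hwm k).comp measurable_snd).aestronglyMeasurable
        (fun p => hwM k p.2) (iF _ _)).integral_prod_left
    have j3 : Integrable (fun s => ∫ x, |discreteTest b n h φ s x - transportTest b G φ s x|)
      (volume.restrict I) := (integrable_sub_fun (iQ _ _) (iF _ _)).abs.integral_prod_left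
    have t2 : |(∫ s in I, ∫ x, w k x * discreteTest b n h φ s x) -
        ∫ s in I, ∫ x, w k x * transportTest b G φ s x| ≤
        M * ∫ s in I, ∫ x, |discreteTest b n h φ s x - transportTest b G φ s x| := by
      rw [← integral_sub j1 j2, ← integral_const_mul, ← Real.norm_eq_abs]
      refine norm_integral_le_of_norm_le (j3.const_mul M) ?_
      filter_upwards [(iQ (k * τ) ((k + 1) * τ)).prod_right_ae,
        (iF (k * τ) ((k + 1) * τ)).prod_right_ae] with s hs1 hs2
      have a1 := integrable_bdd_mul (hwm k).aestronglyMeasurable (hwM k) hs1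
      have a2 := integrable_bdd_mul (hwm k).aestronglyMeasurable (hwM k) hs2
      rw [Real.norm_eq_abs]
      simp only [Function.uncurry_apply_pair] at a1 a2 hs1 hs2
      rw [← integral_sub a1 a2, ← integral_const_mul, ← Real.norm_eq_abs]
      refine norm_integral_le_of_norm_le ((integrable_sub_fun hs1 hs2).abs.const_mul M)
        (ae_of_all _ fun x => ?_)
      rw [Real.norm_eq_abs, ← mul_sub, abs_mul]
      exact mul_le_mul_of_nonneg_right (hwM k x) (abs_nonneg _)
    push_cast
    rw [← intervalIntegral.integral_add_adjacent_intervals (i1 _ _ hk0) (i1 _ _ hk1),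
      ← intervalIntegral.integral_add_adjacent_intervals (i2 _ _ hk0) (i2 _ _ hk1),
      intervalIntegral.integral_of_le hk1, intervalIntegral.integral_of_le hk1]
    change |_ - _ - (_ + ∫ s in I, ∫ x, w ⌊s / τ⌋₊ x * transportTest b G φ s x)| ≤
      M * (_ + (_ + ∫ s in I, ∫ x, |discreteTest b n h φ s x - transportTest b G φ s x|))
    rw [e1]
    rw [abs_le] at *
    constructor <;> linarith [ih.1, ih.2, t1.1, t1.2, t2.1, t2.2]

/-- Centred differences approximate the divergence of the regularised field times `φ` up to `O(C n *
h n)`. At each time the cut-off is eventually inactive, and the mollified field and divergence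
converge in `L^1`; dominated convergence handles the time integral. -/
theorem TransportField.tendsto_discreteTest (hF : TransportField b G) (hd : Nonempty (Fin d))
    {C h : ℕ → ℝ} (hC : ∀ n i s x, |truncField b n i s x| ≤ C n)
    (hC1 : ∀ n i s x, |Torus.partialDeriv i (truncField b n i s) x| ≤ C n)
    (hC2 : ∀ n i s x, |Torus.partialDeriv i (Torus.partialDeriv i (truncField b n i s)) x| ≤ C n)
    (hh : ∀ n, 0 < h n) (hCh : ∀ n : ℕ, C n * h n ≤ 1 / ((n : ℝ) + 1)) {φ : Torus d → ℝ}
    (hφ : Smooth φ) (T : ℝ) :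
    Tendsto (fun n => ∫ s in Ioc 0 T, ∫ x,
      |discreteTest b n (h n) φ s x - transportTest b G φ s x|) atTop (𝓝 0) := by
  obtain ⟨L, hL0, hL⟩ := hF.div_bound
  obtain ⟨B, hB0, hφ0, hφ1, hφ2⟩ : ∃ B, 0 ≤ B ∧ (∀ x, |φ x| ≤ B) ∧
      (∀ i x, |Torus.partialDeriv i φ x| ≤ B) ∧
      ∀ i x, |Torus.partialDeriv i (Torus.partialDeriv i φ) x| ≤ B := by
    obtain ⟨B0, h00, h0⟩ := hφ.exists_bound
    choose B1 h10 h1 using fun j => (hφ.partialDeriv j).exists_bound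
    choose B2 h20 h2 using fun j => ((hφ.partialDeriv j).partialDeriv j).exists_bound
    have s1 := fun j => Finset.single_le_sum (f := B1) (fun j _ => h10 j) (Finset.mem_univ j)
    have s2 := fun j => Finset.single_le_sum (f := B2) (fun j _ => h20 j) (Finset.mem_univ j)
    have p1 : 0 ≤ ∑ j, B1 j := Finset.sum_nonneg fun j _ => h10 j
    have p2 : 0 ≤ ∑ j, B2 j := Finset.sum_nonneg fun j _ => h20 j
    exact ⟨B0 + ∑ j, B1 j + ∑ j, B2 j, by positivity, fun x => (h0 x).trans (by linarith),
      fun i x => (h1 i x).trans (by linarith [s1 i]), fun i x => (h2 i x).trans (by linarith [s2 i])⟩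
  set R : ℕ → ℝ → Torus d → ℝ := fun n s x => ∑ i, Torus.partialDeriv i
    (fun x => truncField b n i s x * φ x) x with hR
  have hQR : ∀ n s x, |discreteTest b n (h n) φ s x - R n s x| ≤ d * (4 * B) * (1 / ((n : ℝ) + 1)) := by
    intro n s x
    simp only [discreteTest, hR]
    rw [← Finset.sum_sub_distrib]
    refine (Finset.abs_sum_le_sum_abs _ _).trans ?_
    have h1 : ∀ i, |(truncField b n i s (x + axisPoint i (h n)) * φ (x + axisPoint i (h n)) -
        truncField b n i s (x - axisPoint i (h n)) * φ (x - axisPoint i (h n))) / (2 * h n) -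
        Torus.partialDeriv i (fun x => truncField b n i s x * φ x) x| ≤ 4 * C n * B * h n := fun i =>
      ((hF.truncField_smooth hd n i s).mul hφ).abs_axis_central_difference_le i
        ((hF.truncField_smooth hd n i s).abs_second_partialDeriv_mul_le hφ i (hC n i s) (hC1 n i s)
          (hC2 n i s) hφ0 (hφ1 i) (hφ2 i)) x (hh n)
    refine (sum_fin_le h1).trans ?_
    calc (d : ℝ) * (4 * C n * B * h n) = d * (4 * B) * (C n * h n) := by ring
      _ ≤ _ := mul_le_mul_of_nonneg_left (hCh n) (by positivity)
  have hReq : ∀ n s x, R n s x = (∑ i, truncField b n i s x * Torus.partialDeriv i φ x) +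
      (∑ i, Torus.partialDeriv i (truncField b n i s) x) * φ x := by
    intro n s x
    simp only [hR]
    rw [Finset.sum_mul, ← Finset.sum_add_distrib]
    refine Finset.sum_congr rfl fun i _ => ?_
    rw [(hF.truncField_smooth hd n i s).partialDeriv_mul hφ, add_comm]
  have ibt : ∀ n i s, Integrable (truncField b n i s) := fun n i s =>
    (hF.truncField_smooth hd n i s).integrable
  have ib : ∀ s i, Integrable (b i s) := fun s i => hF.integrable_slice hd s i
  have iD : ∀ s, Integrable fun x => ∑ i, G i i s x := fun s =>
    integrable_sum_of_normed fun i _ => (hF.isWeakPartial s i i).integrable_deriv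
  have iF := hF.integrable_transportTest_slice hd hφ
  have hQm : ∀ n, Measurable (Function.uncurry (discreteTest b n (h n) φ)) := fun n =>
    hF.measurable_discreteTest n (h n) hφ
  have hFm := hF.measurable_transportTest hφ
  have ibs : ∀ i, Integrable (fun s => ∫ x, |b i s x|) (volume.restrict (Ioc 0 T)) := fun i =>
    (hF.integrable_restrict (Ioc 0 T) i).abs.integral_prod_left
  have hβb : ∀ n i s, ∫ x, |truncField b n i s x| ≤ ∫ x, |b i s x| := fun n i s => by
    unfold truncField
    split_ifs
    · exact integral_abs_conv_le (mollifier_smooth n) (mollifier_nonneg n) (integral_mollifier n)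
        (ib s i)
    · simpa using integral_nonneg fun x => abs_nonneg (b i s x)
  have habs : ∀ (f : Fin d → Torus d → ℝ) (D : Torus d → ℝ) (x : Torus d),
      |(∑ i, f i x * Torus.partialDeriv i φ x) + D x * φ x| ≤ (∑ i, |f i x|) * B + |D x| * B := by
    intro f D x
    refine (abs_add_le _ _).trans (add_le_add ((Finset.abs_sum_le_sum_abs _ _).trans ?_) ?_)
    · rw [Finset.sum_mul]
      refine Finset.sum_le_sum fun i _ => ?_
      rw [abs_mul]; exact mul_le_mul_of_nonneg_left (hφ1 i x) (abs_nonneg _)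
    · rw [abs_mul]; exact mul_le_mul_of_nonneg_left (hφ0 x) (abs_nonneg _)
  have := tendsto_integral_filter_of_dominated_convergence (μ := volume.restrict (Ioc 0 T))
    (l := atTop) (F := fun n s => ∫ x, |discreteTest b n (h n) φ s x - transportTest b G φ s x|)
    (f := fun _ => (0 : ℝ))
    (fun s => (d * (4 * B) + 2 * L * B) + ∑ i, (2 * B) * ∫ x, |b i s x|)
    (Eventually.of_forall fun n => (((hQm n).sub hFm).abs.stronglyMeasurable.integral_prod_right
      (f := fun s x => |discreteTest b n (h n) φ s x - transportTest b G φ s x|)).aestronglyMeasurable)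
    (Eventually.of_forall fun n => ae_of_all _ fun s => ?_)
    ((integrable_const _).add (integrable_sum_of_normed fun i _ => (ibs i).const_mul _))
    (ae_of_all _ fun s => ?_)
  · simpa using this
  · rw [Real.norm_eq_abs, abs_of_nonneg (integral_nonneg fun _ => abs_nonneg _)]
    have i1 : ∀ i, Integrable fun x => |truncField b n i s x| := fun i => (ibt n i s).abs
    have i2 : ∀ i, Integrable fun x => |b i s x| := fun i => (ib s i).abs
    have i3 := ((integrable_sum_of_normed (s := Finset.univ) fun i _ => i1 i).mul_const B)
    have i4 := ((integrable_sum_of_normed (s := Finset.univ) fun i _ => i2 i).mul_const B)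
    have hle : ∫ x, |discreteTest b n (h n) φ s x - transportTest b G φ s x| ≤
        ∫ x, ((d * (4 * B) + 2 * L * B) + ((∑ i, |truncField b n i s x|) * B +
          (∑ i, |b i s x|) * B)) := by
      refine integral_mono_of_nonneg (ae_of_all _ fun _ => abs_nonneg _)
        ((integrable_const _).add (i3.add i4)) ?_
      filter_upwards [hL s] with x hx
      have h1 := hQR n s x
      have h2 := habs (fun i => truncField b n i s)
        (fun x => ∑ i, Torus.partialDeriv i (truncField b n i s) x) x
      rw [← hReq] at h2
      have h3 := habs (fun i => b i s) (fun x => ∑ i, G i i s x) x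
      change |transportTest b G φ s x| ≤ _ at h3
      have h4 := mul_le_mul_of_nonneg_right
        (hF.sum_partialDeriv_truncField_le hd hL0 hL n s x) hB0
      have h5 := mul_le_mul_of_nonneg_right hx hB0
      have h6 : d * (4 * B) * (1 / ((n : ℝ) + 1)) ≤ d * (4 * B) := by
        refine mul_le_of_le_one_right (by positivity) ?_
        rw [div_le_one (by positivity)]; linarith [(Nat.cast_nonneg n : (0 : ℝ) ≤ n)]
      have h7 : |discreteTest b n (h n) φ s x - transportTest b G φ s x| ≤
          |discreteTest b n (h n) φ s x - R n s x| + |R n s x| + |transportTest b G φ s x| := by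
        have := abs_sub_le (discreteTest b n (h n) φ s x) (R n s x) (transportTest b G φ s x)
        linarith [abs_sub (R n s x) (transportTest b G φ s x)]
      linarith
    refine hle.trans ?_
    rw [integral_add (integrable_const _) (integrable_add_fun i3 i4), integral_add i3 i4,
      integral_const, integral_mul_const, integral_mul_const, integral_finsetSum _ fun i _ => i1 i,
      integral_finsetSum _ fun i _ => i2 i, ← Finset.mul_sum]
    have h8 : ∑ i, ∫ x, |truncField b n i s x| ≤ ∑ i, ∫ x, |b i s x| :=
      Finset.sum_le_sum fun i _ => hβb n i s
    have h9 := mul_le_mul_of_nonneg_right h8 hB0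
    simp only [probReal_univ, smul_eq_mul, one_mul]
    linarith
  · have hs : ∀ᶠ n : ℕ in atTop, ∀ i, ∫ x, |b i s x| ≤ n := by
      rw [eventually_all]
      exact fun i => (tendsto_natCast_atTop_atTop (R := ℝ)).eventually_ge_atTop _
    have hlim : Tendsto (fun n : ℕ => d * (4 * B) * (1 / ((n : ℝ) + 1)) +
        ((∑ i, ∫ x, |conv (mollifier n) (b i s) x - b i s x|) * B +
          (∫ x, |conv (mollifier n) (fun x => ∑ i, G i i s x) x - ∑ i, G i i s x|) * B)) atTop
        (𝓝 0) := by
      have a1 := (tendsto_one_div_add_atTop_nhds_zero_nat (𝕜 := ℝ)).const_mul (d * (4 * B))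
      have a2 := (tendsto_finsetSum Finset.univ fun i _ =>
        tendsto_integral_abs_conv_sub (ib s i)).mul_const B
      have a3 := (tendsto_integral_abs_conv_sub (iD s)).mul_const B
      simpa using a1.add (a2.add a3)
    refine tendsto_of_tendsto_of_tendsto_of_le_of_le' tendsto_const_nhds hlim
      (Eventually.of_forall fun n => integral_nonneg fun _ => abs_nonneg _) ?_
    filter_upwards [hs] with n hn
    have eβ : ∀ i, truncField b n i s = conv (mollifier n) (b i s) := fun i => by
      simp only [truncField, hn]; simp
    have hk := mollifier_smooth (d := d) n
    have i1 : ∀ i, Integrable fun x => |conv (mollifier n) (b i s) x - b i s x| := fun i =>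
      (integrable_sub_fun (conv_smooth hk (ib s i)).integrable (ib s i)).abs
    have i2 : Integrable fun x => |conv (mollifier n) (fun x => ∑ i, G i i s x) x - ∑ i, G i i s x| :=
      (integrable_sub_fun (conv_smooth hk (iD s)).integrable (iD s)).abs
    have i3 := ((integrable_sum_of_normed (s := Finset.univ) fun i _ => i1 i).mul_const B)
    have hle : ∫ x, |discreteTest b n (h n) φ s x - transportTest b G φ s x| ≤
        ∫ x, (d * (4 * B) * (1 / ((n : ℝ) + 1)) +
        ((∑ i, |conv (mollifier n) (b i s) x - b i s x|) * B +
          |conv (mollifier n) (fun x => ∑ i, G i i s x) x - ∑ i, G i i s x| * B)) := by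
      refine integral_mono_of_nonneg (ae_of_all _ fun _ => abs_nonneg _)
        ((integrable_const _).add (i3.add (i2.mul_const B))) (ae_of_all _ fun x => ?_)
      have h1 := hQR n s x
      have h2 := habs (fun i x => conv (mollifier n) (b i s) x - b i s x)
        (fun x => conv (mollifier n) (fun x => ∑ i, G i i s x) x - ∑ i, G i i s x) x
      have h3 : R n s x - transportTest b G φ s x =
          (∑ i, (conv (mollifier n) (b i s) x - b i s x) * Torus.partialDeriv i φ x) +
          (conv (mollifier n) (fun x => ∑ i, G i i s x) x - ∑ i, G i i s x) * φ x := by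
        rw [hReq, hF.sum_partialDeriv_truncField hd n s hn]
        simp only [eβ, transportTest, sub_mul, Finset.sum_sub_distrib]
        ring
      rw [← h3] at h2
      exact (abs_sub_le _ (R n s x) _).trans (add_le_add h1 h2)
    refine hle.trans (le_of_eq ?_)
    rw [integral_add (integrable_const _) (integrable_add_fun i3 (i2.mul_const B)),
      integral_add i3 (i2.mul_const B), integral_const, integral_mul_const, integral_mul_const,
      integral_finsetSum _ fun i _ => i1 i]
    simp

end Consistency

/-! ### Construction of a convergent family of schemes. -/

/-- A convergent sequence of approximation schemes for the transport equation, stable in `L^p` and,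
with a loss of integrability, in `W^{1,p}`. -/
structure ApproximationScheme (b : Fin d → ℝ → Torus d → ℝ) (G : Fin d → Fin d → ℝ → Torus d → ℝ)
    (T L : ℝ) (h : ℕ → ℝ) (S : ℕ → (Torus d → ℝ) → ℝ → Torus d → ℝ) : Prop where
  step_pos : ∀ n, 0 < h n
  step_tendsto : Tendsto h atTop (𝓝 0)
  measurable : ∀ n u, Measurable u → Measurable (Function.uncurry (S n u))
  abs_le : ∀ n u M, (∀ x, |u x| ≤ M) → ∀ t x, |S n u t x| ≤ M
  mem_powBall : ∀ n u M, Measurable u → (∀ x, |u x| ≤ M) → ∀ p : ℝ, 1 ≤ p → ∀ t ∈ Icc 0 T,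
    S n u t ∈ powBall volume p (Real.exp (L * T) * ∫ x, |u x| ^ p)
  gradient_mem_powBall : ∀ p q : ℝ, 1 ≤ q → q < p → ∃ C, 0 ≤ C ∧ ∀ (n : ℕ) (u : Torus d → ℝ) (M : ℝ)
    (g : Fin d → Torus d → ℝ) (A : ℝ), Measurable u → (∀ x, |u x| ≤ M) →
    (∀ j, IsWeakPartial j u (g j)) → 0 < A →
    (∀ j, ∫⁻ x, ENNReal.ofReal (|g j x| ^ p) ≤ ENNReal.ofReal (A ^ p)) → ∀ t ∈ Icc 0 T, ∀ j,
      (fun x => (S n u t (x + axisPoint j (h n)) - S n u t x) / h n) ∈ powBall volume q (C * A ^ q)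
  tendsto : ∀ u M, Measurable u → (∀ x, |u x| ≤ M) → ∀ φ : Torus d → ℝ, Smooth φ → ∀ t ∈ Icc 0 T,
    Tendsto (fun n => (∫ x, S n u t x * φ x) - (∫ x, u x * φ x) -
      ∫ s in (0 : ℝ)..t, ∫ x, S n u s x * transportTest b G φ s x) atTop (𝓝 0)

theorem mem_powBall_of_bound {Y : Type*} [MeasurableSpace Y] {μ : Measure Y} [IsFiniteMeasure μ]
    {f : Y → ℝ} (hf : Measurable f) {M : ℝ} (hM : ∀ x, |f x| ≤ M) {q C : ℝ} (hq : 1 ≤ q)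
    (hC : ∫ x, |f x| ^ q ∂μ ≤ C) : f ∈ powBall μ q C := by
  refine ⟨hf.aestronglyMeasurable, ?_, hC⟩
  refine integrable_of_measurable_of_bound ((convexCost_rpow hq).continuous.measurable.comp hf)
    (M := M ^ q) fun x => ?_
  rw [abs_of_nonneg (Real.rpow_nonneg (abs_nonneg _) _)]
  exact Real.rpow_le_rpow (abs_nonneg _) (hM x) (by linarith)

/-- With `E = d (C n + 1)`, the choice `τ = h / E` gives the CFL condition. The accumulated
viscosity `h ^ 2 / τ = E h` still vanishes because `h` is taken much smaller than `1 / E`. -/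
theorem exists_scheme_steps {d : ℕ} (hd : 0 < d) {C : ℕ → ℝ} (hC : ∀ n, 0 ≤ C n) {L : ℝ} (hL : 0 ≤ L) :
    ∃ h τ : ℕ → ℝ, ∀ n : ℕ, 0 < h n ∧ 0 < τ n ∧ d * τ n * C n ≤ h n ∧ d * C n * h n ≤ 1 ∧
      C n * h n ≤ 1 / ((n : ℝ) + 1) ∧ τ n * (L + 1) ≤ 1 ∧ h n ^ 2 / τ n ≤ 1 / ((n : ℝ) + 1) ∧
      h n ≤ 1 / ((n : ℝ) + 1) ∧ τ n ≤ 1 / ((n : ℝ) + 1) := by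
  have hd1 : (1 : ℝ) ≤ d := by exact_mod_cast hd
  refine ⟨fun n => 1 / ((n + 1) * (d * (C n + 1) * (L + 2))),
    fun n => 1 / ((n + 1) * (d * (C n + 1) * (L + 2))) / (d * (C n + 1)), fun n => ?_⟩
  have hCn := hC n
  set E := d * (C n + 1) with hE
  set N : ℝ := n + 1 with hN
  have hN1 : 1 ≤ N := by simp [hN]
  have hE1 : 1 ≤ E := by nlinarith
  have hdE : d * C n ≤ E := by nlinarith
  have hCE : C n ≤ E := by nlinarith
  have hF : 1 ≤ L + 2 := by linarith
  have hEF : 1 ≤ E * (L + 2) := one_le_mul_of_one_le_of_one_le hE1 hF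
  have hD : 0 < N * (E * (L + 2)) := by positivity
  have hle : 1 / (N * (E * (L + 2))) ≤ 1 / N :=
    one_div_le_one_div_of_le (by linarith) (le_mul_of_one_le_right (by linarith) hEF)
  have hτ : 1 / (N * (E * (L + 2))) / E ≤ 1 / (N * (E * (L + 2))) :=
    div_le_self (by positivity) hE1
  have hEN : E * (1 / (N * (E * (L + 2)))) = 1 / (N * (L + 2)) := by field_simp
  have h1 : 1 / (N * (L + 2)) ≤ 1 / N :=
    one_div_le_one_div_of_le (by linarith) (le_mul_of_one_le_right (by linarith) hF)
  have h2 : 1 / N ≤ 1 := by rw [div_le_one (by linarith)]; exact hN1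
  have hpos : 0 < 1 / (N * (E * (L + 2))) := by positivity
  refine ⟨hpos, by positivity, ?_, ?_, ?_, ?_, ?_, hle, hτ.trans hle⟩
  · have : d * (1 / (N * (E * (L + 2))) / E) * C n = 1 / (N * (E * (L + 2))) * ((d * C n) / E) := by
      field_simp
    rw [this]
    exact mul_le_of_le_one_right hpos.le ((div_le_one (by linarith)).2 hdE)
  · exact (mul_le_mul_of_nonneg_right hdE hpos.le).trans (by rw [hEN]; exact h1.trans h2)
  · exact (mul_le_mul_of_nonneg_right hCE hpos.le).trans (by rw [hEN]; exact h1)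
  · refine (mul_le_mul_of_nonneg_right hτ (by linarith)).trans ?_
    rw [div_mul_eq_mul_div, one_mul, div_le_one hD]
    nlinarith [one_le_mul_of_one_le_of_one_le hN1 hE1]
  · have : (1 / (N * (E * (L + 2)))) ^ 2 / (1 / (N * (E * (L + 2))) / E) = 1 / (N * (L + 2)) := by
      field_simp
    rw [this]; exact h1

theorem TransportField.exists_approximationScheme {b : Fin d → ℝ → Torus d → ℝ}
    {G : Fin d → Fin d → ℝ → Torus d → ℝ} (hF : TransportField b G) (hd : Nonempty (Fin d)) {T : ℝ}
    (hT : 0 < T) : ∃ L h S, ApproximationScheme b G T L h S := by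
  have hd0 : 0 < d := Fin.pos hd.some
  have hd' : (0 : ℝ) < d := by exact_mod_cast hd0
  obtain ⟨L, hL0, hL⟩ := hF.div_bound
  choose C hC0 hC using hF.exists_truncField_bound hd
  have hCa := fun n i s x => (hC n i s x).1
  have hCb := fun n i s x => ((hC n i s x).2 i).1
  have hCc := fun n i s x => ((hC n i s x).2 i).2 i
  obtain ⟨h, τ, hτ⟩ := exists_scheme_steps hd0 hC0 hL0
  choose hh hτ0 hcfl hdiv hCh hτL hhτ hhn hτn using hτ
  have hg : ∀ n, GridField (gridVelocity b n (h n) (τ n)) (fun i => axisPoint i (h n)) (τ n) (L + 1) :=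
    fun n => hF.gridField hd hL0 hL (hCa n) (hCc n) (hh n) (hτ0 n) (hcfl n) (hdiv n)
  have hlim : Tendsto (fun n : ℕ => 1 / ((n : ℝ) + 1)) atTop (𝓝 0) :=
    tendsto_one_div_add_atTop_nhds_zero_nat (𝕜 := ℝ)
  have hk : ∀ n, ∀ t ∈ Icc 0 T, (⌊t / τ n⌋₊ : ℝ) * τ n ≤ t := fun n t ht => by
    rw [← le_div_iff₀ (hτ0 n)]; exact Nat.floor_le (div_nonneg ht.1 (hτ0 n).le)
  -- The step recorded is twice the grid size, since the discrete gradient uses doubled grid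
  -- vectors.
  refine ⟨L + 1, fun n => h n + h n, fun n u t =>
    lfIterate (gridVelocity b n (h n) (τ n)) (fun i => axisPoint i (h n)) u ⌊t / τ n⌋₊,
    ⟨fun n => add_pos (hh n) (hh n), ?_, ?_, ?_, ?_, ?_, ?_⟩⟩
  · have h0 : Tendsto h atTop (𝓝 0) := squeeze_zero (fun n => (hh n).le) hhn hlim
    simpa using h0.add h0
  · exact fun n u hu => measurable_path (fun k => (hg n).measurable_iterate hu k) (τ n)
  · exact fun n u M hM t x => (hg n).abs_iterate_le hd0 hM _ x
  · intro n u M hu hM p hp t ht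
    exact mem_powBall_of_bound ((hg n).measurable_iterate hu _) ((hg n).abs_iterate_le hd0 hM _) hp
      ((hg n).integral_iterate_rpow_le hd0 hu hM (hτ0 n).le (by linarith) hp ((hk n t ht).trans ht.2))
  · intro p q hq hqp
    -- The permitted loss of exponent fixes `δ`. An exponential moment of `∇b` of order `1 / δ` is
    -- then needed, and it is finite since all of them are.
    set δ := Real.log (p / q) / (3 * (1 + 2 ^ p) * d * T) with hδ
    have hD : 0 < 3 * (1 + (2 : ℝ) ^ p) * d * T := by positivity
    have hδ0 : 0 < δ := div_pos (Real.log_pos (by rw [lt_div_iff₀] <;> linarith)) hD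
    obtain ⟨K, hK0, hK⟩ := hF.exp_bound (1 / δ) (by positivity)
    refine ⟨Real.exp ((L + 1) * T) * (d + T * ((1 + 2 ^ p) * d ^ 2 * δ * (6 + 2 * K))) + d,
      by positivity, ?_⟩
    intro n u M g A hu hM hug hA hgA t ht j
    have hui : Integrable u := integrable_of_measurable_of_bound hu hM
    set w := lfIterate (gridVelocity b n (h n) (τ n)) (fun i => axisPoint i (h n)) u ⌊t / τ n⌋₊ with hw
    have hwm : Measurable w := (hg n).measurable_iterate hu _
    have hwM : ∀ x, |w x| ≤ M := (hg n).abs_iterate_le hd0 hM _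
    have hhh : 0 < h n + h n := add_pos (hh n) (hh n)
    -- This normalises the initial discrete gradient to have `p`-th moments at most `1`, so that
    -- undoing the scaling gives a final bound proportional to `A ^ q`. Interpolation needs this
    -- homogeneity.
    set Λ := 1 / ((h n + h n) * A) with hΛ
    have hΛ0 : 0 < Λ := by positivity
    have main := (hg n).integral_iterate_gradient_le hd0 hu hM (hτ0 n) (by linarith) (hτL n) hq hqp hδ0
      (T := T) (le_of_eq (by rw [hδ]; field_simp))
      (hF.integral_exp_gridVelocity_le hd (hCa n) hδ0 hK0 hK (hh n) (hτ0 n)) Λ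
      (k := ⌊t / τ n⌋₊) ((hk n t ht).trans ht.2)
    have hX0 : ∀ j, ∫ x, |Λ * (u (x + (axisPoint j (h n) + axisPoint j (h n))) - u x)| ^ p ≤ 1 := by
      intro j
      have hcost := lintegral_cost_translate_le (convexCost_rpow (by linarith : 1 ≤ p)) hui hug
        (EuclideanSpace.single j (h n + h n))
      have e1 : ∀ x, ∑ i, (EuclideanSpace.single j (h n + h n) : EuclideanSpace ℝ (Fin d)) i * g i x =
          (h n + h n) * g j x := fun x => by simp [PiLp.single_apply]
      simp_rw [e1] at hcost
      have e2 : ∀ a : ℝ, ENNReal.ofReal (|Λ * a| ^ p) =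
          ENNReal.ofReal (Λ ^ p) * ENNReal.ofReal (|a| ^ p) := fun a => by
        rw [abs_mul, abs_of_pos hΛ0, Real.mul_rpow hΛ0.le (abs_nonneg _),
          ENNReal.ofReal_mul (Real.rpow_nonneg hΛ0.le _)]
      have e3 : ∀ a : ℝ, ENNReal.ofReal (|(h n + h n) * a| ^ p) =
          ENNReal.ofReal ((h n + h n) ^ p) * ENNReal.ofReal (|a| ^ p) := fun a => by
        rw [abs_mul, abs_of_pos hhh, Real.mul_rpow hhh.le (abs_nonneg _),
          ENNReal.ofReal_mul (Real.rpow_nonneg hhh.le _)]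
      have hle : ∫⁻ x, ENNReal.ofReal (|Λ * (u (x + (axisPoint j (h n) + axisPoint j (h n))) - u x)| ^ p) ≤
          ENNReal.ofReal 1 := by
        simp_rw [e2]
        rw [lintegral_const_mul' _ _ ENNReal.ofReal_ne_top, ← axisPoint_add]
        refine (mul_le_mul_right hcost _).trans ?_
        simp_rw [e3]
        rw [lintegral_const_mul' _ _ ENNReal.ofReal_ne_top]
        refine (mul_le_mul_right (mul_le_mul_right (hgA j) _) _).trans (le_of_eq ?_)
        rw [← ENNReal.ofReal_mul (by positivity), ← ENNReal.ofReal_mul (by positivity),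
          ← Real.mul_rpow hhh.le hA.le, ← Real.mul_rpow hΛ0.le (by positivity), hΛ,
          one_div_mul_cancel (by positivity), Real.one_rpow]
      refine (mem_powBall_of_lintegral ?_ (by linarith) zero_le_one hle).2.2
      exact (((hu.comp (measurable_id.add_const _)).sub hu).const_mul Λ).aestronglyMeasurable
    refine mem_powBall_of_bound (M := (M + M) / (h n + h n))
      (((hwm.comp (measurable_id.add_const _)).sub hwm).div_const _) (fun x => ?_) hq ?_
    · rw [abs_div, abs_of_pos hhh]
      exact div_le_div_of_nonneg_right ((abs_sub _ _).trans (add_le_add (hwM _) (hwM _))) hhh.le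
    · have e4 : ∀ x, |(w (x + axisPoint j (h n + h n)) - w x) / (h n + h n)| ^ q =
          A ^ q * |Λ * (w (x + (axisPoint j (h n) + axisPoint j (h n))) - w x)| ^ q := fun x => by
        rw [← Real.mul_rpow hA.le (abs_nonneg _), ← axisPoint_add]
        congr 1
        rw [abs_mul, abs_div, abs_of_pos hhh, abs_of_pos hΛ0, hΛ]
        field_simp
      refine (integral_congr_ae (ae_of_all _ e4)).le.trans ?_
      rw [integral_const_mul, mul_comm]
      refine mul_le_mul_of_nonneg_right ?_ (Real.rpow_nonneg hA.le _)
      refine (Finset.single_le_sum (f := fun j => ∫ x, |Λ *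
        (w (x + (axisPoint j (h n) + axisPoint j (h n))) - w x)| ^ q)
        (fun i _ => integral_nonneg fun _ => Real.rpow_nonneg (abs_nonneg _) _)
        (Finset.mem_univ j)).trans (main.trans ?_)
      gcongr
      exact (sum_fin_le hX0).trans (by simp)
  · intro u M hu hM φ hφ t ht
    have hM0 : 0 ≤ M := (abs_nonneg _).trans (hM 0)
    choose B hB0 hB using fun i => ((hφ.partialDeriv i).partialDeriv i).exists_bound
    obtain ⟨B', hB'⟩ : ∃ B', ∀ i, B i ≤ B' :=
      ⟨∑ i, B i, fun i => Finset.single_le_sum (fun j _ => hB0 j) (Finset.mem_univ i)⟩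
    have hB'0 : 0 ≤ B' := (hB0 hd.some).trans (hB' _)
    have iF : Integrable (fun s => ∫ x, |transportTest b G φ s x|) (volume.restrict (Ioc 0 T)) :=
      (hF.integrable_transportTest hφ (Ioc 0 T)).abs.integral_prod_left
    have iD : ∀ n, Integrable (fun s => ∫ x, |discreteTest b n (h n) φ s x - transportTest b G φ s x|)
        (volume.restrict (Ioc 0 T)) := fun n =>
      (integrable_sub_fun (hF.integrable_discreteTest (hCa n) (h n) hφ (Ioc 0 T))
        (hF.integrable_transportTest hφ (Ioc 0 T))).abs.integral_prod_left
    set k : ℕ → ℕ := fun n => ⌊t / τ n⌋₊ with hkdef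
    have hk0 : ∀ n, 0 ≤ (k n : ℝ) * τ n := fun n => mul_nonneg (Nat.cast_nonneg _) (hτ0 n).le
    have hkt : ∀ n, (k n : ℝ) * τ n ≤ t := fun n => hk n t ht
    have hkt' : ∀ n, t - k n * τ n ≤ 1 / ((n : ℝ) + 1) := fun n => by
      have := Nat.lt_floor_add_one (t / τ n)
      rw [div_lt_iff₀ (hτ0 n)] at this
      have h1 := hτn n
      simp only [hkdef]; linarith
    have hsub : ∀ a c : ℝ, 0 ≤ a → c ≤ T → Ioc a c ⊆ Ioc 0 T := fun a c ha hc => Ioc_subset_Ioc ha hc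
    -- The part of the time integral between the last grid time and `t` vanishes by continuity of
    -- the primitive.
    have lim1 : Tendsto (fun n => ∫ s in (k n * τ n)..t, ∫ x, |transportTest b G φ s x|) atTop (𝓝 0) := by
      have hii : IntervalIntegrable (fun s => ∫ x, |transportTest b G φ s x|) volume 0 T :=
        (intervalIntegrable_iff_integrableOn_Ioc_of_le hT.le).2 iF
      have hc : ContinuousOn (fun r => ∫ s in t..r, ∫ x, |transportTest b G φ s x|) (Icc 0 T) := by
        have := intervalIntegral.continuousOn_primitive_interval' hii
          (a := t) (by rwa [uIcc_of_le hT.le])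
        rwa [uIcc_of_le hT.le] at this
      have hkT : Tendsto (fun n => (k n : ℝ) * τ n) atTop (𝓝[Icc 0 T] t) := by
        refine tendsto_nhdsWithin_iff.2 ⟨?_, Eventually.of_forall fun n => ⟨hk0 n, (hkt n).trans ht.2⟩⟩
        have := squeeze_zero (fun n => sub_nonneg.2 (hkt n)) hkt' hlim
        simpa using this.const_sub t
      have := ((hc t ht).tendsto.comp hkT).neg
      simp only [intervalIntegral.integral_same, neg_zero] at this
      refine this.congr fun n => ?_
      rw [Function.comp_apply, ← intervalIntegral.integral_symm]
    have lim2 := hF.tendsto_discreteTest hd hCa hCb hCc hh hCh hφ T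
    have lim : Tendsto (fun n : ℕ => M * (t * B' * (1 / ((n : ℝ) + 1)) + ∫ s in Ioc 0 T, ∫ x,
        |discreteTest b n (h n) φ s x - transportTest b G φ s x|) +
        M * ∫ s in (k n * τ n)..t, ∫ x, |transportTest b G φ s x|) atTop (𝓝 0) := by
      simpa using (((hlim.const_mul (t * B')).add lim2).const_mul M).add (lim1.const_mul M)
    refine squeeze_zero_norm (fun n => ?_) lim
    set w := fun s : ℝ => lfIterate (gridVelocity b n (h n) (τ n)) (fun i => axisPoint i (h n)) u
      ⌊s / τ n⌋₊ with hw
    have hwm : Measurable (Function.uncurry w) :=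
      measurable_path (fun k => (hg n).measurable_iterate hu k) (τ n)
    have hwM : ∀ s x, |w s x| ≤ M := fun s x => (hg n).abs_iterate_le hd0 hM _ x
    have iw : Integrable (fun s => ∫ x, w s x * transportTest b G φ s x) (volume.restrict (Ioc 0 T)) :=
      (integrable_bdd_mul hwm.aestronglyMeasurable (fun p => hwM p.1 p.2)
        (hF.integrable_transportTest hφ (Ioc 0 T))).integral_prod_left
    have ii : ∀ a c, 0 ≤ a → a ≤ c → c ≤ T →
        IntervalIntegrable (fun s => ∫ x, w s x * transportTest b G φ s x) volume a c :=
      fun a c ha hac hc => (intervalIntegrable_iff_integrableOn_Ioc_of_le hac).2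
        (IntegrableOn.mono_set iw (hsub a c ha hc))
    have cons := hF.scheme_consistency hd (hCa n) (hg n) (hτ0 n) hu hM hφ
      (fun i x => (hB i x).trans (hB' i)) (k n)
    have split := intervalIntegral.integral_add_adjacent_intervals
      (ii 0 (k n * τ n) le_rfl (hk0 n) ((hkt n).trans ht.2)) (ii (k n * τ n) t (hk0 n) (hkt n) ht.2)
    have hrem : |∫ s in (k n * τ n)..t, ∫ x, w s x * transportTest b G φ s x| ≤
        M * ∫ s in (k n * τ n)..t, ∫ x, |transportTest b G φ s x| := by
      rw [intervalIntegral.integral_of_le (hkt n), intervalIntegral.integral_of_le (hkt n),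
        ← integral_const_mul, ← Real.norm_eq_abs]
      refine norm_integral_le_of_norm_le
        ((IntegrableOn.mono_set iF (hsub _ _ (hk0 n) ht.2)).const_mul M) (ae_of_all _ fun s => ?_)
      by_cases hi : Integrable (transportTest b G φ s)
      · rw [← integral_const_mul]
        refine norm_integral_le_of_norm_le (hi.abs.const_mul M) (ae_of_all _ fun x => ?_)
        rw [Real.norm_eq_abs, abs_mul]
        exact mul_le_mul_of_nonneg_right (hwM s x) (abs_nonneg _)
      · exact absurd (hF.integrable_transportTest_slice hd hφ s) hi
    have hdisc : ∫ s in (0 : ℝ)..(k n * τ n), ∫ x,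
        |discreteTest b n (h n) φ s x - transportTest b G φ s x| ≤ ∫ s in Ioc 0 T, ∫ x,
        |discreteTest b n (h n) φ s x - transportTest b G φ s x| := by
      rw [intervalIntegral.integral_of_le (hk0 n)]
      exact setIntegral_mono_set (iD n)
        (ae_of_all _ fun s => integral_nonneg fun _ => abs_nonneg _)
        (LE.le.eventuallyLE (hsub _ _ le_rfl ((hkt n).trans ht.2)))
    have hkh : k n * (B' * h n ^ 2) ≤ t * B' * (1 / ((n : ℝ) + 1)) := by
      have e5 : k n * (B' * h n ^ 2) = k n * τ n * B' * (h n ^ 2 / τ n) := by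
        have := (hτ0 n).ne'
        field_simp
      rw [e5]
      exact mul_le_mul (mul_le_mul_of_nonneg_right (hkt n) hB'0) (hhτ n)
        (div_nonneg (sq_nonneg _) (hτ0 n).le) (mul_nonneg ht.1 hB'0)
    have hsum := mul_le_mul_of_nonneg_left (add_le_add hkh hdisc) hM0
    rw [Real.norm_eq_abs]
    change |(∫ x, w t x * φ x) - (∫ x, u x * φ x) -
      ∫ s in (0 : ℝ)..t, ∫ x, w s x * transportTest b G φ s x| ≤ _
    change |(∫ x, w t x * φ x) - (∫ x, u x * φ x) -
      ∫ s in (0 : ℝ)..(k n * τ n), ∫ x, w s x * transportTest b G φ s x| ≤ _ at cons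
    rw [← split, ← sub_sub]
    exact (abs_sub _ _).trans (add_le_add (cons.trans hsum) hrem)

/-! ### Weak limits through convex combinations. -/

theorem ae_eq_of_forall_integral_smooth {f g : Torus d → ℝ} (hf : Integrable f) (hg : Integrable g)
    (h : ∀ φ : Torus d → ℝ, Smooth φ → ∫ x, f x * φ x = ∫ x, g x * φ x) : f =ᵐ[volume] g := by
  have e : ∀ n, conv (mollifier n) f = conv (mollifier n) g := fun n => funext fun x => by
    have := h _ ((mollifier_smooth n).comp_sub x)
    rw [conv_eq, conv_eq]
    simpa only [mul_comm] using this
  refine ae_eq_of_integral_abs_tendsto (f := fun n => conv (mollifier n) f)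
    (fun n => (conv_smooth (mollifier_smooth n) hf).integrable) hf hg
    (tendsto_integral_abs_conv_sub hf) ?_
  simp_rw [e]
  exact tendsto_integral_abs_conv_sub hg

section ConvexCombinations

variable {V : Type*} [AddCommGroup V] [Module ℝ V]

/-- The points of `W` where `Λ` is close to `c` form a convex set. Linearity is required only on
`W`, because the functionals in question are integrals, which are additive only on integrable
functions. -/
theorem tendsto_of_mem_convexHull {F H : ℕ → V} (hH : ∀ n, H n ∈ convexHull ℝ (F '' Ici n)) {W : Set V}
    (hW : Convex ℝ W) (hF : ∀ n, F n ∈ W) {Λ : V → ℝ}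
    (hΛ : ∀ x ∈ W, ∀ y ∈ W, ∀ a b : ℝ, Λ (a • x + b • y) = a * Λ x + b * Λ y) {c : ℝ}
    (h : Tendsto (fun n => Λ (F n)) atTop (𝓝 c)) : Tendsto (fun n => Λ (H n)) atTop (𝓝 c) := by
  refine Metric.tendsto_atTop.2 fun ε hε => ?_
  obtain ⟨N, hN⟩ := Metric.tendsto_atTop.1 h (ε / 2) (by positivity)
  refine ⟨N, fun n hn => ?_⟩
  have hC : Convex ℝ {x | x ∈ W ∧ |Λ x - c| ≤ ε / 2} := by
    rintro x ⟨hx, hx'⟩ y ⟨hy, hy'⟩ a b ha hb hab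
    refine ⟨hW hx hy ha hb hab, ?_⟩
    rw [hΛ x hx y hy, show a * Λ x + b * Λ y - c = a * (Λ x - c) + b * (Λ y - c) by
      linear_combination c * hab]
    rw [abs_le] at *
    constructor <;> nlinarith [hx'.1, hx'.2, hy'.1, hy'.2]
  have := convexHull_min (s := F '' Ici n) (t := {x | x ∈ W ∧ |Λ x - c| ≤ ε / 2}) (by
    rintro _ ⟨m, hm, rfl⟩
    exact ⟨hF m, (hN m (hn.trans hm)).le⟩) hC (hH n)
  exact lt_of_le_of_lt this.2 (by linarith)

/-- The same weights act on a companion sequence: the difference quotients are to be combined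
exactly as the approximate solutions are. -/
theorem exists_mem_convexHull_prod {V' : Type*} [AddCommGroup V'] [Module ℝ V'] {F : ℕ → V} (E : ℕ → V')
    {s : Set ℕ} {v : V} (hv : v ∈ convexHull ℝ (F '' s)) :
    ∃ w, (v, w) ∈ convexHull ℝ ((fun m => (F m, E m)) '' s) := by
  have := (LinearMap.fst ℝ V V').image_convexHull ((fun m => (F m, E m)) '' s)
  rw [image_image] at this
  change _ = convexHull ℝ (F '' s) at this
  rw [← this] at hv
  obtain ⟨⟨a, w⟩, h, rfl⟩ := hv
  exact ⟨w, h⟩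

end ConvexCombinations

/-- Weak sequential compactness of balls of `L^q`, `q > 1`. -/
theorem exists_weak_limit {q C : ℝ} (hq : 1 < q) {f : ℕ → Torus d → ℝ}
    (hf : ∀ n, f n ∈ powBall volume q C) {ℓ : (Torus d → ℝ) → ℝ}
    (hℓ : ∀ φ, Smooth φ → Tendsto (fun n => ∫ x, f n x * φ x) atTop (𝓝 (ℓ φ))) :
    ∃ g, Measurable g ∧ g ∈ powBall volume q C ∧ (∀ φ, Smooth φ → ∫ x, g x * φ x = ℓ φ) ∧
      ∀ M, (∀ n, ∀ᵐ x, |f n x| ≤ M) → ∀ᵐ x, |g x| ≤ M := by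
  -- Tail convex combinations have the same limit against each test function and converge strongly,
  -- so the strong limit represents `ℓ`.
  obtain ⟨H, g, hH, hgm, hg, hHg⟩ := exists_convex_tendsto hq hf
  have hHb : ∀ n, H n ∈ powBall volume q C := fun n =>
    convexHull_min (by rintro _ ⟨m, -, rfl⟩; exact hf m) (convex_powBall hq.le) (hH n)
  have hHi := fun n => integrable_of_mem_powBall hq.le (hHb n)
  have hgi := integrable_of_mem_powBall hq.le hg
  refine ⟨g, hgm, hg, fun φ hφ => ?_, fun M hM => ?_⟩
  · obtain ⟨B, -, hB⟩ := hφ.exists_bound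
    have t1 := tendsto_of_mem_convexHull hH (convex_powBall hq.le) hf
      (Λ := fun f => ∫ x, f x * φ x) (fun x hx y hy a b => by
        have i1 := integrable_mul_bdd (integrable_of_mem_powBall hq.le hx)
          hφ.continuous.aestronglyMeasurable hB
        have i2 := integrable_mul_bdd (integrable_of_mem_powBall hq.le hy)
          hφ.continuous.aestronglyMeasurable hB
        rw [← integral_const_mul, ← integral_const_mul, ← integral_add (i1.const_mul a) (i2.const_mul b)]
        refine integral_congr_ae (ae_of_all _ fun z => ?_)
        simp only [Pi.add_apply, Pi.smul_apply, smul_eq_mul]; ring) (hℓ φ hφ)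
    refine tendsto_nhds_unique ?_ t1
    rw [tendsto_iff_norm_sub_tendsto_zero]
    refine squeeze_zero (fun _ => norm_nonneg _) (fun n => abs_integral_mul_sub_le (hHi n) hgi
      hφ.continuous.aestronglyMeasurable (ae_of_all _ hB)) ?_
    simpa using hHg.const_mul B
  · have hc : Convex ℝ {f : Torus d → ℝ | ∀ᵐ x, |f x| ≤ M} := by
      intro f hf g hg a b ha hb hab
      change ∀ᵐ x, |(a • f + b • g) x| ≤ M
      filter_upwards [hf, hg] with x h1 h2
      simp only [Pi.add_apply, Pi.smul_apply, smul_eq_mul]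
      rw [abs_le] at *
      constructor <;> nlinarith [h1.1, h1.2, h2.1, h2.2]
    have hHM : ∀ n, ∀ᵐ x, |H n x| ≤ M := fun n =>
      convexHull_min (by rintro _ ⟨m, -, rfl⟩; exact hM m) hc (hH n)
    obtain ⟨ns, -, hns⟩ := exists_subseq_tendsto_ae hHi hgi hHg
    filter_upwards [hns, ae_all_iff.2 hHM] with x h1 h2
    exact le_of_tendsto' h1.abs fun k => h2 (ns k)

/-- Smooth functions detect continuity in time of bounded curves against all of `L¹`. -/
theorem continuousOn_integral_mul {S : Set ℝ} {u : ℝ → Torus d → ℝ} {M : ℝ}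
    (hu : ∀ t ∈ S, AEStronglyMeasurable (u t) volume) (hM : ∀ t ∈ S, ∀ᵐ x, |u t x| ≤ M)
    (h : ∀ φ, Smooth φ → ContinuousOn (fun t => ∫ x, u t x * φ x) S) {φ : Torus d → ℝ}
    (hφ : Integrable φ) : ContinuousOn (fun t => ∫ x, u t x * φ x) S := by
  have hs := fun n => conv_smooth (mollifier_smooth (d := d) n) hφ
  -- Mollifying the test function changes the integral by at most `M` times an `L^1` distance,
  -- uniformly in time.
  refine TendstoUniformlyOn.continuousOn (F := fun n t => ∫ x, u t x * conv (mollifier n) φ x)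
    (p := atTop) ?_ (Eventually.of_forall fun n => h _ (hs n)).frequently
  refine Metric.tendstoUniformlyOn_iff.2 fun ε hε => ?_
  have hl := (tendsto_integral_abs_conv_sub hφ).const_mul M
  rw [mul_zero] at hl
  filter_upwards [hl.eventually (Iio_mem_nhds hε)] with n hn t ht
  rw [dist_comm, Real.dist_eq]
  refine lt_of_le_of_lt ?_ hn
  have := abs_integral_mul_sub_le (hs n).integrable hφ (hu t ht) (hM t ht)
  simpa only [mul_comm] using this

theorem convex_measurable_bounded {Y : Type*} [MeasurableSpace Y] (M : ℝ) :
    Convex ℝ {f : Y → ℝ | Measurable f ∧ ∀ z, |f z| ≤ M} := by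
  rintro f ⟨f1, f2⟩ g ⟨g1, g2⟩ a b ha hb hab
  refine ⟨(f1.const_smul a).add (g1.const_smul b), fun z => ?_⟩
  simp only [Pi.add_apply, Pi.smul_apply, smul_eq_mul]
  have h1 := f2 z
  have h2 := g2 z
  rw [abs_le] at *
  constructor <;> nlinarith [h1.1, h1.2, h2.1, h2.2]

/-- Integration by parts for forward difference quotients, up to a small error. -/
theorem abs_integral_difference_quotient_add_le {U φ : Torus d → ℝ} {M C h : ℝ} (hU : Measurable U)
    (hM : ∀ x, |U x| ≤ M) (hφ : Smooth φ) (j : Fin d)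
    (hC : ∀ x, |Torus.partialDeriv j (Torus.partialDeriv j φ) x| ≤ C) (hh : 0 < h) :
    |(∫ x, (U (x + axisPoint j h) - U x) / h * φ x) + ∫ x, U x * Torus.partialDeriv j φ x| ≤
      M * (C * h) := by
  obtain ⟨B, hB0, hB⟩ := hφ.exists_bound
  obtain ⟨B1, -, hB1⟩ := (hφ.partialDeriv j).exists_bound
  have hM0 : 0 ≤ M := (abs_nonneg _).trans (hM 0)
  set e := axisPoint j h with he
  have hφm := hφ.continuous.measurable
  have iU : Integrable U := integrable_of_measurable_of_bound hU hM
  have i1 : Integrable fun x => U (x + e) * φ x :=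
    integrable_mul_bdd (integrable_comp_add_right iU e) hφm.aestronglyMeasurable hB
  have i2 : Integrable fun x => U x * φ x := integrable_mul_bdd iU hφm.aestronglyMeasurable hB
  have i3 : Integrable fun x => U x * φ (x - e) :=
    integrable_mul_bdd iU (hφm.comp (measurable_id.sub_const e)).aestronglyMeasurable fun x => hB _
  have i4 : Integrable fun x => U x * Torus.partialDeriv j φ x :=
    integrable_mul_bdd iU (hφ.partialDeriv j).continuous.aestronglyMeasurable hB1
  have e1 : ∫ x, (U (x + e) - U x) / h * φ x = ((∫ x, U x * φ (x - e)) - ∫ x, U x * φ x) / h := by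
    have s1 : ∫ x, U x * φ (x - e) = ∫ x, U (x + e) * φ x := by
      rw [← integral_add_right_eq_self _ e]; simp
    rw [s1, ← integral_sub i1 i2, ← integral_div]
    exact integral_congr_ae (ae_of_all _ fun x => by ring)
  have e2 : ((∫ x, U x * φ (x - e)) - ∫ x, U x * φ x) / h + ∫ x, U x * Torus.partialDeriv j φ x =
      ∫ x, U x * ((φ (x - e) - φ x + h * Torus.partialDeriv j φ x) / h) := by
    rw [← integral_sub i3 i2, ← integral_div, ← integral_add ((integrable_sub_fun i3 i2).div_const h) i4]
    exact integral_congr_ae (ae_of_all _ fun x => by field_simp)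
  rw [e1, e2, ← Real.norm_eq_abs]
  refine (norm_integral_le_of_norm_le (integrable_const (M * (C * h)))
    (ae_of_all _ fun x => ?_)).trans (le_of_eq (by simp))
  rw [Real.norm_eq_abs, abs_mul, abs_div, abs_of_pos hh]
  refine mul_le_mul (hM x) ?_ (by positivity) hM0
  have := hφ.abs_axis_taylor_le j hC x (-h)
  rw [axisPoint_neg, ← sub_eq_add_neg, neg_sq, neg_mul, sub_neg_eq_add] at this
  rw [div_le_iff₀ hh, mul_assoc, ← sq]
  exact this

/-! ### Existence of solutions. -/

section Existence

variable {b : Fin d → ℝ → Torus d → ℝ} {G : Fin d → Fin d → ℝ → Torus d → ℝ} {T L : ℝ} {h : ℕ → ℝ}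
  {S : ℕ → (Torus d → ℝ) → ℝ → Torus d → ℝ} {u : Torus d → ℝ} {M : ℝ}

/-- Compactness is applied in `L^2` of space-time. Clamping the limit makes the bound hold
everywhere and does not affect the convergence. -/
theorem ApproximationScheme.exists_limit (hS : ApproximationScheme b G T L h S) (hu : Measurable u)
    (hM : ∀ x, |u x| ≤ M) : ∃ (H : ℕ → ℝ × Torus d → ℝ) (V : ℝ × Torus d → ℝ),
      (∀ n, H n ∈ convexHull ℝ ((fun m => Function.uncurry (S m u)) '' Ici n)) ∧ Measurable V ∧
      (∀ z, |V z| ≤ M) ∧ ∀ᵐ s ∂volume.restrict (Icc 0 T), ∀ᵐ x,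
        Tendsto (fun n => H n (s, x)) atTop (𝓝 (V (s, x))) := by
  have hM0 : 0 ≤ M := (abs_nonneg _).trans (hM 0)
  set μ := (volume.restrict (Icc 0 T)).prod (volume : Measure (Torus d)) with hμ
  have hSm := fun n => hS.measurable n u hu
  have hSb : ∀ n z, |Function.uncurry (S n u) z| ≤ M := fun n z => hS.abs_le n u M hM z.1 z.2
  have hball : ∀ n, Function.uncurry (S n u) ∈ powBall μ 2 (∫ _z, M ^ (2 : ℝ) ∂μ) := fun n => by
    have hmem := mem_powBall_of_bound (μ := μ) (hSm n) (hSb n) one_le_two le_rfl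
    exact ⟨hmem.1, hmem.2.1, integral_mono hmem.2.1 (integrable_const _) fun z =>
      Real.rpow_le_rpow (abs_nonneg _) (hSb n z) zero_le_two⟩
  obtain ⟨H, g, hH, hgm, hg, hHg⟩ := exists_convex_tendsto one_lt_two hball
  have hHb : ∀ n, Measurable (H n) ∧ ∀ z, |H n z| ≤ M := fun n =>
    convexHull_min (by rintro _ ⟨m, -, rfl⟩; exact ⟨hSm m, hSb m⟩) (convex_measurable_bounded M) (hH n)
  obtain ⟨ns, hns, hae⟩ := exists_subseq_tendsto_ae
    (fun n => integrable_of_measurable_of_bound (hHb n).1 (hHb n).2)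
    (integrable_of_mem_powBall one_le_two hg) hHg
  refine ⟨fun n => H (ns n), fun z => max (-M) (min (g z) M), fun n => ?_,
    measurable_const.max (hgm.min measurable_const), fun z => ?_, ?_⟩
  · exact convexHull_mono (image_mono (Ici_subset_Ici.2 (hns.id_le n))) (hH (ns n))
  · rw [_root_.abs_le]
    exact ⟨le_max_left _ _, max_le (by linarith) (min_le_right _ _)⟩
  · have h2 : ∀ᵐ z ∂μ, Tendsto (fun n => H (ns n) z) atTop (𝓝 (max (-M) (min (g z) M))) := by
      filter_upwards [hae] with z hz
      have := (tendsto_const_nhds (x := -M)).max (hz.min (tendsto_const_nhds (x := M)))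
      refine this.congr fun n => ?_
      have := _root_.abs_le.1 ((hHb (ns n)).2 z)
      rw [min_eq_left this.2, max_eq_right this.1]
    exact Measure.ae_ae_of_ae_prod h2

/-- The consistency relation is linear, so convex combinations inherit it, and its time integral
converges by domination. This yields convergence at every time `t`, where `exists_limit` gives it at
almost every time only. -/
theorem ApproximationScheme.tendsto_integral_of_limit (hF : TransportField b G) (hd : Nonempty (Fin d))
    (hS : ApproximationScheme b G T L h S) (hu : Measurable u) (hM : ∀ x, |u x| ≤ M)
    {H : ℕ → ℝ × Torus d → ℝ} {V : ℝ × Torus d → ℝ}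
    (hH : ∀ n, H n ∈ convexHull ℝ ((fun m => Function.uncurry (S m u)) '' Ici n))
    (hHV : ∀ᵐ s ∂volume.restrict (Icc 0 T), ∀ᵐ x, Tendsto (fun n => H n (s, x)) atTop (𝓝 (V (s, x))))
    {φ : Torus d → ℝ} (hφ : Smooth φ) {t : ℝ} (ht : t ∈ Icc 0 T) :
    Tendsto (fun n => ∫ x, H n (t, x) * φ x) atTop (𝓝 ((∫ x, u x * φ x) +
      ∫ s in (0 : ℝ)..t, ∫ x, V (s, x) * transportTest b G φ s x)) := by
  obtain ⟨B, hB0, hB⟩ := hφ.exists_bound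
  have hSb : ∀ n, Measurable (Function.uncurry (S n u)) ∧ ∀ z, |Function.uncurry (S n u) z| ≤ M :=
    fun n => ⟨hS.measurable n u hu, fun z => hS.abs_le n u M hM z.1 z.2⟩
  have hHb : ∀ n, Measurable (H n) ∧ ∀ z, |H n z| ≤ M := fun n =>
    convexHull_min (by rintro _ ⟨m, -, rfl⟩; exact hSb m) (convex_measurable_bounded M) (hH n)
  have iF := hF.integrable_transportTest hφ (Ioc 0 t)
  have j1 : ∀ {f : ℝ × Torus d → ℝ}, (Measurable f ∧ ∀ z, |f z| ≤ M) →
      Integrable fun x => f (t, x) * φ x := fun hf =>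
    integrable_bdd_mul (hf.1.comp measurable_prodMk_left).aestronglyMeasurable (fun x => hf.2 _)
      hφ.integrable
  have j2 : ∀ {f : ℝ × Torus d → ℝ}, (Measurable f ∧ ∀ z, |f z| ≤ M) → ∀ s,
      Integrable fun x => f (s, x) * transportTest b G φ s x := fun hf s =>
    integrable_bdd_mul (hf.1.comp measurable_prodMk_left).aestronglyMeasurable (fun x => hf.2 _)
      (hF.integrable_transportTest_slice hd hφ s)
  have j3 : ∀ {f : ℝ × Torus d → ℝ}, (Measurable f ∧ ∀ z, |f z| ≤ M) →
      Integrable (fun s => ∫ x, f (s, x) * transportTest b G φ s x) (volume.restrict (Ioc 0 t)) :=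
    fun hf => (integrable_bdd_mul hf.1.aestronglyMeasurable hf.2 iF).integral_prod_left
  have t1 := tendsto_of_mem_convexHull hH (convex_measurable_bounded M) hSb
    (Λ := fun f => (∫ x, f (t, x) * φ x) - ∫ s in (0 : ℝ)..t, ∫ x, f (s, x) * transportTest b G φ s x)
    (c := ∫ x, u x * φ x) (fun f hf g hg a c => by
      have e1 : ∫ x, (a • f + c • g) (t, x) * φ x =
          a * (∫ x, f (t, x) * φ x) + c * ∫ x, g (t, x) * φ x := by
        rw [← integral_const_mul, ← integral_const_mul, ← integral_add ((j1 hf).const_mul a)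
          ((j1 hg).const_mul c)]
        refine integral_congr_ae (ae_of_all _ fun z => ?_)
        simp only [Pi.add_apply, Pi.smul_apply, smul_eq_mul]; ring
      have e2 : ∀ s, ∫ x, (a • f + c • g) (s, x) * transportTest b G φ s x =
          a * (∫ x, f (s, x) * transportTest b G φ s x) +
            c * ∫ x, g (s, x) * transportTest b G φ s x := fun s => by
        rw [← integral_const_mul, ← integral_const_mul, ← integral_add ((j2 hf s).const_mul a)
          ((j2 hg s).const_mul c)]
        refine integral_congr_ae (ae_of_all _ fun z => ?_)
        simp only [Pi.add_apply, Pi.smul_apply, smul_eq_mul]; ring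
      simp only [intervalIntegral.integral_of_le ht.1]
      rw [e1]
      simp_rw [e2]
      rw [integral_add ((j3 hf).const_mul a) ((j3 hg).const_mul c), integral_const_mul,
        integral_const_mul]
      ring) (by
      have := (hS.tendsto u M hu hM φ hφ t ht).add_const (∫ x, u x * φ x)
      rw [zero_add] at this
      refine this.congr fun n => ?_
      simp only [Function.uncurry]; ring)
  have t2 : Tendsto (fun n => ∫ s in (0 : ℝ)..t, ∫ x, H n (s, x) * transportTest b G φ s x) atTop
      (𝓝 (∫ s in (0 : ℝ)..t, ∫ x, V (s, x) * transportTest b G φ s x)) := by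
    simp only [intervalIntegral.integral_of_le ht.1]
    refine tendsto_integral_of_dominated_convergence (fun s => M * ∫ x, |transportTest b G φ s x|)
      (fun n => (j3 (hHb n)).aestronglyMeasurable) (iF.abs.integral_prod_left.const_mul M)
      (fun n => ae_of_all _ fun s => ?_) ?_
    · rw [← integral_const_mul]
      refine norm_integral_le_of_norm_le
        ((hF.integrable_transportTest_slice hd hφ s).abs.const_mul M) (ae_of_all _ fun x => ?_)
      rw [Real.norm_eq_abs, abs_mul]
      exact mul_le_mul_of_nonneg_right ((hHb n).2 _) (abs_nonneg _)
    · have hsub : Ioc 0 t ⊆ Icc 0 T := Ioc_subset_Icc_self.trans (Icc_subset_Icc_right ht.2)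
      filter_upwards [ae_restrict_of_ae_restrict_of_subset hsub hHV] with s hs
      refine tendsto_integral_of_dominated_convergence (fun x => M * |transportTest b G φ s x|)
        (fun n => (j2 (hHb n) s).aestronglyMeasurable)
        ((hF.integrable_transportTest_slice hd hφ s).abs.const_mul M)
        (fun n => ae_of_all _ fun x => ?_) ?_
      · rw [Real.norm_eq_abs, abs_mul]
        exact mul_le_mul_of_nonneg_right ((hHb n).2 _) (abs_nonneg _)
      · filter_upwards [hs] with x hx
        exact hx.mul_const _
  refine (t1.add t2).congr fun n => ?_
  ring

theorem ApproximationScheme.exists_solution (hF : TransportField b G) (hd : Nonempty (Fin d))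
    (hS : ApproximationScheme b G T L h S) (hu : Measurable u) (hM : ∀ x, |u x| ≤ M) :
    ∃ U : ℝ → Torus d → ℝ,
      AEStronglyMeasurable (fun z : ℝ × Torus d => U z.1 z.2) ((volume.restrict (Icc 0 T)).prod volume) ∧
      (∀ t ∈ Icc 0 T, Measurable (U t)) ∧ (∀ t ∈ Icc 0 T, ∀ᵐ x, |U t x| ≤ M) ∧
      (∀ φ, Smooth φ → ContinuousOn (fun t => ∫ x, U t x * φ x) (Icc 0 T)) ∧
      (∀ t ∈ Icc 0 T, ∀ φ, Smooth φ → (∫ x, U t x * φ x) - ∫ x, u x * φ x =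
        ∫ s in (0 : ℝ)..t, ∫ x, U s x * transportTest b G φ s x) ∧
      (∀ p : ℝ, 1 < p → ∀ t ∈ Icc 0 T,
        U t ∈ powBall volume p (Real.exp (L * T) * ∫ x, |u x| ^ p)) ∧
      ∀ q C : ℝ, 1 < q → (∀ n, ∀ t ∈ Icc 0 T, ∀ j, (fun x => (S n u t (x + axisPoint j (h n)) -
        S n u t x) / h n) ∈ powBall volume q C) →
        ∀ t ∈ Icc 0 T, ∀ j, ∃ g, IsWeakPartial j (U t) g ∧ g ∈ powBall volume q C := by
  obtain ⟨H, V, hH, hVm, hVM, hHV⟩ := hS.exists_limit hu hM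
  have hSb : ∀ n, Measurable (Function.uncurry (S n u)) ∧ ∀ z, |Function.uncurry (S n u) z| ≤ M :=
    fun n => ⟨hS.measurable n u hu, fun z => hS.abs_le n u M hM z.1 z.2⟩
  have hHb : ∀ n, Measurable (H n) ∧ ∀ z, |H n z| ≤ M := fun n =>
    convexHull_min (by rintro _ ⟨m, -, rfl⟩; exact hSb m) (convex_measurable_bounded M) (hH n)
  have hHs : ∀ n t, Measurable fun x => H n (t, x) := fun n t => (hHb n).1.comp measurable_prodMk_left
  set ℓ : ℝ → (Torus d → ℝ) → ℝ := fun t φ => (∫ x, u x * φ x) +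
    ∫ s in (0 : ℝ)..t, ∫ x, V (s, x) * transportTest b G φ s x with hℓ
  have hlim : ∀ t ∈ Icc 0 T, ∀ φ, Smooth φ →
      Tendsto (fun n => ∫ x, H n (t, x) * φ x) atTop (𝓝 (ℓ t φ)) := fun t ht φ hφ =>
    hS.tendsto_integral_of_limit hF hd hu hM hH hHV hφ ht
  have hball : ∀ n, ∀ p : ℝ, 1 ≤ p → ∀ t ∈ Icc 0 T,
      (fun x => H n (t, x)) ∈ powBall volume p (Real.exp (L * T) * ∫ x, |u x| ^ p) := by
    intro n p hp t ht
    have hc := (convex_powBall (μ := (volume : Measure (Torus d))) (C := Real.exp (L * T) *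
      ∫ x, |u x| ^ p) hp).is_linear_preimage
      (f := fun (f : ℝ × Torus d → ℝ) x => f (t, x)) ⟨fun _ _ => rfl, fun _ _ => rfl⟩
    exact convexHull_min (by rintro _ ⟨m, -, rfl⟩; exact hS.mem_powBall m u M hu hM p hp t ht) hc (hH n)
  have hex : ∀ t, ∃ v : Torus d → ℝ, t ∈ Icc 0 T → Measurable v ∧ (∀ᵐ x, |v x| ≤ M) ∧
      ∀ φ, Smooth φ → ∫ x, v x * φ x = ℓ t φ := by
    intro t
    by_cases ht : t ∈ Icc 0 T
    · obtain ⟨v, h1, -, h3, h4⟩ := exists_weak_limit one_lt_two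
        (fun n => hball n 2 one_le_two t ht) (hlim t ht)
      exact ⟨v, fun _ => ⟨h1, h4 M fun n => ae_of_all _ fun x => (hHb n).2 _, h3⟩⟩
    · exact ⟨0, fun h => absurd h ht⟩
  choose v hv using hex
  classical
  -- The space-time limit is right at almost every time and is jointly measurable; at the remaining
  -- times the weak limit `v t` replaces it. The curve obtained represents `ℓ t` at every time of
  -- the interval.
  set good : Set ℝ := {t | ∀ φ, Smooth φ → ∫ x, V (t, x) * φ x = ℓ t φ} with hgood
  have hgood_ae : ∀ᵐ t ∂volume.restrict (Icc 0 T), t ∈ good := by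
    filter_upwards [hHV, ae_restrict_mem measurableSet_Icc] with t hHVt ht φ hφ
    obtain ⟨B, -, hB⟩ := hφ.exists_bound
    refine tendsto_nhds_unique ?_ (hlim t ht φ hφ)
    refine tendsto_integral_of_dominated_convergence (fun x => M * |φ x|)
      (fun n => ((hHs n t).mul hφ.continuous.measurable).aestronglyMeasurable)
      (hφ.integrable.abs.const_mul M) (fun n => ae_of_all _ fun x => ?_)
      (hHVt.mono fun x hx => hx.mul_const _)
    rw [Real.norm_eq_abs, abs_mul]
    exact mul_le_mul_of_nonneg_right ((hHb n).2 _) (abs_nonneg _)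
  set U : ℝ → Torus d → ℝ := fun t => if t ∈ good then fun x => V (t, x) else v t with hU
  have hUgood : ∀ t ∈ good, U t = fun x => V (t, x) := fun t ht => if_pos ht
  have hUm : ∀ t ∈ Icc 0 T, Measurable (U t) := fun t ht => by
    by_cases hg : t ∈ good
    · rw [hUgood t hg]; exact hVm.comp measurable_prodMk_left
    · simp only [hU, if_neg hg]; exact (hv t ht).1
  have hUM : ∀ t ∈ Icc 0 T, ∀ᵐ x, |U t x| ≤ M := fun t ht => by
    by_cases hg : t ∈ good
    · rw [hUgood t hg]; exact ae_of_all _ fun x => hVM _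
    · simp only [hU, if_neg hg]; exact (hv t ht).2.1
  have hUℓ : ∀ t ∈ Icc 0 T, ∀ φ, Smooth φ → ∫ x, U t x * φ x = ℓ t φ := fun t ht φ hφ => by
    by_cases hg : t ∈ good
    · rw [hUgood t hg]; exact hg φ hφ
    · simp only [hU, if_neg hg]; exact (hv t ht).2.2 φ hφ
  have hUi : ∀ t ∈ Icc 0 T, Integrable (U t) := fun t ht =>
    Integrable.of_bound (hUm t ht).aestronglyMeasurable M (hUM t ht)
  refine ⟨U, ?_, hUm, hUM, fun φ hφ => ?_, fun t ht φ hφ => ?_, fun p hp t ht => ?_, ?_⟩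
  · refine hVm.aestronglyMeasurable.congr ?_
    have := (Measure.quasiMeasurePreserving_fst (μ := volume.restrict (Icc 0 T))
      (ν := (volume : Measure (Torus d)))).ae hgood_ae
    filter_upwards [this] with z hz
    rw [hUgood _ hz]
  · refine ContinuousOn.congr (f := fun t => ℓ t φ) ?_ fun t ht => hUℓ t ht φ hφ
    refine continuousOn_const.add ?_
    rcases lt_or_ge T 0 with hT | hT
    · rw [Icc_eq_empty (not_le.2 hT)]; exact continuousOn_empty _
    have hi : IntervalIntegrable (fun s => ∫ x, V (s, x) * transportTest b G φ s x) volume 0 T :=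
      (intervalIntegrable_iff_integrableOn_Ioc_of_le hT).2
        (integrable_bdd_mul hVm.aestronglyMeasurable hVM
          (hF.integrable_transportTest hφ (Ioc 0 T))).integral_prod_left
    have := intervalIntegral.continuousOn_primitive_interval' hi (a := 0) left_mem_uIcc
    rwa [uIcc_of_le hT] at this
  · rw [hUℓ t ht φ hφ, hℓ]
    simp only [add_sub_cancel_left]
    rw [intervalIntegral.integral_of_le ht.1, intervalIntegral.integral_of_le ht.1]
    refine integral_congr_ae ?_
    have hsub : Ioc 0 t ⊆ Icc 0 T := Ioc_subset_Icc_self.trans (Icc_subset_Icc_right ht.2)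
    filter_upwards [ae_restrict_of_ae_restrict_of_subset hsub hgood_ae] with s hs
    rw [hUgood s hs]
  · obtain ⟨g, -, h2, h3, -⟩ := exists_weak_limit hp (fun n => hball n p hp.le t ht) (hlim t ht)
    have hgU : g =ᵐ[volume] U t := ae_eq_of_forall_integral_smooth
      (integrable_of_mem_powBall hp.le h2) (hUi t ht) fun φ hφ => by rw [h3 φ hφ, hUℓ t ht φ hφ]
    have hcongr : (fun x => |g x| ^ p) =ᵐ[volume] fun x => |U t x| ^ p :=
      hgU.mono fun x hx => by simp only [hx]
    exact ⟨h2.1.congr hgU, h2.2.1.congr hcongr, (integral_congr_ae hcongr) ▸ h2.2.2⟩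
  · intro q C hq hD t ht j
    set D : ℕ → Torus d → ℝ := fun n x => (S n u t (x + axisPoint j (h n)) - S n u t x) / h n with hDdef
    -- The quotients, combined with the weights of `H n`, stay in the same ball. Discrete
    -- integration by parts identifies their weak limit as the weak derivative.
    choose w hw using fun n => exists_mem_convexHull_prod D (hH n)
    have hwb : ∀ n, w n ∈ powBall volume q C := fun n => by
      have hc := (convex_powBall (μ := (volume : Measure (Torus d))) (C := C) hq.le).linear_preimage
        (LinearMap.snd ℝ (ℝ × Torus d → ℝ) (Torus d → ℝ))
      exact convexHull_min (by rintro _ ⟨m, -, rfl⟩; exact hD m t ht j) hc (hw n)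
    have hwlim : ∀ φ, Smooth φ → Tendsto (fun n => ∫ x, w n x * φ x) atTop
        (𝓝 (-ℓ t (Torus.partialDeriv j φ))) := by
      intro φ hφ
      obtain ⟨B, -, hB⟩ := hφ.exists_bound
      obtain ⟨B2, -, hB2⟩ := ((hφ.partialDeriv j).partialDeriv j).exists_bound
      have k1 : ∀ {f : ℝ × Torus d → ℝ}, (Measurable f ∧ ∀ z, |f z| ≤ M) →
          Integrable fun x => f (t, x) * Torus.partialDeriv j φ x := fun hf =>
        integrable_bdd_mul (hf.1.comp measurable_prodMk_left).aestronglyMeasurable (fun x => hf.2 _)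
          (hφ.partialDeriv j).integrable
      have k2 : ∀ {f : Torus d → ℝ}, f ∈ powBall volume q C → Integrable fun x => f x * φ x :=
        fun hf => integrable_mul_bdd (integrable_of_mem_powBall hq.le hf)
          hφ.continuous.aestronglyMeasurable hB
      have := tendsto_of_mem_convexHull hw
        ((convex_measurable_bounded (Y := ℝ × Torus d) M).prod (convex_powBall hq.le))
        (fun n => ⟨hSb n, hD n t ht j⟩)
        (Λ := fun z => (∫ x, z.2 x * φ x) + ∫ x, z.1 (t, x) * Torus.partialDeriv j φ x) (c := 0)
        (fun x hx y hy a c => by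
          have e1 : ∫ z, (a • x + c • y).2 z * φ z =
              a * (∫ z, x.2 z * φ z) + c * ∫ z, y.2 z * φ z := by
            rw [← integral_const_mul, ← integral_const_mul, ← integral_add ((k2 hx.2).const_mul a)
              ((k2 hy.2).const_mul c)]
            refine integral_congr_ae (ae_of_all _ fun z => ?_)
            simp only [Prod.snd_add, Prod.smul_snd, Pi.add_apply, Pi.smul_apply, smul_eq_mul]; ring
          have e2 : ∫ z, (a • x + c • y).1 (t, z) * Torus.partialDeriv j φ z =
              a * (∫ z, x.1 (t, z) * Torus.partialDeriv j φ z) +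
                c * ∫ z, y.1 (t, z) * Torus.partialDeriv j φ z := by
            rw [← integral_const_mul, ← integral_const_mul, ← integral_add ((k1 hx.1).const_mul a)
              ((k1 hy.1).const_mul c)]
            refine integral_congr_ae (ae_of_all _ fun z => ?_)
            simp only [Prod.fst_add, Prod.smul_fst, Pi.add_apply, Pi.smul_apply, smul_eq_mul]; ring
          simp only [e1, e2]; ring)
        (squeeze_zero_norm (fun n => abs_integral_difference_quotient_add_le
            ((hSb n).1.comp measurable_prodMk_left) (fun x => (hSb n).2 (t, x)) hφ j hB2
            (hS.step_pos n)) (by simpa using (hS.step_tendsto.const_mul B2).const_mul M))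
      have h3 := this.sub (hlim t ht _ (hφ.partialDeriv j))
      rw [zero_sub] at h3
      exact h3.congr fun n => by ring
    obtain ⟨g, -, g2, g3, -⟩ := exists_weak_limit hq hwb hwlim
    exact ⟨g, ⟨hUi t ht, integrable_of_mem_powBall hq.le g2, fun φ hφ => by
      rw [g3 φ hφ, neg_neg, hUℓ t ht _ (hφ.partialDeriv j)]⟩, g2⟩

end Existence

/-! ### Well-posedness and additivity in the datum. -/

theorem abs_clamp_le {M : ℝ} (hM : 0 ≤ M) (r : ℝ) : |max (-M) (min r M)| ≤ M :=
  abs_le.2 ⟨le_max_left _ _, max_le (by linarith) (min_le_right _ _)⟩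

theorem clamp_eq_self {M r : ℝ} (hr : |r| ≤ M) : max (-M) (min r M) = r := by
  rw [min_eq_left (abs_le.1 hr).2, max_eq_right (abs_le.1 hr).1]

theorem exists_measurable_bounded_representative {Y : Type*} [MeasurableSpace Y] {μ : Measure Y}
    {f : Y → ℝ} (hf : MemLp f ⊤ μ) :
    ∃ (g : Y → ℝ) (M : ℝ), Measurable g ∧ (∀ x, |g x| ≤ M) ∧ f =ᵐ[μ] g := by
  obtain ⟨M, hM⟩ : ∃ M : ℝ, ∀ᵐ x ∂μ, |f x| ≤ M := by
    refine ⟨(eLpNorm f ⊤ μ).toReal, ?_⟩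
    filter_upwards [enorm_ae_le_eLpNormEssSup f μ] with x hx
    rw [← eLpNorm_exponent_top] at hx
    rw [← Real.norm_eq_abs, ← toReal_enorm]
    exact ENNReal.toReal_mono hf.eLpNorm_ne_top hx
  have hm := hf.1.aemeasurable
  refine ⟨fun x => max (-|M|) (min (hm.mk f x) |M|), |M|,
    measurable_const.max (hm.measurable_mk.min measurable_const),
    fun x => abs_clamp_le (abs_nonneg M) _, ?_⟩
  filter_upwards [hM, hm.ae_eq_mk] with x hx hx'
  rw [← hx', clamp_eq_self (hx.trans (le_abs_self M))]

section WellPosed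

variable {T : ℝ} {b : ℝ → Torus d → EuclideanSpace ℝ (Fin d)} {D : ℝ → Torus d → ℝ}
  {β : Fin d → ℝ → Torus d → ℝ} {G : Fin d → Fin d → ℝ → Torus d → ℝ}

theorem intervalIntegral_test_congr
    (hag : ∀ᵐ s ∂volume.restrict (Icc 0 T), (∀ i, β i s =ᵐ[volume] fun x => b s x i) ∧
      (fun x => ∑ i, G i i s x) =ᵐ[volume] D s) {v V : ℝ → Torus d → ℝ}
    (hvV : ∀ᵐ s ∂volume.restrict (Icc 0 T), V s =ᵐ[volume] v s) {t : ℝ} (ht : t ∈ Icc 0 T)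
    (φ : Torus d → ℝ) :
    ∫ s in (0 : ℝ)..t, ∫ x, v s x * ((∑ i, b s x i * Torus.partialDeriv i φ x) + D s x * φ x) =
      ∫ s in (0 : ℝ)..t, ∫ x, V s x * transportTest β G φ s x := by
  rw [intervalIntegral.integral_of_le ht.1, intervalIntegral.integral_of_le ht.1]
  have hsub : Ioc 0 t ⊆ Icc 0 T := Ioc_subset_Icc_self.trans (Icc_subset_Icc_right ht.2)
  refine integral_congr_ae ?_
  filter_upwards [ae_restrict_of_ae_restrict_of_subset hsub hag,
    ae_restrict_of_ae_restrict_of_subset hsub hvV] with s hs hs'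
  refine integral_congr_ae ?_
  filter_upwards [ae_all_iff.2 hs.1, hs.2, hs'] with x h1 h2 h3
  simp only [transportTest, h1, h2, h3]

theorem IsTransportSolution.exists_representative {u₀ : Torus d → ℝ} {u : ℝ → Torus d → ℝ}
    (h : IsTransportSolution T b D u₀ u)
    (hag : ∀ᵐ s ∂volume.restrict (Icc 0 T), (∀ i, β i s =ᵐ[volume] fun x => b s x i) ∧
      (fun x => ∑ i, G i i s x) =ᵐ[volume] D s) :
    ∃ (V : ℝ → Torus d → ℝ) (M : ℝ), Measurable (Function.uncurry V) ∧ (∀ s x, |V s x| ≤ M) ∧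
      (∀ t ∈ Icc 0 T, ∀ᵐ x, |u t x| ≤ M) ∧
      (∀ᵐ s ∂volume.restrict (Icc 0 T), V s =ᵐ[volume] u s) ∧
      ∀ t ∈ Icc 0 T, ∀ φ, Smooth φ → (∫ x, u t x * φ x) - ∫ x, u₀ x * φ x =
        ∫ s in (0 : ℝ)..t, ∫ x, V s x * transportTest β G φ s x := by
  obtain ⟨M, hM⟩ := h.bounded
  have hM' : ∀ t ∈ Icc 0 T, ∀ᵐ x, |u t x| ≤ |M| := fun t ht =>
    (hM t ht).mono fun x hx => hx.trans (le_abs_self M)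
  have hm := h.aestronglyMeasurable.aemeasurable
  set V : ℝ → Torus d → ℝ := fun s x =>
    max (-|M|) (min (hm.mk (fun z : ℝ × Torus d => u z.1 z.2) (s, x)) |M|) with hV
  have hVu : ∀ᵐ s ∂volume.restrict (Icc 0 T), V s =ᵐ[volume] u s := by
    filter_upwards [Measure.ae_ae_of_ae_prod hm.ae_eq_mk, ae_restrict_mem measurableSet_Icc]
      with s hs hsT
    filter_upwards [hs, hM' s hsT] with x hx hx'
    simp only [hV]
    rw [← hx, clamp_eq_self hx']
  refine ⟨V, |M|, ?_, fun s x => abs_clamp_le (abs_nonneg M) _, hM', hVu, fun t ht φ hφ => ?_⟩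
  · exact measurable_const.max (hm.measurable_mk.min measurable_const)
  · rw [h.integral_eq t ht φ hφ]
    exact intervalIntegral_test_congr hag hVu ht φ

/-- Additive form of uniqueness. -/
theorem IsTransportSolution.ae_eq_add (hF : TransportField β G) (hd : Nonempty (Fin d))
    (hag : ∀ᵐ s ∂volume.restrict (Icc 0 T), (∀ i, β i s =ᵐ[volume] fun x => b s x i) ∧
      (fun x => ∑ i, G i i s x) =ᵐ[volume] D s)
    {u₀ a₀ c₀ : Torus d → ℝ} {u a c : ℝ → Torus d → ℝ} (hu : IsTransportSolution T b D u₀ u)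
    (ha : IsTransportSolution T b D a₀ a) (hc : IsTransportSolution T b D c₀ c)
    (hai : Integrable a₀) (hci : Integrable c₀)
    (h0 : u₀ =ᵐ[volume] fun x => a₀ x + c₀ x) {t : ℝ} (ht : t ∈ Icc 0 T) :
    u t =ᵐ[volume] fun x => a t x + c t x := by
  obtain ⟨Vu, Mu, um, ub, ub', uV, ue⟩ := hu.exists_representative hag
  obtain ⟨Va, Ma, am, ab, ab', aV, ae⟩ := ha.exists_representative hag
  obtain ⟨Vc, Mc, cm, cb, cb', cV, ce⟩ := hc.exists_representative hag
  have tri : ∀ {x y z : ℝ}, |x| ≤ Mu → |y| ≤ Ma → |z| ≤ Mc → |x - y - z| ≤ Mu + Ma + Mc :=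
    fun {x y z} hx hy hz => by
      rw [abs_le] at *
      constructor <;> linarith [hx.1, hx.2, hy.1, hy.2, hz.1, hz.2]
  -- The difference `u - a - c` solves the equation with zero datum.
  have key := hF.eq_zero_of_solution hd (T := T) (M := Mu + Ma + Mc)
    (v := fun t x => u t x - a t x - c t x) (V := fun t x => Vu t x - Va t x - Vc t x)
    ((um.sub am).sub cm) (fun s x => tri (ub s x) (ab s x) (cb s x))
    (fun t ht => ((hu.aestronglyMeasurable_slice t ht).sub (ha.aestronglyMeasurable_slice t ht)).sub
      (hc.aestronglyMeasurable_slice t ht))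
    (fun t ht => by
      filter_upwards [ub' t ht, ab' t ht, cb' t ht] with x h1 h2 h3
      exact tri h1 h2 h3)
    (by
      filter_upwards [uV, aV, cV] with s h1 h2 h3
      filter_upwards [h1, h2, h3] with x h1 h2 h3
      rw [h1, h2, h3])
    (fun t ht φ hφ => by
      obtain ⟨B, -, hB⟩ := hφ.exists_bound
      have hφm := hφ.continuous.aestronglyMeasurable (μ := (volume : Measure (Torus d)))
      have i0 : ∀ {w : ℝ → Torus d → ℝ} {M : ℝ}, AEStronglyMeasurable (w t) volume →
          (∀ᵐ x, |w t x| ≤ M) → Integrable fun x => w t x * φ x := fun hw hM =>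
        integrable_mul_bdd (Integrable.of_bound hw _ hM) hφm hB
      have iu := i0 (hu.aestronglyMeasurable_slice t ht) (ub' t ht)
      have ia := i0 (ha.aestronglyMeasurable_slice t ht) (ab' t ht)
      have ic := i0 (hc.aestronglyMeasurable_slice t ht) (cb' t ht)
      have e0 : ∫ x, u₀ x * φ x = (∫ x, a₀ x * φ x) + ∫ x, c₀ x * φ x := by
        rw [← integral_add (integrable_mul_bdd hai hφm hB) (integrable_mul_bdd hci hφm hB)]
        refine integral_congr_ae (h0.mono fun x hx => ?_)
        simp only [hx]; ring
      have e1 : ∫ x, (u t x - a t x - c t x) * φ x =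
          (∫ x, u t x * φ x) - (∫ x, a t x * φ x) - ∫ x, c t x * φ x := by
        rw [← integral_sub iu ia, ← integral_sub (integrable_sub_fun iu ia) ic]
        exact integral_congr_ae (ae_of_all _ fun x => by ring)
      have hFi := hF.integrable_transportTest hφ (Ioc 0 t)
      have hFs := hF.integrable_transportTest_slice hd hφ
      have j1 : ∀ {V : ℝ → Torus d → ℝ} {M : ℝ}, Measurable (Function.uncurry V) →
          (∀ s x, |V s x| ≤ M) → ∀ s, Integrable fun x => V s x * transportTest β G φ s x :=
        fun hV hM s => integrable_bdd_mul (hV.comp measurable_prodMk_left).aestronglyMeasurable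
          (hM s) (hFs s)
      have j2 : ∀ {V : ℝ → Torus d → ℝ} {M : ℝ}, Measurable (Function.uncurry V) →
          (∀ s x, |V s x| ≤ M) → Integrable (fun s => ∫ x, V s x * transportTest β G φ s x)
            (volume.restrict (Ioc 0 t)) := fun hV hM =>
        (integrable_bdd_mul hV.aestronglyMeasurable (fun p => hM p.1 p.2) hFi).integral_prod_left
      have e2 : ∀ s, ∫ x, (Vu s x - Va s x - Vc s x) * transportTest β G φ s x =
          (∫ x, Vu s x * transportTest β G φ s x) - (∫ x, Va s x * transportTest β G φ s x) -
            ∫ x, Vc s x * transportTest β G φ s x := fun s => by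
        rw [← integral_sub (j1 um ub s) (j1 am ab s),
          ← integral_sub (integrable_sub_fun (j1 um ub s) (j1 am ab s)) (j1 cm cb s)]
        exact integral_congr_ae (ae_of_all _ fun x => by ring)
      have e3 : ∫ s in (0 : ℝ)..t, ∫ x, (Vu s x - Va s x - Vc s x) * transportTest β G φ s x =
          (∫ s in (0 : ℝ)..t, ∫ x, Vu s x * transportTest β G φ s x) -
          (∫ s in (0 : ℝ)..t, ∫ x, Va s x * transportTest β G φ s x) -
            ∫ s in (0 : ℝ)..t, ∫ x, Vc s x * transportTest β G φ s x := by
        simp_rw [e2, intervalIntegral.integral_of_le ht.1]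
        rw [integral_sub (integrable_sub_fun (j2 um ub) (j2 am ab)) (j2 cm cb),
          integral_sub (j2 um ub) (j2 am ab)]
      refine e1.trans (Eq.trans ?_ e3.symm)
      rw [← ue t ht φ hφ, ← ae t ht φ hφ, ← ce t ht φ hφ, e0]
      ring) ht
  filter_upwards [key] with x hx
  simp only [Pi.zero_apply] at hx
  linarith

theorem IsTransportSolution.zero : IsTransportSolution T b D (fun _ => 0) fun _ _ => 0 where
  aestronglyMeasurable := aestronglyMeasurable_const
  aestronglyMeasurable_slice _ _ := aestronglyMeasurable_const
  bounded := ⟨0, fun _ _ => by simp⟩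
  weaklyContinuous φ _ := by simpa using continuousOn_const
  integral_eq t _ φ _ := by simp

theorem IsTransportSolution.ae_eq (hF : TransportField β G) (hd : Nonempty (Fin d))
    (hag : ∀ᵐ s ∂volume.restrict (Icc 0 T), (∀ i, β i s =ᵐ[volume] fun x => b s x i) ∧
      (fun x => ∑ i, G i i s x) =ᵐ[volume] D s)
    {u₀ : Torus d → ℝ} {u v : ℝ → Torus d → ℝ} (hu : IsTransportSolution T b D u₀ u)
    (hv : IsTransportSolution T b D u₀ v) (h0 : Integrable u₀) {t : ℝ} (ht : t ∈ Icc 0 T) :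
    u t =ᵐ[volume] v t := by
  simpa using hu.ae_eq_add hF hd hag hv .zero h0 (integrable_zero _ _ _) (by simp) ht

/-- Existence of solutions, with propagation of `L^p` bounds and, up to a loss of integrability, of
`W^{1,p}` bounds. -/
theorem TransportField.exists_isTransportSolution (hF : TransportField β G) (hd : Nonempty (Fin d))
    (hT : 0 < T)
    (hag : ∀ᵐ s ∂volume.restrict (Icc 0 T), (∀ i, β i s =ᵐ[volume] fun x => b s x i) ∧
      (fun x => ∑ i, G i i s x) =ᵐ[volume] D s) :
    ∃ (E : ℝ) (K : ℝ → ℝ → ℝ), 0 ≤ E ∧ (∀ p q, 1 < q → q < p → 0 ≤ K p q) ∧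
      ∀ u₀ : Torus d → ℝ, MemLp u₀ ⊤ → ∃ u, IsTransportSolution T b D u₀ u ∧
        (∀ p : ℝ, 1 < p → ∀ t ∈ Icc 0 T, u t ∈ powBall volume p (E * ∫ x, |u₀ x| ^ p)) ∧
        ∀ (p q A : ℝ) (g : Fin d → Torus d → ℝ), 1 < q → q < p → 0 < A →
          (∀ j, IsWeakPartial j u₀ (g j)) →
          (∀ j, ∫⁻ x, ENNReal.ofReal (|g j x| ^ p) ≤ ENNReal.ofReal (A ^ p)) → ∀ t ∈ Icc 0 T, ∀ j,
            ∃ g', IsWeakPartial j (u t) g' ∧ g' ∈ powBall volume q (K p q * A ^ q) := by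
  obtain ⟨L, h, S, hS⟩ := hF.exists_approximationScheme hd hT
  -- The constants are chosen before the datum: interpolation applies them to a family of data, one
  -- pair for each scale.
  have hK : ∀ p q : ℝ, ∃ C : ℝ, 1 < q → q < p → 0 ≤ C ∧ ∀ (n : ℕ) (u : Torus d → ℝ) (M : ℝ)
      (g : Fin d → Torus d → ℝ) (A : ℝ), Measurable u → (∀ x, |u x| ≤ M) →
      (∀ j, IsWeakPartial j u (g j)) → 0 < A →
      (∀ j, ∫⁻ x, ENNReal.ofReal (|g j x| ^ p) ≤ ENNReal.ofReal (A ^ p)) → ∀ t ∈ Icc 0 T, ∀ j,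
        (fun x => (S n u t (x + axisPoint j (h n)) - S n u t x) / h n) ∈
          powBall volume q (C * A ^ q) := by
    intro p q
    by_cases hpq : 1 < q ∧ q < p
    · obtain ⟨C, hC⟩ := hS.gradient_mem_powBall p q hpq.1.le hpq.2
      exact ⟨C, fun _ _ => hC⟩
    · exact ⟨0, fun h1 h2 => absurd ⟨h1, h2⟩ hpq⟩
  choose K hK using hK
  refine ⟨Real.exp (L * T), K, (Real.exp_pos _).le, fun p q h1 h2 => (hK p q h1 h2).1, fun u₀ hu₀ => ?_⟩
  obtain ⟨v, M, hvm, hvM, huv⟩ := exists_measurable_bounded_representative hu₀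
  obtain ⟨U, h1, h2, h3, h4, h5, h6, h7⟩ := hS.exists_solution hF hd hvm hvM
  refine ⟨U, ⟨h1, fun t ht => (h2 t ht).aestronglyMeasurable, ⟨M, h3⟩, fun φ hφ =>
    continuousOn_integral_mul (fun t ht => (h2 t ht).aestronglyMeasurable) h3 h4 hφ,
    fun t ht φ hφ => ?_⟩, fun p hp t ht => ?_, fun p q A g hq hqp hA hg hgA t ht j => ?_⟩
  · have e : ∫ x, u₀ x * φ x = ∫ x, v x * φ x :=
      integral_congr_ae (huv.mono fun x hx => by simp only [hx])
    rw [e, h5 t ht φ hφ]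
    exact (intervalIntegral_test_congr hag (ae_of_all _ fun s => ae_eq_refl _) ht φ).symm
  · have e : ∫ x, |u₀ x| ^ p = ∫ x, |v x| ^ p :=
      integral_congr_ae (huv.mono fun x hx => by simp only [hx])
    rw [e]
    exact h6 p hp t ht
  · exact h7 q _ hq (fun n t ht j => (hK p q hq hqp).2 n v M g A hvm hvM
      (fun j => (hg j).congr huv (ae_eq_refl _)) hA hgA t ht j) t ht j

end WellPosed

/-! ### Splitting a Sobolev datum at every scale. -/

theorem abs_deriv_periodicBump_le : ∃ K, 0 ≤ K ∧ ∀ (n : ℕ) (s : ℝ),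
    |deriv (periodicBump n) s| ≤ K * (n + 1) := by
  obtain ⟨K, hK0, hK⟩ := exists_deriv_lineBump_bound
  refine ⟨K * Real.pi, by positivity, fun n s => ?_⟩
  have hn : (0 : ℝ) < n + 1 := by positivity
  rw [deriv_periodicBump, abs_mul, abs_mul, abs_mul, abs_of_pos hn, abs_of_pos Real.pi_pos]
  calc _ ≤ K * ((n + 1) * (1 * Real.pi)) := by
        gcongr
        exacts [hK _, Real.abs_cos_le_one _]
    _ = _ := by ring

theorem exists_mollifier_bound : ∃ B, 0 ≤ B ∧ ∀ (n : ℕ) (z : Torus d),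
    |mollifier n z| ≤ B * (n + 1) ^ d ∧
      ∀ i, |Torus.partialDeriv i (mollifier n) z| ≤ B * (n + 1) ^ (d + 1) := by
  obtain ⟨K, hK0, hK⟩ := abs_deriv_periodicBump_le
  refine ⟨Real.pi ^ d * (K + 1), by positivity, fun n z => ?_⟩
  have hn : (0 : ℝ) < n + 1 := by positivity
  have hc := integral_circleBump_pos n
  have hc' : (∫ a, circleBump n a)⁻¹ ≤ Real.pi * (n + 1) := by
    rw [inv_le_comm₀ hc (by positivity), ← one_div]; exact integral_circleBump_ge n
  have h1 : ∀ a, |circleBump n a / ∫ a, circleBump n a| ≤ Real.pi * (n + 1) := fun a => by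
    rw [abs_div, abs_of_pos hc, abs_of_nonneg (circleBump_nonneg n a), div_eq_mul_inv,
      ← one_mul (Real.pi * _)]
    refine mul_le_mul ?_ hc' (inv_nonneg.2 hc.le) zero_le_one
    induction a using QuotientAddGroup.induction_on with
    | H s => exact lineBump.le_one
  have h2 : ∀ a, |circleBumpDeriv n a / ∫ a, circleBump n a| ≤
      Real.pi * (n + 1) * (K * (n + 1)) := fun a => by
    rw [abs_div, abs_of_pos hc, div_eq_mul_inv, mul_comm]
    refine mul_le_mul hc' ?_ (abs_nonneg _) (by positivity)
    induction a using QuotientAddGroup.induction_on with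
    | H s => exact hK n s
  constructor
  · rw [mollifier, Finset.abs_prod]
    calc _ ≤ ∏ _i : Fin d, Real.pi * ((n : ℝ) + 1) :=
          Finset.prod_le_prod (fun _ _ => abs_nonneg _) fun i _ => h1 _
      _ = Real.pi ^ d * 1 * (n + 1) ^ d := by simp [mul_pow]
      _ ≤ _ := by gcongr; linarith
  · intro i
    rw [partialDeriv_mollifier, Finset.abs_prod, ← Finset.mul_prod_erase _ _ (Finset.mem_univ i)]
    simp only [if_true]
    have h3 : ∏ j ∈ Finset.univ.erase i, |(if j = i then circleBumpDeriv n (z j) else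
        circleBump n (z j)) / ∫ a, circleBump n a| ≤ ∏ _j ∈ Finset.univ.erase i,
          Real.pi * ((n : ℝ) + 1) := by
      refine Finset.prod_le_prod (fun _ _ => abs_nonneg _) fun j hj => ?_
      rw [if_neg (Finset.mem_erase.1 hj).1]; exact h1 _
    calc _ ≤ Real.pi * (n + 1) * (K * (n + 1)) * ∏ _j ∈ Finset.univ.erase i, Real.pi * ((n : ℝ) + 1) :=
          mul_le_mul (h2 _) h3 (Finset.prod_nonneg fun _ _ => abs_nonneg _) (by positivity)
      _ = K * (n + 1) * ∏ _j : Fin d, Real.pi * ((n : ℝ) + 1) := by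
          rw [← Finset.mul_prod_erase _ _ (Finset.mem_univ i)]; ring
      _ = Real.pi ^ d * K * (n + 1) ^ (d + 1) := by simp [mul_pow]; ring
      _ ≤ _ := by gcongr; linarith

theorem measurableSet_unitBox :
    MeasurableSet {h : EuclideanSpace ℝ (Fin d) | ∀ i, h i ∈ Ioc (0 : ℝ) 1} := by
  rw [Set.ofPred_forall]
  exact MeasurableSet.iInter fun i => measurableSet_Ioc.preimage (by fun_prop)

/-- The half-open unit box is a fundamental domain, so the outer integral of the Gagliardo energy
can be compared with integrals over the torus. -/
theorem measurePreserving_proj : MeasurePreserving (proj (d := d))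
    (volume.restrict {h : EuclideanSpace ℝ (Fin d) | ∀ i, h i ∈ Ioc (0 : ℝ) 1}) volume := by
  have h1 : MeasurePreserving (fun (a : Fin d → ℝ) i => (a i : UnitAddCircle))
      (Measure.pi fun _ => volume.restrict (Ioc (0 : ℝ) 1)) (Measure.pi fun _ => volume) :=
    measurePreserving_pi _ _ fun i => by
      simpa using UnitAddCircle.measurePreserving_mk 0
  rw [← Measure.restrict_pi_pi] at h1
  have h2 := (PiLp.volume_preserving_ofLp (Fin d)).restrict_preimage
    (s := Set.univ.pi fun _ : Fin d => Ioc (0 : ℝ) 1) (MeasurableSet.univ_pi fun _ => measurableSet_Ioc)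
  have e : {h : EuclideanSpace ℝ (Fin d) | ∀ i, h i ∈ Ioc (0 : ℝ) 1} =
      WithLp.ofLp ⁻¹' (Set.univ.pi fun _ : Fin d => Ioc (0 : ℝ) 1) := by
    ext h; simp [Set.mem_pi]
  rw [e]
  exact h1.comp h2

theorem eq_of_proj_eq {y z : EuclideanSpace ℝ (Fin d)} (hy : ∀ i, y i ∈ Ioc (0 : ℝ) 1)
    (hz : ∀ i, z i ∈ Ioc (0 : ℝ) 1) (h : proj y = proj z) : y = z := by
  ext i
  have h1 : ((y i : ℝ) : AddCircle (1 : ℝ)) = (z i : ℝ) := congrFun h i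
  exact (AddCircle.coe_eq_coe_iff_of_mem_Ioc (a := (0 : ℝ)) (by simpa using hy i)
    (by simpa using hz i)).1 h1

/-- Jensen's inequality for a weight. -/
theorem lintegral_mul_rpow_le {Y : Type*} [MeasurableSpace Y] {μ : Measure Y} {κ w : Y → ℝ≥0∞}
    (hκ : AEMeasurable κ μ) (hw : AEMeasurable w μ) {p : ℝ} (hp : 1 < p) :
    (∫⁻ y, κ y * w y ∂μ) ^ p ≤ (∫⁻ y, κ y ∂μ) ^ (p - 1) * ∫⁻ y, κ y * w y ^ p ∂μ := by
  have hpq := (Real.HolderConjugate.conjExponent hp)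
  set q := Real.conjExponent p with hq
  have hp0 : 0 < p := by linarith
  have hq0 : 0 < q := hpq.symm.pos
  have h := ENNReal.lintegral_mul_le_Lp_mul_Lq μ hpq (f := fun y => κ y ^ (1 / p) * w y)
    (g := fun y => κ y ^ (1 / q)) ((hκ.pow_const _).mul hw) (hκ.pow_const _)
  have e1 : ∀ y, ((fun y => κ y ^ (1 / p) * w y) * fun y => κ y ^ (1 / q)) y = κ y * w y := fun y => by
    simp only [Pi.mul_apply]
    rw [mul_right_comm, ← ENNReal.rpow_add_of_nonneg _ _ (by positivity) (by positivity), one_div,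
      one_div, hpq.inv_add_inv_eq_one, ENNReal.rpow_one]
  have e2 : ∀ y, (κ y ^ (1 / p) * w y) ^ p = κ y * w y ^ p := fun y => by
    rw [ENNReal.mul_rpow_of_nonneg _ _ hp0.le, ← ENNReal.rpow_mul, one_div_mul_cancel hp0.ne',
      ENNReal.rpow_one]
  have e3 : ∀ y, (κ y ^ (1 / q)) ^ q = κ y := fun y => by
    rw [← ENNReal.rpow_mul, one_div_mul_cancel hq0.ne', ENNReal.rpow_one]
  simp_rw [e1, e2, e3] at h
  refine (ENNReal.rpow_le_rpow h hp0.le).trans (le_of_eq ?_)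
  rw [ENNReal.mul_rpow_of_nonneg _ _ hp0.le, ← ENNReal.rpow_mul, ← ENNReal.rpow_mul,
    one_div_mul_cancel hp0.ne', ENNReal.rpow_one, mul_comm]
  congr 2
  rw [hq, Real.conjExponent]
  field_simp

/-- Hölder's inequality with weight `|κ|` gives the power of `I`. On the support `|h| ≤ ρ`, so `|κ|`
is at most `B ρ^(d + p α) / |h|^(d + p α)`, the Gagliardo weight. The small representative of `z`
must lie in the box over which the energy is integrated. -/
theorem lintegral_kernel_difference_le (hd : Nonempty (Fin d)) {κ u : Torus d → ℝ} {B I ρ α p : ℝ}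
    (hκ : Measurable κ) (hu : Measurable u) (hB : ∀ z, |κ z| ≤ B) (hI0 : 0 ≤ I)
    (hI : ∫ z, |κ z| ≤ I) (hp : 1 < p) (hα : 0 < α)
    (hρ : ∀ z, κ z ≠ 0 → ∃ h : EuclideanSpace ℝ (Fin d), (∀ i, h i ∈ Ioc (0 : ℝ) 1) ∧ ‖h‖ ≤ ρ ∧
      proj h = z) :
    ∫⁻ x, ENNReal.ofReal (|∫ z, κ z * (u (x + z) - u x)| ^ p) ≤
      ENNReal.ofReal (I ^ (p - 1) * (B * ρ ^ (d + p * α))) * gagliardoEnergy α p u := by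
  have hp0 : 0 < p := by linarith
  have hB0 : 0 ≤ B := (abs_nonneg _).trans (hB 0)
  have hκi : Integrable κ := integrable_of_measurable_of_bound hκ hB
  have hwm : Measurable fun q : Torus d × Torus d => ‖u (q.1 + q.2) - u q.1‖ₑ :=
    ((hu.comp measurable_add).sub (hu.comp measurable_fst)).enorm
  have hκm : Measurable fun z => ‖κ z‖ₑ := hκ.enorm
  have hIκ : ∫⁻ z, ‖κ z‖ₑ ≤ ENNReal.ofReal I := by
    rw [← ofReal_integral_norm_eq_lintegral_enorm hκi]
    exact ENNReal.ofReal_le_ofReal hI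
  have epow : ∀ a : ℝ, ENNReal.ofReal (|a| ^ p) = ‖a‖ₑ ^ p := fun a => by
    rw [← ENNReal.ofReal_rpow_of_nonneg (abs_nonneg _) hp0.le, ← Real.norm_eq_abs, ofReal_norm]
  have h1 : ∀ x, ENNReal.ofReal (|∫ z, κ z * (u (x + z) - u x)| ^ p) ≤
      ENNReal.ofReal (I ^ (p - 1)) * ∫⁻ z, ‖κ z‖ₑ * ‖u (x + z) - u x‖ₑ ^ p := fun x => by
    rw [epow]
    refine (ENNReal.rpow_le_rpow (enorm_integral_le_lintegral_enorm _) hp0.le).trans ?_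
    simp_rw [enorm_mul]
    refine (lintegral_mul_rpow_le hκm.aemeasurable
      (hwm.comp measurable_prodMk_left).aemeasurable hp).trans ?_
    rw [← ENNReal.ofReal_rpow_of_nonneg hI0 (by linarith)]
    exact mul_le_mul_left (ENNReal.rpow_le_rpow hIκ (by linarith)) _
  refine (lintegral_mono h1).trans ?_
  rw [lintegral_const_mul' _ _ ENNReal.ofReal_ne_top, ENNReal.ofReal_mul (Real.rpow_nonneg hI0 _),
    mul_assoc]
  refine mul_le_mul_right ?_ _
  have hjm : Measurable fun q : Torus d × Torus d => ‖κ q.2‖ₑ * ‖u (q.1 + q.2) - u q.1‖ₑ ^ p :=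
    (hκm.comp measurable_snd).mul (hwm.pow_const p)
  have hJ : Measurable fun z => ∫⁻ x, ‖κ z‖ₑ * ‖u (x + z) - u x‖ₑ ^ p :=
    (hjm.comp measurable_swap).lintegral_prod_right'
  rw [lintegral_lintegral_swap hjm.aemeasurable, ← measurePreserving_proj.lintegral_comp hJ,
    gagliardoEnergy, ← lintegral_const_mul' _ _ ENNReal.ofReal_ne_top]
  refine setLIntegral_mono' measurableSet_unitBox fun h hh => ?_
  rw [← lintegral_const_mul' _ _ ENNReal.ofReal_ne_top]
  refine lintegral_mono fun x => ?_
  by_cases hz : κ (proj h) = 0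
  · simp [hz]
  obtain ⟨h', hh', hle, he⟩ := hρ _ hz
  rw [eq_of_proj_eq hh' hh he] at hle
  have hpos : 0 < ‖h‖ := norm_pos_iff.2 fun h0 => by
    have := (hh hd.some).1
    simp [h0] at this
  have he0 : 0 ≤ (d : ℝ) + p * α := by positivity
  change ‖κ (proj h)‖ₑ * ‖u (x + proj h) - u x‖ₑ ^ p ≤ _
  rw [← epow, ← ENNReal.ofReal_mul (mul_nonneg hB0 (Real.rpow_nonneg (hpos.le.trans hle) _)),
    ← ofReal_norm, ← ENNReal.ofReal_mul (norm_nonneg _)]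
  refine ENNReal.ofReal_le_ofReal ?_
  rw [mul_div_assoc', le_div_iff₀ (Real.rpow_pos_of_pos hpos _)]
  have h3 := Real.rpow_le_rpow hpos.le hle he0
  have h4 : 0 ≤ |u (x + proj h) - u x| ^ p := Real.rpow_nonneg (abs_nonneg _) _
  calc _ ≤ B * |u (x + proj h) - u x| ^ p * ρ ^ ((d : ℝ) + p * α) := by
        refine mul_le_mul (mul_le_mul_of_nonneg_right (hB _) h4) h3 (Real.rpow_nonneg hpos.le _)
          (mul_nonneg hB0 h4)
    _ = _ := by ring

/-- `u` is the sum of a function with `p`-integrable gradient of size `r ^ (α - 1)` and a function of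
size `r ^ α` in `L^p`, for every scale `r`. -/
def IsInterpolable (α p K : ℝ) (u : Torus d → ℝ) : Prop :=
  ∀ r : ℝ, 0 < r → r ≤ 1 → ∃ (a c : Torus d → ℝ) (g : Fin d → Torus d → ℝ), MemLp a ⊤ ∧ MemLp c ⊤ ∧
    (u =ᵐ[volume] fun x => a x + c x) ∧ (∀ j, IsWeakPartial j a (g j)) ∧
    (∀ j, ∫⁻ x, ENNReal.ofReal (|g j x| ^ p) ≤ ENNReal.ofReal ((K * r ^ (α - 1)) ^ p)) ∧
    ∫⁻ x, ENNReal.ofReal (|c x| ^ p) ≤ ENNReal.ofReal ((K * r ^ α) ^ p)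

theorem conv_translate_sub {κ u : Torus d → ℝ} (hκ : Smooth κ) (hu : Integrable u) (e x : Torus d) :
    conv κ (fun y => u (y + e)) x - (∫ z, κ z) * u x = ∫ z, κ (e - z) * (u (x + z) - u x) := by
  have i1 : Integrable fun z => κ (e - z) * u (x + z) :=
    (hκ.comp_sub e).integrable_mul ((measurePreserving_add_left volume x).integrable_comp_of_integrable hu)
  have i2 : Integrable fun z => κ (e - z) * u x := (hκ.comp_sub e).integrable.mul_const _
  simp_rw [mul_sub]
  rw [integral_sub i1 i2, integral_mul_const, integral_sub_left_eq_self κ volume e, conv,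
    ← integral_sub_left_eq_self (fun z => κ z * u (x - z + e)) volume e]
  congr 2
  ext z
  congr 2
  abel

/-- The energy only sees shifts with positive coordinates, while the mollifier is centred at the
origin. A translation by `2 / (n + 1)` in every coordinate puts its support into `(0, 3 / (n +
1)]^d`, inside the unit box once `n ≥ 2`. -/
theorem mollifier_shift_support (hd : Nonempty (Fin d)) {n : ℕ} (hn : 2 ≤ n) {z : Torus d}
    (hz : mollifier n (proj (WithLp.toLp 2 fun _ => 2 / ((n : ℝ) + 1)) - z) ≠ 0 ∨
      ∃ i, Torus.partialDeriv i (mollifier n) (proj (WithLp.toLp 2 fun _ => 2 / ((n : ℝ) + 1)) - z) ≠ 0) :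
    ∃ h : EuclideanSpace ℝ (Fin d), (∀ i, h i ∈ Ioc (0 : ℝ) 1) ∧ ‖h‖ ≤ 3 * d / ((n : ℝ) + 1) ∧
      proj h = z := by
  obtain ⟨y, hy, hy'⟩ := mollifier_support hz
  have hn' : (3 : ℝ) ≤ n + 1 := by
    have : (2 : ℝ) ≤ n := by exact_mod_cast hn
    linarith
  have hN : 0 < (n : ℝ) + 1 := by linarith
  have hε : 0 < 1 / ((n : ℝ) + 1) := by positivity
  have e2 : 2 / ((n : ℝ) + 1) = 2 * (1 / ((n : ℝ) + 1)) := by ring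
  have e3 : 3 * (1 / ((n : ℝ) + 1)) ≤ 1 := by
    rw [mul_one_div, div_le_one hN]; exact hn'
  have hb : ∀ i, 2 / ((n : ℝ) + 1) - y i ∈ Ioc 0 (3 * (1 / ((n : ℝ) + 1))) := fun i => by
    have := abs_le.1 (hy' i)
    rw [e2]
    constructor <;> linarith [this.1, this.2]
  refine ⟨WithLp.toLp 2 (fun _ => 2 / ((n : ℝ) + 1)) - y, fun i => ⟨(hb i).1, (hb i).2.trans e3⟩, ?_, ?_⟩
  · rw [EuclideanSpace.norm_eq]
    refine Real.sqrt_le_iff.2 ⟨by positivity, ?_⟩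
    have hd1 : (1 : ℝ) ≤ d := by exact_mod_cast Fin.pos hd.some
    have : ∀ i, ‖(WithLp.toLp 2 (fun _ => 2 / ((n : ℝ) + 1)) - y : EuclideanSpace ℝ (Fin d)) i‖ ^ 2 ≤
        (3 * (1 / ((n : ℝ) + 1))) ^ 2 := fun i => by
      refine pow_le_pow_left₀ (norm_nonneg _) ?_ 2
      exact (abs_of_pos (hb i).1).le.trans (hb i).2
    refine (sum_fin_le this).trans ?_
    calc (d : ℝ) * (3 * (1 / ((n : ℝ) + 1))) ^ 2 = d * 1 * (3 / ((n : ℝ) + 1)) ^ 2 := by ring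
      _ ≤ d * d * (3 / ((n : ℝ) + 1)) ^ 2 := by gcongr
      _ = _ := by ring
  · rw [sub_eq_add_neg, proj_add, proj_neg, hy]; abel

/-- The regular part is a shifted mollification of `u` at scale `1 / N ~ r` and the remainder is the
rest. Both `∇a` and `a - u` are integrals of increments of `u` against a kernel. -/
theorem exists_isInterpolable_of_gagliardoEnergy (hd : Nonempty (Fin d)) {α p M : ℝ} {u : Torus d → ℝ}
    (hα : 0 < α) (hα1 : α ≤ 1) (hp : 1 < p) (hu : Measurable u) (hM : ∀ x, |u x| ≤ M)
    (hE : gagliardoEnergy α p u < ⊤) : ∃ K, 0 < K ∧ IsInterpolable α p K u := by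
  have hp0 : 0 < p := by linarith
  have hd1 : (1 : ℝ) ≤ d := by exact_mod_cast Fin.pos hd.some
  have hui := integrable_of_measurable_of_bound (μ := (volume : Measure (Torus d))) hu hM
  obtain ⟨B, hB0, hB⟩ := exists_mollifier_bound (d := d)
  obtain ⟨C, hC0, hC⟩ := integral_abs_partialDeriv_mollifier_le (d := d)
  set E := (gagliardoEnergy α p u).toReal with hEdef
  have hE' : gagliardoEnergy α p u = ENNReal.ofReal E := (ENNReal.ofReal_toReal hE.ne).symm
  have hE0 : 0 ≤ E := ENNReal.toReal_nonneg
  set R := B * (3 * (d : ℝ)) ^ ((d : ℝ) + p * α) * E with hR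
  have hR0 : 0 ≤ R := by positivity
  set K₀ := (((C + 1) ^ (p - 1) * (R + 1)) ^ (1 / p)) with hK₀
  have hK₀0 : 0 < K₀ := by positivity
  have hK₀p : K₀ ^ p = (C + 1) ^ (p - 1) * (R + 1) := by
    rw [hK₀, ← Real.rpow_mul (by positivity), one_div_mul_cancel hp0.ne', Real.rpow_one]
  have hC1 : 1 ≤ (C + 1) ^ (p - 1) := Real.one_le_rpow (by linarith) (by linarith)
  refine ⟨4 * K₀, by positivity, fun r hr hr1 => ?_⟩
  -- This gives `1 / r ≤ N ≤ 4 / r` together with `n ≥ 2`.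
  set n := ⌈1 / r⌉₊ + 1 with hn
  set N : ℝ := (n : ℝ) + 1 with hN
  have hr1' : 1 ≤ 1 / r := by rw [le_div_iff₀ hr]; linarith
  have hN1 : 1 / r ≤ N := by
    have := Nat.le_ceil (1 / r); simp only [hN, hn]; push_cast; linarith
  have hN4 : N ≤ 4 * (1 / r) := by
    have := (Nat.ceil_lt_add_one (by positivity : 0 ≤ 1 / r)); simp only [hN, hn]; push_cast; linarith
  have hn2 : 2 ≤ n := by
    have : 0 < ⌈1 / r⌉₊ := Nat.ceil_pos.2 (by positivity)
    omega
  have hN0 : 0 < N := by positivity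
  set e : Torus d := proj (WithLp.toLp 2 fun _ => 2 / N) with he
  have hk := mollifier_smooth (d := d) n
  have hue : Integrable fun x => u (x + e) := integrable_comp_add_right hui e
  have has := conv_smooth hk hue
  set a := conv (mollifier n) (fun x => u (x + e)) with ha
  obtain ⟨A, -, hA⟩ := has.exists_bound
  -- It is used with `m = 1`, `I = C * N` for a derivative of the mollifier, which has zero
  -- integral, and with `m = 0`, `I = 1` for the mollifier itself.
  have key : ∀ (κ : Torus d → ℝ) (m : ℕ) (I : ℝ), Smooth κ → (∀ z, |κ z| ≤ B * N ^ (d + m)) →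
      0 ≤ I → ∫ z, |κ z| ≤ I →
      (∀ z, κ z ≠ 0 → mollifier n z ≠ 0 ∨ ∃ i, Torus.partialDeriv i (mollifier n) z ≠ 0) →
      ∫⁻ x, ENNReal.ofReal (|conv κ (fun y => u (y + e)) x - (∫ z, κ z) * u x| ^ p) ≤
        ENNReal.ofReal (I ^ (p - 1) * (R * N ^ ((m : ℝ) - p * α))) := by
    intro κ m I hκ hκB hI0 hκI hκs
    simp_rw [conv_translate_sub hκ hui e]
    refine (lintegral_kernel_difference_le hd (hκ.comp_sub e).continuous.measurable hu
      (fun z => hκB (e - z)) hI0 ?_ hp hα (fun z hz => mollifier_shift_support hd hn2 (hκs _ hz))).trans ?_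
    · rwa [integral_sub_left_eq_self (fun z => |κ z|) volume e]
    · rw [hE', ← ENNReal.ofReal_mul (by positivity)]
      refine ENNReal.ofReal_le_ofReal (le_of_eq ?_)
      rw [Real.div_rpow (by positivity) hN0.le, ← Real.rpow_natCast N (d + m), Nat.cast_add, hR,
        show (m : ℝ) - p * α = ((d : ℝ) + m) - (d + p * α) by ring, Real.rpow_sub hN0]
      ring
  refine ⟨a, fun x => u x - a x, fun j => Torus.partialDeriv j a,
    memLp_top_of_bound has.continuous.aestronglyMeasurable A (ae_of_all _ hA),
    memLp_top_of_bound (hu.sub has.continuous.measurable).aestronglyMeasurable (M + A)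
      (ae_of_all _ fun x => (abs_sub _ _).trans (add_le_add (hM x) (hA x))),
    ae_of_all _ fun x => by ring, fun j => has.isWeakPartial j, fun j => ?_, ?_⟩
  · have h1 := key (Torus.partialDeriv j (mollifier n)) 1 (C * N) (hk.partialDeriv j)
      (fun z => (hB n z).2 j) (by positivity) (hC n j) fun z hz => Or.inr ⟨j, hz⟩
    rw [hk.integral_partialDeriv j] at h1
    simp only [zero_mul, sub_zero] at h1
    have h2 : ∀ x, Torus.partialDeriv j a x =
        conv (Torus.partialDeriv j (mollifier n)) (fun y => u (y + e)) x :=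
      partialDeriv_conv hk hue j
    simp_rw [h2]
    refine h1.trans (ENNReal.ofReal_le_ofReal ?_)
    have h3 : N ^ (1 - α) ≤ 4 * r ^ (α - 1) := by
      calc N ^ (1 - α) ≤ (4 * (1 / r)) ^ (1 - α) := Real.rpow_le_rpow hN0.le hN4 (by linarith)
        _ = 4 ^ (1 - α) * r ^ (α - 1) := by
            rw [Real.mul_rpow (by norm_num) (by positivity), one_div, ← Real.rpow_neg_one,
              ← Real.rpow_mul hr.le]
            congr 2; ring
        _ ≤ 4 ^ (1 : ℝ) * r ^ (α - 1) := by
            refine mul_le_mul_of_nonneg_right ?_ (Real.rpow_nonneg hr.le _)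
            exact Real.rpow_le_rpow_of_exponent_le (by norm_num) (by linarith)
        _ = _ := by rw [Real.rpow_one]
    calc (C * N) ^ (p - 1) * (R * N ^ (((1 : ℕ) : ℝ) - p * α))
        = C ^ (p - 1) * R * (N ^ (1 - α)) ^ p := by
          rw [Real.mul_rpow hC0 hN0.le, ← Real.rpow_mul hN0.le,
            show (1 - α) * p = (p - 1) + (((1 : ℕ) : ℝ) - p * α) by push_cast; ring, Real.rpow_add hN0]
          ring
      _ ≤ K₀ ^ p * (4 * r ^ (α - 1)) ^ p := by
          rw [hK₀p]
          gcongr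
          · linarith
          · linarith
      _ = _ := by
          rw [← Real.mul_rpow hK₀0.le (by positivity)]
          congr 1; ring
  · have h1 := key (mollifier n) 0 1 hk (fun z => by simpa using (hB n z).1) zero_le_one
      (by simp_rw [abs_of_nonneg (mollifier_nonneg n _)]; rw [integral_mollifier])
      fun z hz => Or.inl hz
    rw [integral_mollifier] at h1
    simp only [one_mul] at h1
    simp_rw [abs_sub_comm (u _) (a _)]
    refine h1.trans (ENNReal.ofReal_le_ofReal ?_)
    have h3 : N ^ (-α) ≤ r ^ α := by
      rw [Real.rpow_neg hN0.le, ← Real.inv_rpow hN0.le]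
      refine Real.rpow_le_rpow (by positivity) ?_ hα.le
      rw [inv_le_comm₀ hN0 hr, ← one_div]; exact hN1
    calc 1 ^ (p - 1) * (R * N ^ (((0 : ℕ) : ℝ) - p * α)) = 1 * R * (N ^ (-α)) ^ p := by
          rw [Real.one_rpow, one_mul, one_mul, ← Real.rpow_mul hN0.le]
          congr 2; push_cast; ring
      _ ≤ (C + 1) ^ (p - 1) * (R + 1) * (r ^ α) ^ p := by
          gcongr
          linarith
      _ = (K₀ * r ^ α) ^ p := by rw [← hK₀p, Real.mul_rpow hK₀0.le (by positivity)]
      _ ≤ _ := by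
          refine Real.rpow_le_rpow (by positivity) ?_ hp0.le
          exact mul_le_mul_of_nonneg_right (by linarith) (Real.rpow_nonneg hr.le _)

theorem lintegral_rpow_lt_top {p : ℝ} (hp : 0 < p) {g : Torus d → ℝ} (hg : MemLp g (ENNReal.ofReal p)) :
    ∫⁻ x, ENNReal.ofReal (|g x| ^ p) < ⊤ := by
  have h1 := lintegral_rpow_enorm_lt_top_of_eLpNorm_lt_top (by simpa using hp) ENNReal.ofReal_ne_top hg.2
  rw [ENNReal.toReal_ofReal hp.le] at h1
  convert h1 using 3 with x
  rw [← ENNReal.ofReal_rpow_of_nonneg (abs_nonneg _) hp.le, ← Real.norm_eq_abs, ofReal_norm]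

theorem gagliardoEnergy_congr {α p : ℝ} {u v : Torus d → ℝ} (h : u =ᵐ[volume] v) :
    gagliardoEnergy α p u = gagliardoEnergy α p v := by
  refine lintegral_congr fun y => lintegral_congr_ae ?_
  have h' := (measurePreserving_add_right volume (proj y)).quasiMeasurePreserving.ae h
  filter_upwards [h, h'] with x h1 h2
  rw [h1, h2]

theorem MemSobolevOne.exists_gradient_bound {p : ℝ} (hp : 0 < p) {u : Torus d → ℝ}
    (hu : MemSobolevOne p u) : ∃ (g : Fin d → Torus d → ℝ) (A : ℝ), 0 < A ∧
      (∀ j, IsWeakPartial j u (g j)) ∧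
      ∀ j, ∫⁻ x, ENNReal.ofReal (|g j x| ^ p) ≤ ENNReal.ofReal (A ^ p) := by
  choose g hg hgp using hu.2
  set A := ∑ j, (∫⁻ x, ENNReal.ofReal (|g j x| ^ p)).toReal with hA
  have hA0 : 0 ≤ A := Finset.sum_nonneg fun _ _ => ENNReal.toReal_nonneg
  refine ⟨g, (A + 1) ^ (1 / p), by positivity, hg, fun j => ?_⟩
  rw [← Real.rpow_mul (by positivity), one_div_mul_cancel hp.ne', Real.rpow_one,
    ← ENNReal.ofReal_toReal (lintegral_rpow_lt_top hp (hgp j)).ne]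
  refine ENNReal.ofReal_le_ofReal ?_
  have := Finset.single_le_sum (f := fun j => (∫⁻ x, ENNReal.ofReal (|g j x| ^ p)).toReal)
    (fun _ _ => ENNReal.toReal_nonneg) (Finset.mem_univ j)
  linarith

theorem exists_isInterpolable (hd : Nonempty (Fin d)) {α p : ℝ} {u : Torus d → ℝ}
    (hα : 0 < α) (hα1 : α ≤ 1) (hp : 1 < p) (hu : MemLp u ⊤) (hu' : MemSobolev α p u) :
    ∃ K, 0 < K ∧ IsInterpolable α p K u := by
  have hp0 : 0 < p := by linarith
  by_cases h1 : α = 1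
  · rw [MemSobolev, if_pos h1] at hu'
    obtain ⟨g, A, hA, hg, hgA⟩ := hu'.exists_gradient_bound hp0
    -- For `α = 1` the regular part may have a gradient of size `r ^ 0` at every scale, so no
    -- splitting is needed.
    refine ⟨A, hA, fun r hr hr1 => ⟨u, fun _ => 0, g, hu, MemLp.zero, by simp, hg, fun j => ?_, ?_⟩⟩
    · rw [h1, sub_self, Real.rpow_zero, mul_one]
      exact hgA j
    · simp [Real.zero_rpow hp0.ne']
  · rw [MemSobolev, if_neg h1] at hu'
    obtain ⟨v, M, hv, hvM, huv⟩ := exists_measurable_bounded_representative hu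
    obtain ⟨K, hK, h⟩ := exists_isInterpolable_of_gagliardoEnergy hd hα hα1 hp hv hvM
      (by rw [← gagliardoEnergy_congr huv]; exact hu'.2)
    refine ⟨K, hK, fun r hr hr1 => ?_⟩
    obtain ⟨a, c, g, ha, hc, hac, hg⟩ := h r hr hr1
    exact ⟨a, c, g, ha, hc, huv.trans hac, hg⟩

/-! ### From a modulus of continuity to the Gagliardo energy. -/

theorem norm_le_card_of_mem_unitBox {h : EuclideanSpace ℝ (Fin d)} (hh : ∀ i, h i ∈ Ioc (0 : ℝ) 1) :
    ‖h‖ ≤ d := by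
  rw [EuclideanSpace.norm_eq]
  refine Real.sqrt_le_iff.2 ⟨Nat.cast_nonneg d, ?_⟩
  have : ∀ i, ‖h i‖ ^ 2 ≤ 1 := fun i => by
    rw [Real.norm_eq_abs, sq_abs]
    nlinarith [(hh i).1, (hh i).2]
  refine (sum_fin_le this).trans ?_
  rw [mul_one]
  rcases Nat.eq_zero_or_pos d with h0 | h0
  · simp [h0]
  · have : (1 : ℝ) ≤ d := by exact_mod_cast h0
    nlinarith

theorem lintegral_rpow_add_le {Y : Type*} [MeasurableSpace Y] {μ : Measure Y} {f g : Y → ℝ}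
    (hf : AEStronglyMeasurable f μ) {q : ℝ} (hq : 1 ≤ q) :
    ∫⁻ x, ENNReal.ofReal (|f x + g x| ^ q) ∂μ ≤ ENNReal.ofReal (2 ^ q) *
      ((∫⁻ x, ENNReal.ofReal (|f x| ^ q) ∂μ) + ∫⁻ x, ENNReal.ofReal (|g x| ^ q) ∂μ) := by
  have hq0 : 0 ≤ q := by linarith
  have hm : AEMeasurable (fun x => ENNReal.ofReal (|f x| ^ q)) μ :=
    ((convexCost_rpow hq).continuous.comp_aestronglyMeasurable hf).aemeasurable.ennreal_ofReal
  rw [← lintegral_add_left' hm, ← lintegral_const_mul' _ _ ENNReal.ofReal_ne_top]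
  refine lintegral_mono fun x => ?_
  have h1 := Real.rpow_nonneg (abs_nonneg (f x)) q
  have h2 := Real.rpow_nonneg (abs_nonneg (g x)) q
  rw [← ENNReal.ofReal_add h1 h2, ← ENNReal.ofReal_mul (by positivity)]
  refine ENNReal.ofReal_le_ofReal ?_
  have h3 : |f x + g x| ≤ 2 * max |f x| |g x| := (abs_add_le _ _).trans (by
    linarith [le_max_left |f x| |g x|, le_max_right |f x| |g x|])
  refine (Real.rpow_le_rpow (abs_nonneg _) h3 hq0).trans ?_
  rw [Real.mul_rpow zero_le_two (by positivity)]
  refine mul_le_mul_of_nonneg_left ?_ (by positivity)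
  rcases le_total |f x| |g x| with h | h
  · rw [max_eq_right h]; linarith
  · rw [max_eq_left h]; linarith

/-- Where `|c| ≤ r` the integrand is at most `r ^ q`; elsewhere `|c| ^ q ≤ r ^ (q - p) * |c| ^ p`.
The result scales correctly in `r`. -/
theorem lintegral_rpow_le_of_lintegral_rpow_le {c : Torus d → ℝ} {p q K r : ℝ} (hK : 0 ≤ K) (hr : 0 < r)
    (hq : 0 ≤ q) (hqp : q ≤ p)
    (h : ∫⁻ x, ENNReal.ofReal (|c x| ^ p) ≤ ENNReal.ofReal ((K * r) ^ p)) :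
    ∫⁻ x, ENNReal.ofReal (|c x| ^ q) ≤ ENNReal.ofReal (r ^ q * (1 + K ^ p)) := by
  have hle : ∀ x, ENNReal.ofReal (|c x| ^ q) ≤
      ENNReal.ofReal (r ^ q) + ENNReal.ofReal (r ^ (q - p)) * ENNReal.ofReal (|c x| ^ p) := fun x => by
    rw [← ENNReal.ofReal_mul (by positivity), ← ENNReal.ofReal_add (by positivity) (by positivity)]
    refine ENNReal.ofReal_le_ofReal ?_
    rcases le_total |c x| r with hc | hc
    · have h1 := Real.rpow_le_rpow (abs_nonneg _) hc hq
      have h2 : 0 ≤ r ^ (q - p) * |c x| ^ p := by positivity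
      linarith
    · have hc0 : 0 < |c x| := hr.trans_le hc
      have h1 : |c x| ^ q = |c x| ^ (q - p) * |c x| ^ p := by rw [← Real.rpow_add hc0]; congr 1; ring
      have h2 : |c x| ^ (q - p) ≤ r ^ (q - p) := Real.rpow_le_rpow_of_nonpos hr hc (by linarith)
      have h3 : 0 ≤ r ^ q := by positivity
      rw [h1]
      have := mul_le_mul_of_nonneg_right h2 (Real.rpow_nonneg (abs_nonneg (c x)) p)
      linarith
  refine (lintegral_mono hle).trans ?_
  rw [lintegral_add_left measurable_const, lintegral_const, measure_univ, mul_one,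
    lintegral_const_mul' _ _ ENNReal.ofReal_ne_top]
  refine (add_le_add_right (mul_le_mul_right h _) _).trans (le_of_eq ?_)
  rw [← ENNReal.ofReal_mul (by positivity), ← ENNReal.ofReal_add (by positivity) (by positivity),
    Real.mul_rpow hK hr.le, Real.rpow_sub hr]
  congr 1
  field_simp

theorem lintegral_translate_le_of_gradient {a : Torus d → ℝ} {g : Fin d → Torus d → ℝ} {q X : ℝ}
    (hq : 1 ≤ q) (hai : Integrable a) (hg : ∀ j, IsWeakPartial j a (g j)) (hX0 : 0 ≤ X)
    (hX : ∀ j, ∫⁻ x, ENNReal.ofReal (|g j x| ^ q) ≤ ENNReal.ofReal X) (h : EuclideanSpace ℝ (Fin d)) :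
    ∫⁻ x, ENNReal.ofReal (|a (x + proj h) - a x| ^ q) ≤
      ENNReal.ofReal (‖h‖ ^ q * ((d : ℝ) ^ (q - 1) * (d * X))) := by
  have hq0 : 0 ≤ q := by linarith
  refine (lintegral_cost_translate_le (convexCost_rpow hq) hai hg h).trans ?_
  have hle : ∀ x, ENNReal.ofReal (|∑ i, h i * g i x| ^ q) ≤
      ENNReal.ofReal (‖h‖ ^ q * (d : ℝ) ^ (q - 1)) * ∑ i, ENNReal.ofReal (|g i x| ^ q) := fun x => by
    rw [← ENNReal.ofReal_sum_of_nonneg fun i _ => Real.rpow_nonneg (abs_nonneg _) _,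
      ← ENNReal.ofReal_mul (by positivity)]
    refine ENNReal.ofReal_le_ofReal ?_
    have h1 : |∑ i, h i * g i x| ≤ ‖h‖ * ∑ i, |g i x| := by
      rw [Finset.mul_sum]
      refine (Finset.abs_sum_le_sum_abs _ _).trans (Finset.sum_le_sum fun i _ => ?_)
      rw [abs_mul]
      exact mul_le_mul_of_nonneg_right (PiLp.norm_apply_le h i) (abs_nonneg _)
    refine (Real.rpow_le_rpow (abs_nonneg _) h1 hq0).trans ?_
    rw [Real.mul_rpow (norm_nonneg _) (Finset.sum_nonneg fun i _ => abs_nonneg _), mul_assoc]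
    refine mul_le_mul_of_nonneg_left ?_ (by positivity)
    simpa using Real.rpow_sum_le_const_mul_sum_rpow Finset.univ (fun i => g i x) hq
  refine (lintegral_mono hle).trans ?_
  have hm : ∀ i, AEMeasurable (fun x => ENNReal.ofReal (|g i x| ^ q)) volume := fun i =>
    ((convexCost_rpow hq).continuous.comp_aestronglyMeasurable
      (hg i).integrable_deriv.aestronglyMeasurable).aemeasurable.ennreal_ofReal
  rw [lintegral_const_mul' _ _ ENNReal.ofReal_ne_top, lintegral_finsetSum' _ fun i _ => hm i]
  refine (mul_le_mul_right (Finset.sum_le_sum fun i _ => hX i) _).trans (le_of_eq ?_)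
  rw [← ENNReal.ofReal_sum_of_nonneg fun _ _ => hX0, ← ENNReal.ofReal_mul (by positivity)]
  simp [mul_assoc]

theorem lintegral_translate_le {c : Torus d → ℝ} (hc : AEStronglyMeasurable c volume) {q : ℝ}
    (hq : 1 ≤ q) (y : Torus d) : ∫⁻ x, ENNReal.ofReal (|c (x + y) - c x| ^ q) ≤
      ENNReal.ofReal (2 ^ q) * (2 * ∫⁻ x, ENNReal.ofReal (|c x| ^ q)) := by
  have h := lintegral_rpow_add_le (f := fun x => c (x + y)) (g := fun x => -c x)
    (hc.comp_measurePreserving (measurePreserving_add_right volume y)) hq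
  rw [lintegral_add_right_eq_self (fun x => ENNReal.ofReal (|c x| ^ q)) y] at h
  simp only [abs_neg, ← sub_eq_add_neg, ← two_mul] at h
  exact h

/-- In polar coordinates on a ball containing the box, the radial integrand is `y ^ (s - 1)`. -/
theorem lintegral_norm_rpow_unitBox_lt_top (hd : Nonempty (Fin d)) {s : ℝ} (hs : 0 < s) :
    ∫⁻ h in {h : EuclideanSpace ℝ (Fin d) | ∀ i, h i ∈ Ioc (0 : ℝ) 1},
      ENNReal.ofReal (‖h‖ ^ (s - d)) < ⊤ := by
  have hsub : {h : EuclideanSpace ℝ (Fin d) | ∀ i, h i ∈ Ioc (0 : ℝ) 1} ⊆ Metric.ball 0 (d + 1) :=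
    fun h hh => by
      rw [mem_ball_zero_iff]
      exact (norm_le_card_of_mem_unitBox hh).trans_lt (by linarith)
  have hi : IntegrableOn (fun h : EuclideanSpace ℝ (Fin d) => ‖h‖ ^ (s - d))
      (Metric.ball 0 ((d : ℝ) + 1)) := by
    refine (integrableOn_fun_norm_addHaar volume (f := fun y => y ^ (s - d))).2 ?_
    have h1 : IntegrableOn (fun y : ℝ => y ^ (s - 1)) (Ioo 0 ((d : ℝ) + 1)) := by
      have := (intervalIntegral.intervalIntegrable_rpow' (a := 0) (b := (d : ℝ) + 1)
        (by linarith : -1 < s - 1))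
      exact ((intervalIntegrable_iff_integrableOn_Ioc_of_le (by positivity)).1 this).mono_set
        Ioo_subset_Ioc_self
    refine h1.congr_fun (fun y hy => ?_) measurableSet_Ioo
    simp only [finrank_euclideanSpace, Fintype.card_fin, smul_eq_mul]
    rw [← Real.rpow_natCast, ← Real.rpow_add hy.1, Nat.cast_sub (Fin.pos hd.some)]
    congr 1; push_cast; ring
  refine lt_of_le_of_lt (lintegral_mono_set hsub) ?_
  exact (hasFiniteIntegral_iff_ofReal (ae_of_all _ fun h => Real.rpow_nonneg (norm_nonneg _) _)).1 hi.2

/-- A bounded function that is Hölder continuous of order `α` in `L^q` has finite Gagliardo energy of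
every order below `α q / p`. -/
theorem gagliardoEnergy_lt_top (hd : Nonempty (Fin d)) {α' p q γ M C : ℝ} {u : Torus d → ℝ}
    (hqp : q ≤ p) (hγ : p * α' < γ) (hq : 0 < q)
    (hM : ∀ᵐ x, |u x| ≤ M) (hM0 : 0 ≤ M)
    (hC : ∀ h : EuclideanSpace ℝ (Fin d), (∀ i, h i ∈ Ioc (0 : ℝ) 1) →
      ∫⁻ x, ENNReal.ofReal (|u (x + proj h) - u x| ^ q) ≤ ENNReal.ofReal (C * ‖h‖ ^ γ)) :
    gagliardoEnergy α' p u < ⊤ := by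
  have hle : ∀ h ∈ {h : EuclideanSpace ℝ (Fin d) | ∀ i, h i ∈ Ioc (0 : ℝ) 1},
      ∫⁻ x, ENNReal.ofReal (|u (x + proj h) - u x| ^ p / ‖h‖ ^ ((d : ℝ) + p * α')) ≤
        ENNReal.ofReal ((2 * M) ^ (p - q) * C) * ENNReal.ofReal (‖h‖ ^ (γ - p * α' - d)) := by
    intro h hh
    have hpos : 0 < ‖h‖ := norm_pos_iff.2 fun h0 => by
      have := (hh hd.some).1
      simp [h0] at this
    -- Boundedness of `u` trades the power `p` of the increment for the smaller power `q`, in which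
    -- the modulus of continuity is known.
    have h1 : ∀ᵐ x, ENNReal.ofReal (|u (x + proj h) - u x| ^ p / ‖h‖ ^ ((d : ℝ) + p * α')) ≤
        ENNReal.ofReal ((2 * M) ^ (p - q) / ‖h‖ ^ ((d : ℝ) + p * α')) *
          ENNReal.ofReal (|u (x + proj h) - u x| ^ q) := by
      filter_upwards [hM, (measurePreserving_add_right volume (proj h)).quasiMeasurePreserving.ae hM]
        with x hx hx'
      rw [← ENNReal.ofReal_mul (by positivity)]
      refine ENNReal.ofReal_le_ofReal ?_
      rw [div_mul_eq_mul_div]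
      refine div_le_div_of_nonneg_right ?_ (by positivity)
      have h2 : |u (x + proj h) - u x| ≤ 2 * M := (abs_sub _ _).trans (by linarith)
      have h3 : |u (x + proj h) - u x| ^ p =
          |u (x + proj h) - u x| ^ (p - q) * |u (x + proj h) - u x| ^ q := by
        rw [← Real.rpow_add_of_nonneg (abs_nonneg _) (by linarith) hq.le]; congr 1; ring
      rw [h3]
      exact mul_le_mul_of_nonneg_right (Real.rpow_le_rpow (abs_nonneg _) h2 (by linarith))
        (Real.rpow_nonneg (abs_nonneg _) _)
    refine (lintegral_mono_ae h1).trans ?_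
    rw [lintegral_const_mul' _ _ ENNReal.ofReal_ne_top]
    refine (mul_le_mul_right (hC h hh) _).trans (le_of_eq ?_)
    rw [← ENNReal.ofReal_mul (by positivity), ← ENNReal.ofReal_mul' (by positivity),
      show γ - p * α' - d = γ - (d + p * α') by ring, Real.rpow_sub hpos]
    congr 1; ring
  refine lt_of_le_of_lt (setLIntegral_mono' measurableSet_unitBox hle) ?_
  rw [lintegral_const_mul' _ _ ENNReal.ofReal_ne_top]
  exact ENNReal.mul_lt_top ENNReal.ofReal_lt_top
    (lintegral_norm_rpow_unitBox_lt_top hd (by linarith))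

theorem memLp_of_mem_powBall {q C p : ℝ} (hq : 0 < q) (hpq : p ≤ q) {f : Torus d → ℝ}
    (hf : f ∈ powBall volume q C) : MemLp f (ENNReal.ofReal p) := by
  refine MemLp.mono_exponent ?_ (ENNReal.ofReal_le_ofReal hpq)
  refine (integrable_norm_rpow_iff hf.1 (by simpa using hq) ENNReal.ofReal_ne_top).1 ?_
  rw [ENNReal.toReal_ofReal hq.le]
  exact hf.2.1

/-- A uniform `L^q` propagation bound and a uniform `W^{1,q}` propagation bound interpolate to a
modulus of continuity of order `α` in `L^q`. -/
theorem lintegral_translate_le_of_isInterpolable (hd : Nonempty (Fin d)) {α p q K₀ E K : ℝ}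
    {u₀ u : Torus d → ℝ} {R : (Torus d → ℝ) → (Torus d → ℝ) → Prop} (hK₀ : 0 < K₀) (hE : 0 ≤ E)
    (hK : 0 ≤ K) (hq : 1 < q) (hqp : q ≤ p) (hu₀ : IsInterpolable α p K₀ u₀)
    (hex : ∀ a₀, MemLp a₀ ⊤ → ∃ a, R a₀ a)
    (hadd : ∀ a₀ a c₀ c, MemLp a₀ ⊤ → MemLp c₀ ⊤ → (u₀ =ᵐ[volume] fun x => a₀ x + c₀ x) → R a₀ a →
      R c₀ c → u =ᵐ[volume] fun x => a x + c x)
    (hpow : ∀ c₀ c, R c₀ c → c ∈ powBall volume q (E * ∫ x, |c₀ x| ^ q))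
    (hgrad : ∀ a₀ a (A : ℝ) (g : Fin d → Torus d → ℝ), R a₀ a → 0 < A →
      (∀ j, IsWeakPartial j a₀ (g j)) →
      (∀ j, ∫⁻ x, ENNReal.ofReal (|g j x| ^ p) ≤ ENNReal.ofReal (A ^ p)) → ∀ j,
        ∃ g', IsWeakPartial j a g' ∧ g' ∈ powBall volume q (K * A ^ q)) :
    ∃ C : ℝ, ∀ h : EuclideanSpace ℝ (Fin d), (∀ i, h i ∈ Ioc (0 : ℝ) 1) →
      ∫⁻ x, ENNReal.ofReal (|u (x + proj h) - u x| ^ q) ≤ ENNReal.ofReal (C * ‖h‖ ^ (α * q)) := by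
  have hd0 : (0 : ℝ) < d := by exact_mod_cast Fin.pos hd.some
  have hq0 : 0 < q := by linarith
  refine ⟨2 ^ q * (d ^ q * (d ^ (q - 1) * (d * (K * K₀ ^ q))) + 2 ^ q * (2 * (E * (1 + K₀ ^ p)))) /
    d ^ (α * q), fun h hh => ?_⟩
  have hpos : 0 < ‖h‖ := norm_pos_iff.2 fun h0 => by
    have := (hh hd.some).1
    simp [h0] at this
  -- The scale is matched to the shift; division by `d` ensures `r ≤ 1` on the unit box.
  set r := ‖h‖ / d with hrdef
  have hr : 0 < r := div_pos hpos hd0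
  have hr1 : r ≤ 1 := (div_le_one hd0).2 (norm_le_card_of_mem_unitBox hh)
  have hhr : ‖h‖ = d * r := by rw [hrdef]; field_simp
  obtain ⟨a₀, c₀, g, ha₀, hc₀, hac, hg, hgb, hcb⟩ := hu₀ r hr hr1
  obtain ⟨a, ha⟩ := hex a₀ ha₀
  obtain ⟨c, hc⟩ := hex c₀ hc₀
  have hA : 0 < K₀ * r ^ (α - 1) := mul_pos hK₀ (Real.rpow_pos_of_pos hr _)
  choose g' hg' hgp using hgrad a₀ a _ g ha hA hg hgb
  have h1 := lintegral_translate_le_of_gradient hq.le (integrable_of_mem_powBall hq.le (hpow _ _ ha))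
    hg' (by positivity) (fun j => lintegral_le_of_mem_powBall (hgp j)) h
  -- A shift of length `d r` of a function with gradient of size `r ^ (α - 1)` has size `r ^ α`, the
  -- same as the remainder.
  have e1 : ‖h‖ ^ q * ((d : ℝ) ^ (q - 1) * (d * (K * (K₀ * r ^ (α - 1)) ^ q))) =
      d ^ q * (d ^ (q - 1) * (d * (K * K₀ ^ q))) * r ^ (α * q) := by
    have : r ^ (α * q) = r ^ q * (r ^ (α - 1)) ^ q := by
      rw [← Real.rpow_mul hr.le, ← Real.rpow_add hr]; congr 1; ring
    rw [hhr, Real.mul_rpow hd0.le hr.le, Real.mul_rpow hK₀.le (by positivity), this]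
    ring
  rw [e1] at h1
  have hcq := lintegral_rpow_le_of_lintegral_rpow_le hK₀.le (Real.rpow_pos_of_pos hr α) hq0.le hqp hcb
  rw [← Real.rpow_mul hr.le] at hcq
  have hci : ∫ x, |c₀ x| ^ q ≤ r ^ (α * q) * (1 + K₀ ^ p) :=
    (mem_powBall_of_lintegral hc₀.1 hq.le (by positivity) hcq).2.2
  have h2 : ∫⁻ x, ENNReal.ofReal (|c (x + proj h) - c x| ^ q) ≤
      ENNReal.ofReal (2 ^ q * (2 * (E * (1 + K₀ ^ p))) * r ^ (α * q)) := by
    refine (lintegral_translate_le (hpow _ _ hc).1 hq.le _).trans ?_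
    refine (mul_le_mul_right (mul_le_mul_right (lintegral_le_of_mem_powBall (hpow _ _ hc)) _) _).trans ?_
    rw [show (2 : ℝ≥0∞) = ENNReal.ofReal 2 by simp, ← ENNReal.ofReal_mul (by positivity),
      ← ENNReal.ofReal_mul (by positivity)]
    refine ENNReal.ofReal_le_ofReal ?_
    calc (2 : ℝ) ^ q * (2 * (E * ∫ x, |c₀ x| ^ q))
        ≤ 2 ^ q * (2 * (E * (r ^ (α * q) * (1 + K₀ ^ p)))) := by gcongr
      _ = _ := by ring
  have hu := hadd _ _ _ _ ha₀ hc₀ hac ha hc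
  have hmp := measurePreserving_add_right (volume : Measure (Torus d)) (proj h)
  have h3 : ∫⁻ x, ENNReal.ofReal (|u (x + proj h) - u x| ^ q) =
      ∫⁻ x, ENNReal.ofReal (|(a (x + proj h) - a x) + (c (x + proj h) - c x)| ^ q) := by
    refine lintegral_congr_ae ?_
    filter_upwards [hu, hmp.quasiMeasurePreserving.ae hu] with x hx hx'
    rw [hx, hx']
    congr 3
    ring
  have ham := (hpow _ _ ha).1
  rw [h3]
  refine (lintegral_rpow_add_le ((ham.comp_measurePreserving hmp).sub ham) hq.le).trans ?_
  refine (mul_le_mul_right (add_le_add h1 h2) _).trans (le_of_eq ?_)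
  rw [← ENNReal.ofReal_add (by positivity) (by positivity), ← ENNReal.ofReal_mul (by positivity),
    hrdef, Real.div_rpow hpos.le hd0.le]
  congr 1
  ring

/-! ### The main theorem. -/

theorem corollary1p4 (d : ℕ) (hd : 1 ≤ d) (T : ℝ) (hT : 0 < T)
    (b : ℝ → Torus d → EuclideanSpace ℝ (Fin d))
    (Db : ℝ → Torus d → Matrix (Fin d) (Fin d) ℝ)
    (hb : Integrable (fun z : ℝ × Torus d => b z.1 z.2)
      ((volume.restrict (Icc 0 T)).prod volume))
    (hDb : ∀ t ∈ Icc 0 T, IsWeakGradient (b t) (Db t))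
    (hexp : ∀ β : ℝ, 0 < β →
      (⨆ t ∈ Icc 0 T, ∫⁻ x, ENNReal.ofReal (Real.exp (β * frobNorm (Db t x)))) < ⊤)
    (hdiv : ∃ L : ℝ, ∀ᵐ t ∂(volume.restrict (Icc 0 T)), ∀ᵐ x, |(Db t x).trace| ≤ L)
    (α p : ℝ) (hα : 0 < α) (hα1 : α ≤ 1) (hp : 1 < p)
    (u₀ : Torus d → ℝ) (hu₀ : MemLp u₀ ⊤) (hu₀' : MemSobolev α p u₀) :
    ∃ u : ℝ → Torus d → ℝ,
      IsTransportSolution T b (fun t x => (Db t x).trace) u₀ u ∧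
      (∀ v : ℝ → Torus d → ℝ, IsTransportSolution T b (fun t x => (Db t x).trace) u₀ v →
        ∀ t ∈ Icc 0 T, v t =ᵐ[volume] u t) ∧
      (∀ α' : ℝ, 0 < α' → α' < α → ∀ t ∈ Icc 0 T, MemSobolev α' p (u t)) ∧
      (α = 1 → ∀ p' : ℝ, 1 ≤ p' → p' < p → ∀ t ∈ Icc 0 T, MemSobolev 1 p' (u t)) := by
  have hd' : Nonempty (Fin d) := ⟨⟨0, hd⟩⟩
  obtain ⟨β, G, hF, hag0⟩ := exists_transportField hb hDb hexp hdiv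
  have hag : ∀ᵐ s ∂volume.restrict (Icc 0 T), (∀ i, β i s =ᵐ[volume] fun x => b s x i) ∧
      (fun x => ∑ i, G i i s x) =ᵐ[volume] (fun t x => (Db t x).trace) s := by
    filter_upwards [hag0] with s hs
    refine ⟨hs.1, ?_⟩
    filter_upwards [ae_all_iff.2 fun i => hs.2 i i] with x hx
    simp [Matrix.trace, hx]
  obtain ⟨E, K, hE, hK, hex⟩ := hF.exists_isTransportSolution hd' hT hag
  have hint : ∀ {f : Torus d → ℝ}, MemLp f ⊤ → Integrable f := fun hf => hf.integrable le_top
  obtain ⟨u, hu, hpow, hgrad⟩ := hex u₀ hu₀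
  obtain ⟨K₀, hK₀, hinter⟩ := exists_isInterpolable hd' hα hα1 hp hu₀ hu₀'
  obtain ⟨M, hM⟩ := hu.bounded
  refine ⟨u, hu, fun v hv t ht => hv.ae_eq hF hd' hag hu (hint hu₀) ht, ?_, ?_⟩
  · intro α' hα' hαα t ht
    rw [MemSobolev, if_neg (by linarith)]
    refine ⟨memLp_of_mem_powBall (by linarith) le_rfl (hpow p hp t ht), ?_⟩
    -- The intermediate exponent is `q = (m + p) / 2`. It satisfies `1 < q < p` and `α' p < α q`, as
    -- the propagation estimates and the convergence of the Gagliardo integral require.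
    set m := max 1 (α' * p / α)
    have hmp : m < p := max_lt hp (by rw [div_lt_iff₀ hα]; nlinarith)
    have hm1 : 1 ≤ m := le_max_left _ _
    have hm2 : α' * p ≤ m * α := (div_le_iff₀ hα).1 (le_max_right _ _)
    have hq1 : 1 < (m + p) / 2 := by linarith
    have hqp : (m + p) / 2 < p := by linarith
    obtain ⟨C, hC⟩ := lintegral_translate_le_of_isInterpolable hd'
      -- `R a₀ a` relates a datum to the value at the fixed time `t` of a solution that satisfies
      -- the propagation bounds.
      (R := fun a₀ a => ∃ w, w t = a ∧ IsTransportSolution T b (fun t x => (Db t x).trace) a₀ w ∧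
        a ∈ powBall volume ((m + p) / 2) (E * ∫ x, |a₀ x| ^ ((m + p) / 2)) ∧
        ∀ (A : ℝ) (g : Fin d → Torus d → ℝ), 0 < A → (∀ j, IsWeakPartial j a₀ (g j)) →
          (∀ j, ∫⁻ x, ENNReal.ofReal (|g j x| ^ p) ≤ ENNReal.ofReal (A ^ p)) → ∀ j,
            ∃ g', IsWeakPartial j a g' ∧ g' ∈ powBall volume ((m + p) / 2) (K p ((m + p) / 2) * A ^ ((m + p) / 2)))
      (u := u t) hK₀ hE (hK p _ hq1 hqp) hq1 hqp.le hinter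
      (fun a₀ ha₀ => by
        obtain ⟨w, hw, hwp, hwg⟩ := hex a₀ ha₀
        exact ⟨w t, w, rfl, hw, hwp _ hq1 t ht,
          fun A g hA hg hgA => hwg p _ A g hq1 hqp hA hg hgA t ht⟩)
      (fun a₀ a c₀ c ha₀ hc₀ h0 => by
        rintro ⟨w, rfl, hw, -⟩ ⟨z, rfl, hz, -⟩
        exact hu.ae_eq_add hF hd' hag hw hz (hint ha₀) (hint hc₀) h0 ht)
      (fun c₀ c => by rintro ⟨w, -, -, h, -⟩; exact h)
      (fun a₀ a A g => by rintro ⟨w, -, -, -, h⟩; exact h A g)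
    exact gagliardoEnergy_lt_top hd' hqp.le (by nlinarith) (by linarith)
      ((hM t ht).mono fun x hx => hx.trans (le_abs_self M)) (abs_nonneg M) hC
  · rintro rfl p' hp'1 hp' t ht
    rw [MemSobolev, if_pos rfl] at hu₀' ⊢
    obtain ⟨g, A, hA, hg, hgA⟩ := hu₀'.exists_gradient_bound (by linarith)
    -- An exponent strictly between `p'` and `p` stays above `1` even for `p' = 1`, where weak
    -- compactness would fail.
    have hq1 : 1 < (p' + p) / 2 := by linarith
    refine ⟨memLp_of_mem_powBall (by linarith) hp'.le (hpow p hp t ht), fun j => ?_⟩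
    obtain ⟨g', hg', hgq⟩ := hgrad p ((p' + p) / 2) A g hq1 (by linarith) hA hg hgA t ht j
    exact ⟨g', hg', memLp_of_mem_powBall (by linarith) (by linarith) hgq⟩
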